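/- Let $d\ge 2$ and let $\Delta$ be an irreducible (row-)stochastic $d\times d$ matrix, written in block form $$\Delta=\begin{bmatrix} a & r\\ c & B\end{bmatrix},$$ where $a$ is a scalar and $B$ is a $(d-1)\times(d-1)$ matrix. Let $\Phi:\{1,\dots,d\}\to\{0,1\}$ be given by $\Phi(1)=0$ and $\Phi(2)=\dots=\Phi(d)=1$. For a stochastic $d\times d$ matrix $P$ let $Y$ be a stationary Markov chain with transition matrix $P$, let $Z=\Phi(Y)$ be the hidden Markov chain defined by $P$ and $\Phi$, and let $H(Z)=\lim_{k\to\infty}-E\log p(z_0\mid z_{-k}^{-1})$ be its entropy rate. An analytic parametrization of $\Delta$ is a map $\vec\varepsilon\mapsto\Delta(\vec\varepsilon)$ from some $\mathbb{R}^m$ to the $d\times d$ real matrices whose entries are real analytic at a point $\vec\varepsilon_0$ and for which $\Delta(\vec\varepsilon_0)=\Delta$. A natural parametrization is one in which the parameters are $d-1$ chosen entries of each row, the remaining entry of the row being one minus their sum. The entropy rate is said to be analytic at $\Delta$ with respect to a parametrization if there is a function $F$, real analytic at $\vec\varepsilon_0$, such that $F(\vec\varepsilon)=H(Z^{\vec\varepsilon})$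 for every $\vec\varepsilon$ near $\vec\varepsilon_0$ for which $\Delta(\vec\varepsilon)$ is stochastic, where $Z^{\vec\varepsilon}$ is the hidden Markov chain defined by $\Delta(\vec\varepsilon)$ and $\Phi$. Consider the two conditions: 1. $a>0$, and $rB^jc>0$ for all $j=0,1,2,\dots$; 2. the maximum eigenvalue of $B$ is simple and strictly greater in absolute value than all other (complex) eigenvalues of $B$. Then the entropy rate is analytic at $\Delta$ with respect to every analytic parametrization if and only if conditions 1 and 2 hold. Moreover, for each natural parametrization, the entropy rate is analytic at $\Delta$ with respect to it if and only if conditions 1 and 2 hold. -/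

import Mathlib

open Filter Topology

noncomputable section

namespace HiddenMarkov

section Chain

variable {S A : Type*} [Fintype S] [DecidableEq S] [Fintype A] [DecidableEq A]

/-- `π` is a stationary probability vector of the transition matrix `Δ`. -/
def IsStationary (Δ : Matrix S S ℝ) (π : S → ℝ) : Prop :=
  π ∈ stdSimplex ℝ S ∧ Matrix.vecMul π Δ = π

/-- The probability `p(y_0 ⋯ y_k)` of a block of the Markov chain with initial distribution `π`
and transition matrix `Δ`. -/
def markovProb (Δ : Matrix S S ℝ) (π : S → ℝ) {k : ℕ} (y : Fin (k + 1) → S) : ℝ :=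
  π (y 0) * ∏ i : Fin k, Δ (y i.castSucc) (y i.succ)

/-- The probability `p(z_0 ⋯ z_k)` of a block of the hidden Markov chain `Z = Φ(Y)`. -/
def hiddenProb (Δ : Matrix S S ℝ) (π : S → ℝ) (Φ : S → A) {k : ℕ} (z : Fin (k + 1) → A) : ℝ :=
  ∑ y : Fin (k + 1) → S with Φ ∘ y = z, markovProb Δ π y

/-- `-E log p(z_{k+1} | z_0 ⋯ z_k)`, the conditional entropy of a symbol of the hidden Markov chain
given the `k + 1` preceding ones (blocks of probability zero contribute zero). -/
def condEntropy (Δ : Matrix S S ℝ) (π : S → ℝ) (Φ : S → A) (k : ℕ) : ℝ :=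
  -∑ z : Fin (k + 2) → A,
    hiddenProb Δ π Φ z * Real.log (hiddenProb Δ π Φ z / hiddenProb Δ π Φ (Fin.init z))

/-- `h` is the entropy rate of the stationary hidden Markov chain given by `Δ`, `π` and `Φ`. -/
def HasEntropyRate (Δ : Matrix S S ℝ) (π : S → ℝ) (Φ : S → A) (h : ℝ) : Prop :=
  Tendsto (fun k => condEntropy Δ π Φ k) atTop (𝓝 h)

/-- The entropy rate of the hidden Markov chain given by `Θ ε` and `Φ` is real analytic at `ε₀`:
there is a function, analytic at `ε₀`, whose value at every `ε` near `ε₀` for which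
`Θ ε` is a stochastic matrix is the entropy rate of the stationary hidden Markov chain. -/
def EntropyRateAnalyticAt {E : Type*} [NormedAddCommGroup E] [NormedSpace ℝ E]
    (Φ : S → A) (Θ : E → Matrix S S ℝ) (ε₀ : E) : Prop :=
  ∃ F : E → ℝ, AnalyticAt ℝ F ε₀ ∧
    ∀ᶠ ε in 𝓝 ε₀, Θ ε ∈ Matrix.rowStochastic ℝ S →
      ∀ π : S → ℝ, IsStationary (Θ ε) π → HasEntropyRate (Θ ε) π Φ (F ε)

end Chain

/-- All entries of `Θ` are real analytic at `ε₀`, and `Θ ε₀ = Δ`. -/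
def IsAnalyticParametrization {S E : Type*} [NormedAddCommGroup E] [NormedSpace ℝ E]
    (Θ : E → Matrix S S ℝ) (ε₀ : E) (Δ : Matrix S S ℝ) : Prop :=
  (∀ i j, AnalyticAt ℝ (fun ε => Θ ε i j) ε₀) ∧ Θ ε₀ = Δ

section Natural

variable {n : ℕ}

/-- The natural parametrization of the matrices with row sums one: in row `i` the entries outside
column `k i` are free parameters, and the entry in column `k i` is one minus their sum. -/
def naturalParam (k : Fin (n + 1) → Fin (n + 1)) (x : Fin (n + 1) → Fin n → ℝ) :
    Matrix (Fin (n + 1)) (Fin (n + 1)) ℝ :=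
  Matrix.of fun i => Fin.insertNth (α := fun _ => ℝ) (k i) (1 - ∑ j, x i j) (x i)

/-- The natural parameters of a matrix: in row `i`, the entries outside column `k i`. -/
def naturalCoord (k : Fin (n + 1) → Fin (n + 1)) (Δ : Matrix (Fin (n + 1)) (Fin (n + 1)) ℝ) :
    Fin (n + 1) → Fin n → ℝ :=
  fun i j => Δ i ((k i).succAbove j)

/-- The observation map: the first state is mapped to `0`, every other state to `1`. -/
def unambiguousObs (i : Fin (n + 1)) : Fin 2 := if i = 0 then 0 else 1

/-- The row `r` in the block form `Δ = [[a, r], [c, B]]`. -/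
def blockR (Δ : Matrix (Fin (n + 1)) (Fin (n + 1)) ℝ) : Fin n → ℝ := fun j => Δ 0 j.succ

/-- The column `c` in the block form `Δ = [[a, r], [c, B]]`. -/
def blockC (Δ : Matrix (Fin (n + 1)) (Fin (n + 1)) ℝ) : Fin n → ℝ := fun i => Δ i.succ 0

/-- The square block `B` in the block form `Δ = [[a, r], [c, B]]`. -/
def blockB (Δ : Matrix (Fin (n + 1)) (Fin (n + 1)) ℝ) : Matrix (Fin n) (Fin n) ℝ :=
  Δ.submatrix Fin.succ Fin.succ

/-- `a > 0` and `r B^j c > 0` for all `j ≥ 0`. -/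
def PositivityCondition (Δ : Matrix (Fin (n + 1)) (Fin (n + 1)) ℝ) : Prop :=
  0 < Δ 0 0 ∧ ∀ j : ℕ, 0 < dotProduct (blockR Δ) (Matrix.mulVec (blockB Δ ^ j) (blockC Δ))

/-- `B` has a (complex) eigenvalue of algebraic multiplicity one that is strictly larger in modulus
than every other complex eigenvalue of `B`. -/
def HasSimpleDominantEigenvalue (B : Matrix (Fin n) (Fin n) ℝ) : Prop :=
  ∃ lam : ℂ, (B.map Complex.ofReal).charpoly.rootMultiplicity lam = 1 ∧
    ∀ mu : ℂ, (B.map Complex.ofReal).charpoly.IsRoot mu → mu ≠ lam → ‖mu‖ < ‖lam‖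

end Natural

end HiddenMarkov

end

set_option linter.unusedSectionVars false

open Filter Topology

noncomputable section

namespace HiddenMarkov

open Matrix

section
section Nonneg

variable {ι κ : Type*} [Fintype ι] [Fintype κ]

/-! State 0 is the only state that emits the symbol 0, so the observed process restarts at every
visit to it: it is a renewal process. Let `f 0 = a` and `f (j + 1) = r B ^ j c` be the law of the
return time. Sorting blocks by their last 0 shows that the entropy rate is `π 0` times the entropy
of this law, and `π 0` is the reciprocal of the mean return time `1 + r (1 - B)⁻¹ 1`
(`hasEntropyRate_iff`). Irreducibility makes some power of `B` a contraction, so the mean return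
time is analytic and everything turns on `loopEntropy`, the sum of `-f j log f j`.

Sufficiency (`exists_analyticAt_loopEntropy`). If `B` has a simple dominant eigenvalue `l`, then `r
B ^ j c = l ^ j g j`, where `g` is an analytic function of the matrix with values in the bounded
sequences, and under the positivity condition it is bounded below by a positive constant. Hence `log
f (j + 1) = j log l + log g j`, and summation against geometric weights is analytic.

Necessity. Natural coordinates chart the matrices with row sums one, so analyticity passes to
`LoopEntropyAnalyticAt`. This is an open condition, which permits perturbing the matrix at will. If
some `f m` vanishes, a mixture with weight `ε` of the uniform matrix makes the first such term at
least `κ ε`; then `-f log f` gains at least of order `ε log (1 / ε)`, while all other terms together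
lose only `O(ε)`, against differentiability (`loopProb_pos_of_analyticAt`).

For the spectral condition, `r` and `c` are first made positive without changing the spectrum of
`B`. Two explicit two-parameter families of perturbations are then incompatible with analyticity.
(a) If `P` is a nonnegative eigenprojection at `lam` with `α = r P c`, interpolation between `B` and
`lam P` produces return probabilities `lam ^ j (α + s + d j exp (-j δ))`. When `d j ≤ -η` infinitely
often, the mixed Taylor coefficients in `s` and `δ` outgrow every geometric bound
(`false_of_analytic_exp`). (b) If `B` has a Jordan block of size two at `lam`, splitting it produces
`lam ^ j (β (exp ((j + h) δ) - 1) / δ + s exp ((j + h) δ) + ν j)`. Its coefficients of `s ^ 2` would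
force the Taylor series of `z exp (2 z) / (exp z - 1)` to converge beyond its poles at `± 2 π i`
(`false_of_analytic_linear`). A multiple Perron eigenvalue is reduced by small perturbations to
multiplicity exactly two with all other eigenvalues strictly smaller in modulus; semisimple, it
contradicts (a), otherwise (b). If the Perron eigenvalue is simple but another eigenvalue has the
same modulus, the oscillation of `r B ^ j c / lam ^ j` about its Abel mean `α` contradicts (a). -/

lemma vecMul_entry_nonneg {v : ι → ℝ} {M : Matrix ι κ ℝ} (hv : ∀ i, 0 ≤ v i)
    (hM : ∀ i j, 0 ≤ M i j) (j : κ) : 0 ≤ (v ᵥ* M) j := by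
  simp only [vecMul, dotProduct]
  exact Finset.sum_nonneg fun i _ => mul_nonneg (hv i) (hM i j)

lemma mulVec_entry_nonneg {v : κ → ℝ} {M : Matrix ι κ ℝ} (hv : ∀ i, 0 ≤ v i)
    (hM : ∀ i j, 0 ≤ M i j) (j : ι) : 0 ≤ (M *ᵥ v) j := by
  simp only [mulVec, dotProduct]
  exact Finset.sum_nonneg fun i _ => mul_nonneg (hM j i) (hv i)

end Nonneg

/-! ### Block probabilities through forward vectors. -/

section Forward

variable {S A : Type*} [Fintype S] [DecidableEq S] [Fintype A] [DecidableEq A]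

/-- The forward vector of a block: `forwardVec Δ π Φ k z s` is the probability that the hidden
chain emits the block `z` and that the Markov chain is then in state `s`. -/
def forwardVec (Δ : Matrix S S ℝ) (π : S → ℝ) (Φ : S → A) :
    (k : ℕ) → (Fin (k + 1) → A) → S → ℝ
  | 0, z, s => if Φ s = z 0 then π s else 0
  | k + 1, z, s =>
    if Φ s = z (Fin.last _) then (forwardVec Δ π Φ k (Fin.init z) ᵥ* Δ) s else 0

lemma sum_fin_snoc {M : Type*} [AddCommMonoid M] {T : Type*} [Fintype T] {k : ℕ}
    (g : (Fin (k + 1) → T) → M) :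
    ∑ y, g y = ∑ y : Fin k → T, ∑ t, g (Fin.snoc (α := fun _ => T) y t) := by
  rw [← (Fin.snocEquiv (fun _ : Fin (k + 1) => T)).sum_comp g, Fintype.sum_prod_type_right]
  rfl

lemma markovProb_snoc (Δ : Matrix S S ℝ) (π : S → ℝ) {k : ℕ} (y : Fin (k + 1) → S) (t : S) :
    markovProb Δ π (k := k + 1) (Fin.snoc (α := fun _ => S) y t) =
      markovProb Δ π y * Δ (y (Fin.last k)) t := by
  unfold markovProb
  rw [Fin.prod_univ_castSucc, ← mul_assoc]
  congr 1
  · congr 1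
    refine Finset.prod_congr rfl fun i _ => ?_
    rw [Fin.snoc_castSucc, ← Fin.castSucc_succ, Fin.snoc_castSucc]
  · rw [Fin.snoc_castSucc, Fin.succ_last, Fin.snoc_last]

lemma comp_snoc_eq_iff {k : ℕ} (Φ : S → A) (y : Fin k → S) (t : S) (z : Fin (k + 1) → A) :
    Φ ∘ (Fin.snoc (α := fun _ => S) y t) = z ↔ Φ ∘ y = Fin.init z ∧ Φ t = z (Fin.last k) := by
  constructor
  · rintro rfl
    constructor
    · ext i; simp [Fin.init]
    · simp
  · rintro ⟨h1, h2⟩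
    ext i
    refine Fin.lastCases ?_ (fun i => ?_) i
    · simp [h2]
    · have := congrFun h1 i
      simpa [Fin.init] using this

/-- Induction on the block length: splitting off the last state makes the sum over paths factor
through the state before it, where the indicator leaves a single value. -/
lemma sum_markovProb_eq_forwardVec (Δ : Matrix S S ℝ) (π : S → ℝ) (Φ : S → A) :
    ∀ (k : ℕ) (z : Fin (k + 1) → A) (s : S),
      ∑ y : Fin (k + 1) → S, (if Φ ∘ y = z ∧ y (Fin.last k) = s then markovProb Δ π y else 0) =
        forwardVec Δ π Φ k z s
  | 0, z, s => by
    rw [Finset.sum_eq_single (fun _ => s)]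
    · have : (Φ ∘ (fun _ : Fin 1 => s) = z) ↔ Φ s = z 0 := by
        constructor
        · intro h; exact congrFun h 0
        · intro h; ext i; fin_cases i; exact h
      simp [forwardVec, this, markovProb]
    · intro y _ hy
      rw [if_neg]
      rintro ⟨-, h⟩
      apply hy
      ext i
      fin_cases i
      exact h
    · simp
  | k + 1, z, s => by
    rw [sum_fin_snoc]
    simp only [comp_snoc_eq_iff, Fin.snoc_last, markovProb_snoc]
    rw [forwardVec]
    have h1 : ∀ y : Fin (k + 1) → S,
        ∑ t, (if (Φ ∘ y = Fin.init z ∧ Φ t = z (Fin.last (k + 1))) ∧ t = s then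
          markovProb Δ π y * Δ (y (Fin.last k)) t else 0) =
        if Φ s = z (Fin.last (k + 1)) then
          (if Φ ∘ y = Fin.init z then markovProb Δ π y * Δ (y (Fin.last k)) s else 0) else 0 := by
      intro y
      rw [Finset.sum_eq_single s]
      · by_cases h : Φ s = z (Fin.last (k + 1)) <;> simp [h]
      · intro t _ ht
        simp [ht]
      · simp
    simp only [h1]
    split_ifs with h
    · simp only [vecMul, dotProduct, ← sum_markovProb_eq_forwardVec Δ π Φ k, Finset.sum_mul]
      rw [Finset.sum_comm]
      refine Finset.sum_congr rfl fun y _ => ?_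
      rw [Finset.sum_eq_single (y (Fin.last k))]
      · simp
      · intro t _ ht
        rw [if_neg (by rintro ⟨-, h⟩; exact ht h.symm), zero_mul]
      · simp
    · simp

lemma hiddenProb_eq_sum_forwardVec (Δ : Matrix S S ℝ) (π : S → ℝ) (Φ : S → A) {k : ℕ}
    (z : Fin (k + 1) → A) : hiddenProb Δ π Φ z = ∑ s, forwardVec Δ π Φ k z s := by
  simp only [← sum_markovProb_eq_forwardVec]
  rw [Finset.sum_comm, hiddenProb, Finset.sum_filter]
  refine Finset.sum_congr rfl fun y _ => ?_
  rw [Finset.sum_eq_single (y (Fin.last k))]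
  · simp
  · intro t _ ht
    rw [if_neg (by rintro ⟨-, h⟩; exact ht h.symm)]
  · simp

lemma forwardVec_snoc (Δ : Matrix S S ℝ) (π : S → ℝ) (Φ : S → A) {k : ℕ}
    (z : Fin (k + 1) → A) (b : A) :
    forwardVec Δ π Φ (k + 1) (Fin.snoc (α := fun _ => A) z b) =
      fun s => if Φ s = b then (forwardVec Δ π Φ k z ᵥ* Δ) s else 0 := by
  ext s
  rw [forwardVec, Fin.snoc_last, Fin.init_snoc]

/-- Summing over all observed blocks forgets the observation, so only the stationary law of the last
state remains. -/
lemma sum_forwardVec (Δ : Matrix S S ℝ) (π : S → ℝ) (Φ : S → A) (hπ : π ᵥ* Δ = π) :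
    ∀ k, ∑ z, forwardVec Δ π Φ k z = π
  | 0 => by
    ext s
    rw [sum_fin_snoc]
    have h : ∀ c : A, (Fin.snoc (α := fun _ => A) (default : Fin 0 → A) c) (0 : Fin 1) = c :=
      fun c => rfl
    simp [forwardVec, Finset.sum_apply, h]
  | k + 1 => by
    ext s
    rw [sum_fin_snoc]
    simp only [forwardVec_snoc, Finset.sum_apply]
    simp only [Finset.sum_ite_eq, Finset.mem_univ, if_true]
    have h := congrFun (congrArg (fun v => v ᵥ* Δ) (sum_forwardVec Δ π Φ hπ k)) s
    simp only [hπ, sum_vecMul, Finset.sum_apply] at h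
    exact h

lemma forwardVec_nonneg {Δ : Matrix S S ℝ} {π : S → ℝ} (Φ : S → A) (hΔ : ∀ i j, 0 ≤ Δ i j)
    (hπ : ∀ i, 0 ≤ π i) : ∀ k z s, 0 ≤ forwardVec Δ π Φ k z s
  | 0, z, s => by
    rw [forwardVec]; split_ifs; exacts [hπ s, le_rfl]
  | k + 1, z, s => by
    rw [forwardVec]
    split_ifs
    · exact vecMul_entry_nonneg (forwardVec_nonneg Φ hΔ hπ k _) hΔ s
    · exact le_rfl

end Forward

/-! ### Renewal decomposition of the conditional entropy. -/

section Unambiguous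

variable {n : ℕ}

/-- `loopProb Δ k` is the probability that the chain started in state `0` returns to it
for the first time after `k + 1` steps. -/
def loopProb (Δ : Matrix (Fin (n + 1)) (Fin (n + 1)) ℝ) : ℕ → ℝ
  | 0 => Δ 0 0
  | j + 1 => blockR Δ ⬝ᵥ (blockB Δ ^ j) *ᵥ blockC Δ

/-- The conditional entropy of the next symbol as a function of the forward vector. -/
def nextEntropy (Δ : Matrix (Fin (n + 1)) (Fin (n + 1)) ℝ) (α : Fin (n + 1) → ℝ) : ℝ :=
  -((α ᵥ* Δ) 0 * Real.log ((α ᵥ* Δ) 0 / ∑ s, α s) +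
    (∑ s : Fin n, (α ᵥ* Δ) s.succ) * Real.log ((∑ s : Fin n, (α ᵥ* Δ) s.succ) / ∑ s, α s))

lemma restrict_zero (v : Fin (n + 1) → ℝ) :
    (fun s => if unambiguousObs s = 0 then v s else 0) = v 0 • Pi.single 0 1 := by
  ext s
  refine Fin.cases ?_ (fun s => ?_) s <;> simp [unambiguousObs]

lemma restrict_one (v : Fin (n + 1) → ℝ) :
    (fun s => if unambiguousObs s = 1 then v s else 0) = Fin.cons 0 (fun s => v s.succ) := by
  ext s
  refine Fin.cases ?_ (fun s => ?_) s <;> simp [unambiguousObs]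

/-- A block influences the law of the next symbol only through its forward vector, and the next
symbol takes two values. -/
lemma condEntropy_eq_sum_nextEntropy (Δ : Matrix (Fin (n + 1)) (Fin (n + 1)) ℝ)
    (π : Fin (n + 1) → ℝ) (k : ℕ) :
    condEntropy Δ π unambiguousObs k =
      ∑ z, nextEntropy Δ (forwardVec Δ π unambiguousObs k z) := by
  rw [condEntropy, sum_fin_snoc, ← Finset.sum_neg_distrib]
  refine Finset.sum_congr rfl fun z _ => ?_
  rw [Fin.sum_univ_two]
  simp only [Fin.init_snoc, hiddenProb_eq_sum_forwardVec, forwardVec_snoc, nextEntropy]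
  rw [restrict_zero, restrict_one]
  simp [Fin.sum_univ_succ]

/-- This is the renewal property. After the symbol 0 the forward vector is a multiple of the unit
vector at state 0, so homogeneity of `Ψ` reduces all blocks ending in 0 to their total mass `π 0`;
blocks ending in 1 are pushed one step and lose their entry at state 0. -/
lemma sum_forwardVec_recursion (Δ : Matrix (Fin (n + 1)) (Fin (n + 1)) ℝ)
    {π : Fin (n + 1) → ℝ} (hπ : π ᵥ* Δ = π) (hΔ0 : ∀ i j, 0 ≤ Δ i j) (hπ0 : ∀ i, 0 ≤ π i)
    (Ψ : (Fin (n + 1) → ℝ) → ℝ) (hΨ : ∀ t : ℝ, 0 ≤ t → ∀ v, Ψ (t • v) = t * Ψ v) (k : ℕ) :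
    ∑ z, Ψ (forwardVec Δ π unambiguousObs (k + 1) z) =
      π 0 * Ψ (Pi.single 0 1) +
      ∑ z, Ψ (Fin.cons 0 fun s => (forwardVec Δ π unambiguousObs k z ᵥ* Δ) s.succ) := by
  rw [sum_fin_snoc]
  simp only [Fin.sum_univ_two, forwardVec_snoc, restrict_zero, restrict_one,
    Finset.sum_add_distrib]
  congr 1
  have h : ∀ z, Ψ ((forwardVec Δ π unambiguousObs k z ᵥ* Δ) 0 • Pi.single 0 1) =
      (forwardVec Δ π unambiguousObs k z ᵥ* Δ) 0 * Ψ (Pi.single 0 1) := fun z =>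
    hΨ _ (vecMul_entry_nonneg (forwardVec_nonneg _ hΔ0 hπ0 k z) hΔ0 0) _
  simp only [h, ← Finset.sum_mul]
  congr 1
  have := congrFun (congrArg (fun v => v ᵥ* Δ) (sum_forwardVec Δ π unambiguousObs hπ k)) 0
  simpa [sum_vecMul, Finset.sum_apply, hπ] using this

lemma vecMul_single_zero (Δ : Matrix (Fin (n + 1)) (Fin (n + 1)) ℝ) :
    (fun s : Fin n => ((Pi.single 0 1 : Fin (n + 1) → ℝ) ᵥ* Δ) s.succ) = blockR Δ := by
  ext s; simp [blockR]

lemma cons_vecMul_zero (Δ : Matrix (Fin (n + 1)) (Fin (n + 1)) ℝ) (v : Fin n → ℝ) :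
    ((Fin.cons 0 v : Fin (n + 1) → ℝ) ᵥ* Δ) 0 = v ⬝ᵥ blockC Δ := by
  simp [vecMul, dotProduct, Fin.sum_univ_succ, blockC]

lemma cons_vecMul_succ (Δ : Matrix (Fin (n + 1)) (Fin (n + 1)) ℝ) (v : Fin n → ℝ) :
    (fun s : Fin n => ((Fin.cons 0 v : Fin (n + 1) → ℝ) ᵥ* Δ) s.succ) = v ᵥ* blockB Δ := by
  ext s; simp [vecMul, dotProduct, Fin.sum_univ_succ, blockB]

/-- Blocks are sorted by their last 0: the summand of `i` collects those ending in a 0 followed by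
`i + 1` ones, the final term is the block without any 0. The function `Ψ` is quantified inside the
induction because the step applies the hypothesis to `Ψ` precomposed with one step of the chain. -/
lemma sum_forwardVec_eq (Δ : Matrix (Fin (n + 1)) (Fin (n + 1)) ℝ)
    {π : Fin (n + 1) → ℝ} (hπ : π ᵥ* Δ = π) (hΔ0 : ∀ i j, 0 ≤ Δ i j) (hπ0 : ∀ i, 0 ≤ π i) (k : ℕ) :
    ∀ (Ψ : (Fin (n + 1) → ℝ) → ℝ), (∀ t : ℝ, 0 ≤ t → ∀ v, Ψ (t • v) = t * Ψ v) →
    ∑ z, Ψ (forwardVec Δ π unambiguousObs k z) =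
      π 0 * (Ψ (Pi.single 0 1) + ∑ i ∈ Finset.range k,
        Ψ (Fin.cons 0 (blockR Δ ᵥ* blockB Δ ^ i))) +
      Ψ (Fin.cons 0 ((fun s => π (Fin.succ s)) ᵥ* blockB Δ ^ k)) := by
  induction k with
  | zero =>
    intro Ψ hΨ
    rw [sum_fin_snoc]
    have h : ∀ c : Fin 2, (Fin.snoc (α := fun _ => Fin 2) (default : Fin 0 → Fin 2) c) (0 : Fin 1)
        = c := fun c => rfl
    have h' : ∀ c : Fin 2, forwardVec Δ π unambiguousObs 0
        (Fin.snoc (α := fun _ => Fin 2) (default : Fin 0 → Fin 2) c) =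
        fun s => if unambiguousObs s = c then π s else 0 := by
      intro c; ext s; simp only [forwardVec, h]
    rw [Finset.univ_unique, Finset.sum_singleton, Fin.sum_univ_two]
    erw [h' 0, h' 1]
    rw [restrict_zero, restrict_one, hΨ _ (hπ0 0)]
    simp
  | succ k ih =>
    intro Ψ hΨ
    rw [sum_forwardVec_recursion Δ hπ hΔ0 hπ0 Ψ hΨ,
      ih (fun v => Ψ (Fin.cons 0 fun s => (v ᵥ* Δ) s.succ))]
    · simp only [vecMul_single_zero, cons_vecMul_succ, vecMul_vecMul, ← pow_succ]
      rw [Finset.sum_range_succ']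
      simp
      ring
    · intro t ht v
      rw [← hΨ t ht]
      congr 1
      ext s
      refine Fin.cases ?_ (fun s => ?_) s <;> simp [smul_vecMul]

lemma nextEntropy_smul (Δ : Matrix (Fin (n + 1)) (Fin (n + 1)) ℝ) (t : ℝ) (v : Fin (n + 1) → ℝ) :
    nextEntropy Δ (t • v) = t * nextEntropy Δ v := by
  rcases eq_or_ne t 0 with rfl | ht
  · simp [nextEntropy]
  · simp only [nextEntropy, smul_vecMul, Pi.smul_apply, smul_eq_mul, ← Finset.mul_sum,
      mul_div_mul_left _ _ ht]
    ring

lemma entropy_split {x y : ℝ} (hx : 0 ≤ x) (hy : 0 ≤ y) :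
    -(x * Real.log (x / (x + y)) + y * Real.log (y / (x + y))) =
      Real.negMulLog x + Real.negMulLog y - Real.negMulLog (x + y) := by
  rcases hx.eq_or_lt with rfl | hx
  · rcases hy.eq_or_lt with rfl | hy
    · simp
    · simp [hy.ne']
  · rcases hy.eq_or_lt with rfl | hy
    · simp [hx.ne']
    · rw [Real.log_div hx.ne' (by positivity), Real.log_div hy.ne' (by positivity)]
      simp only [Real.negMulLog]
      ring

lemma nextEntropy_eq {Δ : Matrix (Fin (n + 1)) (Fin (n + 1)) ℝ}
    (hΔ : Δ ∈ rowStochastic ℝ (Fin (n + 1))) {α : Fin (n + 1) → ℝ} (hα : ∀ i, 0 ≤ α i) :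
    nextEntropy Δ α = Real.negMulLog ((α ᵥ* Δ) 0) +
      Real.negMulLog (∑ s : Fin n, (α ᵥ* Δ) s.succ) - Real.negMulLog (∑ s, α s) := by
  have hp : ∀ j, 0 ≤ (α ᵥ* Δ) j := vecMul_entry_nonneg hα hΔ.1
  have hs : ∑ s, α s = (α ᵥ* Δ) 0 + ∑ s : Fin n, (α ᵥ* Δ) s.succ := by
    rw [← Fin.sum_univ_succ]
    have : (α ᵥ* Δ) ⬝ᵥ (1 : Fin (n + 1) → ℝ) = α ⬝ᵥ 1 := by
      rw [← dotProduct_mulVec, hΔ.2]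
    simpa [dotProduct] using this.symm
  rw [nextEntropy, hs, entropy_split (hp 0) (Finset.sum_nonneg fun s _ => hp _)]

/-- Each run of ones contributes the entropy term of one return probability plus a difference of two
tail terms. The tails telescope, so only the last one survives, and it vanishes in the limit. -/
lemma condEntropy_eq {Δ : Matrix (Fin (n + 1)) (Fin (n + 1)) ℝ}
    (hΔ : Δ ∈ rowStochastic ℝ (Fin (n + 1))) {π : Fin (n + 1) → ℝ} (hπ : IsStationary Δ π) (k : ℕ) :
    condEntropy Δ π unambiguousObs k =
      π 0 * (∑ i ∈ Finset.range (k + 1), Real.negMulLog (loopProb Δ i) +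
        Real.negMulLog (∑ s, (blockR Δ ᵥ* blockB Δ ^ k) s)) +
      nextEntropy Δ (Fin.cons 0 ((fun s => π (Fin.succ s)) ᵥ* blockB Δ ^ k)) := by
  rw [condEntropy_eq_sum_nextEntropy Δ π, sum_forwardVec_eq Δ hπ.2 hΔ.1 hπ.1.1 k _
    (fun t _ v => nextEntropy_smul Δ t v)]
  congr 2
  have hB : ∀ i : ℕ, ∀ s, 0 ≤ (blockR Δ ᵥ* blockB Δ ^ i) s := by
    intro i
    induction i with
    | zero => intro s; simpa [blockR] using hΔ.1 0 s.succ
    | succ i ih =>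
      intro s
      rw [pow_succ, ← vecMul_vecMul]
      exact vecMul_entry_nonneg ih (fun i j => hΔ.1 i.succ j.succ) s
  have h0 : nextEntropy Δ (Pi.single 0 1) = Real.negMulLog (loopProb Δ 0) +
      Real.negMulLog (∑ s, blockR Δ s) := by
    rw [nextEntropy_eq hΔ (fun i => by by_cases h : i = 0 <;> simp [h]),
      Fintype.sum_congr _ _ (congrFun (vecMul_single_zero Δ))]
    simp [loopProb]
  have hi : ∀ i, nextEntropy Δ (Fin.cons 0 (blockR Δ ᵥ* blockB Δ ^ i)) =
      Real.negMulLog (loopProb Δ (i + 1)) +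
      (Real.negMulLog (∑ s, (blockR Δ ᵥ* blockB Δ ^ (i + 1)) s) -
      Real.negMulLog (∑ s, (blockR Δ ᵥ* blockB Δ ^ i) s)) := by
    intro i
    rw [nextEntropy_eq hΔ (fun j => by
      refine Fin.cases ?_ (fun j => ?_) j
      · simp
      · simpa using hB i j), cons_vecMul_zero, Fintype.sum_congr _ _
        (congrFun (cons_vecMul_succ Δ _)), vecMul_vecMul, ← pow_succ, Fin.sum_univ_succ]
    simp [loopProb, dotProduct_mulVec]
    ring
  rw [h0, Finset.sum_congr rfl fun i _ => hi i, Finset.sum_add_distrib,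
    Finset.sum_range_sub (fun i => Real.negMulLog (∑ s, (blockR Δ ᵥ* blockB Δ ^ i) s)),
    Finset.sum_range_succ']
  simp
  ring

end Unambiguous

end

/-! ### Transient blocks, Kac's formula and the entropy rate. -/

section
open scoped Matrix.Norms.Operator

/-- Some positive power of the matrix is a strict contraction for the `ℓ^∞` operator norm. -/
def IsTransient {n : ℕ} (B : Matrix (Fin n) (Fin n) ℝ) : Prop := ∃ K, 0 < K ∧ ‖B ^ K‖ < 1

lemma exists_geometric_bound {R : Type*} [NormedRing R] {x : R} {K : ℕ} (hK : 0 < K)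
    (hx : ‖x ^ K‖ < 1) : ∃ C θ : ℝ, 0 < C ∧ 0 < θ ∧ θ < 1 ∧ ∀ k, ‖x ^ k‖ ≤ C * θ ^ k := by
  -- The maximum with `1 / 2` keeps `ρ`, and hence `θ`, positive even when `x ^ K` is zero.
  set ρ : ℝ := max ‖x ^ K‖ (1 / 2) with hρ
  have hρ0 : 0 < ρ := lt_of_lt_of_le (by norm_num) (le_max_right _ _)
  have hρ1 : ρ < 1 := max_lt hx (by norm_num)
  set θ : ℝ := ρ ^ ((K : ℝ)⁻¹) with hθ
  have hθ0 : 0 < θ := Real.rpow_pos_of_pos hρ0 _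
  have hθ1 : θ < 1 := Real.rpow_lt_one hρ0.le hρ1 (by positivity)
  have hθK : θ ^ K = ρ := Real.rpow_inv_natCast_pow hρ0.le hK.ne'
  set M : ℝ := 1 + ‖(1 : R)‖ + ∑ s ∈ Finset.range K, ‖x ^ s‖ with hM
  have hM0 : 0 < M := by positivity
  have hMs : ∀ s < K, ‖x ^ s‖ ≤ M := by
    intro s hs
    have := Finset.single_le_sum (f := fun s => ‖x ^ s‖) (fun i _ => norm_nonneg _)
      (Finset.mem_range.2 hs)
    have h1 := norm_nonneg (1 : R)
    linarith
  have hq : ∀ q s, s < K → ‖x ^ (K * q + s)‖ ≤ ρ ^ q * M := by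
    intro q
    induction q with
    | zero => intro s hs; simpa using hMs s hs
    | succ q ih =>
      intro s hs
      rw [show K * (q + 1) + s = K + (K * q + s) by ring, pow_add]
      calc ‖x ^ K * x ^ (K * q + s)‖ ≤ ‖x ^ K‖ * ‖x ^ (K * q + s)‖ := norm_mul_le _ _
        _ ≤ ρ * (ρ ^ q * M) := by
          gcongr
          · exact le_max_left _ _
          · exact ih s hs
        _ = _ := by ring
  refine ⟨M / θ ^ K, θ, by positivity, hθ0, hθ1, fun k => ?_⟩
  have h := hq (k / K) (k % K) (Nat.mod_lt _ hK)
  rw [Nat.div_add_mod] at h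
  refine h.trans ?_
  rw [div_mul_eq_mul_div, le_div_iff₀ (by positivity)]
  have h1 : θ ^ k = ρ ^ (k / K) * θ ^ (k % K) := by
    conv_lhs => rw [← Nat.div_add_mod k K, pow_add, pow_mul, hθK]
  have h2 : θ ^ K ≤ θ ^ (k % K) :=
    pow_le_pow_of_le_one hθ0.le hθ1.le (Nat.mod_lt _ hK).le
  rw [h1]
  calc ρ ^ (k / K) * M * θ ^ K ≤ ρ ^ (k / K) * M * θ ^ (k % K) := by gcongr
    _ = _ := by ring

variable {n : ℕ}

lemma IsTransient.bound {B : Matrix (Fin n) (Fin n) ℝ} (hB : IsTransient B) :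
    ∃ C θ : ℝ, 0 < C ∧ 0 < θ ∧ θ < 1 ∧ ∀ k, ‖B ^ k‖ ≤ C * θ ^ k := by
  obtain ⟨K, hK, h⟩ := hB
  exact exists_geometric_bound hK h

lemma abs_dotProduct_le (v w : Fin n → ℝ) : |v ⬝ᵥ w| ≤ (∑ i, |v i|) * ‖w‖ := by
  rw [dotProduct, Finset.sum_mul]
  refine (Finset.abs_sum_le_sum_abs _ _).trans (Finset.sum_le_sum fun i _ => ?_)
  rw [abs_mul]
  gcongr
  exact norm_le_pi_norm w i

lemma abs_bilin_le (v w : Fin n → ℝ) (M : Matrix (Fin n) (Fin n) ℝ) :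
    |v ⬝ᵥ M *ᵥ w| ≤ (∑ i, |v i|) * ‖w‖ * ‖M‖ := by
  refine (abs_dotProduct_le _ _).trans ?_
  rw [mul_assoc, mul_comm ‖w‖]
  gcongr
  · exact linfty_opNorm_mulVec M w

lemma IsTransient.tendsto_pow {B : Matrix (Fin n) (Fin n) ℝ} (hB : IsTransient B) :
    Tendsto (fun k => B ^ k) atTop (𝓝 0) := by
  obtain ⟨C, θ, hC, hθ0, hθ1, h⟩ := hB.bound
  have h2 : Tendsto (fun k : ℕ => C * θ ^ k) atTop (𝓝 0) := by
    simpa using (tendsto_pow_atTop_nhds_zero_of_lt_one hθ0.le hθ1).const_mul C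
  exact squeeze_zero_norm h h2

/-- The bound `-y log y ≤ 1` at `y = √x`. It turns geometric decay of probabilities into geometric
decay of their entropy terms, at the cost of a square root of the ratio. -/
lemma negMulLog_le_two_mul_sqrt {x : ℝ} (hx : 0 ≤ x) : Real.negMulLog x ≤ 2 * √x := by
  have key : ∀ y : ℝ, 0 ≤ y → -(y * Real.log y) ≤ 1 := by
    intro y hy
    rcases hy.eq_or_lt with rfl | hy
    · simp
    · have h := Real.one_sub_inv_le_log_of_pos hy
      have h2 := mul_le_mul_of_nonneg_left h hy.le
      rw [mul_sub, mul_inv_cancel₀ hy.ne'] at h2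
      linarith
  have h1 := key (√x) (Real.sqrt_nonneg x)
  rw [Real.log_sqrt hx] at h1
  have h2 : Real.negMulLog x = 2 * √x * (-(√x * (Real.log x / 2))) := by
    rw [Real.negMulLog]
    have := Real.mul_self_sqrt hx
    linear_combination (-Real.log x) * (-this)
  rw [h2]
  calc 2 * √x * (-(√x * (Real.log x / 2))) ≤ 2 * √x * 1 := by gcongr
    _ = _ := by ring

section Rate

variable {Δ : Matrix (Fin (n + 1)) (Fin (n + 1)) ℝ}

lemma blockB_nonneg (hΔ : ∀ i j, 0 ≤ Δ i j) (i j : Fin n) : 0 ≤ blockB Δ i j := hΔ _ _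

lemma blockR_nonneg (hΔ : ∀ i j, 0 ≤ Δ i j) (i : Fin n) : 0 ≤ blockR Δ i := hΔ _ _

lemma blockC_nonneg (hΔ : ∀ i j, 0 ≤ Δ i j) (i : Fin n) : 0 ≤ blockC Δ i := hΔ _ _

lemma loopProb_nonneg (hΔ : ∀ i j, 0 ≤ Δ i j) : ∀ k, 0 ≤ loopProb Δ k
  | 0 => hΔ 0 0
  | k + 1 => dotProduct_nonneg_of_nonneg (blockR_nonneg hΔ)
      (mulVec_entry_nonneg (blockC_nonneg hΔ) (pow_apply_nonneg (blockB_nonneg hΔ) k))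

lemma exists_loopProb_bound (hB : IsTransient (blockB Δ)) :
    ∃ C θ : ℝ, 0 < C ∧ 0 < θ ∧ θ < 1 ∧ ∀ k, |loopProb Δ k| ≤ C * θ ^ k := by
  obtain ⟨C, θ, hC, hθ0, hθ1, h⟩ := hB.bound
  set R := (∑ i, |blockR Δ i|) * ‖blockC Δ‖ with hR
  have hR0 : 0 ≤ R := by positivity
  refine ⟨|Δ 0 0| + 1 + R * C / θ, θ, by positivity, hθ0, hθ1, fun k => ?_⟩
  have hRC : 0 ≤ R * C / θ := by positivity
  cases k with
  | zero => simp only [loopProb, pow_zero, mul_one]; linarith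
  | succ j =>
    calc |loopProb Δ (j + 1)| ≤ R * ‖blockB Δ ^ j‖ := abs_bilin_le _ _ _
      _ ≤ R * (C * θ ^ j) := by gcongr; exact h j
      _ = R * C / θ * θ ^ (j + 1) := by rw [pow_succ]; field_simp
      _ ≤ _ := by
        gcongr
        have := abs_nonneg (Δ 0 0)
        linarith

lemma summable_negMulLog_of_geometric {f : ℕ → ℝ} (hf0 : ∀ k, 0 ≤ f k) (hf1 : ∀ k, f k ≤ 1)
    {C θ : ℝ} (hθ0 : 0 < θ) (hθ1 : θ < 1) (hf : ∀ k, f k ≤ C * θ ^ k) :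
    Summable fun k => Real.negMulLog (f k) := by
  have hs : Summable fun k : ℕ => 2 * (√C * (√θ) ^ k) :=
    ((summable_geometric_of_lt_one (Real.sqrt_nonneg _)
      (by rw [Real.sqrt_lt' one_pos]; simpa using hθ1)).mul_left _).mul_left _
  refine Summable.of_nonneg_of_le (fun k => Real.negMulLog_nonneg (hf0 k) (hf1 k))
    (fun k => ?_) hs
  refine (negMulLog_le_two_mul_sqrt (hf0 k)).trans ?_
  gcongr
  have h0 : 0 ≤ C := by have := (hf0 0).trans (hf 0); simpa using this
  refine Real.sqrt_le_iff.2 ⟨by positivity, (hf k).trans (le_of_eq ?_)⟩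
  rw [mul_pow, Real.sq_sqrt h0, ← pow_mul, mul_comm k 2, pow_mul, Real.sq_sqrt hθ0.le]

lemma blockB_mulVec_one (hΔ : Δ *ᵥ 1 = 1) : blockB Δ *ᵥ 1 = 1 - blockC Δ := by
  ext i
  have := congrFun hΔ i.succ
  simp only [mulVec, dotProduct, Fin.sum_univ_succ, Pi.one_apply, mul_one] at this
  simp only [mulVec, dotProduct, blockB, blockC, submatrix_apply, Pi.one_apply, mul_one,
    Pi.sub_apply]
  linarith

lemma blockR_sum (hΔ : Δ *ᵥ 1 = 1) : ∑ i, blockR Δ i = 1 - Δ 0 0 := by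
  have := congrFun hΔ 0
  simp only [mulVec, dotProduct, Fin.sum_univ_succ, Pi.one_apply, mul_one] at this
  simp only [blockR]
  linarith

/-- The tail `r B ^ k 1` is the probability of no return within `k + 1` steps; since `c = 1 - B 1`,
each return probability is a difference of consecutive tails. -/
lemma sum_loopProb (hΔ : Δ *ᵥ 1 = 1) (k : ℕ) :
    ∑ i ∈ Finset.range (k + 1), loopProb Δ i =
      1 - blockR Δ ⬝ᵥ (blockB Δ ^ k) *ᵥ 1 := by
  induction k with
  | zero => simp [loopProb, dotProduct, blockR_sum hΔ]
  | succ k ih =>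
    rw [Finset.sum_range_succ, ih, loopProb]
    have h : blockC Δ = 1 - blockB Δ *ᵥ 1 := by rw [blockB_mulVec_one hΔ]; simp
    rw [h, mulVec_sub, dotProduct_sub, mulVec_mulVec, ← pow_succ]
    ring

lemma loopProb_le_one (hΔ : Δ ∈ rowStochastic ℝ (Fin (n + 1))) (k : ℕ) : loopProb Δ k ≤ 1 := by
  have h1 := Finset.single_le_sum (f := loopProb Δ) (fun i _ => loopProb_nonneg hΔ.1 i)
    (Finset.mem_range.2 (Nat.lt_succ_self k))
  have h2 : 0 ≤ blockR Δ ⬝ᵥ (blockB Δ ^ k) *ᵥ 1 :=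
    dotProduct_nonneg_of_nonneg (blockR_nonneg hΔ.1)
      (mulVec_entry_nonneg (fun _ => zero_le_one) (pow_apply_nonneg (blockB_nonneg hΔ.1) k))
  rw [Nat.succ_eq_add_one, sum_loopProb hΔ.2] at h1
  linarith

lemma summable_negMulLog_loopProb (hΔ : Δ ∈ rowStochastic ℝ (Fin (n + 1)))
    (hB : IsTransient (blockB Δ)) : Summable fun k => Real.negMulLog (loopProb Δ k) := by
  obtain ⟨C, θ, hC, hθ0, hθ1, h⟩ := exists_loopProb_bound hB
  exact summable_negMulLog_of_geometric (loopProb_nonneg hΔ.1) (loopProb_le_one hΔ) hθ0 hθ1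
    fun k => (le_abs_self _).trans (h k)

/-- The entropy of the first return time to state `0`. -/
def loopEntropy (Δ : Matrix (Fin (n + 1)) (Fin (n + 1)) ℝ) : ℝ :=
  ∑' k, Real.negMulLog (loopProb Δ k)

/-- Both boundary terms of the finite formula are continuous functions of a row times `B ^ k`,
vanishing at zero, and `B ^ k` tends to zero. -/
lemma hasEntropyRate_of_isTransient (hΔ : Δ ∈ rowStochastic ℝ (Fin (n + 1)))
    (hB : IsTransient (blockB Δ)) {π : Fin (n + 1) → ℝ} (hπ : IsStationary Δ π) :
    HasEntropyRate Δ π unambiguousObs (π 0 * loopEntropy Δ) := by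
  rw [HasEntropyRate]
  simp only [condEntropy_eq hΔ hπ]
  have hpow := hB.tendsto_pow
  have hv : ∀ v : Fin n → ℝ, Tendsto (fun k => v ᵥ* blockB Δ ^ k) atTop (𝓝 0) := by
    intro v
    have h : Continuous fun M : Matrix (Fin n) (Fin n) ℝ => v ᵥ* M := by fun_prop
    simpa [Function.comp_def] using (h.tendsto 0).comp hpow
  have h1 : Tendsto (fun k => ∑ i ∈ Finset.range (k + 1), Real.negMulLog (loopProb Δ i)) atTop
      (𝓝 (loopEntropy Δ)) :=
    ((summable_negMulLog_loopProb hΔ hB).hasSum.tendsto_sum_nat).comp (tendsto_add_atTop_nat 1)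
  have h2 : Tendsto (fun k => Real.negMulLog (∑ s, (blockR Δ ᵥ* blockB Δ ^ k) s)) atTop
      (𝓝 0) := by
    have h : Continuous fun w : Fin n → ℝ => Real.negMulLog (∑ s, w s) :=
      Real.continuous_negMulLog.comp (by fun_prop)
    simpa [Function.comp_def] using (h.tendsto 0).comp (hv (blockR Δ))
  set v : Fin n → ℝ := fun s => π s.succ
  have hv0 : ∀ k s, 0 ≤ (v ᵥ* blockB Δ ^ k) s := fun k =>
    vecMul_entry_nonneg (fun s => hπ.1.1 s.succ) (pow_apply_nonneg (blockB_nonneg hΔ.1) k)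
  have h3 : Tendsto (fun k => nextEntropy Δ (Fin.cons 0 (v ᵥ* blockB Δ ^ k))) atTop (𝓝 0) := by
    have heq : ∀ k, nextEntropy Δ (Fin.cons 0 (v ᵥ* blockB Δ ^ k)) =
        Real.negMulLog ((v ᵥ* blockB Δ ^ k) ⬝ᵥ blockC Δ) +
        Real.negMulLog (∑ s, ((v ᵥ* blockB Δ ^ k) ᵥ* blockB Δ) s) -
        Real.negMulLog (∑ s, (v ᵥ* blockB Δ ^ k) s) := by
      intro k
      rw [nextEntropy_eq hΔ (fun j => by
        refine Fin.cases ?_ (fun j => ?_) j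
        · simp
        · simpa using hv0 k j), cons_vecMul_zero, Fintype.sum_congr _ _
          (congrFun (cons_vecMul_succ Δ _)), Fin.sum_univ_succ]
      simp
    simp only [heq]
    have h : Continuous fun w : Fin n → ℝ => Real.negMulLog (w ⬝ᵥ blockC Δ) +
        Real.negMulLog (∑ s, (w ᵥ* blockB Δ) s) - Real.negMulLog (∑ s, w s) :=
      ((Real.continuous_negMulLog.comp (by fun_prop)).add
        (Real.continuous_negMulLog.comp (by fun_prop))).sub
        (Real.continuous_negMulLog.comp (by fun_prop))
    simpa [Function.comp_def] using (h.tendsto 0).comp (hv v)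
  simpa using ((h1.add h2).const_mul (π 0)).add h3

/-- For a transient matrix `B` the matrix `1 - B` is invertible. -/
lemma IsTransient.isUnit_one_sub {B : Matrix (Fin n) (Fin n) ℝ} (hB : IsTransient B) :
    IsUnit (1 - B) := by
  obtain ⟨K, hK, h⟩ := hB
  have h1 : IsUnit (1 - B ^ K) := isUnit_one_sub_of_norm_lt_one h
  have h2 : (1 - B) * ∑ i ∈ Finset.range K, B ^ i = 1 - B ^ K := by
    have := mul_neg_geom_sum B K
    exact this
  have h3 : Commute (1 - B) (∑ i ∈ Finset.range K, B ^ i) :=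
    Commute.sum_right _ _ _ fun i _ =>
      ((Commute.one_left _).sub_left ((Commute.refl B).pow_right i))
  rw [← h2] at h1
  exact (h3.isUnit_mul_iff.1 h1).1

/-- The partial sums of the Neumann series are nonnegative and converge to the inverse. -/
lemma IsTransient.inv_nonneg {B : Matrix (Fin n) (Fin n) ℝ} (hB : IsTransient B)
    (h0 : ∀ i j, 0 ≤ B i j) (i j : Fin n) : 0 ≤ ((1 - B)⁻¹) i j := by
  have hU := hB.isUnit_one_sub
  have hdet := (isUnit_iff_isUnit_det _).1 hU
  have h1 : ∀ k, ∑ i ∈ Finset.range k, B ^ i = (1 - B)⁻¹ * (1 - B ^ k) := by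
    intro k
    rw [← mul_neg_geom_sum B k, ← mul_assoc, nonsing_inv_mul _ hdet, one_mul]
  have h2 : Tendsto (fun k => ((1 - B)⁻¹ * (1 - B ^ k) : Matrix (Fin n) (Fin n) ℝ) i j)
      atTop (𝓝 (((1 - B)⁻¹) i j)) := by
    have h : Continuous fun M : Matrix (Fin n) (Fin n) ℝ => ((1 - B)⁻¹ * (1 - M)) i j := by
      fun_prop
    simpa [Function.comp_def] using (h.tendsto 0).comp hB.tendsto_pow
  refine ge_of_tendsto' h2 fun k => ?_
  rw [← h1, Matrix.sum_apply]
  exact Finset.sum_nonneg fun m _ => pow_apply_nonneg h0 m i j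

/-- The mean return time to state `0`. -/
def meanReturn (Δ : Matrix (Fin (n + 1)) (Fin (n + 1)) ℝ) : ℝ :=
  1 + blockR Δ ⬝ᵥ (1 - blockB Δ)⁻¹ *ᵥ 1

lemma one_le_meanReturn (hΔ : ∀ i j, 0 ≤ Δ i j) (hB : IsTransient (blockB Δ)) :
    1 ≤ meanReturn Δ := by
  have : 0 ≤ blockR Δ ⬝ᵥ (1 - blockB Δ)⁻¹ *ᵥ 1 :=
    dotProduct_nonneg_of_nonneg (blockR_nonneg hΔ) (mulVec_entry_nonneg (fun _ => zero_le_one)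
      (hB.inv_nonneg (blockB_nonneg hΔ)))
  rw [meanReturn]; linarith

/-- Kac's formula. Off state 0, stationarity reads `v (1 - B) = π 0 • r`; solving for `v` and
normalising the total mass gives the mean return time. -/
lemma stationary_apply_zero (hB : IsTransient (blockB Δ)) {π : Fin (n + 1) → ℝ}
    (hπ : IsStationary Δ π) : π 0 * meanReturn Δ = 1 := by
  have hdet := (isUnit_iff_isUnit_det _).1 hB.isUnit_one_sub
  set v : Fin n → ℝ := fun s => π s.succ with hv
  have h1 : v = π 0 • blockR Δ + v ᵥ* blockB Δ := by
    ext s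
    have := congrFun hπ.2 s.succ
    simp only [vecMul, dotProduct, Fin.sum_univ_succ] at this
    simp only [hv, vecMul, dotProduct, blockR, blockB, submatrix_apply, Pi.add_apply,
      Pi.smul_apply, smul_eq_mul]
    exact this.symm
  have h2 : v ᵥ* (1 - blockB Δ) = π 0 • blockR Δ := by
    rw [vecMul_sub, vecMul_one]
    nth_rewrite 1 [h1]
    simp
  have h3 : v = π 0 • (blockR Δ ᵥ* (1 - blockB Δ)⁻¹) := by
    rw [← smul_vecMul, ← h2, vecMul_vecMul, mul_nonsing_inv _ hdet, vecMul_one]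
  have h4 := hπ.1.2
  rw [Fin.sum_univ_succ] at h4
  have h5 : ∑ s : Fin n, π s.succ = v ⬝ᵥ 1 := by simp [dotProduct, hv]
  rw [h5, h3, smul_dotProduct, ← dotProduct_mulVec] at h4
  rw [meanReturn, mul_add, mul_one]
  simpa using h4

/-- The vector is explicit: mass one at state 0 and the expected numbers of visits `r (1 - B)⁻¹`
during one excursion elsewhere, normalised. Its equation at state 0 is the row-sum identity. -/
lemma exists_isStationary (hΔ : Δ ∈ rowStochastic ℝ (Fin (n + 1)))
    (hB : IsTransient (blockB Δ)) : ∃ π, IsStationary Δ π := by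
  have hdet := (isUnit_iff_isUnit_det _).1 hB.isUnit_one_sub
  have hm := one_le_meanReturn hΔ.1 hB
  set w := blockR Δ ᵥ* (1 - blockB Δ)⁻¹ with hw
  have hw0 : ∀ i, 0 ≤ w i := vecMul_entry_nonneg (blockR_nonneg hΔ.1)
    (hB.inv_nonneg (blockB_nonneg hΔ.1))
  have hw1 : w ᵥ* blockB Δ = w - blockR Δ := by
    have : w ᵥ* (1 - blockB Δ) = blockR Δ := by
      rw [hw, vecMul_vecMul, nonsing_inv_mul _ hdet, vecMul_one]
    rw [vecMul_sub, vecMul_one] at this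
    rw [← this]; simp
  have hwm : meanReturn Δ = 1 + ∑ i, w i := by
    rw [meanReturn, dotProduct_mulVec, ← hw]
    simp [dotProduct]
  have hwc : Δ 0 0 + w ⬝ᵥ blockC Δ = 1 := by
    have : blockC Δ = 1 - blockB Δ *ᵥ 1 := by rw [blockB_mulVec_one hΔ.2]; simp
    rw [this, dotProduct_sub, dotProduct_mulVec, hw1, sub_dotProduct]
    have := blockR_sum hΔ.2
    simp only [dotProduct, Pi.one_apply, mul_one]
    linarith
  set u : Fin (n + 1) → ℝ := Fin.cons 1 w with hu
  have hu1 : u ᵥ* Δ = u := by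
    ext s
    refine Fin.cases ?_ (fun s => ?_) s
    · simp only [vecMul, dotProduct, Fin.sum_univ_succ, hu, Fin.cons_zero, Fin.cons_succ, one_mul]
      simpa [dotProduct, blockC] using hwc
    · have := congrFun hw1 s
      simp only [vecMul, dotProduct, Fin.sum_univ_succ, hu, Fin.cons_zero, Fin.cons_succ, one_mul]
      simp only [vecMul, dotProduct, blockB, submatrix_apply, Pi.sub_apply, blockR] at this
      rw [this]; ring
  refine ⟨(meanReturn Δ)⁻¹ • u, ⟨fun i => ?_, ?_⟩, ?_⟩
  · refine mul_nonneg (inv_nonneg.2 (by linarith)) ?_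
    refine Fin.cases ?_ (fun s => ?_) i
    · simp [hu]
    · simpa [hu] using hw0 s
  · simp only [Pi.smul_apply, smul_eq_mul, ← Finset.mul_sum, Fin.sum_univ_succ, hu,
      Fin.cons_zero, Fin.cons_succ]
    rw [← hwm, inv_mul_cancel₀ (by linarith)]
  · rw [smul_vecMul, hu1]

/-- The existence of a stationary vector is needed for the forward direction, since otherwise the
left side would hold vacuously for every `h`. -/
lemma hasEntropyRate_iff (hΔ : Δ ∈ rowStochastic ℝ (Fin (n + 1)))
    (hB : IsTransient (blockB Δ)) (h : ℝ) :
    (∀ π, IsStationary Δ π → HasEntropyRate Δ π unambiguousObs h) ↔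
      h = loopEntropy Δ / meanReturn Δ := by
  have hm := one_le_meanReturn hΔ.1 hB
  have h0 : ∀ π, IsStationary Δ π → π 0 * loopEntropy Δ = loopEntropy Δ / meanReturn Δ := by
    intro π hπ
    rw [eq_div_iff (by linarith), mul_right_comm, stationary_apply_zero hB hπ, one_mul]
  constructor
  · intro H
    obtain ⟨π, hπ⟩ := exists_isStationary hΔ hB
    rw [← h0 π hπ]
    exact tendsto_nhds_unique (H π hπ) (hasEntropyRate_of_isTransient hΔ hB hπ)
  · rintro rfl π hπ
    rw [← h0 π hπ]
    exact hasEntropyRate_of_isTransient hΔ hB hπ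

end Rate

end

/-! ### Irreducibility makes the block `B` transient. -/

section
open scoped Matrix.Norms.Operator

variable {n : ℕ} {Δ : Matrix (Fin (n + 1)) (Fin (n + 1)) ℝ}

lemma opNorm_lt_one_iff_of_nonneg {M : Matrix (Fin n) (Fin n) ℝ} (hM : ∀ i j, 0 ≤ M i j) :
    ‖M‖ < 1 ↔ ∀ i, (M *ᵥ 1) i < 1 := by
  rw [linfty_opNorm_def, ← NNReal.coe_one, NNReal.coe_lt_coe,
    Finset.sup_lt_iff (by simp)]
  simp only [Finset.mem_univ, forall_const, ← NNReal.coe_lt_coe, NNReal.coe_sum, coe_nnnorm,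
    NNReal.coe_one, mulVec, dotProduct, Pi.one_apply, mul_one, Real.norm_eq_abs,
    abs_of_nonneg (hM _ _)]

/-- If every `B ^ t c` vanished at `i`, the same would hold at each `j` with `B i j ≠ 0`. No path
from `i` could then ever reach state 0. -/
lemma exists_pow_mulVec_blockC_pos (hirr : Δ.IsIrreducible) (i : Fin n) :
    ∃ t, 0 < ((blockB Δ ^ t) *ᵥ blockC Δ) i := by
  have hΔ := hirr.nonneg
  by_contra! hcon
  have hnn : ∀ t i, 0 ≤ ((blockB Δ ^ t) *ᵥ blockC Δ) i := fun t =>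
    mulVec_entry_nonneg (blockC_nonneg hΔ) (pow_apply_nonneg (blockB_nonneg hΔ) t)
  have hz : ∀ k, ∀ i : Fin n, (∀ t, ((blockB Δ ^ t) *ᵥ blockC Δ) i = 0) →
      (Δ ^ k) i.succ 0 = 0 := by
    intro k
    induction k with
    | zero => intro i _; simp
    | succ k ih =>
      intro i hi
      rw [pow_succ', mul_apply, Fin.sum_univ_succ]
      have hc : Δ i.succ 0 = 0 := by simpa [blockC] using hi 0
      rw [hc, zero_mul, zero_add]
      refine Finset.sum_eq_zero fun j _ => ?_
      by_cases hij : Δ i.succ j.succ = 0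
      · rw [hij, zero_mul]
      · rw [ih j, mul_zero]
        intro t
        have h := hi (t + 1)
        rw [pow_succ', ← mulVec_mulVec, mulVec, dotProduct] at h
        have h2 := (Finset.sum_eq_zero_iff_of_nonneg fun j _ =>
          mul_nonneg (blockB_nonneg hΔ i j) (hnn t j)).1 h j (Finset.mem_univ _)
        exact (mul_eq_zero.1 h2).resolve_left hij
  obtain ⟨k, -, hk⟩ := (isIrreducible_iff_exists_pow_pos hΔ).1 hirr i.succ 0
  exact hk.ne' (hz k i fun t => le_antisymm (hcon t) (hnn t i))

lemma exists_blockR_vecMul_pow_pos (hirr : Δ.IsIrreducible) (i : Fin n) :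
    ∃ t, 0 < (blockR Δ ᵥ* (blockB Δ ^ t)) i := by
  obtain ⟨t, ht⟩ := exists_pow_mulVec_blockC_pos hirr.transpose i
  refine ⟨t, ?_⟩
  have h1 : blockB Δᵀ = (blockB Δ)ᵀ := rfl
  have h2 : blockC Δᵀ = blockR Δ := rfl
  rwa [h1, h2, ← transpose_pow, mulVec_transpose] at ht

lemma pow_mulVec_one (hΔ : Δ *ᵥ 1 = 1) (k : ℕ) :
    (blockB Δ ^ k) *ᵥ 1 = 1 - ∑ t ∈ Finset.range k, (blockB Δ ^ t) *ᵥ blockC Δ := by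
  induction k with
  | zero => simp
  | succ k ih =>
    rw [pow_succ, ← mulVec_mulVec, blockB_mulVec_one hΔ, mulVec_sub, ih,
      Finset.sum_range_succ]
    abel

/-- For `K` larger than every hitting time `t i`, state 0 is reached within `K` steps with positive
probability from everywhere, so all row sums of `B ^ K` are below one. -/
lemma isTransient_of_isIrreducible (hΔ : Δ ∈ rowStochastic ℝ (Fin (n + 1)))
    (hirr : Δ.IsIrreducible) : IsTransient (blockB Δ) := by
  choose t ht using exists_pow_mulVec_blockC_pos hirr
  set K := ∑ i, t i + 1 with hK
  refine ⟨K, Nat.succ_pos _, ?_⟩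
  rw [opNorm_lt_one_iff_of_nonneg (pow_apply_nonneg (blockB_nonneg hΔ.1) K)]
  intro i
  rw [pow_mulVec_one hΔ.2, Pi.sub_apply, Finset.sum_apply, Pi.one_apply]
  have hti : t i ∈ Finset.range K := by
    rw [Finset.mem_range, hK, Nat.lt_succ_iff]
    exact Finset.single_le_sum (f := t) (fun _ _ => Nat.zero_le _) (Finset.mem_univ i)
  have := Finset.single_le_sum (f := fun t => ((blockB Δ ^ t) *ᵥ blockC Δ) i)
    (fun t _ => mulVec_entry_nonneg (blockC_nonneg hΔ.1)
      (pow_apply_nonneg (blockB_nonneg hΔ.1) t) i) hti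
  have h2 := ht i
  linarith

/-- Openness is what lets the entropy formula be used throughout a neighbourhood, where
irreducibility may fail. -/
lemma isOpen_isTransient : IsOpen {B : Matrix (Fin n) (Fin n) ℝ | IsTransient B} := by
  have : {B : Matrix (Fin n) (Fin n) ℝ | IsTransient B} =
      ⋃ K ∈ {K : ℕ | 0 < K}, {B | ‖B ^ K‖ < 1} := by
    ext B; simp [IsTransient]
  rw [this]
  exact isOpen_biUnion fun K _ => isOpen_lt (by fun_prop) continuous_const

lemma continuous_blockB : Continuous (blockB : Matrix (Fin (n + 1)) (Fin (n + 1)) ℝ → _) :=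
  continuous_id.matrix_submatrix _ _

lemma IsTransient.eventually (h : IsTransient (blockB Δ)) :
    ∀ᶠ Δ' in 𝓝 Δ, IsTransient (blockB Δ') :=
  continuous_blockB.continuousAt.eventually (isOpen_isTransient.mem_nhds h)

end

/-! ### Analytic maps into the space of bounded sequences. -/

section
open scoped BoundedContinuousFunction

section PowerSequence

variable {R : Type*} [NormedRing R] [NormedAlgebra ℝ R]

/-- The weighted right shift `x ↦ (0, M x 0, M x 1, …)` on bounded sequences. -/
def shiftMul : R →L[ℝ] (ℕ →ᵇ R) →L[ℝ] (ℕ →ᵇ R) :=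
  LinearMap.mkContinuous₂ (LinearMap.mk₂ ℝ
    (fun M x => BoundedContinuousFunction.ofNormedAddCommGroupDiscrete
      (fun k => Nat.casesOn k 0 fun k => M * x k) (‖M‖ * ‖x‖) (by
        rintro (_ | k)
        · simpa using by positivity
        · exact (norm_mul_le _ _).trans (by gcongr; exact x.norm_coe_le_norm k)))
    (fun M N x => by ext (_ | k) <;> simp [add_mul])
    (fun a M x => by ext (_ | k) <;> simp)
    (fun M x y => by ext (_ | k) <;> simp [mul_add])
    (fun a M x => by ext (_ | k) <;> simp)) 1 (fun M x => by
      rw [one_mul]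
      refine (BoundedContinuousFunction.norm_le (by positivity)).2 ?_
      rintro (_ | k)
      · simpa using by positivity
      · exact (norm_mul_le _ _).trans (by gcongr; exact x.norm_coe_le_norm k))

@[simp] lemma shiftMul_zero (M : R) (x : ℕ →ᵇ R) : shiftMul M x 0 = 0 := rfl

@[simp] lemma shiftMul_succ (M : R) (x : ℕ →ᵇ R) (k : ℕ) :
    shiftMul M x (k + 1) = M * x k := rfl

lemma shiftMul_pow_apply (M : R) (x : ℕ →ᵇ R) (K k : ℕ) :
    (shiftMul M ^ K) x k = if k < K then 0 else M ^ K * x (k - K) := by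
  induction K generalizing k with
  | zero => simp
  | succ K ih =>
    rw [pow_succ', mul_apply_eq_comp]
    cases k with
    | zero => simp
    | succ k =>
      rw [shiftMul_succ, ih]
      simp only [Nat.add_lt_add_iff_right, Nat.add_sub_add_right]
      split_ifs
      · simp
      · rw [pow_succ', mul_assoc]

/-- A contracting power of `M` thus gives a contracting power of the shift operator, so that the
latter's resolvent exists. -/
lemma norm_shiftMul_pow_le (M : R) (K : ℕ) : ‖(shiftMul M) ^ K‖ ≤ ‖M ^ K‖ := by
  refine ContinuousLinearMap.opNorm_le_bound _ (norm_nonneg _) fun x => ?_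
  refine (BoundedContinuousFunction.norm_le (by positivity)).2 fun k => ?_
  rw [shiftMul_pow_apply]
  split_ifs
  · simpa using by positivity
  · exact (norm_mul_le _ _).trans (by gcongr; exact x.norm_coe_le_norm _)

lemma isUnit_one_sub_of_norm_pow_lt_one {A : Type*} [NormedRing A] [HasSummableGeomSeries A]
    {x : A} {K : ℕ} (h : ‖x ^ K‖ < 1) : IsUnit (1 - x) := by
  have h1 : IsUnit (1 - x ^ K) := isUnit_one_sub_of_norm_lt_one h
  have h3 : Commute (1 - x) (∑ i ∈ Finset.range K, x ^ i) :=
    Commute.sum_right _ _ _ fun i _ => (Commute.one_left _).sub_left ((Commute.refl x).pow_right i)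
  rw [← mul_neg_geom_sum x K] at h1
  exact (h3.isUnit_mul_iff.1 h1).1

/-- The solution is `(1 - S v)⁻¹ ι`: units form an open set, on which inversion is analytic. -/
lemma exists_analyticAt_resolvent {V X : Type*} [NormedAddCommGroup V] [NormedSpace ℝ V]
    [NormedAddCommGroup X] [NormedSpace ℝ X] [CompleteSpace X] (S : V →L[ℝ] X →L[ℝ] X) (ι : X)
    {v₀ : V} {K : ℕ} (h : ‖S v₀ ^ K‖ < 1) :
    ∃ Φ : V → X, AnalyticAt ℝ Φ v₀ ∧ ∀ᶠ v in 𝓝 v₀, Φ v - S v (Φ v) = ι := by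
  have hu : IsUnit (1 - S v₀) := isUnit_one_sub_of_norm_pow_lt_one h
  have hcont : Continuous fun v : V => 1 - S v := continuous_const.sub S.continuous
  refine ⟨fun v => Ring.inverse (1 - S v) ι, ?_, ?_⟩
  · have h1 : AnalyticAt ℝ (fun v : V => 1 - S v) v₀ := analyticAt_const.sub (S.analyticAt v₀)
    obtain ⟨z, hz⟩ := hu
    have h2 : AnalyticAt ℝ (Ring.inverse : (X →L[ℝ] X) → _) (1 - S v₀) := by
      rw [← hz]; exact analyticAt_inverse z
    have h3 := AnalyticAt.comp (f := fun v : V => 1 - S v) h2 h1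
    exact ((ContinuousLinearMap.apply ℝ X ι).analyticAt _).comp h3
  · filter_upwards [hcont.continuousAt.eventually (Units.isOpen.mem_nhds hu)] with v hv
    have h4 : (1 - S v) (Ring.inverse (1 - S v) ι) = ι := by
      rw [← mul_apply_eq_comp, Ring.mul_inverse_cancel _ hv]; rfl
    simpa using h4

/-- The map sending `M` to the bounded sequence of its powers is analytic at every `M₀` some power
of which is a strict contraction. -/
lemma exists_analyticAt_powers [CompleteSpace R] {M₀ : R} {K : ℕ} (hM : ‖M₀ ^ K‖ < 1) :
    ∃ Φ : R → (ℕ →ᵇ R), AnalyticAt ℝ Φ M₀ ∧ ∀ᶠ M in 𝓝 M₀, ∀ k, Φ M k = M ^ k := by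
  -- The sequence of powers is the solution of `x = ι + shiftMul M x` with `ι = (1, 0, 0, …)`.
  set ι : ℕ →ᵇ R := BoundedContinuousFunction.ofNormedAddCommGroupDiscrete
    (fun k => if k = 0 then 1 else 0) ‖(1 : R)‖ (fun k => by split_ifs <;> simp) with hι
  obtain ⟨Φ, hΦ, h⟩ := exists_analyticAt_resolvent (shiftMul (R := R)) ι (K := K)
    ((norm_shiftMul_pow_le _ _).trans_lt hM)
  refine ⟨Φ, hΦ, ?_⟩
  filter_upwards [h] with M h4 k
  have h5 : ∀ k, Φ M k - shiftMul M (Φ M) k = ι k := fun k => by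
    simpa using DFunLike.congr_fun h4 k
  induction k with
  | zero => simpa [hι] using h5 0
  | succ k ih =>
    have := h5 (k + 1)
    rw [shiftMul_succ, ih, ← pow_succ', sub_eq_iff_eq_add] at this
    rw [this]; simp [hι]

end PowerSequence

section Logarithm

/-- The pointwise logarithm of bounded sequences is analytic at every sequence that is bounded below
by a positive constant. -/
lemma exists_analyticAt_log {g₀ : ℕ →ᵇ ℝ} {c : ℝ} (hc : 0 < c) (hg : ∀ k, c ≤ g₀ k) :
    ∃ Λ : (ℕ →ᵇ ℝ) → (ℕ →ᵇ ℝ), AnalyticAt ℝ Λ g₀ ∧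
      ∀ᶠ g in 𝓝 g₀, ∀ k, Λ g k = Real.log (g k) := by
  have hpos : ∀ k, 0 < g₀ k := fun k => hc.trans_le (hg k)
  set gi : ℕ →ᵇ ℝ := BoundedContinuousFunction.ofNormedAddCommGroupDiscrete
    (fun k => (g₀ k)⁻¹) c⁻¹ (fun k => by
      rw [norm_inv, Real.norm_of_nonneg (hpos k).le]
      exact inv_anti₀ hc (hg k)) with hgi
  set gl : ℕ →ᵇ ℝ := BoundedContinuousFunction.ofNormedAddCommGroupDiscrete
    (fun k => Real.log (g₀ k)) (|Real.log c| + |Real.log ‖g₀‖|) (fun k => by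
      have h1 := Real.log_le_log hc (hg k)
      have h2 := Real.log_le_log (hpos k) ((le_abs_self _).trans (g₀.norm_coe_le_norm k))
      have := neg_abs_le (Real.log c)
      have := le_abs_self (Real.log ‖g₀‖)
      have := abs_nonneg (Real.log c)
      have := abs_nonneg (Real.log ‖g₀‖)
      rw [Real.norm_eq_abs, abs_le]
      constructor <;> linarith) with hgl
  -- The series is that of `-log (1 - x)`, to be evaluated at `x = 1 - g / g₀`. Its constant
  -- coefficient is zero because `0⁻¹ = 0`.
  set p := FormalMultilinearSeries.ofScalars (ℕ →ᵇ ℝ) (fun n : ℕ => (n : ℝ)⁻¹) with hp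
  have hrad : (1 : ENNReal) ≤ p.radius := by
    rw [← ENNReal.coe_one]
    refine p.le_radius_of_bound 1 fun n => ?_
    rw [hp, FormalMultilinearSeries.ofScalars_norm]
    simp only [norm_inv, Real.norm_natCast, NNReal.coe_one, one_pow, mul_one]
    exact Nat.cast_inv_le_one n
  have hps := p.hasFPowerSeriesOnBall (zero_lt_one.trans_le hrad)
  have hpt : ∀ x : ℕ →ᵇ ℝ, ‖x‖ < 1 → ∀ k, p.sum x k = -Real.log (1 - x k) := by
    intro x hx k
    have hmem : x ∈ Metric.eball (0 : ℕ →ᵇ ℝ) p.radius := by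
      refine Metric.eball_subset_eball hrad ?_
      rw [mem_eball_zero_iff, enorm_eq_nnnorm]
      exact_mod_cast (by simpa [← NNReal.coe_lt_coe] using hx : ‖x‖₊ < 1)
    have h1 := (hps.hasSum hmem).mapL (BoundedContinuousFunction.evalCLM ℝ k)
    have hxk : |x k| < 1 := (x.norm_coe_le_norm k).trans_lt hx
    have h2 := Real.hasSum_pow_div_log_of_abs_lt_one hxk
    have h3 : HasSum (fun n : ℕ => (n : ℝ)⁻¹ * x k ^ n) (-Real.log (1 - x k)) := by
      rw [← hasSum_nat_add_iff' 1]
      simpa [div_eq_inv_mul] using h2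
    refine HasSum.unique ?_ h3
    simpa [hp, FormalMultilinearSeries.ofScalars_apply_eq] using h1
  refine ⟨fun g => gl - p.sum (1 - g * gi), ?_, ?_⟩
  · have h1 : AnalyticAt ℝ (fun g : ℕ →ᵇ ℝ => 1 - g * gi) g₀ :=
      analyticAt_const.sub (analyticAt_id.mul analyticAt_const)
    have h0 : 1 - g₀ * gi = 0 := by
      ext k; simp [hgi, mul_inv_cancel₀ (hpos k).ne']
    have h2 : AnalyticAt ℝ p.sum (1 - g₀ * gi) := by rw [h0]; exact hps.analyticAt
    exact analyticAt_const.sub (AnalyticAt.comp (f := fun g : ℕ →ᵇ ℝ => 1 - g * gi) h2 h1)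
  · have h0 : ‖1 - g₀ * gi‖ < 1 := by
      have : 1 - g₀ * gi = 0 := by ext k; simp [hgi, mul_inv_cancel₀ (hpos k).ne']
      rw [this]; simp
    have hcont : Continuous fun g : ℕ →ᵇ ℝ => ‖1 - g * gi‖ := by fun_prop
    filter_upwards [hcont.continuousAt.eventually (gt_mem_nhds h0)] with g hgn k
    have hk : |1 - g k * (g₀ k)⁻¹| < 1 := by
      have := ((1 - g * gi).norm_coe_le_norm k).trans_lt hgn
      simpa [hgi] using this
    have hgk : 0 < g k * (g₀ k)⁻¹ := by have := (abs_lt.1 hk).2; linarith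
    have hgk' : 0 < g k := by
      have := mul_pos hgk (hpos k)
      rwa [inv_mul_cancel_right₀ (hpos k).ne'] at this
    rw [BoundedContinuousFunction.sub_apply, hpt _ hgn]
    simp only [hgl, hgi, BoundedContinuousFunction.coe_ofNormedAddCommGroupDiscrete,
      BoundedContinuousFunction.coe_sub, BoundedContinuousFunction.coe_one,
      BoundedContinuousFunction.coe_mul, Pi.sub_apply, Pi.one_apply, Pi.mul_apply, sub_sub_cancel]
    rw [Real.log_mul hgk'.ne' (inv_ne_zero (hpos k).ne'), Real.log_inv]
    ring

end Logarithm

end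

/-! ### Eigenprojections at simple eigenvalues and Gelfand's formula. -/

section
section EigenProj

open Polynomial

variable {ι K : Type*} [Fintype ι] [DecidableEq ι] [Field K]

/-- The eigenprojection of `B` at a simple eigenvalue `l`. -/
def eigenProj (B : Matrix ι ι K) (l : K) : Matrix ι ι K :=
  (B.charpoly.derivative.eval l)⁻¹ • adjugate (scalar ι l - B)

lemma eval_charmatrix (B : Matrix ι ι K) (l : K) :
    (evalRingHom l).mapMatrix (charmatrix B) = scalar ι l - B := by
  ext i j
  by_cases h : i = j <;> simp [charmatrix, h]

/-- Over polynomials `(X - B) v = (X - l) v`, while the adjugate times `X - B` is the characteristic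
polynomial `(X - l) q`. Cancelling `X - l` and evaluating at `l` leaves `q l`, the derivative of the
characteristic polynomial at `l`. -/
lemma adjugate_scalar_sub_mul {κ : Type*} {B : Matrix ι ι K} {l : K} {v : Matrix ι κ K}
    (hl : B.charpoly.IsRoot l) (hv : B * v = l • v) :
    adjugate (scalar ι l - B) * v = B.charpoly.derivative.eval l • v := by
  obtain ⟨q, hq⟩ := dvd_iff_isRoot.2 hl
  have hd : B.charpoly.derivative.eval l = q.eval l := by rw [hq]; simp
  set w : Matrix ι κ K[X] := v.map C with hw
  have h1 : charmatrix B * w = (X - C l : K[X]) • w := by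
    have h2 : (B.map C) * w = C l • w := by
      rw [hw, ← Matrix.map_mul, hv]
      ext i j; simp
    have h3 : charmatrix B = scalar ι X - B.map C := rfl
    rw [h3, Matrix.sub_mul, h2, sub_smul]
    congr 1
    simp [smul_eq_diagonal_mul]
  have h4 : (X - C l : K[X]) • (adjugate (charmatrix B) * w) = (X - C l : K[X]) • (q • w) := by
    rw [← Matrix.mul_smul, ← h1, ← Matrix.mul_assoc, adjugate_mul, smul_mul, Matrix.one_mul,
      smul_smul, ← hq]; rfl
  have h5 : adjugate (charmatrix B) * w = q • w := by
    ext1 i j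
    have := Matrix.ext_iff.2 h4 i j
    rw [Matrix.smul_apply, Matrix.smul_apply, smul_eq_mul, smul_eq_mul] at this
    exact mul_left_cancel₀ (X_sub_C_ne_zero l) this
  rw [hd, ← eval_charmatrix, ← RingHom.map_adjugate]
  have h6 := congrArg (fun M : Matrix ι κ K[X] => M.map (evalRingHom l)) h5
  simp only [Matrix.map_mul] at h6
  have h7 : w.map (evalRingHom l) = v := by ext i j; simp [hw]
  rw [h7] at h6
  rw [RingHom.mapMatrix_apply, h6]
  ext i j; simp [hw]

variable {B : Matrix ι ι K} {l : K}

lemma mul_adjugate_scalar_sub (hl : B.charpoly.IsRoot l) :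
    B * adjugate (scalar ι l - B) = l • adjugate (scalar ι l - B) := by
  have h := mul_adjugate (scalar ι l - B)
  rw [← eval_charpoly, hl.eq_zero, zero_smul, Matrix.sub_mul, sub_eq_zero] at h
  rw [← h]; simp [smul_eq_diagonal_mul]

lemma adjugate_scalar_sub_mul_self (hl : B.charpoly.IsRoot l) :
    adjugate (scalar ι l - B) * B = l • adjugate (scalar ι l - B) := by
  have h := adjugate_mul (scalar ι l - B)
  rw [← eval_charpoly, hl.eq_zero, zero_smul, Matrix.mul_sub, sub_eq_zero] at h
  rw [← h]; ext; simp [mul_comm]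

lemma mul_eigenProj (hl : B.charpoly.IsRoot l) : B * eigenProj B l = l • eigenProj B l := by
  rw [eigenProj, Matrix.mul_smul, mul_adjugate_scalar_sub hl, smul_comm]

lemma eigenProj_mul (hl : B.charpoly.IsRoot l) : eigenProj B l * B = l • eigenProj B l := by
  rw [eigenProj, Matrix.smul_mul, adjugate_scalar_sub_mul_self hl, smul_comm]

lemma eigenProj_mul_of_mul_eq {κ : Type*} {v : Matrix ι κ K} (hl : B.charpoly.IsRoot l)
    (hd : B.charpoly.derivative.eval l ≠ 0) (hv : B * v = l • v) : eigenProj B l * v = v := by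
  rw [eigenProj, Matrix.smul_mul, adjugate_scalar_sub_mul hl hv, smul_smul, inv_mul_cancel₀ hd,
    one_smul]

lemma eigenProj_mulVec {v : ι → K} (hl : B.charpoly.IsRoot l)
    (hd : B.charpoly.derivative.eval l ≠ 0) (hv : B *ᵥ v = l • v) : eigenProj B l *ᵥ v = v := by
  have h := eigenProj_mul_of_mul_eq (v := replicateCol Unit v) hl hd (by
    rw [← replicateCol_mulVec, hv, replicateCol_smul])
  rwa [← replicateCol_mulVec, replicateCol_inj] at h

lemma eigenProj_mul_self (hl : B.charpoly.IsRoot l) (hd : B.charpoly.derivative.eval l ≠ 0) :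
    eigenProj B l * eigenProj B l = eigenProj B l :=
  eigenProj_mul_of_mul_eq hl hd (mul_eigenProj hl)

/-- The summands `l • P` and `B - l • P` annihilate each other. Exponent zero is excluded, since the
right side would be `P + 1`. -/
lemma pow_eq_of_eigenProj (hl : B.charpoly.IsRoot l) (hd : B.charpoly.derivative.eval l ≠ 0)
    (k : ℕ) : B ^ (k + 1) = l ^ (k + 1) • eigenProj B l + (B - l • eigenProj B l) ^ (k + 1) := by
  induction k with
  | zero => simp
  | succ k ih =>
    have h2 : (B - l • eigenProj B l) ^ (k + 1) * eigenProj B l = 0 := by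
      rw [pow_succ, Matrix.mul_assoc, Matrix.sub_mul, mul_eigenProj hl, Matrix.smul_mul,
        eigenProj_mul_self hl hd, sub_self, Matrix.mul_zero]
    rw [pow_succ B, pow_succ (B - l • eigenProj B l) (k + 1), Matrix.mul_sub, Matrix.mul_smul, h2,
      ih, Matrix.add_mul,
      Matrix.smul_mul, eigenProj_mul hl, smul_smul, ← pow_succ, smul_zero, sub_zero]

lemma eigenProj_ne_zero (hl : B.charpoly.IsRoot l) (hd : B.charpoly.derivative.eval l ≠ 0) :
    eigenProj B l ≠ 0 := by
  intro h0
  obtain ⟨v, hv, h⟩ := exists_mulVec_eq_zero_iff.2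
    (show (scalar ι l - B).det = 0 by rw [← eval_charpoly]; exact hl)
  rw [sub_mulVec, sub_eq_zero] at h
  have h2 := eigenProj_mulVec hl hd (v := v) (by
    rw [← h]; simp [← smul_one_eq_diagonal, smul_mulVec])
  rw [h0, zero_mulVec] at h2
  exact hv h2.symm

end EigenProj

section SpectralRadius

open scoped Matrix.Norms.Operator

variable {n : ℕ}

lemma norm_map_ofReal (M : Matrix (Fin n) (Fin n) ℝ) : ‖M.map Complex.ofReal‖ = ‖M‖ := by
  simp [linfty_opNorm_def]

lemma map_ofReal_pow (M : Matrix (Fin n) (Fin n) ℝ) (k : ℕ) :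
    (M ^ k).map Complex.ofReal = (M.map Complex.ofReal) ^ k :=
  map_pow Complex.ofRealHom.mapMatrix M k

/-- Gelfand's formula for the complexification, which has the same `ℓ^∞` operator norm. The empty
matrix is treated separately. -/
lemma exists_norm_pow_lt {M : Matrix (Fin n) (Fin n) ℝ} {ρ : ℝ} (hρ : 0 < ρ)
    (h : ∀ μ : ℂ, (M.map Complex.ofReal).charpoly.IsRoot μ → ‖μ‖ < ρ) :
    ∃ K, 0 < K ∧ ‖M ^ K‖ < ρ ^ K := by
  rcases n with - | n
  · exact ⟨1, one_pos, by simpa [Subsingleton.elim M 0] using hρ⟩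
  set A := M.map Complex.ofReal with hA
  lift ρ to NNReal using hρ.le
  have h1 : spectralRadius ℂ A < ρ := by
    refine spectrum.spectralRadius_lt_of_forall_lt A (r := ρ) ?_
    intro k hk
    have := h k (mem_spectrum_iff_isRoot_charpoly.1 hk)
    exact_mod_cast this
  have h2 := (spectrum.pow_nnnorm_pow_one_div_tendsto_nhds_spectralRadius A).eventually_lt_const h1
  obtain ⟨K, hK, hK0⟩ := (h2.and (eventually_gt_atTop 0)).exists
  refine ⟨K, hK0, ?_⟩
  rw [← norm_map_ofReal, map_ofReal_pow, ← hA]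
  have hK' : (0 : ℝ) < K := by exact_mod_cast hK0
  have h3 : (‖A ^ K‖₊ : ENNReal) < (ρ : ENNReal) ^ (K : ℝ) := by
    rwa [one_div, ENNReal.rpow_inv_lt_iff hK'] at hK
  rw [ENNReal.rpow_natCast] at h3
  exact_mod_cast h3

end SpectralRadius

end

/-! ### Deflation and the dominant eigenvalue of `B`. -/

section
open scoped Matrix.Norms.Operator

variable {n : ℕ}

lemma charpoly_map_ofReal (B : Matrix (Fin n) (Fin n) ℝ) :
    (B.map Complex.ofReal).charpoly = B.charpoly.map Complex.ofRealHom :=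
  charpoly_map B Complex.ofRealHom

lemma isRoot_charpoly_ofReal {B : Matrix (Fin n) (Fin n) ℝ} {l : ℝ} :
    (B.map Complex.ofReal).charpoly.IsRoot (l : ℂ) ↔ B.charpoly.IsRoot l := by
  rw [charpoly_map_ofReal]
  exact Polynomial.isRoot_map_iff Complex.ofRealHom.injective (x := l)

lemma derivative_eval_ofReal (B : Matrix (Fin n) (Fin n) ℝ) (l : ℝ) :
    (B.map Complex.ofReal).charpoly.derivative.eval (l : ℂ) =
      ((B.charpoly.derivative.eval l : ℝ) : ℂ) := by
  rw [charpoly_map_ofReal, Polynomial.derivative_map]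
  exact Polynomial.eval_map_apply Complex.ofRealHom l

lemma eigenProj_map_ofReal (B : Matrix (Fin n) (Fin n) ℝ) (l : ℝ) :
    eigenProj (B.map Complex.ofReal) (l : ℂ) = (eigenProj B l).map Complex.ofReal := by
  rw [eigenProj, eigenProj, derivative_eval_ofReal]
  have h1 : scalar (Fin n) (l : ℂ) - B.map Complex.ofReal =
      Complex.ofRealHom.mapMatrix (scalar (Fin n) l - B) := by
    ext i j
    by_cases h : i = j <;> simp [h]
  rw [h1, ← RingHom.map_adjugate]
  ext i j; simp

lemma isRoot_charpoly_iff_exists_mulVec {K : Type*} [Field K] {B : Matrix (Fin n) (Fin n) K}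
    {l : K} : B.charpoly.IsRoot l ↔ ∃ v, v ≠ 0 ∧ B *ᵥ v = l • v := by
  rw [Polynomial.IsRoot, eval_charpoly, ← exists_mulVec_eq_zero_iff]
  refine exists_congr fun v => and_congr_right fun _ => ?_
  rw [sub_mulVec, sub_eq_zero, eq_comm]
  simp [← smul_one_eq_diagonal, smul_mulVec]

lemma map_ofReal_eq_zero {M : Matrix (Fin n) (Fin n) ℝ} : M.map Complex.ofReal = 0 ↔ M = 0 := by
  constructor
  · intro h; ext i j
    have := Matrix.ext_iff.2 h i j
    simpa using this
  · rintro rfl; ext; simp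

/-- If every complex eigenvalue vanishes, the matrix is nilpotent. -/
lemma pow_eq_zero_of_forall_root {B : Matrix (Fin n) (Fin n) ℝ}
    (h : ∀ μ : ℂ, (B.map Complex.ofReal).charpoly.IsRoot μ → μ = 0) : B ^ n = 0 := by
  set A := B.map Complex.ofReal with hA
  have hs := IsAlgClosed.splits A.charpoly
  have hm := A.charpoly_monic
  have h1 : A.charpoly = Polynomial.X ^ n := by
    have h2 : A.charpoly.roots = Multiset.replicate n 0 := by
      rw [Multiset.eq_replicate]
      refine ⟨?_, fun b hb => h b (Polynomial.isRoot_of_mem_roots hb)⟩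
      rw [← hs.natDegree_eq_card_roots, charpoly_natDegree_eq_dim, Fintype.card_fin]
    rw [hs.eq_prod_roots_of_monic hm, h2]
    simp
  have h3 := aeval_self_charpoly A
  rw [h1, map_pow, Polynomial.aeval_X, hA, ← map_ofReal_pow, map_ofReal_eq_zero] at h3
  exact h3

/-- An eigenvector of the deflated matrix at `μ ≠ 0` is killed by the projection, hence is an
eigenvector of `B` at `μ`. Here `μ ≠ l`, because the projection fixes eigenvectors at `l`; so
dominance bounds the whole spectrum. -/
lemma exists_norm_pow_sub_eigenProj_lt {B : Matrix (Fin n) (Fin n) ℝ} {l : ℝ} (hl0 : l ≠ 0)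
    (hl : B.charpoly.IsRoot l) (hd : B.charpoly.derivative.eval l ≠ 0)
    (hdom : ∀ μ : ℂ, (B.map Complex.ofReal).charpoly.IsRoot μ → μ ≠ l → ‖μ‖ < ‖(l : ℂ)‖) :
    ∃ K, 0 < K ∧ ‖(l⁻¹ • (B - l • eigenProj B l)) ^ K‖ < 1 := by
  set A := B.map Complex.ofReal with hA
  have hlc : A.charpoly.IsRoot (l : ℂ) := isRoot_charpoly_ofReal.2 hl
  have hdc : A.charpoly.derivative.eval (l : ℂ) ≠ 0 := by
    rw [hA, derivative_eval_ofReal]; exact_mod_cast hd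
  have hN : (B - l • eigenProj B l).map Complex.ofReal = A - (l : ℂ) • eigenProj A (l : ℂ) := by
    rw [eigenProj_map_ofReal]; ext i j; simp [hA]
  obtain ⟨K, hK, hK2⟩ := exists_norm_pow_lt (M := B - l • eigenProj B l) (abs_pos.2 hl0) (by
    intro μ hμ
    rw [hN] at hμ
    by_cases hμ0 : μ = 0
    · simpa [hμ0] using hl0
    obtain ⟨v, hv, h⟩ := isRoot_charpoly_iff_exists_mulVec.1 hμ
    have hP : eigenProj A (l : ℂ) *ᵥ v = 0 := by
      have h1 := congrArg (fun w => eigenProj A (l : ℂ) *ᵥ w) h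
      simp only [mulVec_mulVec, Matrix.mul_sub, eigenProj_mul hlc, Matrix.mul_smul,
        eigenProj_mul_self hlc hdc, sub_self, zero_mulVec, mulVec_smul] at h1
      exact (smul_eq_zero.1 h1.symm).resolve_left hμ0
    have hAv : A *ᵥ v = μ • v := by
      rw [sub_mulVec, smul_mulVec, hP, smul_zero, sub_zero] at h
      exact h
    have hne : μ ≠ l := by
      rintro rfl
      rw [eigenProj_mulVec hlc hdc hAv] at hP
      exact hv hP
    have := hdom μ (isRoot_charpoly_iff_exists_mulVec.2 ⟨v, hv, hAv⟩) hne
    simpa using this)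
  refine ⟨K, hK, ?_⟩
  rw [smul_pow, norm_smul, norm_pow, norm_inv, Real.norm_eq_abs, inv_pow,
    inv_mul_lt_one₀ (pow_pos (abs_pos.2 hl0) K)]
  exact hK2

lemma tendsto_pow_eigenProj {B : Matrix (Fin n) (Fin n) ℝ} {l : ℝ} (hl0 : l ≠ 0)
    (hl : B.charpoly.IsRoot l) (hd : B.charpoly.derivative.eval l ≠ 0) {K : ℕ} (hK : 0 < K)
    (hN : ‖(l⁻¹ • (B - l • eigenProj B l)) ^ K‖ < 1) :
    Tendsto (fun k => (l⁻¹ • B) ^ k) atTop (𝓝 (eigenProj B l)) := by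
  obtain ⟨C, θ, -, hθ0, hθ1, hb⟩ := exists_geometric_bound hK hN
  have h2 : Tendsto (fun k : ℕ => C * θ ^ k) atTop (𝓝 0) := by
    simpa using (tendsto_pow_atTop_nhds_zero_of_lt_one hθ0.le hθ1).const_mul C
  have h3 := (squeeze_zero_norm hb h2).const_add (eigenProj B l)
  rw [add_zero] at h3
  refine h3.congr' ?_
  filter_upwards [eventually_ge_atTop 1] with k hk
  obtain ⟨k, rfl⟩ := Nat.exists_eq_add_of_le' hk
  rw [smul_pow, smul_pow, pow_eq_of_eigenProj hl hd, smul_add, smul_smul, ← mul_pow,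
    inv_mul_cancel₀ hl0, one_pow, one_smul]

lemma tendsto_apply {M : ℕ → Matrix (Fin n) (Fin n) ℝ} {P : Matrix (Fin n) (Fin n) ℝ}
    (h : Tendsto M atTop (𝓝 P)) (i j : Fin n) : Tendsto (fun k => M k i j) atTop (𝓝 (P i j)) :=
  ((continuous_id.matrix_elem i j).tendsto P).comp h

/-- Each property has its own source: realness comes from conjugation invariance of the spectrum, `l
≠ 0` from positivity of `r B ^ n c`, nonnegativity of the projection from the limit of even scaled
powers, `0 < l` from the odd ones, and the last inequality from irreducibility. -/
lemma exists_dominant {Δ : Matrix (Fin (n + 1)) (Fin (n + 1)) ℝ} (hirr : Δ.IsIrreducible)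
    (hpos : PositivityCondition Δ) (hdom : HasSimpleDominantEigenvalue (blockB Δ)) :
    ∃ l : ℝ, 0 < l ∧ (blockB Δ).charpoly.IsRoot l ∧ (blockB Δ).charpoly.derivative.eval l ≠ 0 ∧
      (∃ K, 0 < K ∧ ‖(l⁻¹ • (blockB Δ - l • eigenProj (blockB Δ) l)) ^ K‖ < 1) ∧
      0 < blockR Δ ⬝ᵥ eigenProj (blockB Δ) l *ᵥ blockC Δ := by
  have hΔ := hirr.nonneg
  set B := blockB Δ with hB
  obtain ⟨lam, hmult, hdom⟩ := hdom
  have hne0 : (B.map Complex.ofReal).charpoly ≠ 0 := (charpoly_monic _).ne_zero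
  have hroot : (B.map Complex.ofReal).charpoly.IsRoot lam :=
    (Polynomial.rootMultiplicity_pos hne0).1 (by omega)
  -- The conjugate is also a root and has the same modulus, so strict dominance makes it equal to
  -- `lam`.
  have hconj : (starRingEnd ℂ) lam = lam := by
    by_contra hne
    have h1 : (B.map Complex.ofReal).charpoly.IsRoot ((starRingEnd ℂ) lam) := by
      have h2 := hroot
      rw [charpoly_map_ofReal, Polynomial.IsRoot, Polynomial.eval_map] at h2 ⊢
      have h3 := Polynomial.aeval_conj B.charpoly lam
      rw [Polynomial.aeval_def, Polynomial.aeval_def] at h3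
      change Polynomial.eval₂ (algebraMap ℝ ℂ) _ _ = 0 at h2
      change Polynomial.eval₂ (algebraMap ℝ ℂ) _ _ = 0
      rw [h3, h2, map_zero]
    have := hdom _ h1 hne
    simp at this
  obtain ⟨l, rfl⟩ := Complex.conj_eq_iff_real.1 hconj
  have hl := isRoot_charpoly_ofReal.1 hroot
  have hd : B.charpoly.derivative.eval l ≠ 0 := by
    intro h0
    have := (Polynomial.one_lt_rootMultiplicity_iff_isRoot (t := (l : ℂ)) hne0).2
      ⟨hroot, by rw [Polynomial.IsRoot, derivative_eval_ofReal, h0, Complex.ofReal_zero]⟩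
    omega
  have hl0 : l ≠ 0 := by
    rintro rfl
    have : B ^ n = 0 := pow_eq_zero_of_forall_root fun μ hμ => by
      by_contra hne
      have := hdom μ hμ (by simpa using hne)
      simp only [Complex.ofReal_zero, norm_zero] at this
      exact absurd this (not_lt.2 (norm_nonneg _))
    have h2 := hpos.2 n
    rw [← hB, this, zero_mulVec, dotProduct_zero] at h2
    exact h2.false
  obtain ⟨K, hK, hN⟩ := exists_norm_pow_sub_eigenProj_lt hl0 hl hd hdom
  set P := eigenProj B l with hP
  have hlim := tendsto_pow_eigenProj hl0 hl hd hK hN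
  have hBk : ∀ k i j, 0 ≤ (B ^ k) i j := fun k => pow_apply_nonneg (blockB_nonneg hΔ) k
  have hP0 : ∀ i j, 0 ≤ P i j := by
    intro i j
    have h1 := (tendsto_apply hlim i j).comp (tendsto_id.const_mul_atTop' (two_pos (α := ℕ)))
    refine ge_of_tendsto' h1 fun k => ?_
    simp only [Function.comp_apply, smul_pow, Matrix.smul_apply, smul_eq_mul, id]
    exact mul_nonneg ((even_two_mul k).pow_nonneg _) (hBk _ _ _)
  obtain ⟨i, j, hij⟩ : ∃ i j, 0 < P i j := by
    by_contra! h
    exact eigenProj_ne_zero hl hd (by ext i j; exact le_antisymm (h i j) (hP0 i j))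
  have hlpos : 0 < l := by
    rcases lt_or_gt_of_ne hl0 with hneg | hpos
    · exfalso
      have h1 := (tendsto_apply hlim i j).comp
        ((tendsto_add_atTop_nat 1).comp (tendsto_id.const_mul_atTop' (two_pos (α := ℕ))))
      refine absurd (le_of_tendsto' h1 (b := 0) fun k => ?_) (not_le.2 hij)
      simp only [Function.comp_apply, smul_pow, Matrix.smul_apply, smul_eq_mul, id]
      refine mul_nonpos_of_nonpos_of_nonneg (Odd.pow_nonpos ⟨k, rfl⟩ ?_) (hBk _ _ _)
      exact inv_nonpos.2 hneg.le
    · exact hpos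
  refine ⟨l, hlpos, hl, hd, ⟨K, hK, hN⟩, ?_⟩
  obtain ⟨s, hs⟩ := exists_blockR_vecMul_pow_pos hirr i
  obtain ⟨t, ht⟩ := exists_pow_mulVec_blockC_pos hirr j
  have hPB : ∀ t, P * B ^ t = l ^ t • P := by
    intro t
    induction t with
    | zero => simp
    | succ t ih => rw [pow_succ, ← Matrix.mul_assoc, ih, Matrix.smul_mul, eigenProj_mul hl,
        smul_smul, ← pow_succ]
  have hBP : ∀ t, B ^ t * P = l ^ t • P := by
    intro t
    induction t with
    | zero => simp
    | succ t ih => rw [pow_succ', Matrix.mul_assoc, ih, Matrix.mul_smul, mul_eigenProj hl,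
        smul_smul, ← pow_succ]
  -- Choosing `s` and `t` so that `r B ^ s` and `B ^ t c` are positive at the positions of a
  -- positive entry of `P` makes the left side positive; the powers of `B` are absorbed by `P`.
  have h1 : (blockR Δ ᵥ* B ^ s) ⬝ᵥ P *ᵥ ((B ^ t) *ᵥ blockC Δ) =
      l ^ s * l ^ t * (blockR Δ ⬝ᵥ P *ᵥ blockC Δ) := by
    rw [mulVec_mulVec, hPB, ← dotProduct_mulVec, mulVec_mulVec, Matrix.mul_smul, hBP, smul_smul,
      smul_mulVec, dotProduct_smul, smul_eq_mul, mul_comm (l ^ t)]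
  have h2 : 0 < (blockR Δ ᵥ* B ^ s) ⬝ᵥ P *ᵥ ((B ^ t) *ᵥ blockC Δ) := by
    have hx : ∀ i, 0 ≤ (blockR Δ ᵥ* B ^ s) i := vecMul_entry_nonneg (blockR_nonneg hΔ) (hBk s)
    have hy : ∀ i, 0 ≤ ((B ^ t) *ᵥ blockC Δ) i := mulVec_entry_nonneg (blockC_nonneg hΔ) (hBk t)
    have hz : ∀ i, 0 ≤ (P *ᵥ ((B ^ t) *ᵥ blockC Δ)) i := mulVec_entry_nonneg hy hP0
    refine Finset.sum_pos' (fun i _ => mul_nonneg (hx i) (hz i)) ⟨i, Finset.mem_univ _, ?_⟩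
    refine mul_pos hs (Finset.sum_pos' (fun k _ => mul_nonneg (hP0 i k) (hy k))
      ⟨j, Finset.mem_univ _, mul_pos hij ht⟩)
  rw [h1] at h2
  exact pos_of_mul_pos_right h2 (by positivity)

end

/-! ### Analytic dependence of eigenvalue, projection and bilinear sequences on the matrix. -/

section
open scoped Matrix.Norms.Operator BoundedContinuousFunction

section Entrywise

variable {E : Type*} [NormedAddCommGroup E] [NormedSpace ℝ E] {m n : ℕ} {x₀ : E}

lemma analyticAt_matrix {f : E → Matrix (Fin n) (Fin n) ℝ}
    (hf : ∀ i j, AnalyticAt ℝ (fun x => f x i j) x₀) : AnalyticAt ℝ f x₀ := by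
  have : f = fun x => ∑ i, ∑ j, f x i j • Matrix.single i j (1 : ℝ) := by
    ext1 x
    conv_lhs => rw [matrix_eq_sum_single (f x)]
    simp [smul_single]
  rw [this]
  exact Finset.analyticAt_fun_sum _ fun i _ => Finset.analyticAt_fun_sum _ fun j _ =>
    (hf i j).smul analyticAt_const

lemma analyticAt_matrix_apply {f : E → Matrix (Fin n) (Fin n) ℝ} (hf : AnalyticAt ℝ f x₀)
    (i j : Fin n) : AnalyticAt ℝ (fun x => f x i j) x₀ :=
  (((entryLinearMap ℝ ℝ i j).toContinuousLinearMap).analyticAt (f x₀)).comp hf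

lemma analyticAt_det {f : E → Matrix (Fin n) (Fin n) ℝ}
    (hf : ∀ i j, AnalyticAt ℝ (fun x => f x i j) x₀) : AnalyticAt ℝ (fun x => (f x).det) x₀ := by
  simp only [det_apply']
  exact Finset.analyticAt_fun_sum _ fun σ _ => analyticAt_const.fun_mul
    (Finset.analyticAt_fun_prod Finset.univ fun i _ => hf (σ i) i)

lemma analyticAt_adjugate {f : E → Matrix (Fin n) (Fin n) ℝ}
    (hf : ∀ i j, AnalyticAt ℝ (fun x => f x i j) x₀) (i j : Fin n) :
    AnalyticAt ℝ (fun x => adjugate (f x) i j) x₀ := by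
  simp only [adjugate_apply]
  refine analyticAt_det fun k l => ?_
  by_cases h : k = j
  · subst h; simp only [updateRow_self]; exact analyticAt_const
  · simp only [updateRow_ne h]; exact hf k l

end Entrywise

section SimpleRoot

variable {n : ℕ}

/-- The characteristic polynomial as a function of the matrix and the argument. -/
def charFun (p : Matrix (Fin n) (Fin n) ℝ × ℝ) : ℝ := p.1.charpoly.eval p.2

lemma analyticAt_scalar_sub {E : Type*} [NormedAddCommGroup E] [NormedSpace ℝ E] {x₀ : E}
    {f : E → Matrix (Fin n) (Fin n) ℝ} {t : E → ℝ} (hf : AnalyticAt ℝ f x₀)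
    (ht : AnalyticAt ℝ t x₀) (i j : Fin n) :
    AnalyticAt ℝ (fun x => (scalar (Fin n) (t x) - f x) i j) x₀ := by
  by_cases h : i = j
  · subst h; simpa using ht.fun_sub (analyticAt_matrix_apply hf i i)
  · simpa [h] using (analyticAt_matrix_apply hf i j).fun_neg

lemma analyticAt_charFun (p : Matrix (Fin n) (Fin n) ℝ × ℝ) : AnalyticAt ℝ charFun p := by
  have h : (charFun : Matrix (Fin n) (Fin n) ℝ × ℝ → ℝ) =
      fun p => (scalar (Fin n) p.2 - p.1).det := by
    ext p; rw [charFun, eval_charpoly]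
  rw [h]
  exact analyticAt_det (analyticAt_scalar_sub analyticAt_fst analyticAt_snd)

/-- Used twice: simplicity of a root becomes invertibility in the implicit function theorem, and the
derivative of the characteristic polynomial becomes jointly analytic in matrix and argument. -/
lemma fderiv_charFun (p : Matrix (Fin n) (Fin n) ℝ × ℝ) (t : ℝ) :
    fderiv ℝ charFun p (0, t) = p.1.charpoly.derivative.eval p.2 * t := by
  have h1 := (analyticAt_charFun p).differentiableAt.hasFDerivAt
  have h2 : HasDerivAt (fun s : ℝ => (p.1, s)) ((0 : Matrix (Fin n) (Fin n) ℝ), (1 : ℝ)) p.2 :=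
    (hasDerivAt_const _ _).prodMk (hasDerivAt_id _)
  have h3 := HasFDerivAt.comp_hasDerivAt (f := fun s : ℝ => (p.1, s)) p.2 h1 h2
  have h4 := p.1.charpoly.hasDerivAt p.2
  have h5 := h3.unique h4
  have h6 : ((0 : Matrix (Fin n) (Fin n) ℝ), t) = t • (0, 1) := by simp
  rw [h6, map_smul, smul_eq_mul, mul_comm]
  exact congrArg (· * t) h5

/-- A simple eigenvalue is locally an analytic function of the matrix. -/
lemma exists_analyticAt_simpleRoot {B₀ : Matrix (Fin n) (Fin n) ℝ} {l₀ : ℝ}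
    (hl : B₀.charpoly.IsRoot l₀) (hd : B₀.charpoly.derivative.eval l₀ ≠ 0) :
    ∃ L : Matrix (Fin n) (Fin n) ℝ → ℝ, AnalyticAt ℝ L B₀ ∧ L B₀ = l₀ ∧
      ∀ᶠ B in 𝓝 B₀, B.charpoly.IsRoot (L B) := by
  have hc : ContDiffAt ℝ ⊤ (charFun : Matrix (Fin n) (Fin n) ℝ × ℝ → ℝ) (B₀, l₀) :=
    (analyticAt_charFun _).contDiffAt
  have hinv : (fderiv ℝ charFun (B₀, l₀) ∘L
      .inr ℝ (Matrix (Fin n) (Fin n) ℝ) ℝ).IsInvertible := by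
    refine ⟨ContinuousLinearEquiv.unitsEquivAut ℝ (Units.mk0 _ hd), ?_⟩
    ext
    simp [fderiv_charFun]
  refine ⟨hc.implicitFunction (by simp) hinv,
    (hc.contDiffAt_implicitFunction (by simp) hinv).analyticAt,
    hc.implicitFunction_apply_self (by simp) hinv, ?_⟩
  filter_upwards [hc.eventually_apply_implicitFunction (by simp) hinv] with B hB
  rw [charFun, charFun] at hB
  exact hB.trans hl

lemma analyticAt_eigenProj {E : Type*} [NormedAddCommGroup E] [NormedSpace ℝ E] {x₀ : E}
    {f : E → Matrix (Fin n) (Fin n) ℝ} {t : E → ℝ} (hf : AnalyticAt ℝ f x₀)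
    (ht : AnalyticAt ℝ t x₀) (hd : (f x₀).charpoly.derivative.eval (t x₀) ≠ 0) :
    AnalyticAt ℝ (fun x => eigenProj (f x) (t x)) x₀ := by
  have h1 : AnalyticAt ℝ (fun x => (f x).charpoly.derivative.eval (t x)) x₀ := by
    have h2 : ∀ x, (f x).charpoly.derivative.eval (t x) = fderiv ℝ charFun (f x, t x) (0, 1) :=
      fun x => by rw [fderiv_charFun, mul_one]
    simp only [h2]
    have h3 := AnalyticAt.comp (f := fun x => (f x, t x)) (analyticAt_charFun (f x₀, t x₀)).fderiv
      (hf.prod ht)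
    exact ((ContinuousLinearMap.apply ℝ ℝ
      ((0 : Matrix (Fin n) (Fin n) ℝ), (1 : ℝ))).analyticAt _).comp h3
  refine analyticAt_matrix fun i j => ?_
  simp only [eigenProj, Matrix.smul_apply, smul_eq_mul]
  exact (h1.inv hd).fun_mul (analyticAt_adjugate (analyticAt_scalar_sub hf ht) i j)

end SimpleRoot

section Sequences

variable {E : Type*} [NormedAddCommGroup E] [NormedSpace ℝ E] {n : ℕ} {x₀ : E}

/-- The entry of a bounded sequence of matrices. -/
def entrySeq (i j : Fin n) : (ℕ →ᵇ Matrix (Fin n) (Fin n) ℝ) →L[ℝ] (ℕ →ᵇ ℝ) :=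
  (entryLinearMap ℝ ℝ i j).toContinuousLinearMap.compLeftContinuousBounded ℕ

/-- If `M`, `r` and `c` are analytic and some power of `M x₀` is a strict contraction, then the
bounded sequence `r M ^ k c` is analytic. -/
lemma exists_analyticAt_bilin {M : E → Matrix (Fin n) (Fin n) ℝ} {r c : E → Fin n → ℝ}
    (hM : AnalyticAt ℝ M x₀) (hr : ∀ i, AnalyticAt ℝ (fun x => r x i) x₀)
    (hc : ∀ i, AnalyticAt ℝ (fun x => c x i) x₀) {K : ℕ} (hK : ‖M x₀ ^ K‖ < 1) :
    ∃ Φ : E → (ℕ →ᵇ ℝ), AnalyticAt ℝ Φ x₀ ∧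
      ∀ᶠ x in 𝓝 x₀, ∀ k, Φ x k = r x ⬝ᵥ (M x ^ k) *ᵥ c x := by
  obtain ⟨Ψ, hΨ, hΨ2⟩ := exists_analyticAt_powers hK
  refine ⟨fun x => ∑ i, ∑ j, (r x i * c x j) • entrySeq i j (Ψ (M x)), ?_, ?_⟩
  · refine Finset.analyticAt_fun_sum _ fun i _ => Finset.analyticAt_fun_sum _ fun j _ => ?_
    refine ((hr i).fun_mul (hc j)).fun_smul ?_
    exact ((entrySeq i j).analyticAt _).comp (hΨ.comp hM)
  · filter_upwards [hM.continuousAt.eventually hΨ2] with x hx k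
    have : ∀ i j, entrySeq i j (Ψ (M x)) k = (M x ^ k) i j := fun i j => by
      rw [← hx k]; rfl
    simp only [BoundedContinuousFunction.coe_sum, Finset.sum_apply,
      BoundedContinuousFunction.coe_smul, this, smul_eq_mul, dotProduct, mulVec, Finset.mul_sum]
    exact Finset.sum_congr rfl fun i _ => Finset.sum_congr rfl fun j _ => by ring

lemma summable_abs_weight_mul {w : ℕ → ℝ} (hw : Summable fun k => |w k|) (x : ℕ →ᵇ ℝ) :
    Summable fun k => |w k * x k| :=
  Summable.of_nonneg_of_le (fun _ => abs_nonneg _) (fun k => by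
    rw [abs_mul]
    exact mul_le_mul_of_nonneg_left (x.norm_coe_le_norm k) (abs_nonneg _)) (hw.mul_right ‖x‖)

lemma abs_tsum_weight_mul_le {w : ℕ → ℝ} (hw : Summable fun k => |w k|) (x : ℕ →ᵇ ℝ) :
    ‖∑' k, w k * x k‖ ≤ (∑' k, |w k|) * ‖x‖ := by
  rw [← tsum_mul_right]
  have hs := summable_abs_weight_mul hw x
  have h1 : ‖∑' k, w k * x k‖ ≤ ∑' k, |w k * x k| := norm_tsum_le_tsum_norm hs
  refine h1.trans (hs.tsum_le_tsum (fun k => ?_) (hw.mul_right ‖x‖))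
  rw [abs_mul]
  exact mul_le_mul_of_nonneg_left (x.norm_coe_le_norm k) (abs_nonneg _)

/-- Summation of bounded sequences against a summable weight. -/
def weightedSum (w : ℕ → ℝ) (hw : Summable fun k => |w k|) : (ℕ →ᵇ ℝ) →L[ℝ] ℝ :=
  LinearMap.mkContinuous
    { toFun := fun x => ∑' k, w k * x k
      map_add' := fun x y => by
        rw [← ((summable_abs_weight_mul hw x).of_abs).tsum_add
          ((summable_abs_weight_mul hw y).of_abs)]
        simp [mul_add]
      map_smul' := fun a x => by
        simp only [BoundedContinuousFunction.coe_smul, smul_eq_mul, RingHom.id_apply,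
          ← tsum_mul_left]
        exact tsum_congr fun k => by ring }
    (∑' k, |w k|) (abs_tsum_weight_mul_le hw)

lemma hasSum_weightedSum (w : ℕ → ℝ) (hw : Summable fun k => |w k|) (x : ℕ →ᵇ ℝ) :
    HasSum (fun k => w k * x k) (weightedSum w hw x) :=
  (summable_abs_weight_mul hw x).of_abs.hasSum

lemma exists_pos_le_of_tendsto {g : ℕ → ℝ} {a : ℝ} (ha : 0 < a) (hg : Tendsto g atTop (𝓝 a))
    (hpos : ∀ k, 0 < g k) : ∃ c, 0 < c ∧ ∀ k, c ≤ g k := by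
  obtain ⟨N, hN⟩ := eventually_atTop.1 (hg.eventually_const_le (half_lt_self ha))
  obtain ⟨i, hi, hmin⟩ := (Finset.range (N + 1)).exists_min_image g ⟨0, by simp⟩
  refine ⟨min (g i) (a / 2), lt_min (hpos i) (half_pos ha), fun k => ?_⟩
  by_cases hk : k < N + 1
  · exact (min_le_left _ _).trans (hmin k (Finset.mem_range.2 hk))
  · exact (min_le_right _ _).trans (hN k (by omega))

end Sequences

end

/-! ### Sufficiency: analyticity of the return entropy. -/

section
open scoped Matrix.Norms.Operator BoundedContinuousFunction

variable {n : ℕ}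

/-- The vector `c - P c` replaces `c` so that the identity also holds at `k = 0`; for larger `k`
nothing changes, as the deflated matrix kills `P c`. -/
lemma pow_mul_bilin_eigenProj {B : Matrix (Fin n) (Fin n) ℝ} {l : ℝ} (hl0 : l ≠ 0)
    (hl : B.charpoly.IsRoot l) (hd : B.charpoly.derivative.eval l ≠ 0) (r c : Fin n → ℝ) (k : ℕ) :
    l ^ k * (r ⬝ᵥ eigenProj B l *ᵥ c +
      r ⬝ᵥ ((l⁻¹ • (B - l • eigenProj B l)) ^ k) *ᵥ (c - eigenProj B l *ᵥ c)) =
      r ⬝ᵥ (B ^ k) *ᵥ c := by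
  cases k with
  | zero => simp [dotProduct_sub]
  | succ k =>
    have h1 : (B - l • eigenProj B l) ^ (k + 1) * eigenProj B l = 0 := by
      rw [pow_succ, Matrix.mul_assoc, Matrix.sub_mul, mul_eigenProj hl, Matrix.smul_mul,
        eigenProj_mul_self hl hd, sub_self, Matrix.mul_zero]
    rw [mulVec_sub, mulVec_mulVec, smul_pow, Matrix.smul_mul, h1, smul_zero, zero_mulVec, sub_zero,
      smul_mulVec, dotProduct_smul, pow_eq_of_eigenProj hl hd, add_mulVec, smul_mulVec,
      dotProduct_add, dotProduct_smul, smul_eq_mul, smul_eq_mul, mul_add, ← mul_assoc (l ^ (k + 1)),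
      ← mul_pow, mul_inv_cancel₀ hl0, one_pow, one_mul]

/-- The margin `θ < 1` splits `B ^ k` into a summable weight `θ ^ k` and a sequence that is still
bounded and analytic. -/
lemma IsTransient.exists_smul {B : Matrix (Fin n) (Fin n) ℝ} (hB : IsTransient B) :
    ∃ θ : ℝ, 0 < θ ∧ θ < 1 ∧ ∃ K, ‖(θ⁻¹ • B) ^ K‖ < 1 := by
  obtain ⟨K, hK, h⟩ := hB
  have h1 : ∀ᶠ t in 𝓝 (1 : ℝ), ‖B ^ K‖ < t ^ K := by
    have : ContinuousAt (fun t : ℝ => t ^ K) 1 := by fun_prop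
    exact this.eventually (lt_mem_nhds (by simpa using h))
  have h2 : ∀ᶠ t in 𝓝[<] (1 : ℝ), ‖B ^ K‖ < t ^ K ∧ 0 < t ∧ t < 1 := by
    filter_upwards [nhdsWithin_le_nhds h1, nhdsWithin_le_nhds (lt_mem_nhds (zero_lt_one' ℝ)),
      self_mem_nhdsWithin] with t ha hb hc using ⟨ha, hb, hc⟩
  obtain ⟨t, ha, hb, hc⟩ := h2.exists
  refine ⟨t, hb, hc, K, ?_⟩
  rw [smul_pow, norm_smul, norm_pow, norm_inv, Real.norm_of_nonneg hb.le, inv_pow,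
    inv_mul_lt_one₀ (by positivity)]
  exact ha

variable {Δ : Matrix (Fin (n + 1)) (Fin (n + 1)) ℝ}

lemma analyticAt_blockB : AnalyticAt ℝ (blockB (n := n)) Δ :=
  analyticAt_matrix fun i j => analyticAt_matrix_apply analyticAt_id i.succ j.succ

lemma analyticAt_blockR (i : Fin n) : AnalyticAt ℝ (fun X => blockR X i) Δ :=
  analyticAt_matrix_apply analyticAt_id 0 i.succ

lemma analyticAt_blockC (i : Fin n) : AnalyticAt ℝ (fun X => blockC X i) Δ :=
  analyticAt_matrix_apply analyticAt_id i.succ 0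

lemma analyticAt_meanReturn (hB : IsTransient (blockB Δ)) :
    AnalyticAt ℝ (meanReturn (n := n)) Δ := by
  obtain ⟨z, hz⟩ := hB.isUnit_one_sub
  have h1 : AnalyticAt ℝ (fun X => (1 - blockB X)⁻¹) Δ := by
    simp only [nonsing_inv_eq_ringInverse]
    have h2 : AnalyticAt ℝ (Ring.inverse : Matrix (Fin n) (Fin n) ℝ → _) (1 - blockB Δ) := by
      rw [← hz]; exact analyticAt_inverse z
    exact AnalyticAt.comp (f := fun X => 1 - blockB X) h2
      (analyticAt_const.fun_sub analyticAt_blockB)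
  unfold meanReturn
  simp only [dotProduct, mulVec, Pi.one_apply, mul_one]
  exact analyticAt_const.fun_add (Finset.analyticAt_fun_sum _ fun i _ =>
    (analyticAt_blockR i).fun_mul (Finset.analyticAt_fun_sum _ fun j _ =>
      analyticAt_matrix_apply h1 i j))

/-- The return probabilities are written in two ways: as `θ ^ k Φ k` in the factor outside the
logarithm, for summability, and as `L ^ k g k` inside it, where `g` is bounded below by a positive
constant because its terms are positive and converge to `r P c > 0`. Both `Φ` and `g` are analytic
into bounded sequences. -/
lemma exists_analyticAt_loopEntropy (hΔ : Δ ∈ rowStochastic ℝ (Fin (n + 1)))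
    (hirr : Δ.IsIrreducible) (hpos : PositivityCondition Δ)
    (hdom : HasSimpleDominantEigenvalue (blockB Δ)) :
    ∃ G : Matrix (Fin (n + 1)) (Fin (n + 1)) ℝ → ℝ, AnalyticAt ℝ G Δ ∧
      ∀ᶠ X in 𝓝 Δ, loopEntropy X = G X := by
  obtain ⟨l₀, hl₀, hroot, hder, ⟨K, hK, hN⟩, hα⟩ := exists_dominant hirr hpos hdom
  obtain ⟨θ, hθ0, hθ1, K', hθ⟩ := (isTransient_of_isIrreducible hΔ hirr).exists_smul
  obtain ⟨L, hL, hLl, hLr⟩ := exists_analyticAt_simpleRoot hroot hder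
  have hB := analyticAt_blockB (Δ := Δ)
  have hl : AnalyticAt ℝ (fun X => L (blockB X)) Δ := hL.comp hB
  have hP : AnalyticAt ℝ (fun X => eigenProj (blockB X) (L (blockB X))) Δ :=
    analyticAt_eigenProj hB hl (by rw [hLl]; exact hder)
  have hNan : AnalyticAt ℝ (fun X => (L (blockB X))⁻¹ •
      (blockB X - L (blockB X) • eigenProj (blockB X) (L (blockB X)))) Δ :=
    (hl.fun_inv (by rw [hLl]; exact hl₀.ne')).fun_smul (hB.fun_sub (hl.fun_smul hP))
  have hPc : ∀ i, AnalyticAt ℝ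
      (fun X => (eigenProj (blockB X) (L (blockB X)) *ᵥ blockC X) i) Δ := fun i =>
    Finset.analyticAt_fun_sum Finset.univ fun j _ => (analyticAt_matrix_apply hP i j).fun_mul
      (analyticAt_blockC j)
  have hct : ∀ i, AnalyticAt ℝ
      (fun X => (blockC X - eigenProj (blockB X) (L (blockB X)) *ᵥ blockC X) i) Δ := fun i =>
    (analyticAt_blockC i).fun_sub (hPc i)
  obtain ⟨Ψ, hΨ, hΨ2⟩ := exists_analyticAt_bilin hNan analyticAt_blockR hct (K := K)
    (by rw [hLl]; exact hN)
  obtain ⟨Φ, hΦ, hΦ2⟩ := exists_analyticAt_bilin (analyticAt_const.fun_smul hB (f := fun _ => θ⁻¹))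
    analyticAt_blockR analyticAt_blockC hθ
  set g : Matrix (Fin (n + 1)) (Fin (n + 1)) ℝ → (ℕ →ᵇ ℝ) := fun X =>
    (blockR X ⬝ᵥ eigenProj (blockB X) (L (blockB X)) *ᵥ blockC X) • 1 + Ψ X with hgdef
  have hgan : AnalyticAt ℝ g Δ := by
    refine AnalyticAt.fun_add (AnalyticAt.fun_smul ?_ analyticAt_const) hΨ
    exact Finset.analyticAt_fun_sum _ fun i _ => (analyticAt_blockR i).fun_mul (hPc i)
  have hg : ∀ᶠ X in 𝓝 Δ, 0 < L (blockB X) ∧ ∀ k,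
      L (blockB X) ^ k * g X k = blockR X ⬝ᵥ (blockB X ^ k) *ᵥ blockC X := by
    have hder' : ∀ᶠ X in 𝓝 Δ, (blockB X).charpoly.derivative.eval (L (blockB X)) ≠ 0 := by
      have h3 := AnalyticAt.comp (f := fun X => (blockB X, L (blockB X)))
        (analyticAt_charFun (blockB Δ, L (blockB Δ))).fderiv (hB.prod hl)
      have h4 := (((ContinuousLinearMap.apply ℝ ℝ
        ((0 : Matrix (Fin n) (Fin n) ℝ), (1 : ℝ))).analyticAt _).comp h3).continuousAt
      have h5 := h4.eventually_ne (y := 0) (by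
        have : fderiv ℝ charFun (blockB Δ, L (blockB Δ)) (0, 1) ≠ 0 := by
          rw [fderiv_charFun, mul_one, hLl]; exact hder
        exact this)
      filter_upwards [h5] with X hX
      have h6 : fderiv ℝ charFun (blockB X, L (blockB X)) (0, 1) ≠ 0 := hX
      rwa [fderiv_charFun, mul_one] at h6
    filter_upwards [hΨ2, hB.continuousAt.eventually hLr, hder',
      hl.continuousAt.eventually (lt_mem_nhds (show 0 < L (blockB Δ) by rw [hLl]; exact hl₀))]
      with X h1 h2 h3 h4
    refine ⟨h4, fun k => ?_⟩
    rw [← pow_mul_bilin_eigenProj h4.ne' h2 h3]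
    simp [hgdef, h1 k]
  have hg0 : ∀ k, 0 < g Δ k := by
    intro k
    obtain ⟨h1, h2⟩ := hg.self_of_nhds
    have h3 := hpos.2 k
    rw [← h2 k] at h3
    exact pos_of_mul_pos_right h3 (by positivity)
  have hglim : Tendsto (fun k => g Δ k) atTop
      (𝓝 (blockR Δ ⬝ᵥ eigenProj (blockB Δ) l₀ *ᵥ blockC Δ)) := by
    have h1 := tendsto_pow_eigenProj hl₀.ne' hroot hder hK hN
    have h2 : Continuous fun M : Matrix (Fin n) (Fin n) ℝ => blockR Δ ⬝ᵥ M *ᵥ blockC Δ := by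
      fun_prop
    refine ((h2.tendsto _).comp h1).congr fun k => ?_
    have h3 := hg.self_of_nhds.2 k
    rw [hLl] at h3
    simp only [Function.comp_apply, smul_pow, smul_mulVec, dotProduct_smul, ← h3, smul_eq_mul]
    rw [← mul_assoc, ← mul_pow, inv_mul_cancel₀ hl₀.ne', one_pow, one_mul]
  obtain ⟨c₀, hc₀, hgc⟩ := exists_pos_le_of_tendsto hα hglim hg0
  obtain ⟨Λ, hΛ, hΛ2⟩ := exists_analyticAt_log hc₀ hgc
  have hgpos : ∀ᶠ X in 𝓝 Δ, ∀ k, 0 < g X k := by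
    have h1 := hgan.continuousAt.eventually (Metric.ball_mem_nhds (g Δ) hc₀)
    filter_upwards [h1] with X hX k
    have h2 := (BoundedContinuousFunction.dist_coe_le_dist (f := g X) (g := g Δ) k).trans_lt hX
    rw [Real.dist_eq] at h2
    have := (abs_lt.1 h2).1
    have := hgc k
    linarith
  have hw0 : Summable fun k : ℕ => |θ ^ k| := by
    simpa [abs_of_pos hθ0] using summable_geometric_of_lt_one hθ0.le hθ1
  have hw1 : Summable fun k : ℕ => |(k : ℝ) * θ ^ k| := by
    have := summable_pow_mul_geometric_of_norm_lt_one 1 (r := θ)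
      (by rwa [Real.norm_of_nonneg hθ0.le])
    simpa using this.abs
  -- Since `log f (k + 1) = k log L + log g k`, the weight `k θ ^ k` goes with `log L` and the
  -- weight `θ ^ k` with `log g`; the term `-a log a` stands apart.
  refine ⟨fun X => Real.negMulLog (X 0 0) - (Real.log (L (blockB X)) *
    weightedSum _ hw1 (Φ X) + weightedSum _ hw0 (Φ X * Λ (g X))), ?_, ?_⟩
  · have ha : AnalyticAt ℝ (fun X : Matrix (Fin (n + 1)) (Fin (n + 1)) ℝ => X 0 0) Δ :=
      analyticAt_matrix_apply analyticAt_id 0 0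
    refine AnalyticAt.fun_sub ?_ (AnalyticAt.fun_add (AnalyticAt.fun_mul ?_ ?_) ?_)
    · exact (ha.fun_neg).fun_mul 
        (AnalyticAt.comp (f := fun X : Matrix (Fin (n + 1)) (Fin (n + 1)) ℝ => X 0 0)
          (analyticAt_log hpos.1) ha)
    · exact (analyticAt_log (by rw [hLl]; exact hl₀)).comp hl
    · exact ((weightedSum _ hw1).analyticAt _).comp hΦ
    · exact ((weightedSum _ hw0).analyticAt _).comp (hΦ.fun_mul (hΛ.comp hgan))
  · filter_upwards [hΦ2, hg, hgpos, hgan.continuousAt.eventually hΛ2] with X h1 h2 h3 h4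
    have hf : ∀ k, loopProb X (k + 1) = θ ^ k * Φ X k := by
      intro k
      rw [h1 k, smul_pow, smul_mulVec, dotProduct_smul, smul_eq_mul, ← mul_assoc, ← mul_pow,
        mul_inv_cancel₀ hθ0.ne', one_pow, one_mul]; rfl
    have hη : ∀ k, Real.negMulLog (loopProb X (k + 1)) = -(Real.log (L (blockB X)) *
        (k * θ ^ k * Φ X k) + θ ^ k * (Φ X * Λ (g X)) k) := by
      intro k
      have hlog : Real.log (loopProb X (k + 1)) =
          k * Real.log (L (blockB X)) + Λ (g X) k := by
        have : loopProb X (k + 1) = L (blockB X) ^ k * g X k := (h2.2 k).symm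
        rw [this, Real.log_mul (pow_pos h2.1 k).ne' (h3 k).ne', Real.log_pow, h4 k]
      rw [Real.negMulLog, hlog, hf k, BoundedContinuousFunction.coe_mul, Pi.mul_apply]
      ring
    have hs := (((hasSum_weightedSum _ hw1 (Φ X)).mul_left (Real.log (L (blockB X)))).add
      (hasSum_weightedSum _ hw0 (Φ X * Λ (g X)))).neg
    simp only [← hη] at hs
    have hs2 := (hasSum_nat_add_iff (f := fun k => Real.negMulLog (loopProb X k)) 1).1 hs
    rw [loopEntropy, hs2.tsum_eq]
    simp [loopProb]
    ring

/-- The entropy rate is analytic at an irreducible matrix satisfying both conditions. -/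
lemma entropyRateAnalyticAt_of_conditions {E : Type*} [NormedAddCommGroup E] [NormedSpace ℝ E]
    {Θ : E → Matrix (Fin (n + 1)) (Fin (n + 1)) ℝ} {ε₀ : E}
    (hΔ : Δ ∈ rowStochastic ℝ (Fin (n + 1))) (hirr : Δ.IsIrreducible)
    (hpos : PositivityCondition Δ) (hdom : HasSimpleDominantEigenvalue (blockB Δ))
    (hΘ : IsAnalyticParametrization Θ ε₀ Δ) : EntropyRateAnalyticAt unambiguousObs Θ ε₀ := by
  obtain ⟨hΘ, rfl⟩ := hΘ
  have hB := isTransient_of_isIrreducible hΔ hirr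
  obtain ⟨G, hG, hG2⟩ := exists_analyticAt_loopEntropy hΔ hirr hpos hdom
  have hΘan : AnalyticAt ℝ Θ ε₀ := analyticAt_matrix hΘ
  refine ⟨fun ε => G (Θ ε) / meanReturn (Θ ε), ?_, ?_⟩
  · refine (hG.comp hΘan).fun_div ((analyticAt_meanReturn hB).comp hΘan) ?_
    have := one_le_meanReturn hΔ.1 hB
    exact (lt_of_lt_of_le one_pos this).ne'
  · filter_upwards [hΘan.continuousAt.eventually hG2, hΘan.continuousAt.eventually hB.eventually]
      with ε h1 h2 h3
    rw [hasEntropyRate_iff h3 h2, h1]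

end

/-! ### Necessity: passage to the return entropy and to admissible blocks. -/

section
open scoped Matrix.Norms.Operator

variable {n : ℕ} {Δ : Matrix (Fin (n + 1)) (Fin (n + 1)) ℝ}

/-- Near `Δ` the entropy of the return time agrees on stochastic matrices with an analytic
function. -/
def LoopEntropyAnalyticAt (Δ : Matrix (Fin (n + 1)) (Fin (n + 1)) ℝ) : Prop :=
  ∃ G : Matrix (Fin (n + 1)) (Fin (n + 1)) ℝ → ℝ, AnalyticAt ℝ G Δ ∧
    ∀ᶠ X in 𝓝 Δ, X ∈ rowStochastic ℝ (Fin (n + 1)) → loopEntropy X = G X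

lemma naturalParam_naturalCoord (k : Fin (n + 1) → Fin (n + 1)) (hΔ : Δ *ᵥ 1 = 1) :
    naturalParam k (naturalCoord k Δ) = Δ := by
  ext i j
  have h := congrFun hΔ i
  simp only [mulVec, dotProduct, Pi.one_apply, mul_one] at h
  rw [Fin.sum_univ_succAbove _ (k i)] at h
  simp only [naturalParam, naturalCoord, Matrix.of_apply]
  refine Fin.succAboveCases (k i) ?_ (fun j => ?_) j
  · rw [Fin.insertNth_apply_same]; linarith
  · rw [Fin.insertNth_apply_succAbove, naturalCoord]

/-- On matrices with row sums one, natural coordinates followed by the parametrization give back the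
matrix; multiplication by the analytic mean return time removes the denominator. -/
lemma loopEntropyAnalyticAt_of_natural (hB : IsTransient (blockB Δ))
    {k : Fin (n + 1) → Fin (n + 1)}
    (h : EntropyRateAnalyticAt unambiguousObs (naturalParam k) (naturalCoord k Δ)) :
    LoopEntropyAnalyticAt Δ := by
  obtain ⟨F, hF, hF2⟩ := h
  have hc : AnalyticAt ℝ (naturalCoord k) Δ := by
    refine AnalyticAt.pi fun i => AnalyticAt.pi fun j => ?_
    exact analyticAt_matrix_apply analyticAt_id i _
  refine ⟨fun X => F (naturalCoord k X) * meanReturn X,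
    (hF.comp hc).fun_mul (analyticAt_meanReturn hB), ?_⟩
  filter_upwards [hc.continuousAt.eventually hF2, hB.eventually] with X h1 h2 h3
  rw [naturalParam_naturalCoord k h3.2] at h1
  have h4 := (hasEntropyRate_iff h3 h2 _).1 (h1 h3)
  have := one_le_meanReturn h3.1 h2
  rw [h4, div_mul_cancel₀ _ (by linarith)]

lemma analyticAt_naturalParam (k : Fin (n + 1) → Fin (n + 1)) (hΔ : Δ *ᵥ 1 = 1) :
    IsAnalyticParametrization (naturalParam k) (naturalCoord k Δ) Δ := by
  refine ⟨fun i j => ?_, naturalParam_naturalCoord k hΔ⟩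
  have hx : ∀ i j, AnalyticAt ℝ (fun x : Fin (n + 1) → Fin n → ℝ => x i j) (naturalCoord k Δ) :=
    fun i j => ((ContinuousLinearMap.proj (R := ℝ) j).comp
      (ContinuousLinearMap.proj (R := ℝ) (φ := fun _ : Fin (n + 1) => Fin n → ℝ) i)).analyticAt _
  simp only [naturalParam, Matrix.of_apply]
  refine Fin.succAboveCases (k i) ?_ (fun j => ?_) j
  · simp only [Fin.insertNth_apply_same]
    exact analyticAt_const.fun_sub (Finset.analyticAt_fun_sum _ fun j _ => hx i j)
  · simp only [Fin.insertNth_apply_succAbove]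
    exact hx i j

/-- Analyticity at a point is an open condition, so every later contradiction may be sought at a
nearby matrix. -/
lemma LoopEntropyAnalyticAt.eventually (h : LoopEntropyAnalyticAt Δ) :
    ∀ᶠ X in 𝓝 Δ, LoopEntropyAnalyticAt X := by
  obtain ⟨G, hG, hG2⟩ := h
  filter_upwards [hG.eventually_analyticAt, eventually_eventually_nhds.2 hG2] with X h1 h2
  exact ⟨G, h1, h2⟩

/-- The matrix with row sums one and given blocks `r` and `B`. -/
def ofBlocks (r : Fin n → ℝ) (B : Matrix (Fin n) (Fin n) ℝ) :
    Matrix (Fin (n + 1)) (Fin (n + 1)) ℝ :=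
  Matrix.of (Fin.cons (Fin.cons (1 - ∑ i, r i) r) fun i => Fin.cons ((1 - B *ᵥ 1) i) (B i))

@[simp] lemma blockR_ofBlocks (r : Fin n → ℝ) (B : Matrix (Fin n) (Fin n) ℝ) :
    blockR (ofBlocks r B) = r := by
  ext; simp [blockR, ofBlocks]

@[simp] lemma blockB_ofBlocks (r : Fin n → ℝ) (B : Matrix (Fin n) (Fin n) ℝ) :
    blockB (ofBlocks r B) = B := by
  ext; simp [blockB, ofBlocks]

@[simp] lemma blockC_ofBlocks (r : Fin n → ℝ) (B : Matrix (Fin n) (Fin n) ℝ) :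
    blockC (ofBlocks r B) = 1 - B *ᵥ 1 := by
  ext; simp [blockC, ofBlocks]

lemma ofBlocks_zero_zero (r : Fin n → ℝ) (B : Matrix (Fin n) (Fin n) ℝ) :
    ofBlocks r B 0 0 = 1 - ∑ i, r i := by simp [ofBlocks]

lemma ofBlocks_block (hΔ : Δ *ᵥ 1 = 1) : ofBlocks (blockR Δ) (blockB Δ) = Δ := by
  ext i j
  refine Fin.cases ?_ (fun i => ?_) i <;> refine Fin.cases ?_ (fun j => ?_) j
  · rw [ofBlocks_zero_zero, blockR_sum hΔ]; ring
  · simp [ofBlocks, blockR]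
  · change blockC (ofBlocks (blockR Δ) (blockB Δ)) i = blockC Δ i
    rw [blockC_ofBlocks, blockB_mulVec_one hΔ, sub_sub_cancel]
  · simp [ofBlocks, blockB]

/-- `r` and `B` are the blocks of a stochastic matrix with positive `r`, `c` and `a`. -/
structure IsAdmissible (r : Fin n → ℝ) (B : Matrix (Fin n) (Fin n) ℝ) : Prop where
  r_pos : ∀ i, 0 < r i
  r_sum : ∑ i, r i < 1
  B_nonneg : ∀ i j, 0 ≤ B i j
  B_sum : ∀ i, (B *ᵥ 1) i < 1

lemma IsAdmissible.ofBlocks_mem {r : Fin n → ℝ} {B : Matrix (Fin n) (Fin n) ℝ}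
    (h : IsAdmissible r B) : ofBlocks r B ∈ rowStochastic ℝ (Fin (n + 1)) := by
  refine ⟨fun i j => ?_, ?_⟩
  · refine Fin.cases ?_ (fun i => ?_) i <;> refine Fin.cases ?_ (fun j => ?_) j
    · rw [ofBlocks_zero_zero]; linarith [h.r_sum]
    · simpa [ofBlocks] using (h.r_pos j).le
    · have := h.B_sum i
      simp only [ofBlocks, Matrix.of_apply, Fin.cons_succ, Fin.cons_zero, Pi.sub_apply,
        Pi.one_apply]
      linarith
    · simpa [ofBlocks] using h.B_nonneg i j
  · ext i
    refine Fin.cases ?_ (fun i => ?_) i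
    · simp [mulVec, dotProduct, Fin.sum_univ_succ, ofBlocks]
    · simp [mulVec, dotProduct, Fin.sum_univ_succ, ofBlocks]

lemma IsAdmissible.isTransient {r : Fin n → ℝ} {B : Matrix (Fin n) (Fin n) ℝ}
    (h : IsAdmissible r B) : IsTransient B :=
  ⟨1, one_pos, by rw [pow_one]; exact (opNorm_lt_one_iff_of_nonneg h.B_nonneg).2 h.B_sum⟩

/-- All conditions are open except nonnegativity of `B`, which therefore remains a hypothesis on the
nearby pair. -/
lemma IsAdmissible.eventually {r : Fin n → ℝ} {B : Matrix (Fin n) (Fin n) ℝ}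
    (h : IsAdmissible r B) : ∀ᶠ p : (Fin n → ℝ) × Matrix (Fin n) (Fin n) ℝ in 𝓝 (r, B),
      (∀ i j, 0 ≤ p.2 i j) → IsAdmissible p.1 p.2 := by
  have h1 : ∀ᶠ p : (Fin n → ℝ) × Matrix (Fin n) (Fin n) ℝ in 𝓝 (r, B), ∀ i, 0 < p.1 i :=
    eventually_all.2 fun i => (show ContinuousAt (fun p : (Fin n → ℝ) ×
      Matrix (Fin n) (Fin n) ℝ => p.1 i) (r, B) by fun_prop).eventually (lt_mem_nhds (h.r_pos i))
  have h2 : ∀ᶠ p : (Fin n → ℝ) × Matrix (Fin n) (Fin n) ℝ in 𝓝 (r, B), ∑ i, p.1 i < 1 :=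
    (show ContinuousAt (fun p : (Fin n → ℝ) × Matrix (Fin n) (Fin n) ℝ => ∑ i, p.1 i) (r, B) by
      fun_prop).eventually (gt_mem_nhds h.r_sum)
  have h3 : ∀ᶠ p : (Fin n → ℝ) × Matrix (Fin n) (Fin n) ℝ in 𝓝 (r, B), ∀ i, (p.2 *ᵥ 1) i < 1 :=
    eventually_all.2 fun i => (show ContinuousAt (fun p : (Fin n → ℝ) ×
      Matrix (Fin n) (Fin n) ℝ => (p.2 *ᵥ 1) i) (r, B) by fun_prop).eventually
        (gt_mem_nhds (h.B_sum i))
  filter_upwards [h1, h2, h3] with p a b c d using ⟨a, b, d, c⟩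

/-- The contribution of the return times at least two to the entropy of the return time. -/
def returnEntropy (r : Fin n → ℝ) (B : Matrix (Fin n) (Fin n) ℝ) : ℝ :=
  ∑' j : ℕ, Real.negMulLog (r ⬝ᵥ (B ^ j) *ᵥ (1 - B *ᵥ 1))

/-- Near `(r, B)` the function `returnEntropy` agrees, where `B` is nonnegative, with an analytic
function. -/
def ReturnEntropyAnalyticAt (r : Fin n → ℝ) (B : Matrix (Fin n) (Fin n) ℝ) : Prop :=
  ∃ G : (Fin n → ℝ) × Matrix (Fin n) (Fin n) ℝ → ℝ, AnalyticAt ℝ G (r, B) ∧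
    ∀ᶠ p in 𝓝 (r, B), (∀ i j, 0 ≤ p.2 i j) → returnEntropy p.1 p.2 = G p

lemma ReturnEntropyAnalyticAt.eventually {r : Fin n → ℝ} {B : Matrix (Fin n) (Fin n) ℝ}
    (h : ReturnEntropyAnalyticAt r B) :
    ∀ᶠ p : (Fin n → ℝ) × Matrix (Fin n) (Fin n) ℝ in 𝓝 (r, B),
      ReturnEntropyAnalyticAt p.1 p.2 := by
  obtain ⟨G, hG, hG2⟩ := h
  filter_upwards [hG.eventually_analyticAt, eventually_eventually_nhds.2 hG2] with X h1 h2
  exact ⟨G, h1, h2⟩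

lemma IsAdmissible.summable {r : Fin n → ℝ} {B : Matrix (Fin n) (Fin n) ℝ}
    (h : IsAdmissible r B) :
    Summable fun j : ℕ => Real.negMulLog (r ⬝ᵥ (B ^ j) *ᵥ (1 - B *ᵥ 1)) := by
  have h1 := summable_negMulLog_loopProb h.ofBlocks_mem (by simpa using h.isTransient)
  simpa [loopProb] using (summable_nat_add_iff 1).2 h1

lemma IsAdmissible.loopEntropy_eq {r : Fin n → ℝ} {B : Matrix (Fin n) (Fin n) ℝ}
    (h : IsAdmissible r B) :
    loopEntropy (ofBlocks r B) = Real.negMulLog (1 - ∑ i, r i) + returnEntropy r B := by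
  have h1 := summable_negMulLog_loopProb h.ofBlocks_mem (by simpa using h.isTransient)
  rw [loopEntropy, h1.tsum_eq_zero_add]
  simp [loopProb, returnEntropy, ofBlocks_zero_zero]

lemma analyticAt_ofBlocks (p : (Fin n → ℝ) × Matrix (Fin n) (Fin n) ℝ) :
    AnalyticAt ℝ (fun p : (Fin n → ℝ) × Matrix (Fin n) (Fin n) ℝ => ofBlocks p.1 p.2) p := by
  have hr : ∀ i, AnalyticAt ℝ (fun p : (Fin n → ℝ) × Matrix (Fin n) (Fin n) ℝ => p.1 i) p :=
    fun i => ((ContinuousLinearMap.proj (R := ℝ) (φ := fun _ : Fin n => ℝ) i).comp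
      (ContinuousLinearMap.fst ℝ _ _)).analyticAt p
  have hB : ∀ i j, AnalyticAt ℝ
      (fun p : (Fin n → ℝ) × Matrix (Fin n) (Fin n) ℝ => p.2 i j) p :=
    analyticAt_matrix_apply analyticAt_snd
  refine analyticAt_matrix fun i j => ?_
  refine Fin.cases ?_ (fun i => ?_) i <;> refine Fin.cases ?_ (fun j => ?_) j
  · simp only [ofBlocks_zero_zero]
    exact analyticAt_const.fun_sub (Finset.analyticAt_fun_sum _ fun i _ => hr i)
  · simpa [ofBlocks] using hr j
  · simp only [ofBlocks, Matrix.of_apply, Fin.cons_succ, Fin.cons_zero, Pi.sub_apply,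
      Pi.one_apply, mulVec, dotProduct, mul_one]
    exact analyticAt_const.fun_sub (Finset.analyticAt_fun_sum _ fun j _ => hB i j)
  · simpa [ofBlocks] using hB i j

lemma LoopEntropyAnalyticAt.returnEntropyAnalyticAt {r : Fin n → ℝ}
    {B : Matrix (Fin n) (Fin n) ℝ} (h : LoopEntropyAnalyticAt (ofBlocks r B))
    (hadm : IsAdmissible r B) : ReturnEntropyAnalyticAt r B := by
  obtain ⟨G, hG, hG2⟩ := h
  have hof := analyticAt_ofBlocks (r, B)
  have ha : AnalyticAt ℝ (fun p : (Fin n → ℝ) × Matrix (Fin n) (Fin n) ℝ => 1 - ∑ i, p.1 i)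
      (r, B) := by
    simpa only [ofBlocks_zero_zero] using analyticAt_matrix_apply hof 0 0
  have ha2 : AnalyticAt ℝ (fun p : (Fin n → ℝ) × Matrix (Fin n) (Fin n) ℝ =>
      Real.negMulLog (1 - ∑ i, p.1 i)) (r, B) :=
    ha.fun_neg.fun_mul (AnalyticAt.comp (f := fun p : (Fin n → ℝ) × Matrix (Fin n) (Fin n) ℝ =>
      1 - ∑ i, p.1 i) (analyticAt_log (by have := hadm.r_sum; simpa using this)) ha)
  refine ⟨fun p => G (ofBlocks p.1 p.2) - Real.negMulLog (1 - ∑ i, p.1 i),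
    AnalyticAt.fun_sub (AnalyticAt.comp (f := fun p : (Fin n → ℝ) × Matrix (Fin n) (Fin n) ℝ =>
      ofBlocks p.1 p.2) hG hof) ha2, ?_⟩
  filter_upwards [hadm.eventually, hof.continuousAt.eventually hG2] with p h1 h2 h3
  have h4 := h1 h3
  rw [← h2 h4.ofBlocks_mem, h4.loopEntropy_eq]
  ring

end

/-! ### Necessity of the positivity condition. -/

section
open scoped Matrix.Norms.Operator

variable {n : ℕ} {Δ : Matrix (Fin (n + 1)) (Fin (n + 1)) ℝ}

section Monotone

lemma pow_entry_le_pow {X Y : Matrix (Fin n) (Fin n) ℝ} (hX : ∀ i j, 0 ≤ X i j)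
    (hXY : ∀ i j, X i j ≤ Y i j) (k : ℕ) (i j : Fin n) : (X ^ k) i j ≤ (Y ^ k) i j := by
  induction k generalizing i j with
  | zero => simp
  | succ k ih =>
    rw [pow_succ, pow_succ, mul_apply, mul_apply]
    exact Finset.sum_le_sum fun l _ => mul_le_mul (ih i l) (hXY l j) (hX l j)
      ((pow_apply_nonneg hX k i l).trans (ih i l))

lemma mulVec_entry_le {X Y : Matrix (Fin n) (Fin n) ℝ} {v w : Fin n → ℝ}
    (hv : ∀ i, 0 ≤ v i) (hXY : ∀ i j, X i j ≤ Y i j) (hvw : ∀ i, v i ≤ w i)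
    (hY : ∀ i j, 0 ≤ Y i j) (i : Fin n) : (X *ᵥ v) i ≤ (Y *ᵥ w) i :=
  Finset.sum_le_sum (s := Finset.univ) fun j _ => mul_le_mul (hXY i j) (hvw j) (hv j) (hY i j)

lemma dotProduct_entry_le {v w v' w' : Fin n → ℝ} (hw : ∀ i, 0 ≤ w i) (hvv : ∀ i, v i ≤ v' i)
    (hww : ∀ i, w i ≤ w' i) (hv' : ∀ i, 0 ≤ v' i) : v ⬝ᵥ w ≤ v' ⬝ᵥ w' :=
  Finset.sum_le_sum fun i _ => mul_le_mul (hvv i) (hww i) (hw i) (hv' i)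

lemma loopProb_mono {X Y : Matrix (Fin (n + 1)) (Fin (n + 1)) ℝ} (hX : ∀ i j, 0 ≤ X i j)
    (hXY : ∀ i j, X i j ≤ Y i j) : ∀ k, loopProb X k ≤ loopProb Y k
  | 0 => hXY 0 0
  | k + 1 => by
    have hY : ∀ i j, 0 ≤ Y i j := fun i j => (hX i j).trans (hXY i j)
    have hX' := pow_apply_nonneg (blockB_nonneg hX) k
    exact dotProduct_entry_le (mulVec_entry_nonneg (blockC_nonneg hX) hX')
      (fun i => hXY _ _) (mulVec_entry_le (blockC_nonneg hX)
        (pow_entry_le_pow (blockB_nonneg hX) (fun i j => hXY _ _) k) (fun i => hXY _ _)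
        (pow_apply_nonneg (blockB_nonneg hY) k)) (blockR_nonneg hY)

lemma loopProb_smul (t : ℝ) (X : Matrix (Fin (n + 1)) (Fin (n + 1)) ℝ) :
    ∀ k, loopProb (t • X) k = t ^ (k + 1) * loopProb X k
  | 0 => by simp [loopProb]
  | k + 1 => by
    have h1 : blockB (t • X) = t • blockB X := rfl
    have h2 : blockR (t • X) = t • blockR X := rfl
    have h3 : blockC (t • X) = t • blockC X := rfl
    simp only [loopProb, h1, h2, h3, smul_pow, smul_mulVec, mulVec_smul, smul_dotProduct,
      dotProduct_smul, smul_eq_mul]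
    ring

end Monotone

lemma analyticAt_loopProb (k : ℕ) : AnalyticAt ℝ (fun X => loopProb (n := n) X k) Δ := by
  cases k with
  | zero => exact analyticAt_matrix_apply analyticAt_id 0 0
  | succ k =>
    simp only [loopProb, dotProduct, mulVec]
    have h : AnalyticAt ℝ (fun X => blockB (n := n) X ^ k) Δ := analyticAt_blockB.fun_pow k
    exact Finset.analyticAt_fun_sum _ fun i _ => (analyticAt_blockR i).fun_mul
      (Finset.analyticAt_fun_sum _ fun j _ => (analyticAt_matrix_apply h i j).fun_mul
        (analyticAt_blockC j))

/-- The segment from `Δ` to the uniform matrix. -/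
def uniformMix (Δ : Matrix (Fin (n + 1)) (Fin (n + 1)) ℝ) (ε : ℝ) :
    Matrix (Fin (n + 1)) (Fin (n + 1)) ℝ :=
  (1 - ε) • Δ + ε • Matrix.of fun _ _ => ((n : ℝ) + 1)⁻¹

lemma uniformMix_apply (ε : ℝ) (i j : Fin (n + 1)) :
    uniformMix Δ ε i j = (1 - ε) * Δ i j + ε * ((n : ℝ) + 1)⁻¹ := by simp [uniformMix]

@[simp] lemma uniformMix_zero : uniformMix Δ 0 = Δ := by ext; simp [uniformMix]

lemma uniformMix_mem (hΔ : Δ ∈ rowStochastic ℝ (Fin (n + 1))) {ε : ℝ} (h0 : 0 ≤ ε) (h1 : ε ≤ 1) :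
    uniformMix Δ ε ∈ rowStochastic ℝ (Fin (n + 1)) := by
  refine ⟨fun i j => ?_, ?_⟩
  · rw [uniformMix_apply]
    have := hΔ.1 i j
    have : 0 ≤ 1 - ε := by linarith
    positivity
  · ext i
    have h := congrFun hΔ.2 i
    simp only [mulVec, dotProduct, Pi.one_apply, mul_one] at h ⊢
    simp only [uniformMix_apply, Finset.sum_add_distrib, ← Finset.mul_sum, h]
    have : (n : ℝ) + 1 ≠ 0 := by positivity
    simp [this]

lemma analyticAt_uniformMix (ε : ℝ) : AnalyticAt ℝ (uniformMix Δ) ε :=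
  ((analyticAt_const.fun_sub analyticAt_id).fun_smul analyticAt_const).fun_add
    (analyticAt_id.fun_smul analyticAt_const)

lemma le_loopProb_uniformMix (hΔ : ∀ i j, 0 ≤ Δ i j) {ε : ℝ} (h0 : 0 ≤ ε) (h1 : ε ≤ 1) (k : ℕ) :
    (1 - ε) ^ (k + 1) * loopProb Δ k ≤ loopProb (uniformMix Δ ε) k := by
  rw [← loopProb_smul]
  refine loopProb_mono (fun i j => mul_nonneg (by linarith) (hΔ i j)) (fun i j => ?_) k
  rw [uniformMix_apply]
  change (1 - ε) * Δ i j ≤ _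
  have : 0 ≤ ε * ((n : ℝ) + 1)⁻¹ := by positivity
  linarith

lemma sum_blockC_pos (hn : 1 ≤ n) (hirr : Δ.IsIrreducible) : 0 < ∑ i, blockC Δ i := by
  have hΔ := hirr.nonneg
  refine lt_of_le_of_ne (Finset.sum_nonneg fun i _ => blockC_nonneg hΔ i) fun h => ?_
  have h0 : blockC Δ = 0 := by
    ext i
    exact (Finset.sum_eq_zero_iff_of_nonneg fun i _ => blockC_nonneg hΔ i).1 h.symm i
      (Finset.mem_univ _)
  obtain ⟨t, ht⟩ := exists_pow_mulVec_blockC_pos hirr ⟨0, hn⟩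
  simp [h0] at ht

lemma sum_blockR_pos (hn : 1 ≤ n) (hirr : Δ.IsIrreducible) : 0 < ∑ i, blockR Δ i :=
  sum_blockC_pos hn hirr.transpose

/-- At the first vanishing return probability the mixture grows at least linearly. -/
lemma exists_linear_le_loopProb (hn : 1 ≤ n) (hirr : Δ.IsIrreducible) {k : ℕ}
    (hk : ∀ i < k, 0 < loopProb Δ i) :
    ∃ κ : ℝ, 0 < κ ∧ ∀ ε : ℝ, 0 ≤ ε → ε ≤ 1 / 2 → κ * ε ≤ loopProb (uniformMix Δ ε) k := by
  have hΔ := hirr.nonneg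
  set u : ℝ := ((n : ℝ) + 1)⁻¹ with hu
  have hu0 : 0 < u := by positivity
  have hle : ∀ ε : ℝ, 0 ≤ ε → ε ≤ 1 / 2 → ∀ i j, 1 / 2 * Δ i j ≤ uniformMix Δ ε i j := by
    intro ε h0 h1 i j
    rw [uniformMix_apply]
    have := hΔ i j
    have h2 : 0 ≤ ε * u := by positivity
    nlinarith
  have hle2 : ∀ ε : ℝ, 0 ≤ ε → ε ≤ 1 / 2 → ∀ i j, ε * u ≤ uniformMix Δ ε i j := by
    intro ε h0 h1 i j
    rw [uniformMix_apply]
    have := hΔ i j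
    have h2 : 0 ≤ (1 - ε) * Δ i j := mul_nonneg (by linarith) this
    linarith
  have hnn : ∀ ε : ℝ, 0 ≤ ε → ε ≤ 1 / 2 → ∀ i j, 0 ≤ uniformMix Δ ε i j := fun ε h0 h1 i j =>
    (by positivity : (0 : ℝ) ≤ ε * u).trans (hle2 ε h0 h1 i j)
  rcases k with - | k
  · exact ⟨u, hu0, fun ε h0 h1 => by rw [mul_comm]; exact hle2 ε h0 h1 0 0⟩
  rcases k with - | k
  -- A loop of two steps: the first step is taken by `Δ`, the return jump by the uniform part.
  · refine ⟨1 / 2 * u * ∑ i, blockR Δ i, by have := sum_blockR_pos hn hirr; positivity,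
      fun ε h0 h1 => ?_⟩
    simp only [loopProb, pow_zero, one_mulVec, Finset.mul_sum, Finset.sum_mul, dotProduct]
    refine Finset.sum_le_sum fun i _ => ?_
    calc 1 / 2 * u * blockR Δ i * ε = (1 / 2 * Δ 0 i.succ) * (ε * u) := by rw [blockR]; ring
      _ ≤ _ := mul_le_mul (hle ε h0 h1 _ _) (hle2 ε h0 h1 _ _) (by positivity) (hnn ε h0 h1 _ _)
  -- A loop of `k + 3` steps: `k + 1` steps away from 0 along `Δ`, possible because `loopProb Δ (k +
  -- 1)` is positive, then one jump of the uniform part, then a step of `Δ` into 0. Only one factor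
  -- `ε` is spent.
  · have hr : 0 < ∑ i, (blockR Δ ᵥ* blockB Δ ^ k) i := by
      have hnn' : ∀ i, 0 ≤ (blockR Δ ᵥ* blockB Δ ^ k) i := vecMul_entry_nonneg (blockR_nonneg hΔ)
        (pow_apply_nonneg (blockB_nonneg hΔ) k)
      refine lt_of_le_of_ne (Finset.sum_nonneg fun i _ => hnn' i) fun h => ?_
      have h0 : blockR Δ ᵥ* blockB Δ ^ k = 0 := by
        ext i
        exact (Finset.sum_eq_zero_iff_of_nonneg fun i _ => hnn' i).1 h.symm i (Finset.mem_univ _)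
      have h2 := hk (k + 1) (by omega)
      rw [loopProb, dotProduct_mulVec, h0, zero_dotProduct] at h2
      exact h2.false
    have hc := sum_blockC_pos hn hirr
    refine ⟨(1 / 2) ^ (k + 2) * u * (∑ i, (blockR Δ ᵥ* blockB Δ ^ k) i) * ∑ i, blockC Δ i,
      by positivity, fun ε h0 h1 => ?_⟩
    set X := uniformMix Δ ε
    have hX := hnn ε h0 h1
    have e1 : ∀ i j, (((1 / 2 : ℝ) • blockB Δ) ^ k) i j ≤ (blockB X ^ k) i j :=
      pow_entry_le_pow (fun i j => mul_nonneg (by norm_num) (hΔ _ _)) (fun i j => hle ε h0 h1 _ _) k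
    have e2 : ∀ i, ε * u * (1 / 2) * ∑ i, blockC Δ i ≤ (blockB X *ᵥ blockC X) i := by
      intro i
      rw [Finset.mul_sum]
      refine Finset.sum_le_sum fun j _ => ?_
      rw [mul_assoc]
      exact mul_le_mul (hle2 ε h0 h1 _ _) (hle ε h0 h1 _ _)
        (mul_nonneg (by norm_num) (hΔ _ _)) (hX _ _)
    have e3 : ((1 / 2 : ℝ) • blockR Δ) ⬝ᵥ (((1 / 2 : ℝ) • blockB Δ) ^ k) *ᵥ
        (fun _ => ε * u * (1 / 2) * ∑ i, blockC Δ i) ≤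
        blockR X ⬝ᵥ (blockB X ^ k) *ᵥ (blockB X *ᵥ blockC X) := by
      have hp : ∀ i j, 0 ≤ (((1 / 2 : ℝ) • blockB Δ) ^ k) i j :=
        pow_apply_nonneg (fun i j => mul_nonneg (by norm_num) (hΔ _ _)) k
      have hq : ∀ i : Fin n, 0 ≤ (fun _ => ε * u * (1 / 2) * ∑ i, blockC Δ i : Fin n → ℝ) i :=
        fun _ => by positivity
      exact dotProduct_entry_le (mulVec_entry_nonneg hq hp) (fun i => hle ε h0 h1 _ _)
        (mulVec_entry_le hq e1 e2 (pow_apply_nonneg (blockB_nonneg hX) k)) (blockR_nonneg hX)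
    rw [loopProb, pow_succ (blockB X), ← mulVec_mulVec]
    refine le_trans (le_of_eq ?_) e3
    have e4 : (fun _ => ε * u * (1 / 2) * ∑ i, blockC Δ i : Fin n → ℝ) =
        (ε * u * (1 / 2) * ∑ i, blockC Δ i) • 1 := by ext; simp
    have e5 : ∑ i, (blockR Δ ᵥ* blockB Δ ^ k) i = blockR Δ ⬝ᵥ (blockB Δ ^ k) *ᵥ 1 := by
      rw [dotProduct_mulVec]; simp [dotProduct]
    rw [e4, e5, mulVec_smul, smul_pow, smul_mulVec, smul_dotProduct, dotProduct_smul,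
      dotProduct_smul]
    simp only [smul_eq_mul]
    ring

/-- This bounds all late return probabilities at once, so that they lie together in the interval
where `negMulLog` increases. -/
lemma loopProb_le_tail (hΔ : Δ ∈ rowStochastic ℝ (Fin (n + 1))) {K k : ℕ} (hk : K < k) :
    loopProb Δ k ≤ blockR Δ ⬝ᵥ (blockB Δ ^ K) *ᵥ 1 := by
  have h1 := sum_loopProb hΔ.2 K
  have h2 := sum_loopProb hΔ.2 k
  have h3 : 0 ≤ blockR Δ ⬝ᵥ (blockB Δ ^ k) *ᵥ 1 :=
    dotProduct_nonneg_of_nonneg (blockR_nonneg hΔ.1)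
      (mulVec_entry_nonneg (fun _ => zero_le_one) (pow_apply_nonneg (blockB_nonneg hΔ.1) k))
  have h4 : ∑ i ∈ Finset.range (K + 1), loopProb Δ i ≤ ∑ i ∈ Finset.range k, loopProb Δ i :=
    Finset.sum_le_sum_of_subset_of_nonneg (Finset.range_subset_range.2 hk)
      fun i _ _ => loopProb_nonneg hΔ.1 i
  rw [Finset.sum_range_succ] at h2
  linarith

lemma monotoneOn_negMulLog : MonotoneOn Real.negMulLog (Set.Icc 0 (Real.exp (-1))) := by
  refine monotoneOn_of_deriv_nonneg (convex_Icc _ _) Real.continuous_negMulLog.continuousOn ?_ ?_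
  · intro x hx
    rw [interior_Icc] at hx
    exact (Real.differentiableAt_negMulLog hx.1.ne').differentiableWithinAt
  · intro x hx
    rw [interior_Icc] at hx
    rw [Real.deriv_negMulLog hx.1.ne']
    have := (Real.log_lt_iff_lt_exp hx.1).2 hx.2
    linarith

/-- Up to `exp (-1)` the function `negMulLog` is increasing, so `y` may be lowered to `(1 - ε) ^ (k
+ 1) * x`; Bernoulli's inequality then makes the loss linear in `ε`. -/
lemma negMulLog_sub_ge {x y ε : ℝ} {k : ℕ} (hx : 0 ≤ x) (hx1 : x ≤ 1) (h0 : 0 ≤ ε) (h1 : ε < 1)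
    (hy : (1 - ε) ^ (k + 1) * x ≤ y) (hye : y ≤ Real.exp (-1)) :
    -(((k : ℝ) + 1) * Real.negMulLog x) * ε ≤ Real.negMulLog y - Real.negMulLog x := by
  have hη := Real.negMulLog_nonneg hx hx1
  rcases hx.eq_or_lt with rfl | hx
  · have h2 : 0 ≤ y := by simpa using hy
    have := Real.negMulLog_nonneg h2 (hye.trans (Real.exp_le_one_iff.2 (by norm_num)))
    simpa using this
  have hε : 0 < 1 - ε := by linarith
  have hy1 : 0 < (1 - ε) ^ (k + 1) * x := by positivity
  have h2 := monotoneOn_negMulLog ⟨hy1.le, hy.trans hye⟩ ⟨hy1.le.trans hy, hye⟩ hy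
  have h3 : (1 - ε) ^ (k + 1) * Real.negMulLog x ≤ Real.negMulLog ((1 - ε) ^ (k + 1) * x) := by
    have h4 : Real.log ((1 - ε) ^ (k + 1) * x) ≤ Real.log x := by
      refine Real.log_le_log hy1 ?_
      have : (1 - ε) ^ (k + 1) ≤ 1 := pow_le_one₀ hε.le (by linarith)
      nlinarith
    simp only [Real.negMulLog]
    nlinarith
  have h5 : 1 - ((k : ℝ) + 1) * ε ≤ (1 - ε) ^ (k + 1) := by
    have := one_add_mul_le_pow (a := -ε) (by linarith) (k + 1)
    push_cast at this
    simp only [← sub_eq_add_neg] at this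
    linarith
  have h6 := mul_le_mul_of_nonneg_right h5 hη
  linarith

lemma summable_succ_mul_negMulLog (hΔ : Δ ∈ rowStochastic ℝ (Fin (n + 1)))
    (hB : IsTransient (blockB Δ)) :
    Summable fun k : ℕ => ((k : ℝ) + 1) * Real.negMulLog (loopProb Δ k) := by
  obtain ⟨C, θ, hC, hθ0, hθ1, h⟩ := exists_loopProb_bound hB
  have hs1 : √θ < 1 := by rw [Real.sqrt_lt' one_pos]; simpa using hθ1
  have hs : Summable fun k : ℕ => 2 * √C * (((k : ℝ) + 1) * (√θ) ^ k) := by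
    have a1 := summable_pow_mul_geometric_of_norm_lt_one 1 (r := √θ)
      (by rwa [Real.norm_of_nonneg (Real.sqrt_nonneg _)])
    have a2 := summable_geometric_of_lt_one (Real.sqrt_nonneg θ) hs1
    refine Summable.mul_left _ ((a1.add a2).congr fun k => ?_)
    simp; ring
  refine Summable.of_nonneg_of_le (fun k => mul_nonneg (by positivity)
    (Real.negMulLog_nonneg (loopProb_nonneg hΔ.1 k) (loopProb_le_one hΔ k))) (fun k => ?_) hs
  have h1 := negMulLog_le_two_mul_sqrt (loopProb_nonneg hΔ.1 k)
  have h2 : √(loopProb Δ k) ≤ √C * (√θ) ^ k := by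
    refine Real.sqrt_le_iff.2 ⟨by positivity, ((le_abs_self _).trans (h k)).trans (le_of_eq ?_)⟩
    rw [mul_pow, Real.sq_sqrt hC.le, ← pow_mul, mul_comm k 2, pow_mul, Real.sq_sqrt hθ0.le]
  calc ((k : ℝ) + 1) * Real.negMulLog (loopProb Δ k) ≤ ((k : ℝ) + 1) * (2 * (√C * (√θ) ^ k)) := by
        gcongr; linarith
    _ = _ := by ring

/-- If `f 0 = 0` the entropy term can only grow; otherwise `negMulLog` is differentiable at `f 0`.
-/
lemma exists_linear_lower_bound {f : ℝ → ℝ} (hf : DifferentiableAt ℝ f 0)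
    (hf0 : ∀ᶠ ε in 𝓝[>] (0 : ℝ), 0 ≤ f ε ∧ f ε ≤ 1) (h0 : 0 ≤ f 0) :
    ∃ C : ℝ, ∀ᶠ ε in 𝓝[>] (0 : ℝ), -C * ε ≤ Real.negMulLog (f ε) - Real.negMulLog (f 0) := by
  rcases h0.eq_or_lt with h0 | h0
  · refine ⟨0, ?_⟩
    filter_upwards [hf0] with ε hε
    rw [← h0]
    simpa using Real.negMulLog_nonneg hε.1 hε.2
  · have h1 : DifferentiableAt ℝ (fun ε => Real.negMulLog (f ε)) 0 :=
      (Real.differentiableAt_negMulLog h0.ne').comp (0 : ℝ) hf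
    obtain ⟨C, hC⟩ := h1.isBigO_sub.bound
    refine ⟨C, ?_⟩
    filter_upwards [nhdsWithin_le_nhds hC, self_mem_nhdsWithin] with ε h2 h3
    rw [sub_zero, Real.norm_eq_abs, Real.norm_of_nonneg (le_of_lt h3)] at h2
    have := neg_abs_le (Real.negMulLog (f ε) - Real.negMulLog (f 0))
    linarith

/-- If the entropy of the return time is analytic at an irreducible matrix, then every return time
has positive probability. -/
lemma loopProb_pos_of_analyticAt (hn : 1 ≤ n) (hΔ : Δ ∈ rowStochastic ℝ (Fin (n + 1)))
    (hirr : Δ.IsIrreducible) (h : LoopEntropyAnalyticAt Δ) : ∀ k, 0 < loopProb Δ k := by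
  classical
  by_contra! hcon
  have hz : ∃ k, loopProb Δ k = 0 :=
    hcon.imp fun k hk => le_antisymm hk (loopProb_nonneg hΔ.1 k)
  set m := Nat.find hz with hm
  have hm0 : loopProb Δ m = 0 := Nat.find_spec hz
  have hmin : ∀ i < m, 0 < loopProb Δ i := fun i hi =>
    lt_of_le_of_ne (loopProb_nonneg hΔ.1 i) (Ne.symm (Nat.find_min hz hi))
  obtain ⟨κ, hκ, hlin⟩ := exists_linear_le_loopProb hn hirr hmin
  have hB := isTransient_of_isIrreducible hΔ hirr
  obtain ⟨G, hG, hG2⟩ := h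
  have hmix := analyticAt_uniformMix (Δ := Δ) 0
  have hmix0 : Tendsto (uniformMix Δ) (𝓝[>] 0) (𝓝 Δ) := by
    have := hmix.continuousAt.tendsto
    rw [uniformMix_zero] at this
    exact this.mono_left nhdsWithin_le_nhds
  set f : ℕ → ℝ → ℝ := fun k ε => loopProb (uniformMix Δ ε) k with hf
  have hfdiff : ∀ k, DifferentiableAt ℝ (f k) 0 := fun k =>
    (AnalyticAt.comp (f := uniformMix Δ) (analyticAt_loopProb k) hmix).differentiableAt
  have hf0 : ∀ k, f k 0 = loopProb Δ k := fun k => by simp [hf]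
  have hmem : ∀ᶠ ε in 𝓝[>] (0 : ℝ), 0 < ε ∧ ε ≤ 1 / 2 := by
    filter_upwards [self_mem_nhdsWithin, nhdsWithin_le_nhds (gt_mem_nhds (by norm_num :
      (0 : ℝ) < 1 / 2))] with ε h1 h2 using ⟨h1, h2.le⟩
  have hst : ∀ ε : ℝ, 0 < ε ∧ ε ≤ 1 / 2 → uniformMix Δ ε ∈ rowStochastic ℝ (Fin (n + 1)) :=
    fun ε hε => uniformMix_mem hΔ hε.1.le (by linarith [hε.2])
  have hbd : ∀ k, ∀ᶠ ε in 𝓝[>] (0 : ℝ), 0 ≤ f k ε ∧ f k ε ≤ 1 := by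
    intro k
    filter_upwards [hmem] with ε hε
    exact ⟨loopProb_nonneg (hst ε hε).1 k, loopProb_le_one (hst ε hε) k⟩
  choose C hC using fun k => exists_linear_lower_bound (hfdiff k) (hbd k)
    (by rw [hf0]; exact loopProb_nonneg hΔ.1 k)
  have htail : Continuous fun X : Matrix (Fin (n + 1)) (Fin (n + 1)) ℝ => blockR X := by
    unfold blockR; fun_prop
  -- Beyond `K` all return probabilities stay below `exp (-1)` for small `ε`, and monotonicity gives
  -- explicit losses. The finitely many earlier terms are controlled by differentiability.
  obtain ⟨K, hK⟩ : ∃ K, blockR Δ ⬝ᵥ (blockB Δ ^ K) *ᵥ 1 < Real.exp (-1) := by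
    have hc : Continuous fun M : Matrix (Fin n) (Fin n) ℝ => blockR Δ ⬝ᵥ M *ᵥ 1 := by fun_prop
    have := (hc.tendsto 0).comp hB.tendsto_pow
    simp only [zero_mulVec, dotProduct_zero] at this
    exact (this.eventually_lt_const (Real.exp_pos _)).exists
  have hKε : ∀ᶠ ε in 𝓝[>] (0 : ℝ),
      blockR (uniformMix Δ ε) ⬝ᵥ (blockB (uniformMix Δ ε) ^ K) *ᵥ 1 < Real.exp (-1) := by
    have hc : Continuous fun X : Matrix (Fin (n + 1)) (Fin (n + 1)) ℝ =>
        blockR X ⬝ᵥ (blockB X ^ K) *ᵥ 1 :=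
      htail.dotProduct ((continuous_blockB.pow K).matrix_mulVec continuous_const)
    exact ((hc.tendsto Δ).comp hmix0).eventually_lt_const hK
  -- `b k` is the slope of the admissible loss of term `k`; its summability bounds the total loss
  -- linearly.
  set b : ℕ → ℝ := fun k => if k = m then 0 else
    if k ≤ K then C k else ((k : ℝ) + 1) * Real.negMulLog (loopProb Δ k) with hb
  have hbs : Summable b := by
    refine ((summable_succ_mul_negMulLog hΔ hB).congr_cofinite ?_)
    rw [Filter.EventuallyEq, Nat.cofinite_eq_atTop]
    filter_upwards [eventually_gt_atTop (max K m)] with k hk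
    have h1 : k ≠ m := fun h => by have := le_max_right K m; omega
    have h2 : ¬ k ≤ K := fun h => by have := le_max_left K m; omega
    simp [hb, h1, h2]
  have hfin : ∀ᶠ ε in 𝓝[>] (0 : ℝ), ∀ k ∈ Finset.range (K + 1),
      -C k * ε ≤ Real.negMulLog (f k ε) - Real.negMulLog (f k 0) :=
    (Finset.eventually_all _).2 fun k _ => hC k
  have hupper : ∃ D : ℝ, ∀ᶠ ε in 𝓝[>] (0 : ℝ), G (uniformMix Δ ε) - G Δ ≤ D * ε := by
    have h1 : DifferentiableAt ℝ (fun ε => G (uniformMix Δ ε)) 0 :=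
      (AnalyticAt.comp (f := uniformMix Δ) (by rwa [uniformMix_zero]) hmix).differentiableAt
    obtain ⟨D, hD⟩ := h1.isBigO_sub.bound
    refine ⟨D, ?_⟩
    filter_upwards [nhdsWithin_le_nhds hD, self_mem_nhdsWithin] with ε h2 h3
    rw [sub_zero, Real.norm_eq_abs, Real.norm_of_nonneg (le_of_lt h3), uniformMix_zero] at h2
    exact (le_abs_self _).trans h2
  obtain ⟨D, hD⟩ := hupper
  have hG0 : loopEntropy Δ = G Δ := hG2.self_of_nhds hΔ
  -- The total entropy follows `G` and gains at most `D * ε`, and the other terms lose at most `(∑'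
  -- k, b k) * ε`; term `m` must therefore be `O(ε)`.
  have hmain : ∀ᶠ ε in 𝓝[>] (0 : ℝ), Real.negMulLog (f m ε) ≤ (D + ∑' k, b k) * ε := by
    filter_upwards [hmem, hKε, hfin, hD, hmix0.eventually hG2, hmix0.eventually hB.eventually]
      with ε h1 h2 h3 h4 h5 h6
    have hs := hst ε h1
    rw [← h5 hs, ← hG0] at h4
    have hsum := (summable_negMulLog_loopProb hs h6).hasSum.sub
      (summable_negMulLog_loopProb hΔ hB).hasSum
    have hlow := (hbs.hasSum.neg.mul_right ε).add (hasSum_ite_eq m (Real.negMulLog (f m ε)))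
    have hle := hasSum_le (fun k => ?_) hlow hsum
    · simp only [loopEntropy] at h4
      linarith
    · by_cases hkm : k = m
      · subst hkm
        have : Real.negMulLog (loopProb Δ m) = 0 := by rw [hm0]; simp
        simp [hb, hf, hm0]
      · by_cases hkK : k ≤ K
        · have := h3 k (Finset.mem_range.2 (by omega))
          rw [hf0] at this
          simpa [hb, hkm, hkK, hf] using this
        · have := negMulLog_sub_ge (k := k) (loopProb_nonneg hΔ.1 k) (loopProb_le_one hΔ k) h1.1.le
            (by linarith [h1.2]) (le_loopProb_uniformMix hΔ.1 h1.1.le (by linarith [h1.2]) k)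
            ((loopProb_le_tail hs (by omega)).trans h2.le)
          simpa [hb, hkm, hkK] using this
  have hfm : Tendsto (f m) (𝓝[>] 0) (𝓝[>] 0) := by
    refine tendsto_nhdsWithin_iff.2 ⟨?_, ?_⟩
    · have := (hfdiff m).continuousAt.tendsto
      rw [hf0, hm0] at this
      exact this.mono_left nhdsWithin_le_nhds
    · filter_upwards [hmem] with ε hε
      exact lt_of_lt_of_le (mul_pos hκ hε.1) (hlin ε hε.1.le hε.2)
  have hlog := (Real.tendsto_log_nhdsGT_zero.comp hfm).eventually_lt_atBot
    (-((|D + ∑' k, b k| + 1) / κ))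
  obtain ⟨ε, h1, h2, h3⟩ := (hmain.and (hlog.and hmem)).exists
  simp only [Function.comp_apply] at h2
  have h4 : κ * ε ≤ f m ε := hlin ε h3.1.le h3.2
  have h5 : (|D + ∑' k, b k| + 1) / κ ≤ -Real.log (f m ε) := by linarith
  have h6 : (κ * ε) * ((|D + ∑' k, b k| + 1) / κ) ≤ f m ε * -Real.log (f m ε) :=
    mul_le_mul h4 h5 (by positivity) ((mul_pos hκ h3.1).le.trans h4)
  have h7 : (κ * ε) * ((|D + ∑' k, b k| + 1) / κ) = (|D + ∑' k, b k| + 1) * ε := by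
    field_simp
  rw [h7] at h6
  rw [Real.negMulLog] at h1
  have h8 := le_abs_self (D + ∑' k, b k)
  nlinarith [h3.1]

lemma positivityCondition_of_analyticAt (hn : 1 ≤ n) (hΔ : Δ ∈ rowStochastic ℝ (Fin (n + 1)))
    (hirr : Δ.IsIrreducible) (h : LoopEntropyAnalyticAt Δ) : PositivityCondition Δ :=
  ⟨loopProb_pos_of_analyticAt hn hΔ hirr h 0,
    fun j => loopProb_pos_of_analyticAt hn hΔ hirr h (j + 1)⟩

end

/-! ### Double power series and termwise extraction of coefficients. -/

section
section DoubleSeries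

/-- The coefficient of `s ^ M * w ^ N` in a power series on the plane. -/
def doubleCoeff (p : FormalMultilinearSeries ℝ (ℝ × ℝ) ℝ) (M N : ℕ) : ℝ :=
  ∑ S ∈ Finset.powersetCard M (Finset.univ : Finset (Fin (M + N))),
    p (M + N) (S.piecewise (fun _ => (1, 0)) fun _ => (0, 1))

lemma abs_doubleCoeff_le (p : FormalMultilinearSeries ℝ (ℝ × ℝ) ℝ) (M N : ℕ) :
    |doubleCoeff p M N| ≤ 2 ^ (M + N) * ‖p (M + N)‖ := by
  have h1 : ∀ S ∈ Finset.powersetCard M (Finset.univ : Finset (Fin (M + N))),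
      |p (M + N) (S.piecewise (fun _ => (1, 0)) fun _ => (0, 1))| ≤ ‖p (M + N)‖ := by
    intro S _
    refine ((p (M + N)).le_opNorm _).trans ?_
    refine mul_le_of_le_one_right (norm_nonneg _) (Finset.prod_le_one (fun _ _ => norm_nonneg _) ?_)
    intro i _
    by_cases h : i ∈ S <;> simp [h]
  refine (Finset.abs_sum_le_sum_abs _ _).trans ((Finset.sum_le_sum h1).trans ?_)
  rw [Finset.sum_const, Finset.card_powersetCard, Finset.card_univ, Fintype.card_fin, nsmul_eq_mul]
  gcongr
  exact_mod_cast Nat.choose_le_two_pow _ _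

lemma apply_pair_eq_sum (p : FormalMultilinearSeries ℝ (ℝ × ℝ) ℝ) (n : ℕ) (s w : ℝ) :
    p n (fun _ => (s, w)) =
      ∑ ab ∈ Finset.HasAntidiagonal.antidiagonal n,
        doubleCoeff p ab.1 ab.2 * s ^ ab.1 * w ^ ab.2 := by
  have h1 : (fun _ : Fin n => (s, w)) =
      (fun _ : Fin n => s • ((1 : ℝ), (0 : ℝ))) + fun _ : Fin n => w • ((0 : ℝ), (1 : ℝ)) := by
    ext i <;> simp
  have h2 : ∀ S : Finset (Fin n), p n (S.piecewise (fun _ => s • ((1 : ℝ), (0 : ℝ)))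
      fun _ => w • ((0 : ℝ), (1 : ℝ))) =
      p n (S.piecewise (fun _ => (1, 0)) fun _ => (0, 1)) * s ^ S.card * w ^ (n - S.card) := by
    intro S
    have h3 : (S.piecewise (fun _ => s • ((1 : ℝ), (0 : ℝ))) fun _ => w • ((0 : ℝ), (1 : ℝ))) =
        fun i : Fin n => (if i ∈ S then s else w) •
          (S.piecewise (fun _ => ((1 : ℝ), (0 : ℝ))) (fun _ => ((0 : ℝ), (1 : ℝ))) i) := by
      ext1 i
      by_cases h : i ∈ S <;> simp [h]
    rw [h3, ContinuousMultilinearMap.map_smul_univ, smul_eq_mul, Finset.prod_ite]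
    have h4 : (Finset.univ.filter fun i => i ∈ S) = S := by ext; simp
    have h5 : (Finset.univ.filter fun i => i ∉ S) = Sᶜ := by ext; simp
    rw [h4, h5, Finset.prod_const, Finset.prod_const, Finset.card_compl, Fintype.card_fin]
    ring
  rw [h1, ContinuousMultilinearMap.map_add_univ]
  simp only [h2]
  rw [← Finset.powerset_univ, Finset.sum_powerset, Finset.card_univ, Fintype.card_fin,
    Finset.Nat.sum_antidiagonal_eq_sum_range_succ_mk]
  refine Finset.sum_congr rfl fun M hM => ?_
  have hMn : M ≤ n := Nat.lt_succ_iff.1 (Finset.mem_range.1 hM)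
  obtain ⟨N, rfl⟩ := Nat.exists_eq_add_of_le hMn
  dsimp only
  rw [Nat.add_sub_cancel_left, doubleCoeff, Finset.sum_mul, Finset.sum_mul]
  refine Finset.sum_congr rfl fun S hS => ?_
  rw [(Finset.mem_powersetCard.1 hS).2, Nat.add_sub_cancel_left]

/-- A function analytic at the origin of the plane is the sum of a double power series with
geometrically bounded coefficients. -/
lemma exists_double_power_series {G : ℝ × ℝ → ℝ} (hG : AnalyticAt ℝ G 0) :
    ∃ (e : ℕ → ℕ → ℝ) (C R : ℝ), 0 < C ∧ 0 < R ∧ (∀ M N, |e M N| ≤ C * R ^ (M + N)) ∧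
      ∀ s w : ℝ, |s| * R < 1 / 2 → |w| * R < 1 / 2 →
        HasSum (fun q : ℕ × ℕ => e q.1 q.2 * s ^ q.1 * w ^ q.2) (G (s, w)) := by
  obtain ⟨p, r, hp⟩ := hG
  obtain ⟨r', hr'0, hr'⟩ := ENNReal.lt_iff_exists_nnreal_btwn.1 hp.r_pos
  have hr0 : (0 : ℝ) < r' := by exact_mod_cast hr'0
  obtain ⟨C, hC, hb⟩ := p.norm_mul_pow_le_of_lt_radius (hr'.trans_le hp.r_le)
  have hbound : ∀ M N, |doubleCoeff p M N| ≤ C * (2 / r') ^ (M + N) := by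
    intro M N
    refine (abs_doubleCoeff_le p M N).trans ?_
    have := hb (M + N)
    rw [div_pow, mul_div_assoc', le_div_iff₀ (by positivity), mul_assoc, mul_comm C]
    gcongr
  -- The number of ways to place the two basis vectors is at most `2 ^ (M + N)`, which accounts for
  -- `2 / r'`.
  refine ⟨doubleCoeff p, C, 2 / r', hC, by positivity, hbound, fun s w hs hw => ?_⟩
  set x := |s| * (2 / r') with hx
  set y := |w| * (2 / r') with hy
  have hx0 : 0 ≤ x := by positivity
  have hy0 : 0 ≤ y := by positivity
  have hsum : Summable fun q : ℕ × ℕ => doubleCoeff p q.1 q.2 * s ^ q.1 * w ^ q.2 := by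
    have h1 : Summable fun q : ℕ × ℕ => C * (x ^ q.1 * y ^ q.2) :=
      (Summable.mul_of_nonneg (summable_geometric_of_lt_one hx0 (by linarith))
        (summable_geometric_of_lt_one hy0 (by linarith)) (fun _ => by positivity)
        (fun _ => by positivity)).mul_left C
    refine Summable.of_norm_bounded h1 fun q => ?_
    rw [norm_mul, norm_mul, norm_pow, norm_pow, Real.norm_eq_abs, Real.norm_eq_abs,
      Real.norm_eq_abs]
    calc |doubleCoeff p q.1 q.2| * |s| ^ q.1 * |w| ^ q.2
        ≤ C * (2 / r') ^ (q.1 + q.2) * |s| ^ q.1 * |w| ^ q.2 := by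
          gcongr; exact hbound _ _
      _ = _ := by rw [hx, hy, mul_pow, mul_pow, pow_add]; ring
  have hmem : (s, w) ∈ Metric.eball (0 : ℝ × ℝ) r := by
    refine Metric.eball_subset_eball hr'.le ?_
    rw [Metric.eball_coe, mem_ball_zero_iff, Prod.norm_def, max_lt_iff, Real.norm_eq_abs,
      Real.norm_eq_abs]
    have h2 : ∀ t : ℝ, |t| * (2 / r') < 1 / 2 → |t| < r' := by
      intro t ht
      rw [mul_div_assoc', div_lt_iff₀ hr0] at ht
      have := abs_nonneg t
      linarith
    exact ⟨h2 s hs, h2 w hw⟩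
  have h2 := hp.hasSum hmem
  rw [zero_add] at h2
  have h3 : ∀ n, p n (fun _ => (s, w)) = ∑ ab : Finset.HasAntidiagonal.antidiagonal n,
      doubleCoeff p ab.1.1 ab.1.2 * s ^ ab.1.1 * w ^ ab.1.2 := by
    intro n
    rw [apply_pair_eq_sum, ← Finset.sum_coe_sort]
  have h4 := (Finset.HasAntidiagonal.sigmaAntidiagonalEquivProd (A := ℕ)).hasSum_iff.2 hsum.hasSum
  have h5 := h4.sigma (g := fun n => p n fun _ => (s, w)) fun n => by
    rw [h3 n]
    exact hasSum_fintype _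
  rw [← h5.unique h2]
  exact hsum.hasSum

end DoubleSeries

section Termwise

lemma abs_tail_le {a : ℕ → ℝ} {A x S : ℝ} (hx0 : 0 ≤ x) (hx : x ≤ 1 / 2)
    (ha : ∀ N, |a N| ≤ A * x ^ N) (hS : HasSum a S) (N : ℕ) :
    |S - ∑ i ∈ Finset.range (N + 1), a i| ≤ 2 * A * x ^ (N + 1) := by
  have h1 := (hasSum_nat_add_iff' (N + 1)).2 hS
  have h2 : HasSum (fun i : ℕ => A * x ^ (N + 1) * x ^ i) (A * x ^ (N + 1) * (1 - x)⁻¹) :=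
    (hasSum_geometric_of_lt_one hx0 (by linarith)).mul_left _
  have hA : 0 ≤ A := by simpa using (abs_nonneg _).trans (ha 0)
  have h3 := h1.norm_le_of_bounded h2 fun i => by
    rw [Real.norm_eq_abs, mul_assoc, ← pow_add, add_comm (N + 1)]
    exact ha _
  rw [Real.norm_eq_abs] at h3
  refine h3.trans ?_
  have h4 : (1 - x)⁻¹ ≤ 2 := by
    rw [inv_le_comm₀ (by linarith) two_pos]; linarith
  calc A * x ^ (N + 1) * (1 - x)⁻¹ ≤ A * x ^ (N + 1) * 2 := by gcongr
    _ = _ := by ring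

/-- Two regimes. For `x ≤ 1 / 2` this is a geometric tail. For larger `x` the series need not
converge, but then `1 ≤ 2 * x`, and the value and each of the `N + 1` terms are bounded by `A * (2 *
x) ^ (N + 1)`. -/
lemma abs_remainder_le {a : ℕ → ℝ} {A x v : ℝ} (hx0 : 0 ≤ x) (ha : ∀ N, |a N| ≤ A * x ^ N)
    (hv : |v| ≤ A) (hS : x < 1 → HasSum a v) (N : ℕ) :
    |v - ∑ i ∈ Finset.range (N + 1), a i| ≤ A * (N + 2) * (2 * x) ^ (N + 1) := by
  have hA : 0 ≤ A := (abs_nonneg _).trans hv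
  by_cases hx : x ≤ 1 / 2
  · refine (abs_tail_le hx0 hx ha (hS (by linarith)) N).trans ?_
    rw [mul_pow]
    have h1 : (2 : ℝ) ≤ (N + 2) * 2 ^ (N + 1) := by
      have : (1 : ℝ) ≤ 2 ^ (N + 1) := one_le_pow₀ one_le_two
      have : (0 : ℝ) ≤ N := Nat.cast_nonneg N
      nlinarith
    calc 2 * A * x ^ (N + 1) = A * x ^ (N + 1) * 2 := by ring
      _ ≤ A * x ^ (N + 1) * ((N + 2) * 2 ^ (N + 1)) := by gcongr
      _ = _ := by ring
  · push Not at hx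
    have h2x : 1 ≤ 2 * x := by linarith
    have h1 : ∀ i ∈ Finset.range (N + 1), |a i| ≤ A * (2 * x) ^ (N + 1) := by
      intro i hi
      refine (ha i).trans ?_
      gcongr
      calc x ^ i ≤ (2 * x) ^ i := by gcongr; linarith
        _ ≤ _ := pow_le_pow_right₀ h2x (by rw [Finset.mem_range] at hi; omega)
    have h2 := (Finset.abs_sum_le_sum_abs a _).trans (Finset.sum_le_sum h1)
    rw [Finset.sum_const, Finset.card_range, nsmul_eq_mul] at h2
    push_cast at h2
    have h3 : A ≤ A * (2 * x) ^ (N + 1) := le_mul_of_one_le_right hA (one_le_pow₀ h2x)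
    calc |v - ∑ i ∈ Finset.range (N + 1), a i| ≤ |v| + |∑ i ∈ Finset.range (N + 1), a i| :=
          abs_sub _ _
      _ ≤ A * (2 * x) ^ (N + 1) + (N + 1) * (A * (2 * x) ^ (N + 1)) :=
          add_le_add (hv.trans h3) h2
      _ = _ := by ring

/-- If a convergent power series agrees to the right of the origin with a series of functions whose
power series have radii shrinking at most linearly, then its coefficients are obtained by termwise
summation. -/
lemma coeff_eq_tsum_coeff {k : ℕ → ℝ → ℝ} {a : ℕ → ℕ → ℝ} {κ : ℕ → ℝ} {C C' q ρ R ε : ℝ}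
    (hq0 : 0 ≤ q) (hq : q < 1) (hρ : 0 < ρ) (hε : 0 < ε) (hR : 0 < R)
    (ha : ∀ j N, |a j N| ≤ C * q ^ j * (((j : ℝ) + 1) / ρ) ^ N)
    (hk : ∀ (j : ℕ) (δ : ℝ), 0 < δ → ((j : ℝ) + 1) / ρ * δ < 1 →
      HasSum (fun N => a j N * δ ^ N) (k j δ))
    (hkb : ∀ j δ, 0 < δ → δ < ε → |k j δ| ≤ C * q ^ j)
    (hκ : ∀ N, |κ N| ≤ C' * R ^ N)
    (hsum : ∀ δ, 0 < δ → δ < ε → HasSum (fun N => κ N * δ ^ N) (∑' j, k j δ)) (N : ℕ) :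
    HasSum (fun j => a j N) (κ N) := by
  have hpoly : ∀ N, Summable fun j : ℕ => q ^ j * ((j : ℝ) + 1) ^ N := by
    intro N
    have h1 := (summable_nat_add_iff 1).2 (summable_pow_mul_geometric_of_norm_lt_one N (r := q)
      (by rwa [Real.norm_of_nonneg hq0]))
    rcases hq0.eq_or_lt with rfl | hq0
    · refine summable_of_hasFiniteSupport ((Set.finite_singleton 0).subset fun j hj => ?_)
      by_contra h
      exact hj (by simp [show j ≠ 0 from h])
    · refine (h1.mul_left q⁻¹).congr fun j => ?_
      push_cast
      rw [pow_succ]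
      field_simp
  have hC : 0 ≤ C := by simpa using (abs_nonneg _).trans (ha 0 0)
  have hC' : 0 ≤ C' := by simpa using (abs_nonneg _).trans (hκ 0)
  have has : ∀ N, Summable fun j => a j N := by
    intro N
    refine Summable.of_norm_bounded (((hpoly N).mul_left (C / ρ ^ N))) fun j => ?_
    rw [Real.norm_eq_abs]
    refine (ha j N).trans (le_of_eq ?_)
    rw [div_pow]; ring
  have hks : ∀ δ, 0 < δ → δ < ε → Summable fun j => k j δ := fun δ h0 h1 =>
    Summable.of_norm_bounded ((summable_geometric_of_lt_one hq0 hq).mul_left C) fun j => by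
      rw [Real.norm_eq_abs]; exact hkb j δ h0 h1
  suffices h : κ N = ∑' j, a j N by rw [h]; exact (has N).hasSum
  induction N using Nat.strong_induction_on with
  | _ N ih =>
    set S := ∑' j : ℕ, q ^ j * ((j : ℝ) + 1) ^ (N + 1) with hSdef
    set D := 2 * C' * R ^ (N + 1) + C * (N + 2) * (2 / ρ) ^ (N + 1) * S with hD
    -- With the lower coefficients already identified, subtracting the two expansions leaves the
    -- order `N` difference plus remainders. The remainder of term `j` costs `(j + 1) ^ (N + 1)`,
    -- since its radius shrinks like `1 / (j + 1)`, and this is summable against `q ^ j`.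
    have key : ∀ δ, 0 < δ → δ < ε → δ * R ≤ 1 / 2 →
        |κ N - ∑' j, a j N| * δ ^ N ≤ D * δ ^ (N + 1) := by
      intro δ h0 h1 h2
      have e1 : |(∑' j, k j δ) - ∑ i ∈ Finset.range (N + 1), κ i * δ ^ i| ≤
          2 * C' * (δ * R) ^ (N + 1) :=
        abs_tail_le (by positivity) h2 (fun i => by
          rw [abs_mul, abs_of_pos (pow_pos h0 i), mul_pow]
          calc |κ i| * δ ^ i ≤ C' * R ^ i * δ ^ i := by gcongr; exact hκ i
            _ = _ := by ring) (hsum δ h0 h1) N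
      have e2 : ∀ j, |k j δ - ∑ i ∈ Finset.range (N + 1), a j i * δ ^ i| ≤
          C * (N + 2) * (2 / ρ) ^ (N + 1) * δ ^ (N + 1) * (q ^ j * ((j : ℝ) + 1) ^ (N + 1)) := by
        intro j
        refine (abs_remainder_le (A := C * q ^ j) (x := ((j : ℝ) + 1) / ρ * δ) (by positivity)
          (fun i => ?_) (hkb j δ h0 h1) (hk j δ h0) N).trans (le_of_eq ?_)
        · rw [abs_mul, abs_of_pos (pow_pos h0 i), mul_pow, ← mul_assoc]
          gcongr
          exact ha j i
        · simp only [mul_pow, div_pow]; ring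
      have e3 : HasSum (fun j => k j δ - ∑ i ∈ Finset.range (N + 1), a j i * δ ^ i)
          ((∑' j, k j δ) - ∑ i ∈ Finset.range (N + 1), (∑' j, a j i) * δ ^ i) :=
        (hks δ h0 h1).hasSum.sub (hasSum_sum fun i _ => (has i).hasSum.mul_right _)
      have e4 := e3.norm_le_of_bounded ((hpoly (N + 1)).hasSum.mul_left _) e2
      rw [Real.norm_eq_abs, ← hSdef] at e4
      have e5 : (κ N - ∑' j, a j N) * δ ^ N =
          ((∑' j, k j δ) - ∑ i ∈ Finset.range (N + 1), (∑' j, a j i) * δ ^ i) -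
          ((∑' j, k j δ) - ∑ i ∈ Finset.range (N + 1), κ i * δ ^ i) := by
        rw [Finset.sum_range_succ, Finset.sum_range_succ,
          Finset.sum_congr rfl fun i hi => by rw [← ih i (Finset.mem_range.1 hi)]]
        ring
      rw [← abs_of_pos (pow_pos h0 N), ← abs_mul, e5]
      refine (abs_sub _ _).trans ((add_le_add e4 e1).trans (le_of_eq ?_))
      rw [hD, mul_pow]; ring
    have hzero : |κ N - ∑' j, a j N| ≤ 0 := by
      refine le_of_forall_pos_le_add fun η hη => ?_
      have hD0 : 0 ≤ D := by
        have : 0 ≤ S := tsum_nonneg fun j => by positivity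
        positivity
      set δ := min (ε / 2) (min (1 / (2 * R)) (η / (D + 1))) with hδ
      have d0 : 0 < δ := lt_min (by positivity) (lt_min (by positivity) (by positivity))
      have d1 : δ < ε := (min_le_left _ _).trans_lt (by linarith)
      have d2 : δ * R ≤ 1 / 2 := by
        have : δ ≤ 1 / (2 * R) := (min_le_right _ _).trans (min_le_left _ _)
        rw [le_div_iff₀ (by positivity)] at this
        linarith
      have d3 : D * δ ≤ η := by
        have : δ ≤ η / (D + 1) := (min_le_right _ _).trans (min_le_right _ _)
        rw [le_div_iff₀ (by positivity)] at this
        nlinarith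
      have := key δ d0 d1 d2
      rw [pow_succ, ← mul_assoc, mul_right_comm] at this
      have := le_of_mul_le_mul_right this (pow_pos d0 N)
      linarith
    have := abs_nonpos_iff.1 hzero
    linarith

end Termwise

end

/-! ### Taylor coefficients of the entropy function. -/

section
section NegMulLog

/-- Taylor coefficients at `0` of `s ↦ negMulLog (μ * (a + s))`. -/
def negMulLogCoeff (μ a : ℝ) : ℕ → ℝ
  | 0 => Real.negMulLog (μ * a)
  | 1 => -(μ * (1 + Real.log (μ * a)))
  | M + 2 => -((-1) ^ M * μ / (((M : ℝ) + 1) * (M + 2) * a ^ (M + 1)))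

lemma hasSum_one_sub_mul_log {x : ℝ} (hx : |x| < 1) :
    HasSum (fun n : ℕ => x ^ (n + 2) / (((n : ℝ) + 1) * (n + 2)))
      ((1 - x) * Real.log (1 - x) + x) := by
  have h := Real.hasSum_pow_div_log_of_abs_lt_one hx
  have h3 := (h.mul_left x).sub ((hasSum_nat_add_iff' 1).2 h)
  have hfun : (fun n : ℕ => x ^ (n + 2) / (((n : ℝ) + 1) * (n + 2))) =
      fun b : ℕ => x * (x ^ (b + 1) / ((b : ℝ) + 1)) -
        x ^ (b + 1 + 1) / (((b + 1 : ℕ) : ℝ) + 1) := by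
    ext n
    have : (n : ℝ) + 1 ≠ 0 := by positivity
    have : (n : ℝ) + 2 ≠ 0 := by positivity
    have : (n : ℝ) + 1 + 1 ≠ 0 := by positivity
    push_cast
    field_simp
    ring
  have hval : (1 - x) * Real.log (1 - x) + x = x * -Real.log (1 - x) -
      (-Real.log (1 - x) - ∑ i ∈ Finset.range 1, x ^ (i + 1) / ((i : ℝ) + 1)) := by
    simp; ring
  rw [hfun, hval]
  exact h3

lemma hasSum_negMulLogCoeff {μ a s : ℝ} (hμ : 0 < μ) (ha : 0 < a) (hs : |s| < a) :
    HasSum (fun M => negMulLogCoeff μ a M * s ^ M) (Real.negMulLog (μ * (a + s))) := by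
  have hx : |-(s / a)| < 1 := by
    rw [abs_neg, abs_div, abs_of_pos ha, div_lt_one ha]; exact hs
  have has : 0 < a + s := by have := (abs_lt.1 hs).1; linarith
  have h1x : 1 - -(s / a) = (a + s) / a := by field_simp; ring
  have h := (hasSum_one_sub_mul_log hx).mul_left (-(μ * a))
  rw [h1x] at h
  rw [← hasSum_nat_add_iff' 2]
  have hfun : (fun M => negMulLogCoeff μ a (M + 2) * s ^ (M + 2)) =
      fun i : ℕ => -(μ * a) * ((-(s / a)) ^ (i + 2) / (((i : ℝ) + 1) * (i + 2))) := by
    ext M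
    rw [negMulLogCoeff]
    have : (M : ℝ) + 1 ≠ 0 := by positivity
    have : (M : ℝ) + 2 ≠ 0 := by positivity
    rw [show -(s / a) = -1 * (s / a) by ring, mul_pow, div_pow]
    field_simp
    ring
  have hval : Real.negMulLog (μ * (a + s)) - ∑ i ∈ Finset.range 2, negMulLogCoeff μ a i * s ^ i =
      -(μ * a) * ((a + s) / a * Real.log ((a + s) / a) + -(s / a)) := by
    have e1 : Real.log (μ * (a + s)) = Real.log (μ * a) + Real.log ((a + s) / a) := by
      rw [← Real.log_mul (by positivity) (by positivity)]
      congr 1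
      field_simp
    simp only [Finset.sum_range_succ, Finset.sum_range_zero, negMulLogCoeff, Real.negMulLog, e1]
    field_simp
    ring
  rw [hfun, hval]
  exact h

/-- The square covers arguments above one, which occur because the extraction lemmas do not require
the terms to be probabilities. -/
lemma abs_negMulLog_le {y : ℝ} (hy : 0 ≤ y) : |Real.negMulLog y| ≤ 2 * √y + y ^ 2 := by
  rcases le_total y 1 with h | h
  · rw [abs_of_nonneg (Real.negMulLog_nonneg hy h)]
    have := negMulLog_le_two_mul_sqrt hy
    nlinarith
  · have h1 : 0 ≤ Real.log y := Real.log_nonneg h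
    have h2 : Real.log y ≤ y := Real.log_le_self hy
    rw [Real.negMulLog, neg_mul, abs_neg, abs_of_nonneg (by positivity)]
    have := Real.sqrt_nonneg y
    nlinarith

lemma abs_negMulLog_le_geometric {y C θ : ℝ} {j : ℕ} (hy : 0 ≤ y) (hC : 0 < C) (hθ0 : 0 < θ)
    (hθ1 : θ < 1) (h : y ≤ C * θ ^ j) :
    |Real.negMulLog y| ≤ (2 * √C + C ^ 2) * (√θ) ^ j := by
  have hθ : θ = √θ ^ 2 := (Real.sq_sqrt hθ0.le).symm
  have hs1 : √θ ≤ 1 := Real.sqrt_le_one.2 hθ1.le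
  have h1 : √y ≤ √C * √θ ^ j := by
    refine Real.sqrt_le_iff.2 ⟨by positivity, h.trans (le_of_eq ?_)⟩
    rw [mul_pow, Real.sq_sqrt hC.le, ← pow_mul, mul_comm j 2, pow_mul, Real.sq_sqrt hθ0.le]
  have h2 : y ^ 2 ≤ C ^ 2 * √θ ^ j := by
    calc y ^ 2 ≤ (C * θ ^ j) ^ 2 := by gcongr
      _ = C ^ 2 * (√θ ^ j * √θ ^ (3 * j)) := by
        conv_lhs => rw [hθ]
        ring
      _ ≤ C ^ 2 * (√θ ^ j * 1) := by
        gcongr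
        exact pow_le_one₀ (Real.sqrt_nonneg _) hs1
      _ = _ := by ring
  refine (abs_negMulLog_le hy).trans ?_
  linarith

/-- Extraction of the coefficients in `s` of `∑ j, negMulLog (μ j * (a j + s))`. -/
lemma hasSum_negMulLogCoeff_of_hasSum {μ a : ℕ → ℝ} {κ : ℕ → ℝ} {C C' θ R c₀ ε : ℝ}
    (hC : 0 < C) (hθ0 : 0 < θ) (hθ1 : θ < 1) (hc₀ : 0 < c₀) (hε : 0 < ε) (hR : 0 < R)
    (hμ0 : ∀ j, 0 < μ j) (hμ : ∀ j, μ j ≤ C * θ ^ j) (ha : ∀ j, c₀ ≤ a j)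
    (hμa : ∀ j, μ j * a j ≤ C * θ ^ j) (hκ : ∀ M, |κ M| ≤ C' * R ^ M)
    (hsum : ∀ s, 0 < s → s < ε →
      HasSum (fun M => κ M * s ^ M) (∑' j, Real.negMulLog (μ j * (a j + s)))) (M : ℕ) :
    HasSum (fun j => negMulLogCoeff (μ j) (a j) M) (κ M) := by
  have ha0 : ∀ j, 0 < a j := fun j => hc₀.trans_le (ha j)
  have hs1 : √θ < 1 := by rw [Real.sqrt_lt' one_pos]; simpa using hθ1
  have hs0 : 0 < √θ := Real.sqrt_pos.2 hθ0
  have hθs : ∀ j : ℕ, θ ^ j ≤ √θ ^ j := by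
    intro j
    gcongr
    nlinarith [Real.sq_sqrt hθ0.le]
  set A := 2 * √C + C ^ 2 with hA
  have hA0 : 0 < A := by positivity
  set A2 := 2 * √(2 * C) + (2 * C) ^ 2 with hA2
  have hA20 : 0 < A2 := by positivity
  set D := A2 + A + c₀ * (C + A + C * |Real.log c₀| + C) + C * c₀ with hD
  refine coeff_eq_tsum_coeff (k := fun j s => Real.negMulLog (μ j * (a j + s)))
    (a := fun j M => negMulLogCoeff (μ j) (a j) M) (C := D) (C' := C') (q := √θ) (ρ := c₀) (R := R)
    (ε := min ε 1) hs0.le hs1 hc₀ (lt_min hε one_pos) hR ?_ ?_ ?_ hκ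
    (fun s h0 h1 => hsum s h0 (h1.trans_le (min_le_left _ _))) M
  · intro j M
    have hD0 : 0 ≤ D := by positivity
    have hj : (1 / c₀) ^ M ≤ (((j : ℝ) + 1) / c₀) ^ M := by
      gcongr
      have : (0 : ℝ) ≤ j := Nat.cast_nonneg j
      linarith
    -- The radii of convergence are bounded below by `c₀` uniformly in `j`; the factor `j + 1` is
    -- inserted only to fit the extraction lemma.
    suffices h : |negMulLogCoeff (μ j) (a j) M| ≤ D * √θ ^ j * (1 / c₀) ^ M from
      h.trans (by gcongr)
    have hD1 : A ≤ D := by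
      have : 0 ≤ c₀ * (C + A + C * |Real.log c₀| + C) := by positivity
      have : 0 ≤ C * c₀ := by positivity
      linarith
    match M with
    | 0 =>
      rw [negMulLogCoeff, pow_zero, mul_one]
      refine (abs_negMulLog_le_geometric (by have := hμ0 j; have := ha0 j; positivity) hC hθ0 hθ1
        (hμa j)).trans ?_
      gcongr
    | 1 =>
      rw [negMulLogCoeff, pow_one, abs_neg, abs_mul, abs_of_pos (hμ0 j)]
      have e1 := abs_negMulLog_le_geometric (hμ0 j).le hC hθ0 hθ1 (hμ j)
      rw [Real.negMulLog, neg_mul, abs_neg, abs_mul, abs_of_pos (hμ0 j)] at e1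
      have e2 : |Real.log (a j)| ≤ |Real.log c₀| + a j := by
        have h1 := Real.log_le_log hc₀ (ha j)
        have h2 := Real.log_le_self (ha0 j).le
        have h3 := neg_abs_le (Real.log c₀)
        have h4 := abs_nonneg (Real.log c₀)
        have h5 := ha0 j
        rw [abs_le]
        constructor <;> linarith
      have e3 : |1 + Real.log (μ j * a j)| ≤ 1 + |Real.log (μ j)| + |Real.log (a j)| := by
        rw [Real.log_mul (hμ0 j).ne' (ha0 j).ne']
        have h1 := abs_add_le 1 (Real.log (μ j) + Real.log (a j))
        have h2 := abs_add_le (Real.log (μ j)) (Real.log (a j))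
        rw [abs_one] at h1
        linarith
      have e4 : μ j ≤ C * √θ ^ j := (hμ j).trans (mul_le_mul_of_nonneg_left (hθs j) hC.le)
      have e5 : μ j * a j ≤ C * √θ ^ j := (hμa j).trans (mul_le_mul_of_nonneg_left (hθs j) hC.le)
      calc μ j * |1 + Real.log (μ j * a j)|
          ≤ μ j * (1 + |Real.log (μ j)| + (|Real.log c₀| + a j)) := by
            have := hμ0 j
            gcongr
            linarith
        _ = μ j + μ j * |Real.log (μ j)| + μ j * |Real.log c₀| + μ j * a j := by ring
        _ ≤ C * √θ ^ j + A * √θ ^ j + C * √θ ^ j * |Real.log c₀| + C * √θ ^ j := by gcongr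
        _ = c₀ * (C + A + C * |Real.log c₀| + C) * √θ ^ j * (1 / c₀) := by field_simp
        _ ≤ _ := by
          gcongr
          have : 0 ≤ C * c₀ := by positivity
          linarith
    | M + 2 =>
      have e1 : |negMulLogCoeff (μ j) (a j) (M + 2)| =
          μ j / (((M : ℝ) + 1) * (M + 2) * a j ^ (M + 1)) := by
        have h1 : 0 < (((M : ℝ) + 1) * (M + 2) * a j ^ (M + 1)) := by have := ha0 j; positivity
        rw [negMulLogCoeff, abs_neg, abs_div, abs_mul, abs_pow, abs_neg, abs_one, one_pow, one_mul,
          abs_of_pos (hμ0 j), abs_of_pos h1]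
      have e2 : c₀ ^ (M + 1) ≤ ((M : ℝ) + 1) * (M + 2) * a j ^ (M + 1) := by
        have h1 : c₀ ^ (M + 1) ≤ a j ^ (M + 1) := by gcongr; exact ha j
        have h2 : (1 : ℝ) ≤ ((M : ℝ) + 1) * (M + 2) := by
          have : (0 : ℝ) ≤ M := Nat.cast_nonneg M
          nlinarith
        calc c₀ ^ (M + 1) ≤ 1 * a j ^ (M + 1) := by rwa [one_mul]
          _ ≤ _ := by
            have := (ha0 j).le
            gcongr
      rw [e1]
      calc μ j / (((M : ℝ) + 1) * (M + 2) * a j ^ (M + 1)) ≤ C * √θ ^ j / c₀ ^ (M + 1) := by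
            have := hμ0 j
            gcongr
            exact (hμ j).trans (mul_le_mul_of_nonneg_left (hθs j) hC.le)
        _ = C * c₀ * √θ ^ j * (1 / c₀) ^ (M + 2) := by
          rw [one_div, inv_pow]; field_simp; ring
        _ ≤ _ := by
          gcongr
          have : 0 ≤ c₀ * (C + A + C * |Real.log c₀| + C) := by positivity
          linarith
  · intro j s h0 h1
    refine hasSum_negMulLogCoeff (hμ0 j) (ha0 j) ?_
    rw [abs_of_pos h0]
    have h2 : ((j : ℝ) + 1) * s < c₀ := by
      rw [div_mul_eq_mul_div, div_lt_one hc₀] at h1; exact h1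
    have : (0 : ℝ) ≤ j * s := by positivity
    have := ha j
    linarith
  · intro j s h0 h1
    have h2 : s ≤ 1 := h1.le.trans (min_le_right _ _)
    have h3 : μ j * (a j + s) ≤ 2 * C * θ ^ j := by
      have := hμ0 j
      have := hμ j
      have := hμa j
      nlinarith
    refine (abs_negMulLog_le_geometric (by have := hμ0 j; have := ha0 j; positivity)
      (by positivity) hθ0 hθ1 h3).trans ?_
    gcongr
    have : 0 ≤ c₀ * (C + A + C * |Real.log c₀| + C) := by positivity
    have : 0 ≤ C * c₀ := by positivity
    linarith

end NegMulLog

end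

/-! ### Coefficients in two variables and expansions of inverse powers. -/

section
section ExponentialFamily

/-- Taylor coefficients in `(s, δ)` of `∑ j, negMulLog (μ j δ * (a j δ + s))`. -/
lemma exists_coeff_series {μ a : ℕ → ℝ → ℝ} {G : ℝ × ℝ → ℝ} {C θ c₀ ε : ℝ}
    (hG : AnalyticAt ℝ G 0) (hC : 0 < C) (hθ0 : 0 < θ) (hθ1 : θ < 1) (hc₀ : 0 < c₀) (hε : 0 < ε)
    (hμ0 : ∀ j δ, 0 < δ → δ < ε → 0 < μ j δ)
    (hμ : ∀ j δ, 0 < δ → δ < ε → μ j δ ≤ C * θ ^ j)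
    (ha : ∀ j δ, 0 < δ → δ < ε → c₀ ≤ a j δ)
    (hμa : ∀ j δ, 0 < δ → δ < ε → μ j δ * a j δ ≤ C * θ ^ j)
    (hsum : ∀ᶠ p : ℝ × ℝ in 𝓝 0, 0 < p.2 →
      ∑' j, Real.negMulLog (μ j p.2 * (a j p.2 + p.1)) = G p) :
    ∃ (e : ℕ → ℕ → ℝ) (A R ε' : ℝ), 0 < A ∧ 0 < R ∧ 0 < ε' ∧ ε' ≤ ε ∧
      (∀ M N, |e M N| ≤ A * R ^ (M + N)) ∧
      ∀ M δ, 0 < δ → δ < ε' →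
        HasSum (fun N => e M N * δ ^ N) (∑' j, negMulLogCoeff (μ j δ) (a j δ) M) := by
  obtain ⟨e, A, R, hA, hR, hb, hs⟩ := exists_double_power_series hG
  obtain ⟨ε₁, hε₁, hsum⟩ := Metric.eventually_nhds_iff.1 hsum
  set ε' := min (min ε ε₁) (1 / (2 * R)) with hε'
  have hε'0 : 0 < ε' := by positivity
  have h1 : ε' ≤ ε := (min_le_left _ _).trans (min_le_left _ _)
  have h2 : ε' ≤ ε₁ := (min_le_left _ _).trans (min_le_right _ _)
  have h3 : ∀ x, 0 < x → x < ε' → |x| * R < 1 / 2 := by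
    intro x hx0 hx
    have h4 : x < 1 / (2 * R) := hx.trans_le (min_le_right _ _)
    rw [lt_div_iff₀ (by positivity)] at h4
    rw [abs_of_pos hx0]
    linarith
  refine ⟨e, A, R, ε', hA, hR, hε'0, h1, hb, fun M δ hδ0 hδ => ?_⟩
  have hδR : δ * R < 1 / 2 := by simpa [abs_of_pos hδ0] using h3 δ hδ0 hδ
  have hcol : ∀ M, Summable fun N => e M N * δ ^ N := by
    intro M
    refine Summable.of_norm_bounded (g := fun N => A * R ^ M * (δ * R) ^ N)
      ((summable_geometric_of_lt_one (by positivity) (by linarith)).mul_left _) fun N => ?_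
    rw [Real.norm_eq_abs, abs_mul, abs_of_pos (pow_pos hδ0 N)]
    calc |e M N| * δ ^ N ≤ A * R ^ (M + N) * δ ^ N := by gcongr; exact hb M N
      _ = _ := by rw [pow_add, mul_pow]; ring
  have hcolb : ∀ M, |∑' N, e M N * δ ^ N| ≤ 2 * A * R ^ M := by
    intro M
    have h4 := (hcol M).hasSum.norm_le_of_bounded
      ((hasSum_geometric_of_lt_one (r := δ * R) (by positivity) (by linarith)).mul_left (A * R ^ M))
      fun N => by
        rw [Real.norm_eq_abs, abs_mul, abs_of_pos (pow_pos hδ0 N)]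
        calc |e M N| * δ ^ N ≤ A * R ^ (M + N) * δ ^ N := by gcongr; exact hb M N
          _ = _ := by rw [pow_add, mul_pow]; ring
    rw [Real.norm_eq_abs] at h4
    refine h4.trans ?_
    have h5 : (1 - δ * R)⁻¹ ≤ 2 := by
      rw [inv_le_comm₀ (by linarith) two_pos]; linarith
    calc A * R ^ M * (1 - δ * R)⁻¹ ≤ A * R ^ M * 2 := by gcongr
      _ = _ := by ring
  -- For fixed `δ` the double series is summed over `N` first, which leaves a power series in `s`
  -- for the one-variable extraction.
  have key := hasSum_negMulLogCoeff_of_hasSum (μ := fun j => μ j δ) (a := fun j => a j δ)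
    (κ := fun M => ∑' N, e M N * δ ^ N) (C' := 2 * A) (R := R) (ε := ε') hC hθ0 hθ1 hc₀ hε'0 hR
    (fun j => hμ0 j δ hδ0 (hδ.trans_le h1)) (fun j => hμ j δ hδ0 (hδ.trans_le h1))
    (fun j => ha j δ hδ0 (hδ.trans_le h1)) (fun j => hμa j δ hδ0 (hδ.trans_le h1)) hcolb
    (fun s hs0 hs1 => ?_) M
  · rw [key.tsum_eq]
    exact (hcol M).hasSum
  · have h6 := hs s δ (h3 s hs0 hs1) (h3 δ hδ0 hδ)
    rw [← hsum (y := (s, δ)) ?_ hδ0] at h6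
    · refine h6.prod_fiberwise fun M => ?_
      have h7 := (hcol M).hasSum.mul_right (s ^ M)
      have h8 : (fun N => e M N * s ^ M * δ ^ N) = fun N => e M N * δ ^ N * s ^ M := by
        ext N; ring
      rwa [← h8] at h7
    · rw [dist_zero_right, Prod.norm_def, max_lt_iff, Real.norm_eq_abs, Real.norm_eq_abs,
        abs_of_pos hs0, abs_of_pos hδ0]
      exact ⟨hs1.trans_le h2, hδ.trans_le h2⟩

/-- Power series of `τ ↦ (α - D * exp τ) ^ (-(m + 1))`, which has nonnegative coefficients. -/
lemma exists_coeff_inv_sub_exp {α D c₁ ρ : ℝ} (hα : 0 < α) (hD : 0 ≤ D) (hρ : 0 < ρ) (hc₁ : 0 < c₁)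
    (h : c₁ ≤ α - D * Real.exp ρ) (m : ℕ) :
    ∃ b : ℕ → ℝ, (∀ N, 0 ≤ b N) ∧ (∀ N, b N ≤ (c₁ ^ (m + 1))⁻¹ / ρ ^ N) ∧
      (∀ N, ((m : ℝ) + 1) ^ N * (D / α) ^ N / N.factorial / α ^ (m + 1) ≤ b N) ∧
      ∀ τ, |τ| ≤ ρ → HasSum (fun N => b N * τ ^ N) ((α - D * Real.exp τ) ^ (m + 1))⁻¹ := by
  -- The inverse power is expanded as a negative binomial series in `D * exp τ / α`, and each `exp
  -- (k * τ)` as a power series. All coefficients are nonnegative, so the order of summation may be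
  -- exchanged.
  set t : ℕ × ℕ → ℝ := fun q => ((q.1 + m).choose m : ℝ) * (D / α) ^ q.1 / α ^ (m + 1) *
    ((q.1 : ℝ) ^ q.2 / q.2.factorial) with ht
  have ht0 : ∀ q, 0 ≤ t q := fun q => by positivity
  have hrow : ∀ (τ : ℝ) (k : ℕ), HasSum (fun N => t (k, N) * τ ^ N)
      (((k + m).choose m : ℝ) * (D / α) ^ k / α ^ (m + 1) * Real.exp (k * τ)) := by
    intro τ k
    have h1 := NormedSpace.expSeries_div_hasSum_exp ((k : ℝ) * τ)
    rw [← Real.exp_eq_exp_ℝ] at h1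
    have h2 := h1.mul_left (((k + m).choose m : ℝ) * (D / α) ^ k / α ^ (m + 1))
    have h3 : (fun N => t (k, N) * τ ^ N) = fun N => ((k + m).choose m : ℝ) * (D / α) ^ k /
        α ^ (m + 1) * (((k : ℝ) * τ) ^ N / N.factorial) := by
      ext N
      rw [ht, mul_pow]
      ring
    rwa [← h3] at h2
  have hcolsum : ∀ τ, |τ| ≤ ρ → HasSum (fun k : ℕ => ((k + m).choose m : ℝ) * (D / α) ^ k /
      α ^ (m + 1) * Real.exp (k * τ)) ((α - D * Real.exp τ) ^ (m + 1))⁻¹ := by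
    intro τ hτ
    have h1 : D * Real.exp τ ≤ D * Real.exp ρ := by
      gcongr; exact (le_abs_self τ).trans hτ
    have h2 : ‖D * Real.exp τ / α‖ < 1 := by
      rw [Real.norm_of_nonneg (by positivity), div_lt_one hα]; linarith
    have h3 := (hasSum_choose_mul_geometric_of_norm_lt_one m h2).mul_right (1 / α ^ (m + 1))
    have hv : 1 / (1 - D * Real.exp τ / α) ^ (m + 1) * (1 / α ^ (m + 1)) =
        ((α - D * Real.exp τ) ^ (m + 1))⁻¹ := by
      rw [div_mul_div_comm, one_mul, one_div, ← mul_pow]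
      congr 2
      field_simp
    rw [hv] at h3
    have h4 : (fun k : ℕ => ((k + m).choose m : ℝ) * (D / α) ^ k /
        α ^ (m + 1) * Real.exp (k * τ)) =
        fun k : ℕ => ((k + m).choose m : ℝ) * (D * Real.exp τ / α) ^ k * (1 / α ^ (m + 1)) := by
      ext k
      rw [Real.exp_nat_mul, div_pow, div_pow, mul_pow]
      ring
    rwa [← h4] at h3
  have hsumm : Summable fun q : ℕ × ℕ => t q * ρ ^ q.2 := by
    rw [summable_prod_of_nonneg fun q => mul_nonneg (ht0 q) (by positivity)]
    refine ⟨fun k => (hrow ρ k).summable, ?_⟩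
    simp only [(hrow ρ _).tsum_eq]
    exact (hcolsum ρ (abs_of_pos hρ).le).summable
  have hsummτ : ∀ τ, |τ| ≤ ρ → Summable fun q : ℕ × ℕ => t q * τ ^ q.2 := by
    intro τ hτ
    refine Summable.of_norm_bounded hsumm fun q => ?_
    rw [norm_mul, Real.norm_of_nonneg (ht0 q), norm_pow, Real.norm_eq_abs]
    have := ht0 q
    gcongr
  have hb : ∀ N, Summable fun k => t (k, N) := by
    intro N
    have h1 := hsumm.comp_injective (i := fun k : ℕ => (k, N))
      (fun a b hab => (Prod.mk.inj hab).1)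
    have h2 := h1.mul_right (ρ ^ N)⁻¹
    refine h2.congr fun k => ?_
    simp only [Function.comp_apply]
    field_simp
  have hval : ∀ τ, |τ| ≤ ρ → HasSum (fun N => (∑' k, t (k, N)) * τ ^ N)
      ((α - D * Real.exp τ) ^ (m + 1))⁻¹ := by
    intro τ hτ
    have h1 := (hsummτ τ hτ).hasSum
    have h2 := h1.prod_fiberwise fun k => hrow τ k
    rw [h2.unique (hcolsum τ hτ)] at h1
    have h3 := (Equiv.prodComm ℕ ℕ).hasSum_iff.2 h1
    exact h3.prod_fiberwise fun N => (hb N).hasSum.mul_right (τ ^ N)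
  refine ⟨fun N => ∑' k, t (k, N), fun N => tsum_nonneg fun k => ht0 _, fun N => ?_, fun N => ?_,
    hval⟩
  · have h1 := hval ρ (abs_of_pos hρ).le
    rw [le_div_iff₀ (by positivity)]
    refine (le_hasSum h1 N fun i _ => mul_nonneg (tsum_nonneg fun k => ht0 _)
      (by positivity)).trans ?_
    gcongr
  -- The lower bound keeps the single summand `k = N`, with `N ^ N ≥ N!` and a binomial coefficient
  -- of at least `(m + 1) ^ N / N!`.
  · refine le_trans ?_ ((hb N).le_tsum N fun k _ => ht0 _)
    have h1 : ((m : ℝ) + 1) ^ N ≤ N.factorial * ((N + m).choose m : ℝ) := by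
      have h2 := Nat.pow_succ_le_ascFactorial (m + 1) N
      rw [Nat.ascFactorial_eq_factorial_mul_choose, add_comm m N, Nat.choose_symm_add] at h2
      exact_mod_cast h2
    have h2 : (N.factorial : ℝ) ≤ (N : ℝ) ^ N := by exact_mod_cast Nat.factorial_le_pow N
    calc ((m : ℝ) + 1) ^ N * (D / α) ^ N / N.factorial / α ^ (m + 1)
        ≤ N.factorial * ((N + m).choose m : ℝ) * (D / α) ^ N / N.factorial / α ^ (m + 1) := by
          gcongr
      _ = ((N + m).choose m : ℝ) * (D / α) ^ N / α ^ (m + 1) * 1 := by field_simp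
      _ ≤ _ := by
        rw [ht]
        dsimp only
        gcongr
        rw [le_div_iff₀ (by positivity), one_mul]
        exact h2

/-- Real Taylor series with Cauchy's estimate. -/
lemma exists_coeff_re {g : ℂ → ℂ} {R A : ℝ} (hR : 0 < R) (hg : DiffContOnCl ℂ g (Metric.ball 0 R))
    (hA : ∀ z ∈ Metric.sphere (0 : ℂ) R, ‖g z‖ ≤ A) :
    ∃ b : ℕ → ℝ, (∀ N, |b N| ≤ A / R ^ N) ∧
      ∀ τ : ℝ, |τ| < R → HasSum (fun N => b N * τ ^ N) (g τ).re := by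
  refine ⟨fun N => ((N.factorial : ℂ)⁻¹ * iteratedDeriv N g 0).re, fun N => ?_, fun τ hτ => ?_⟩
  · refine (Complex.abs_re_le_norm _).trans ?_
    rw [norm_mul, norm_inv, Complex.norm_natCast]
    have h1 := Complex.norm_iteratedDeriv_le_of_forall_mem_sphere_norm_le N hR hg hA
    have h2 : (0 : ℝ) < N.factorial := by positivity
    calc (N.factorial : ℝ)⁻¹ * ‖iteratedDeriv N g 0‖
        ≤ (N.factorial : ℝ)⁻¹ * (N.factorial * A / R ^ N) := by gcongr
      _ = A / R ^ N := by field_simp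
  · have h1 := Complex.hasSum_taylorSeries_on_ball (r := R) hg.differentiableOn
      (z := (τ : ℂ)) (by simpa using hτ)
    have h2 := Complex.hasSum_re h1
    have : (fun N => ((N.factorial : ℂ)⁻¹ * iteratedDeriv N g 0).re * τ ^ N) =
      fun N => ((N.factorial : ℂ)⁻¹ • ((τ : ℂ) - 0) ^ N • iteratedDeriv N g 0).re := by
      ext N
      rw [sub_zero, smul_eq_mul, smul_eq_mul, ← Complex.ofReal_pow,
        mul_left_comm, Complex.re_ofReal_mul, mul_comm]
    rw [this]
    exact h2

/-- On the closed unit disc `|Im z| ≤ 1 < π / 2`, so `exp z` has nonnegative real part and the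
denominator has modulus at least `α`; Cauchy's estimate does the rest. -/
lemma exists_coeff_inv_add_exp {α d : ℝ} (hα : 0 < α) (hd : 0 ≤ d) (m : ℕ) :
    ∃ b : ℕ → ℝ, (∀ N, |b N| ≤ (α ^ (m + 1))⁻¹) ∧
      ∀ τ, |τ| < 1 → HasSum (fun N => b N * τ ^ N) ((α + d * Real.exp τ) ^ (m + 1))⁻¹ := by
  have hre : ∀ z ∈ Metric.closedBall (0 : ℂ) 1, α ≤ ((α : ℂ) + d * Complex.exp z).re := by
    intro z hz
    have h1 : |z.im| ≤ 1 := (Complex.abs_im_le_norm z).trans (by simpa using hz)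
    have h2 : 0 ≤ Real.cos z.im := by
      have := abs_le.1 h1
      have := Real.pi_gt_three
      exact Real.cos_nonneg_of_mem_Icc ⟨by linarith, by linarith⟩
    rw [Complex.add_re, Complex.ofReal_re, Complex.re_ofReal_mul, Complex.exp_re]
    have : 0 ≤ d * (Real.exp z.re * Real.cos z.im) := by positivity
    linarith
  have hne : ∀ z ∈ Metric.closedBall (0 : ℂ) 1, ((α : ℂ) + d * Complex.exp z) ≠ 0 := by
    intro z hz h0
    have := hre z hz
    rw [h0] at this
    simp at this
    linarith
  have hdiff : DiffContOnCl ℂ (fun z : ℂ => (((α : ℂ) + d * Complex.exp z) ^ (m + 1))⁻¹)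
      (Metric.ball 0 1) := by
    refine DifferentiableOn.diffContOnCl fun z hz => ?_
    rw [closure_ball (0 : ℂ) one_ne_zero] at hz
    refine DifferentiableAt.differentiableWithinAt ?_
    exact DifferentiableAt.inv (by fun_prop) (pow_ne_zero _ (hne z hz))
  obtain ⟨b, hb1, hb2⟩ := exists_coeff_re (A := (α ^ (m + 1))⁻¹) one_pos hdiff fun z hz => by
    rw [norm_inv, norm_pow]
    have h1 := hre z (Metric.sphere_subset_closedBall hz)
    have h2 := h1.trans (Complex.re_le_norm _)
    gcongr
  refine ⟨b, fun N => by simpa using hb1 N, fun τ hτ => ?_⟩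
  have h1 := hb2 τ hτ
  have h2 : ((((α : ℂ) + d * Complex.exp τ) ^ (m + 1))⁻¹).re =
      ((α + d * Real.exp τ) ^ (m + 1))⁻¹ := by
    have : (((α : ℂ) + d * Complex.exp τ) ^ (m + 1))⁻¹ =
        ((((α + d * Real.exp τ) ^ (m + 1))⁻¹ : ℝ) : ℂ) := by push_cast; rfl
    rw [this, Complex.ofReal_re]
  rwa [h2] at h1

end ExponentialFamily

end

/-! ### The exponential family contradicts analyticity. -/

section
section ExponentialFamily

lemma eventually_mul_pow_lt_self_pow (P : ℝ) {Q : ℝ} (hQ : 0 < Q) :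
    ∀ᶠ N : ℕ in atTop, P * Q ^ N < (N : ℝ) ^ N := by
  have h1 : ∀ᶠ N : ℕ in atTop, P < (2 : ℝ) ^ N :=
    (tendsto_pow_atTop_atTop_of_one_lt one_lt_two).eventually_gt_atTop P
  have h2 : ∀ᶠ N : ℕ in atTop, 2 * Q ≤ (N : ℝ) :=
    tendsto_natCast_atTop_atTop.eventually_ge_atTop _
  filter_upwards [h1, h2] with N h1 h2
  calc P * Q ^ N < 2 ^ N * Q ^ N := by gcongr
    _ = (2 * Q) ^ N := (mul_pow _ _ _).symm
    _ ≤ _ := by gcongr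

/-- Half of the decay, `√q ^ j`, pays for `j ^ N` through `x ^ N / N! ≤ exp x`; the other half
remains summable. -/
lemma exists_hasSum_geometric_mul_pow {q : ℝ} (hq0 : 0 < q) (hq1 : q < 1) :
    ∃ L C : ℝ, 0 < L ∧ 0 < C ∧ ∀ N : ℕ, ∃ S, HasSum (fun j : ℕ => q ^ j * (j : ℝ) ^ N) S ∧
      S ≤ C * N.factorial * L ^ N := by
  have hs0 : 0 < √q := Real.sqrt_pos.2 hq0
  have hs1 : √q < 1 := by rw [Real.sqrt_lt' one_pos]; simpa using hq1
  have hl : 0 < -Real.log √q := by have := Real.log_neg hs0 hs1; linarith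
  have h1s : 0 < 1 - √q := by linarith
  refine ⟨(-Real.log √q)⁻¹, (1 - √q)⁻¹, by positivity, by positivity, fun N => ?_⟩
  have hb : ∀ j : ℕ, q ^ j * (j : ℝ) ^ N ≤ N.factorial * (-Real.log √q)⁻¹ ^ N * √q ^ j := by
    intro j
    have h1 := Real.pow_div_factorial_le_exp (j * (-Real.log √q)) (by positivity) N
    have h2 : Real.exp (j * (-Real.log √q)) = (√q ^ j)⁻¹ := by
      rw [Real.exp_nat_mul, Real.exp_neg, Real.exp_log hs0, inv_pow]
    rw [h2, div_le_iff₀ (by positivity), mul_pow] at h1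
    have h3 : (j : ℝ) ^ N ≤ (√q ^ j)⁻¹ * N.factorial * (-Real.log √q)⁻¹ ^ N := by
      rw [inv_pow, ← div_eq_mul_inv, le_div_iff₀ (by positivity)]
      exact h1
    calc q ^ j * (j : ℝ) ^ N ≤ q ^ j * ((√q ^ j)⁻¹ * N.factorial * (-Real.log √q)⁻¹ ^ N) := by
          gcongr
      _ = (√q ^ 2) ^ j * ((√q ^ j)⁻¹ * N.factorial * (-Real.log √q)⁻¹ ^ N) := by
          rw [Real.sq_sqrt hq0.le]
      _ = _ := by rw [← pow_mul, mul_comm 2 j, pow_mul]; field_simp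
  have hg := (hasSum_geometric_of_lt_one hs0.le hs1).mul_left
    (N.factorial * (-Real.log √q)⁻¹ ^ N)
  have hsum : Summable fun j : ℕ => q ^ j * (j : ℝ) ^ N :=
    Summable.of_nonneg_of_le (fun j => by positivity) hb hg.summable
  refine ⟨_, hsum.hasSum, (hasSum_le hb hsum.hasSum hg).trans (le_of_eq ?_)⟩
  ring

variable {lam α c₀ C θ η : ℝ} {d : ℕ → ℝ}

/-- For `x ≥ 0` Cauchy's estimate makes the coefficients bounded; for `x ≤ 0` they are nonnegative,
and for `x ≤ -η` they have a lower bound with the factor `(m + 1) ^ N`. Thus positive `x` cannot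
cancel the growth produced by negative `x`. The radius is chosen so that `α + x * exp τ` stays above
`c₀ / 2` when `x ≤ 0`. -/
lemma exists_coeff_inv_exp (hα : 0 < α) (hc₀ : 0 < c₀) (hη : 0 < η)
    {x : ℝ} (hd : c₀ ≤ α + x) (m : ℕ) :
    ∃ b : ℕ → ℝ, (∀ N, |b N| ≤ (min (c₀ / 2) α ^ (m + 1))⁻¹ /
        min 1 (Real.log (1 + c₀ / (2 * α))) ^ N) ∧
      (∀ N, -(α ^ (m + 1))⁻¹ ≤ b N) ∧
      (x ≤ -η → ∀ N, ((m : ℝ) + 1) ^ N * (η / α) ^ N / N.factorial / α ^ (m + 1) ≤ b N) ∧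
      ∀ τ, |τ| < min 1 (Real.log (1 + c₀ / (2 * α))) →
        HasSum (fun N => b N * τ ^ N) ((α + x * Real.exp τ) ^ (m + 1))⁻¹ := by
  set ρ := min 1 (Real.log (1 + c₀ / (2 * α))) with hρ
  have hlog : 0 < Real.log (1 + c₀ / (2 * α)) :=
    Real.log_pos (by have : 0 < c₀ / (2 * α) := by positivity
                     linarith)
  have hρ0 : 0 < ρ := lt_min one_pos hlog
  have hρ1 : ρ ≤ 1 := min_le_left _ _
  have hm0 : 0 < min (c₀ / 2) α := lt_min (by positivity) hα
  rcases le_total 0 x with hx | hx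
  · obtain ⟨b, hb1, hb2⟩ := exists_coeff_inv_add_exp hα hx m
    refine ⟨b, fun N => (hb1 N).trans ?_, fun N => (abs_le.1 (hb1 N)).1, fun h => by linarith,
      fun τ hτ => hb2 τ (hτ.trans_le hρ1)⟩
    have h1 : (α ^ (m + 1))⁻¹ ≤ (min (c₀ / 2) α ^ (m + 1))⁻¹ := by
      gcongr; exact min_le_right _ _
    refine h1.trans ?_
    rw [le_div_iff₀ (by positivity)]
    exact mul_le_of_le_one_right (by positivity) (pow_le_one₀ hρ0.le hρ1)
  · have hexp : Real.exp ρ ≤ 1 + c₀ / (2 * α) := by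
      rw [← Real.exp_log (show 0 < 1 + c₀ / (2 * α) by positivity)]
      exact Real.exp_le_exp.2 (min_le_right _ _)
    have hc : c₀ / 2 ≤ α - -x * Real.exp ρ := by
      have h1 : -x * (Real.exp ρ - 1) ≤ α * (c₀ / (2 * α)) := by
        refine mul_le_mul (by linarith) (by linarith) ?_ hα.le
        have := Real.one_le_exp hρ0.le
        linarith
      have h2 : α * (c₀ / (2 * α)) = c₀ / 2 := by field_simp
      linarith
    obtain ⟨b, hb0, hb1, hb2, hb3⟩ := exists_coeff_inv_sub_exp hα (neg_nonneg.2 hx) hρ0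
      (half_pos hc₀) hc m
    refine ⟨b, fun N => ?_, fun N => le_trans ?_ (hb0 N), fun h N => le_trans ?_ (hb2 N),
      fun τ hτ => ?_⟩
    · rw [abs_of_nonneg (hb0 N)]
      refine (hb1 N).trans ?_
      gcongr
      exact min_le_left _ _
    · have : 0 < (α ^ (m + 1))⁻¹ := by positivity
      linarith
    · gcongr
      linarith
    · have := hb3 τ hτ.le
      rwa [neg_mul, sub_neg_eq_add] at this

/-- Up to sign and a quadratic factor in `m`, the coefficient of `s ^ (m + 2) δ ^ N` is the sum over
`j` of `lam ^ j * j ^ N * b m j N`, and analyticity bounds it by `A * R ^ (m + 2 + N)`. For `d N ≤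
-η` and `m + 1 = K * N` the summand `j = N` alone is, after multiplication by `α ^ (m + 1)`, at
least `N ^ N * (lam * K * η / α) ^ N`. The remaining summands subtract at most `C₁ * N! * L ^ N`, so
a large `K` gives a contradiction. -/
lemma false_of_analytic_exp {G : ℝ × ℝ → ℝ} (hlam0 : 0 < lam) (hlam1 : lam < 1) (hα : 0 < α)
    (hc₀ : 0 < c₀) (hd : ∀ j, c₀ ≤ α + d j) (hθ0 : 0 < θ) (hθ1 : θ < 1) (hC : 0 < C)
    (hdb : ∀ j, lam ^ j * |d j| ≤ C * θ ^ j) (hG : AnalyticAt ℝ G 0)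
    (hsum : ∀ᶠ p : ℝ × ℝ in 𝓝 0, 0 < p.2 →
      ∑' j : ℕ, Real.negMulLog (lam ^ j * (α + p.1 + d j * Real.exp (-(j * p.2)))) = G p)
    (hη : 0 < η) (hinf : ∃ᶠ j in atTop, d j ≤ -η) : False := by
  set ρ := min 1 (Real.log (1 + c₀ / (2 * α))) with hρ
  have hlog : 0 < Real.log (1 + c₀ / (2 * α)) :=
    Real.log_pos (by have : 0 < c₀ / (2 * α) := by positivity
                     linarith)
  have hρ0 : 0 < ρ := lt_min one_pos hlog
  set c₂ := min (c₀ / 2) α with hc₂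
  have hc₂0 : 0 < c₂ := lt_min (by positivity) hα
  have ha : ∀ j : ℕ, ∀ δ : ℝ, 0 < δ → c₂ ≤ α + d j * Real.exp (-(j * δ)) := by
    intro j δ hδ
    have h0 := Real.exp_pos (-((j : ℝ) * δ))
    have h1 : Real.exp (-((j : ℝ) * δ)) ≤ 1 := by
      rw [Real.exp_le_one_iff]
      have : 0 ≤ (j : ℝ) * δ := by positivity
      linarith
    set t := Real.exp (-((j : ℝ) * δ))
    have h2 : c₂ ≤ α := min_le_right _ _
    have h3 : c₂ ≤ c₀ := (min_le_left _ _).trans (by linarith)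
    have h4 := hd j
    nlinarith
  set Θ := max lam θ with hΘ
  have hΘ0 : 0 < Θ := lt_max_of_lt_left hlam0
  have hΘ1 : Θ < 1 := max_lt hlam1 hθ1
  have hlΘ : ∀ j : ℕ, lam ^ j ≤ Θ ^ j := fun j => by gcongr; exact le_max_left _ _
  have hθΘ : ∀ j : ℕ, θ ^ j ≤ Θ ^ j := fun j => by gcongr; exact le_max_right _ _
  obtain ⟨e, A, R, ε', hA, hR, hε', -, he, hes⟩ := exists_coeff_series
    (μ := fun j _ => lam ^ j) (a := fun j δ => α + d j * Real.exp (-(j * δ))) (ε := 1)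
    (C := 1 + α + C) (θ := Θ) (c₀ := c₂) hG (by positivity) hΘ0 hΘ1 hc₂0 one_pos
    (fun j δ _ _ => by positivity)
    (fun j δ _ _ => by
      refine (hlΘ j).trans (le_mul_of_one_le_left (by positivity) (by linarith)))
    (fun j δ h _ => ha j δ h)
    (fun j δ h _ => by
      have h1 : Real.exp (-((j : ℝ) * δ)) ≤ 1 := by
        rw [Real.exp_le_one_iff]
        have : 0 ≤ (j : ℝ) * δ := by positivity
        linarith
      have h2 : d j * Real.exp (-(j * δ)) ≤ |d j| * 1 := by
        have := le_abs_self (d j)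
        gcongr
      calc lam ^ j * (α + d j * Real.exp (-(j * δ))) ≤ lam ^ j * (α + |d j| * 1) := by gcongr
        _ = α * lam ^ j + lam ^ j * |d j| := by ring
        _ ≤ α * Θ ^ j + C * Θ ^ j := by
          have := hlΘ j
          have := hθΘ j
          have := hdb j
          have h3 : C * θ ^ j ≤ C * Θ ^ j := by gcongr
          have h4 : α * lam ^ j ≤ α * Θ ^ j := by gcongr
          linarith
        _ ≤ _ := by
          have : 0 < Θ ^ j := by positivity
          nlinarith)
    (by
      filter_upwards [hsum] with p hp h0
      rw [← hp h0]
      refine tsum_congr fun j => ?_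
      congr 2
      ring)
  choose b hb1 hb2 hb3 hb4 using fun (m j : ℕ) => exists_coeff_inv_exp hα hc₀ hη (hd j) m
  have hcoef : ∀ m N : ℕ, HasSum (fun j : ℕ => -((-1) ^ m / (((m : ℝ) + 1) * (m + 2))) *
      (lam ^ j * (-(j : ℝ)) ^ N * b m j N)) (e (m + 2) N) := by
    intro m N
    have hm1 : (1 : ℝ) ≤ ((m : ℝ) + 1) * (m + 2) := by
      have : (0 : ℝ) ≤ m := Nat.cast_nonneg m
      nlinarith
    refine coeff_eq_tsum_coeff
      (k := fun j δ => negMulLogCoeff (lam ^ j) (α + d j * Real.exp (-(j * δ))) (m + 2))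
      (a := fun j N => -((-1) ^ m / (((m : ℝ) + 1) * (m + 2))) *
        (lam ^ j * (-(j : ℝ)) ^ N * b m j N)) (C := (c₂ ^ (m + 1))⁻¹) (C' := A * R ^ (m + 2))
      (q := lam) (ρ := ρ) (R := R) (ε := ε') hlam0.le hlam1 hρ0 hε' hR ?_ ?_ ?_ ?_
      (fun δ h0 h1 => hes (m + 2) δ h0 h1) N
    · intro j N
      rw [abs_mul, abs_neg, abs_div, abs_pow, abs_neg, abs_one, one_pow,
        abs_of_nonneg (by positivity : (0 : ℝ) ≤ ((m : ℝ) + 1) * (m + 2)), abs_mul, abs_mul,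
        abs_pow, abs_pow, abs_neg, abs_of_pos hlam0, abs_of_nonneg (Nat.cast_nonneg (α := ℝ) j)]
      have h1 : 1 / (((m : ℝ) + 1) * (m + 2)) ≤ 1 := by
        rw [div_le_one (by positivity)]; exact hm1
      calc 1 / (((m : ℝ) + 1) * (m + 2)) * (lam ^ j * (j : ℝ) ^ N * |b m j N|)
          ≤ 1 * (lam ^ j * ((j : ℝ) + 1) ^ N * ((c₂ ^ (m + 1))⁻¹ / ρ ^ N)) := by
            gcongr
            · linarith
            · exact hb1 m j N
        _ = _ := by rw [div_pow]; ring
    · intro j δ hδ0 hδ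
      have h1 : |-((j : ℝ) * δ)| < ρ := by
        rw [abs_neg, abs_of_nonneg (by positivity)]
        rw [div_mul_eq_mul_div, div_lt_one hρ0] at hδ
        linarith
      have h2 := (hb4 m j _ h1).mul_left (-((-1) ^ m / (((m : ℝ) + 1) * (m + 2))) * lam ^ j)
      have h3 : (fun N => -((-1) ^ m / (((m : ℝ) + 1) * (m + 2))) *
          (lam ^ j * (-(j : ℝ)) ^ N * b m j N) * δ ^ N) = fun N =>
          -((-1) ^ m / (((m : ℝ) + 1) * (m + 2))) * lam ^ j * (b m j N * (-((j : ℝ) * δ)) ^ N) := by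
        ext N
        rw [← neg_mul, mul_pow]
        ring
      have h4 : negMulLogCoeff (lam ^ j) (α + d j * Real.exp (-(j * δ))) (m + 2) =
          -((-1) ^ m / (((m : ℝ) + 1) * (m + 2))) * lam ^ j *
            ((α + d j * Real.exp (-(j * δ))) ^ (m + 1))⁻¹ := by
        rw [negMulLogCoeff]
        have := (hc₂0.trans_le (ha j δ hδ0)).ne'
        field_simp
      rw [h3, h4]
      exact h2
    · intro j δ hδ0 hδ
      have h0 := ha j δ hδ0
      have h0' := hc₂0.trans_le h0
      have h1 : 0 < (((m : ℝ) + 1) * (m + 2) * (α + d j * Real.exp (-(j * δ))) ^ (m + 1)) := by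
        positivity
      rw [negMulLogCoeff, abs_neg, abs_div, abs_mul, abs_pow, abs_neg, abs_one, one_pow, one_mul,
        abs_of_pos (pow_pos hlam0 j), abs_of_pos h1, mul_comm (c₂ ^ (m + 1))⁻¹, ← div_eq_mul_inv]
      gcongr
      calc c₂ ^ (m + 1) ≤ (α + d j * Real.exp (-(j * δ))) ^ (m + 1) := by gcongr
        _ ≤ _ := le_mul_of_one_le_left (by positivity) hm1
    · intro N
      refine (he _ _).trans (le_of_eq ?_)
      rw [pow_add]; ring
  obtain ⟨L, C₁, hL, hC₁, hS⟩ := exists_hasSum_geometric_mul_pow hlam0 hlam1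
  -- The summand `j = N` is isolated; adding `(α ^ (m + 1))⁻¹` to every coefficient makes all the
  -- others nonnegative.
  have hlow : ∀ m N : ℕ, d N ≤ -η → lam ^ N * (N : ℝ) ^ N *
      (((m : ℝ) + 1) ^ N * (η / α) ^ N / N.factorial / α ^ (m + 1)) ≤
      ((m : ℝ) + 1) * (m + 2) * (A * R ^ (m + 2 + N)) +
        (C₁ * N.factorial * L ^ N) * (α ^ (m + 1))⁻¹ := by
    intro m N hN
    obtain ⟨S, hS1, hS2⟩ := hS N
    have h1 := (hcoef m N).mul_left (-(-1) ^ m * (((m : ℝ) + 1) * (m + 2)) * (-1) ^ N)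
    have h2 : (fun j : ℕ => -(-1) ^ m * (((m : ℝ) + 1) * (m + 2)) * (-1) ^ N *
        (-((-1) ^ m / (((m : ℝ) + 1) * (m + 2))) * (lam ^ j * (-(j : ℝ)) ^ N * b m j N))) =
        fun j : ℕ => lam ^ j * (j : ℝ) ^ N * b m j N := by
      ext j
      have e1 : ((-1 : ℝ) ^ m) * (-1) ^ m = 1 := by rw [← mul_pow]; norm_num
      have e2 : ((-1 : ℝ) ^ N) * (-1) ^ N = 1 := by rw [← mul_pow]; norm_num
      have e3 : (((m : ℝ) + 1) * (m + 2)) / (((m : ℝ) + 1) * (m + 2)) = 1 :=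
        div_self (by positivity)
      rw [neg_eq_neg_one_mul (j : ℝ), mul_pow]
      calc -(-1) ^ m * (((m : ℝ) + 1) * (m + 2)) * (-1) ^ N * (-((-1) ^ m /
            (((m : ℝ) + 1) * (m + 2))) * (lam ^ j * ((-1) ^ N * (j : ℝ) ^ N) * b m j N))
          = ((-1) ^ m * (-1) ^ m) * ((-1) ^ N * (-1) ^ N) *
            ((((m : ℝ) + 1) * (m + 2)) / (((m : ℝ) + 1) * (m + 2))) *
              (lam ^ j * (j : ℝ) ^ N * b m j N) := by ring
        _ = _ := by rw [e1, e2, e3]; ring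
    rw [h2] at h1
    have h3 := h1.add (hS1.mul_right (α ^ (m + 1))⁻¹)
    have h4 := le_hasSum h3 N fun j _ => by
      have := hb2 m j N
      have h5 : 0 ≤ lam ^ j * (j : ℝ) ^ N := by positivity
      nlinarith
    have h5 : -(-1) ^ m * (((m : ℝ) + 1) * (m + 2)) * (-1) ^ N * e (m + 2) N ≤
        ((m : ℝ) + 1) * (m + 2) * (A * R ^ (m + 2 + N)) := by
      refine (le_abs_self _).trans ?_
      rw [abs_mul, abs_mul, abs_mul, abs_neg, abs_pow, abs_pow, abs_neg, abs_one, one_pow, one_pow,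
        one_mul, mul_one, abs_of_nonneg (by positivity : (0 : ℝ) ≤ ((m : ℝ) + 1) * (m + 2))]
      gcongr
      exact he _ _
    have h6 : lam ^ N * (N : ℝ) ^ N *
        (((m : ℝ) + 1) ^ N * (η / α) ^ N / N.factorial / α ^ (m + 1)) ≤
        lam ^ N * (N : ℝ) ^ N * b m N N := by
      gcongr
      exact hb3 m N hN N
    have h7 : 0 ≤ lam ^ N * (N : ℝ) ^ N * (α ^ (m + 1))⁻¹ := by positivity
    have h8 : S * (α ^ (m + 1))⁻¹ ≤ (C₁ * N.factorial * L ^ N) * (α ^ (m + 1))⁻¹ := by gcongr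
    linarith
  -- `K` makes the base `lam * K * η / α` at least `(1 + C₁) * L + 1`, so that it dominates the loss
  -- and leaves a spare `N ^ N`.
  obtain ⟨K, hK⟩ := exists_nat_gt (((1 + C₁) * L + 1) * (α / (lam * η)))
  have hKX : (1 + C₁) * L + 1 ≤ lam * K * (η / α) := by
    have h1 := mul_lt_mul_of_pos_right hK (show 0 < lam * η / α by positivity)
    have h2 : ((1 + C₁) * L + 1) * (α / (lam * η)) * (lam * η / α) = (1 + C₁) * L + 1 := by
      field_simp
    rw [h2] at h1
    have h3 : (K : ℝ) * (lam * η / α) = lam * K * (η / α) := by ring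
    linarith
  have hK0 : 0 < K := by
    rcases Nat.eq_zero_or_pos K with rfl | h
    · have : 0 < (1 + C₁) * L := by positivity
      simp at hKX
      linarith
    · exact h
  set R₁ := max R 1
  set α₁ := max α 1
  have hR₁ : 1 ≤ R₁ := le_max_right _ _
  have hα₁ : 1 ≤ α₁ := le_max_right _ _
  refine hinf ?_
  filter_upwards [eventually_mul_pow_lt_self_pow (4 * A * R₁)
    (Q := 4 ^ K * R₁ ^ (K + 1) * α₁ ^ K) (by positivity), eventually_gt_atTop 0] with N hN hN0 hdN
  have hKN : 0 < K * N := Nat.mul_pos hK0 hN0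
  -- The order in `s` grows proportionally to `N`, so the analytic bound stays geometric in `N`
  -- while `(m + 1) ^ N` supplies another `N ^ N`.
  obtain ⟨m, hm⟩ : ∃ m, K * N = m + 1 := ⟨K * N - 1, by omega⟩
  have h1 := hlow m N hdN
  have hmc : (m : ℝ) + 1 = K * N := by exact_mod_cast hm.symm
  have hfac : (N.factorial : ℝ) ≤ (N : ℝ) ^ N := by exact_mod_cast Nat.factorial_le_pow N
  have hfac0 : (0 : ℝ) < N.factorial := by positivity
  have hNN : (0 : ℝ) < (N : ℝ) ^ N := by positivity
  -- multiply by `α ^ (m + 1)`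
  have h2 : (N : ℝ) ^ N * (lam * K * (η / α)) ^ N ≤
      α ^ (m + 1) * (lam ^ N * (N : ℝ) ^ N *
      (((m : ℝ) + 1) ^ N * (η / α) ^ N / N.factorial / α ^ (m + 1))) := by
    have e1 : α ^ (m + 1) * (lam ^ N * (N : ℝ) ^ N *
      (((m : ℝ) + 1) ^ N * (η / α) ^ N / N.factorial / α ^ (m + 1))) =
      (N : ℝ) ^ N * (lam * K * (η / α)) ^ N * ((N : ℝ) ^ N / N.factorial) := by
      rw [hmc, mul_pow, mul_pow, mul_pow]
      field_simp
    rw [e1]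
    refine le_mul_of_one_le_right (by positivity) ?_
    rwa [le_div_iff₀ hfac0, one_mul]
  have h3 : (1 + C₁) * L ^ N + 1 ≤ (lam * K * (η / α)) ^ N := by
    have e0 : 0 ≤ (1 + C₁) * L := by positivity
    have e1 : ((1 + C₁) * L) ^ N + 1 ^ N ≤ ((1 + C₁) * L + 1) ^ N :=
      pow_add_pow_le e0 zero_le_one hN0.ne'
    have e2 : (1 + C₁) ≤ (1 + C₁) ^ N := le_self_pow₀ (by linarith) hN0.ne'
    have e3 : (1 + C₁) * L ^ N ≤ ((1 + C₁) * L) ^ N := by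
      rw [mul_pow]; gcongr
    have e4 : ((1 + C₁) * L + 1) ^ N ≤ (lam * K * (η / α)) ^ N := by gcongr
    rw [one_pow] at e1
    linarith
  have h4 : α ^ (m + 1) * ((C₁ * N.factorial * L ^ N) * (α ^ (m + 1))⁻¹) ≤
      (N : ℝ) ^ N * (C₁ * L ^ N) := by
    have e1 : α ^ (m + 1) * ((C₁ * N.factorial * L ^ N) * (α ^ (m + 1))⁻¹) =
        N.factorial * (C₁ * L ^ N) := by field_simp
    rw [e1]
    gcongr
  have h5 : α ^ (m + 1) * (((m : ℝ) + 1) * (m + 2) * (A * R ^ (m + 2 + N))) ≤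
      4 * A * R₁ * (4 ^ K * R₁ ^ (K + 1) * α₁ ^ K) ^ N := by
    have e1 : ((m : ℝ) + 1) * (m + 2) ≤ 4 ^ (m + 2) := by
      have f1 : (m : ℝ) + 1 ≤ 2 ^ (m + 2) := by
        have : m + 1 ≤ 2 ^ (m + 2) := by have := @Nat.lt_two_pow_self (m + 2); omega
        exact_mod_cast this
      have f2 : (m : ℝ) + 2 ≤ 2 ^ (m + 2) := by
        have : m + 2 ≤ 2 ^ (m + 2) := Nat.lt_two_pow_self.le
        exact_mod_cast this
      calc ((m : ℝ) + 1) * (m + 2) ≤ 2 ^ (m + 2) * 2 ^ (m + 2) := by gcongr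
        _ = _ := by rw [← mul_pow]; norm_num
    calc α ^ (m + 1) * (((m : ℝ) + 1) * (m + 2) * (A * R ^ (m + 2 + N)))
        ≤ α₁ ^ (m + 1) * (4 ^ (m + 2) * (A * R₁ ^ (m + 2 + N))) := by
          gcongr
          · exact le_max_left _ _
          · exact le_max_left _ _
      _ = _ := by
        rw [show m + 2 + N = K * N + N + 1 by omega, show m + 2 = K * N + 1 by omega, ← hm,
          mul_pow, mul_pow, ← pow_mul, ← pow_mul, ← pow_mul, pow_succ, pow_succ, add_mul, one_mul]
        ring
  have h6 := mul_le_mul_of_nonneg_left h1 (show 0 ≤ α ^ (m + 1) by positivity)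
  rw [mul_add] at h6
  have h7 : (N : ℝ) ^ N * ((1 + C₁) * L ^ N + 1) ≤ (N : ℝ) ^ N * (lam * K * (η / α)) ^ N := by
    gcongr
  have h8 : 0 ≤ (N : ℝ) ^ N * L ^ N := by positivity
  have h9 : (N : ℝ) ^ N * ((1 + C₁) * L ^ N + 1) =
    (N : ℝ) ^ N * L ^ N + (N : ℝ) ^ N * (C₁ * L ^ N) + (N : ℝ) ^ N := by ring
  linarith

end ExponentialFamily

end

/-! ### The quotient `(exp z - 1) / z` and its zeros. -/

section
section LinearFamily

/-- The entire function `(exp z - 1) / z`. -/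
def expQuot (z : ℂ) : ℂ := dslope Complex.exp 0 z

lemma mul_expQuot (z : ℂ) : z * expQuot z = Complex.exp z - 1 := by
  have := sub_smul_dslope Complex.exp 0 z
  simpa [expQuot] using this

lemma expQuot_zero : expQuot 0 = 1 := by
  rw [expQuot, dslope_same, Complex.deriv_exp, Complex.exp_zero]

lemma differentiable_expQuot : Differentiable ℂ expQuot := by
  rw [← differentiableOn_univ]
  exact (Complex.differentiableOn_dslope univ_mem).2 Complex.differentiable_exp.differentiableOn

lemma expQuot_ne_zero {z : ℂ} (hz : ‖z‖ < 2 * Real.pi) : expQuot z ≠ 0 := by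
  intro h0
  have h1 := mul_expQuot z
  rw [h0, mul_zero, eq_comm, sub_eq_zero, Complex.exp_eq_one_iff] at h1
  obtain ⟨n, rfl⟩ := h1
  rcases eq_or_ne n 0 with rfl | hn
  · simp [expQuot_zero] at h0
  · have h2 : (1 : ℝ) ≤ |(n : ℝ)| := by exact_mod_cast Int.one_le_abs hn
    rw [norm_mul, norm_mul, norm_mul, Complex.norm_I, mul_one, Complex.norm_intCast,
      Complex.norm_real, Complex.norm_two, Real.norm_of_nonneg Real.pi_pos.le] at hz
    have := Real.pi_pos
    nlinarith

lemma exists_le_norm_expQuot {r : ℝ} (hr0 : 0 < r) (hr : r < 2 * Real.pi) :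
    ∃ m, 0 < m ∧ m ≤ 1 ∧ ∀ z ∈ Metric.closedBall (0 : ℂ) r, m ≤ ‖expQuot z‖ := by
  obtain ⟨x, hx, hmin⟩ := (isCompact_closedBall (0 : ℂ) r).exists_isMinOn
    ⟨0, Metric.mem_closedBall_self hr0.le⟩ differentiable_expQuot.continuous.norm.continuousOn
  refine ⟨‖expQuot x‖, norm_pos_iff.2 (expQuot_ne_zero ?_), ?_, fun z hz => hmin hz⟩
  · have : ‖x‖ ≤ r := by simpa using hx
    linarith
  · have := hmin (Metric.mem_closedBall_self hr0.le)
    simpa [expQuot_zero] using this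

/-- The Taylor series at `0` of `exp (2 * z) * z / (exp z - 1)` has radius of convergence at most
`2 * π`. -/
lemma not_bounded_coeff_exp_div_expQuot {b : ℕ → ℝ} {r' r C : ℝ} (hr : 0 < r)
    (hr' : 2 * Real.pi < r')
    (hb : ∀ τ : ℝ, |τ| < r → HasSum (fun N => b N * τ ^ N)
      (Complex.exp (2 * τ) / expQuot τ).re) : ¬ ∀ N, |b N| ≤ C / r' ^ N := by
  intro hC
  have hpi := Real.pi_pos
  obtain ⟨r₂, h1, h2⟩ := exists_between hr'
  have hr₂ : 0 < r₂ := by linarith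
  have hr'0 : 0 < r' := by linarith
  have hq : r₂ / r' < 1 := (div_lt_one hr'0).2 h2
  set f : ℂ → ℂ := fun z => ∑' N, (b N : ℂ) * z ^ N with hf
  have hC0 : 0 ≤ C := by simpa using (abs_nonneg _).trans (hC 0)
  have hfd : DifferentiableOn ℂ f (Metric.ball 0 r₂) := by
    refine Complex.differentiableOn_tsum_of_summable_norm (u := fun N => C * (r₂ / r') ^ N)
      ((summable_geometric_of_lt_one (by positivity) hq).mul_left C) (fun N => by fun_prop)
      Metric.isOpen_ball fun N w hw => ?_
    rw [norm_mul, norm_pow, Complex.norm_real, Real.norm_eq_abs]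
    have hw' : ‖w‖ ≤ r₂ := by simpa using (Metric.mem_ball.1 hw).le
    calc |b N| * ‖w‖ ^ N ≤ C / r' ^ N * r₂ ^ N := by gcongr; exact hC N
      _ = _ := by rw [div_pow]; ring
  have hreal : ∀ τ : ℝ, |τ| < min r (2 * Real.pi) →
      f τ * (Complex.exp τ - 1) = τ * Complex.exp (2 * τ) := by
    intro τ hτ
    have hE : expQuot (τ : ℂ) ≠ 0 :=
      expQuot_ne_zero (by simpa using hτ.trans_le (min_le_right _ _))
    have h3 : (((Complex.exp (2 * τ) / expQuot τ).re : ℝ) : ℂ) =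
        Complex.exp (2 * τ) / expQuot τ := by
      rcases eq_or_ne τ 0 with rfl | h0
      · simp [expQuot_zero]
      · have h4 : expQuot (τ : ℂ) = (((Real.exp τ - 1) / τ : ℝ) : ℂ) := by
          have h5 := mul_expQuot (τ : ℂ)
          have h6 : (τ : ℂ) ≠ 0 := by exact_mod_cast h0
          push_cast
          rw [← h5, mul_div_cancel_left₀ _ h6]
        rw [h4]
        have h7 : Complex.exp (2 * τ) / (((Real.exp τ - 1) / τ : ℝ) : ℂ) =
          ((Real.exp (2 * τ) / ((Real.exp τ - 1) / τ) : ℝ) : ℂ) := by push_cast; rfl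
        rw [h7, Complex.ofReal_re]
    have h4 : f τ = Complex.exp (2 * τ) / expQuot τ := by
      have h5 := Complex.hasSum_ofReal.2 (hb τ (hτ.trans_le (min_le_left _ _)))
      rw [h3] at h5
      rw [← h5.tsum_eq]
      refine tsum_congr fun N => ?_
      push_cast
      rfl
    rw [h4, ← mul_expQuot]
    field_simp
  -- The identity theorem extends `f z * (exp z - 1) = z * exp (2 z)` to a disc containing `2 π i`,
  -- where the left side vanishes and the right side does not.
  have hid : Set.EqOn (fun z => f z * (Complex.exp z - 1)) (fun z => z * Complex.exp (2 * z))
      (Metric.ball 0 r₂) := by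
    refine AnalyticOnNhd.eqOn_of_preconnected_of_frequently_eq (z₀ := 0) ?_ ?_
      (convex_ball (0 : ℂ) r₂).isPreconnected (Metric.mem_ball_self hr₂) ?_
    · exact (hfd.mul (by fun_prop)).analyticOnNhd Metric.isOpen_ball
    · exact DifferentiableOn.analyticOnNhd (by fun_prop) Metric.isOpen_ball
    · have h3 : Tendsto (fun n : ℕ => ((1 / ((n : ℝ) + 1) : ℝ) : ℂ)) atTop (𝓝[≠] 0) := by
        rw [tendsto_nhdsWithin_iff]
        refine ⟨?_, Eventually.of_forall fun n => ?_⟩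
        · have := (Complex.continuous_ofReal.tendsto 0).comp
            (tendsto_one_div_add_atTop_nhds_zero_nat (𝕜 := ℝ))
          rw [Complex.ofReal_zero] at this
          exact this
        · have : (1 / ((n : ℝ) + 1)) ≠ 0 := by positivity
          exact Complex.ofReal_ne_zero.2 this
      refine h3.frequently (Eventually.frequently ?_)
      have h4 := (tendsto_one_div_add_atTop_nhds_zero_nat (𝕜 := ℝ)).eventually
        (gt_mem_nhds (show 0 < min r (2 * Real.pi) by positivity))
      filter_upwards [h4] with n hn
      refine hreal _ ?_
      rw [abs_of_pos (by positivity)]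
      exact hn
  have h3 := hid (show (2 * Real.pi * Complex.I : ℂ) ∈ Metric.ball (0 : ℂ) r₂ by
    simp [abs_of_pos hpi, h1])
  simp only [Complex.exp_two_pi_mul_I, sub_self, mul_zero] at h3
  have h4 := h3.symm
  rw [mul_eq_zero] at h4
  rcases h4 with h4 | h4
  · have : (Real.pi : ℂ) ≠ 0 := by exact_mod_cast hpi.ne'
    simp [this] at h4
  · exact Complex.exp_ne_zero _ h4

lemma re_ofReal_expQuot {t β x : ℝ} {τ : ℝ} (hτ : τ ≠ 0) :
    (Complex.exp (2 * τ) / (β * t * expQuot τ + x)).re =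
      Real.exp (2 * τ) / (β * t * ((Real.exp τ - 1) / τ) + x) := by
  have h4 : expQuot (τ : ℂ) = (((Real.exp τ - 1) / τ : ℝ) : ℂ) := by
    have h5 := mul_expQuot (τ : ℂ)
    have h6 : (τ : ℂ) ≠ 0 := by exact_mod_cast hτ
    push_cast
    rw [← h5, mul_div_cancel_left₀ _ h6]
  have h7 : Complex.exp (2 * τ) / (β * t * expQuot τ + x) =
      ((Real.exp (2 * τ) / (β * t * ((Real.exp τ - 1) / τ) + x) : ℝ) : ℂ) := by
    rw [h4]; push_cast; rfl
  rw [h7, Complex.ofReal_re]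

/-- Power series of `exp (2 * τ) / (β * t * (exp τ - 1) / τ + x)` compared with the case `x = 0`. -/
lemma exists_coeff_exp_div {β r m : ℝ} (hβ : 0 < β) (hr : 0 < r) (hm0 : 0 < m)
    (hm : ∀ z ∈ Metric.closedBall (0 : ℂ) r, m ≤ ‖expQuot z‖) :
    ∃ (b : ℕ → ℝ) (B : ℝ), 0 < B ∧ (∀ N, |b N| ≤ B / r ^ N) ∧
      (∀ τ : ℝ, |τ| < r → HasSum (fun N => b N * τ ^ N)
        (Complex.exp (2 * τ) / expQuot τ).re) ∧
      ∀ t x : ℝ, 1 ≤ t → |x| ≤ β * m / 2 → ∃ c : ℕ → ℝ,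
        (∀ N, |c N| ≤ B * |x| / r ^ N) ∧ ∀ τ : ℝ, τ ≠ 0 → |τ| < r →
          HasSum (fun N => (b N / (β * t) + c N) * τ ^ N)
            (Real.exp (2 * τ) / (β * t * ((Real.exp τ - 1) / τ) + x)) := by
  have hE : ∀ z ∈ Metric.closedBall (0 : ℂ) r, expQuot z ≠ 0 := fun z hz =>
    norm_pos_iff.1 (hm0.trans_le (hm z hz))
  have hexp : ∀ z ∈ Metric.closedBall (0 : ℂ) r, ‖Complex.exp (2 * z)‖ ≤ Real.exp (2 * r) := by
    intro z hz
    rw [Complex.norm_exp]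
    refine Real.exp_le_exp.2 ?_
    have h1 : z.re ≤ r := (Complex.re_le_norm z).trans (by simpa using hz)
    simpa using h1
  have hdE := differentiable_expQuot
  have hcl : closure (Metric.ball (0 : ℂ) r) = Metric.closedBall 0 r := closure_ball _ hr.ne'
  set B := Real.exp (2 * r) / m + 2 * Real.exp (2 * r) / (β * m) ^ 2 with hB
  have hB0 : 0 < B := by positivity
  have hB1 : Real.exp (2 * r) / m ≤ B := le_add_of_nonneg_right (by positivity)
  have hB2 : 2 * Real.exp (2 * r) / (β * m) ^ 2 ≤ B := le_add_of_nonneg_left (by positivity)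
  obtain ⟨b, hb1, hb2⟩ := exists_coeff_re (g := fun z => Complex.exp (2 * z) / expQuot z)
    (A := B) hr (by
      refine DifferentiableOn.diffContOnCl fun z hz => ?_
      rw [hcl] at hz
      exact (DifferentiableAt.div (by fun_prop) (hdE z) (hE z hz)).differentiableWithinAt)
    (fun z hz => by
      have hz' := Metric.sphere_subset_closedBall hz
      rw [norm_div]
      refine le_trans ?_ hB1
      have h1 := hm z hz'
      have h2 := hexp z hz'
      gcongr)
  refine ⟨b, B, hB0, hb1, hb2, fun t x ht hx => ?_⟩
  have hβt : 0 < β * t := by positivity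
  have hlow : ∀ z ∈ Metric.closedBall (0 : ℂ) r, β * m / 2 ≤ ‖(β * t * expQuot z + x : ℂ)‖ := by
    intro z hz
    have h1 : ‖(β * t * expQuot z : ℂ)‖ - ‖(-x : ℂ)‖ ≤ ‖(β * t * expQuot z - -x : ℂ)‖ :=
      norm_sub_norm_le _ _
    rw [norm_mul, norm_mul, Complex.norm_real, Complex.norm_real, norm_neg, Complex.norm_real,
      Real.norm_of_nonneg hβ.le, Real.norm_of_nonneg (by linarith : (0 : ℝ) ≤ t),
      Real.norm_eq_abs, sub_neg_eq_add] at h1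
    have h2 : β * m ≤ β * t * ‖expQuot z‖ := by
      have := hm z hz
      calc β * m = β * 1 * m := by ring
        _ ≤ _ := by gcongr
    linarith
  have hne : ∀ z ∈ Metric.closedBall (0 : ℂ) r, (β * t * expQuot z + x : ℂ) ≠ 0 := fun z hz =>
    norm_pos_iff.1 ((by positivity : 0 < β * m / 2).trans_le (hlow z hz))
  -- The function expanded is the difference between the quotients with and without `x`. It carries
  -- a factor `x`, and both denominators are bounded away from zero uniformly in `t`.
  obtain ⟨c, hc1, hc2⟩ := exists_coeff_re (g := fun z =>
      Complex.exp (2 * z) * (-x) / ((β * t * expQuot z + x) * (β * t * expQuot z)))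
    (A := B * |x|) hr (by
      refine DifferentiableOn.diffContOnCl fun z hz => ?_
      rw [hcl] at hz
      have hβt' : (β * t : ℂ) ≠ 0 := by exact_mod_cast hβt.ne'
      have h1 : DifferentiableAt ℂ (fun z : ℂ => β * t * expQuot z) z := (hdE z).const_mul _
      exact (DifferentiableAt.div (by fun_prop) ((h1.add_const _).mul h1)
        (mul_ne_zero (hne z hz) (mul_ne_zero hβt' (hE z hz)))).differentiableWithinAt)
    (fun z hz => by
      have hz' := Metric.sphere_subset_closedBall hz
      have h1 := hlow z hz'
      have h2 : β * m ≤ ‖(β * t * expQuot z : ℂ)‖ := by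
        rw [norm_mul, norm_mul, Complex.norm_real, Complex.norm_real, Real.norm_of_nonneg hβ.le,
          Real.norm_of_nonneg (by linarith : (0 : ℝ) ≤ t)]
        have := hm z hz'
        calc β * m = β * 1 * m := by ring
          _ ≤ _ := by gcongr
      rw [norm_div, norm_mul, norm_mul, norm_neg, Complex.norm_real, Real.norm_eq_abs]
      calc ‖Complex.exp (2 * z)‖ * |x| / (‖(β * t * expQuot z + x : ℂ)‖ * ‖(β * t * expQuot z : ℂ)‖)
          ≤ Real.exp (2 * r) * |x| / (β * m / 2 * (β * m)) := by
            have := hexp z hz'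
            gcongr
        _ = 2 * Real.exp (2 * r) / (β * m) ^ 2 * |x| := by field_simp
        _ ≤ _ := by gcongr)
  refine ⟨c, hc1, fun τ h0 hτ => ?_⟩
  have hz : (τ : ℂ) ∈ Metric.closedBall (0 : ℂ) r := by simpa using hτ.le
  have h1 := ((hb2 τ hτ).mul_left (1 / (β * t))).add (hc2 τ hτ)
  have h2 : (fun N => (b N / (β * t) + c N) * τ ^ N) =
      fun N => 1 / (β * t) * (b N * τ ^ N) + c N * τ ^ N := by
    ext N; ring
  rw [h2, ← re_ofReal_expQuot h0]
  have h3 : Complex.exp (2 * τ) / (β * t * expQuot τ + x) = ((1 / (β * t) : ℝ) : ℂ) *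
      (Complex.exp (2 * τ) / expQuot τ) + Complex.exp (2 * τ) * (-x) /
        ((β * t * expQuot τ + x) * (β * t * expQuot τ)) := by
    have e1 := hne _ hz
    have e2 := hE _ hz
    have e3 : (β : ℂ) ≠ 0 := by exact_mod_cast hβ.ne'
    have e4 : (t : ℂ) ≠ 0 := by exact_mod_cast (by linarith : (0 : ℝ) < t).ne'
    push_cast
    field_simp
    ring
  rw [h3, Complex.add_re, Complex.re_ofReal_mul]
  exact h1

end LinearFamily

end

/-! ### The linear family contradicts analyticity. -/

section
section LinearFamily

lemma exists_succ_mul_pow_le {q : ℝ} (hq0 : 0 < q) (hq1 : q < 1) :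
    ∃ K, 1 ≤ K ∧ ∀ j : ℕ, ((j : ℝ) + 1) * q ^ j ≤ K * √q ^ j := by
  have hs0 : 0 < √q := Real.sqrt_pos.2 hq0
  have h1 := tendsto_self_mul_const_pow_of_lt_one hs0.le
    (show √q < 1 by rw [Real.sqrt_lt' one_pos]; simpa using hq1)
  obtain ⟨K, hK⟩ := h1.bddAbove_range
  have hK' : ∀ j : ℕ, (j : ℝ) * √q ^ j ≤ K := fun j => hK ⟨j, rfl⟩
  have hK0 : 0 ≤ K := by simpa using hK' 0
  refine ⟨K + 1, by linarith, fun j => ?_⟩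
  have h2 : √q ^ j ≤ 1 := pow_le_one₀ hs0.le (Real.sqrt_le_one.2 hq1.le)
  calc ((j : ℝ) + 1) * q ^ j = (j * √q ^ j + √q ^ j) * √q ^ j := by
        rw [show q ^ j = (√q * √q) ^ j by rw [Real.mul_self_sqrt hq0.le], mul_pow]; ring
    _ ≤ _ := by
      have := hK' j
      gcongr

/-- The left side is maximal at `t = N / l`, where it equals the right side. -/
lemma pow_mul_exp_neg_le {t l : ℝ} (ht : 0 ≤ t) (hl : 0 < l) (N : ℕ) :
    t ^ N * Real.exp (-(l * t)) ≤ (N : ℝ) ^ N * Real.exp (-N) / l ^ N := by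
  rcases Nat.eq_zero_or_pos N with rfl | hN
  · simp; positivity
  have hN' : (0 : ℝ) < N := by exact_mod_cast hN
  have h1 := Real.add_one_le_exp (l * t / N - 1)
  rw [sub_add_cancel] at h1
  have h2 : (l * t / N) ^ N ≤ Real.exp (l * t - N) := by
    calc (l * t / N) ^ N ≤ Real.exp (l * t / N - 1) ^ N := by gcongr
      _ = Real.exp (N * (l * t / N - 1)) := (Real.exp_nat_mul _ _).symm
      _ = _ := by congr 1; field_simp
  rw [div_pow, mul_pow, div_le_iff₀ (by positivity)] at h2
  rw [le_div_iff₀ (by positivity)]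
  calc t ^ N * Real.exp (-(l * t)) * l ^ N = l ^ N * t ^ N * Real.exp (-(l * t)) := by ring
    _ ≤ Real.exp (l * t - N) * N ^ N * Real.exp (-(l * t)) := by gcongr
    _ = N ^ N * (Real.exp (l * t - N) * Real.exp (-(l * t))) := by ring
    _ = _ := by rw [← Real.exp_add]; ring_nf

/-- For `t * δ ≤ 1` the difference quotient is at least `t`; for `t * δ ≥ 1` the factor `1 - exp
(-(t * δ))` is at least one half. The bound is thus uniform in `t`. -/
lemma le_exp_neg_mul {β δ t x : ℝ} (hβ : 0 < β) (hδ0 : 0 < δ) (hδ1 : δ ≤ 1) (ht : 1 ≤ t)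
    (hx : |x| ≤ β / 2) :
    β / 6 ≤ Real.exp (-(t * δ)) * (β * ((Real.exp (t * δ) - 1) / δ) + x) := by
  set X := t * δ with hX
  have hX0 : 0 < X := by positivity
  have hx' := abs_le.1 hx
  have e1 : Real.exp 1 < 3 := Real.exp_one_lt_d9.trans (by norm_num)
  have e2 : 2 < Real.exp 1 := lt_trans (by norm_num) Real.exp_one_gt_d9
  have hEX : Real.exp (-X) * Real.exp X = 1 := by rw [← Real.exp_add]; simp
  have hp := Real.exp_pos (-X)
  rcases le_total X 1 with h | h
  · have h1 : 1 / 3 ≤ Real.exp (-X) := by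
      have : Real.exp (-1) ≤ Real.exp (-X) := Real.exp_le_exp.2 (by linarith)
      refine le_trans ?_ this
      rw [Real.exp_neg, one_div]
      gcongr
    have h2 : t ≤ (Real.exp X - 1) / δ := by
      rw [le_div_iff₀ hδ0]
      have := Real.add_one_le_exp X
      linarith
    have h3 : β / 2 ≤ β * ((Real.exp X - 1) / δ) + x := by nlinarith
    calc β / 6 = 1 / 3 * (β / 2) := by ring
      _ ≤ _ := by gcongr
  · have h1 : Real.exp (-X) ≤ 1 / 2 := by
      have : Real.exp (-X) ≤ Real.exp (-1) := Real.exp_le_exp.2 (by linarith)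
      refine this.trans ?_
      rw [Real.exp_neg, one_div]
      gcongr
    have h2 : Real.exp (-X) * (β * ((Real.exp X - 1) / δ) + x) =
        β * ((1 - Real.exp (-X)) / δ) + Real.exp (-X) * x := by
      field_simp
      linear_combination β * hEX
    have h3 : 1 / 2 ≤ (1 - Real.exp (-X)) / δ := by
      rw [le_div_iff₀ hδ0]; nlinarith
    rw [h2]
    nlinarith

variable {γ lam β h κ C r m : ℝ} {ν : ℕ → ℝ} {G : ℝ × ℝ → ℝ}

/-- The coefficients of `s ^ 2` in the expansion of the entropy of a linearly growing family. -/
lemma exists_bound_hasSum_linear (hγ : 0 < γ) (hlam0 : 0 < lam) (hlam1 : lam < 1) (hβ : 0 < β)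
    (hh : 1 ≤ h) (hr : 0 < r)
    (hm0 : 0 < m) (hm1 : m ≤ 1) (hνm : ∀ j, |ν j| ≤ β * m / 2) (hG : AnalyticAt ℝ G 0)
    (hsum : ∀ᶠ p : ℝ × ℝ in 𝓝 0, 0 < p.2 →
      ∑' j : ℕ, Real.negMulLog (γ * lam ^ j * (β * ((Real.exp ((j + h) * p.2) - 1) / p.2) +
        p.1 * Real.exp ((j + h) * p.2) + ν j)) = G p)
    {b : ℕ → ℝ} {c : ℕ → ℕ → ℝ} {B : ℝ} (hB : 0 < B) (hb : ∀ N, |b N| ≤ B / r ^ N)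
    (hc : ∀ j N, |c j N| ≤ B * |ν j| / r ^ N)
    (hbc : ∀ (j : ℕ) (τ : ℝ), τ ≠ 0 → |τ| < r →
      HasSum (fun N => (b N / (β * (j + h)) + c j N) * τ ^ N)
        (Real.exp (2 * τ) / (β * (j + h) * ((Real.exp τ - 1) / τ) + ν j))) :
    ∃ A R : ℝ, 0 < A ∧ 0 < R ∧ ∀ N, ∃ T, |T| ≤ A * R ^ N ∧
      HasSum (fun j : ℕ => lam ^ j * ((j : ℝ) + h) ^ N * (b N / (β * (j + h)) + c j N)) T := by
  set q := √lam with hq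
  have hq0 : 0 < q := Real.sqrt_pos.2 hlam0
  have hq1 : q < 1 := by rw [hq, Real.sqrt_lt' one_pos]; simpa using hlam1
  have hΘ0 : 0 < √q := Real.sqrt_pos.2 hq0
  have hΘ1 : √q < 1 := by rw [Real.sqrt_lt' one_pos]; simpa using hq1
  obtain ⟨K, hK1, hK⟩ := exists_succ_mul_pow_le hq0 hq1
  have hl : 0 < -Real.log q := by have := Real.log_neg hq0 hq1; linarith
  -- For `δ` below `-log q` one has `lam * exp δ ≤ q`, so the growing exponentials of the family
  -- still leave geometric decay.
  set ε := min 1 (-Real.log q) with hε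
  have hε0 : 0 < ε := lt_min one_pos hl
  have hε1 : ε ≤ 1 := min_le_left _ _
  have hh0 : 0 < h := by linarith
  have hexp : ∀ (j : ℕ) (δ : ℝ), 0 < δ → δ < ε →
      lam ^ j * Real.exp ((j + h) * δ) ≤ Real.exp h * q ^ j := by
    intro j δ h0 h1
    have e1 : Real.exp δ ≤ q⁻¹ := by
      rw [← Real.exp_log hq0, ← Real.exp_neg]
      exact Real.exp_le_exp.2 (h1.le.trans (min_le_right _ _))
    have e2 : Real.exp (h * δ) ≤ Real.exp h := by
      refine Real.exp_le_exp.2 ?_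
      have : δ ≤ 1 := h1.le.trans hε1
      nlinarith
    calc lam ^ j * Real.exp ((j + h) * δ) = (q * q * Real.exp δ) ^ j * Real.exp (h * δ) := by
          rw [hq, Real.mul_self_sqrt hlam0.le, mul_pow, ← Real.exp_nat_mul, add_mul, Real.exp_add]
          ring
      _ ≤ (q * q * q⁻¹) ^ j * Real.exp h := by gcongr
      _ = _ := by rw [mul_inv_cancel_right₀ hq0.ne']; ring
  have hqK : ∀ j : ℕ, q ^ j ≤ K * √q ^ j := fun j =>
    (le_mul_of_one_le_left (by positivity) (by
      have : (0 : ℝ) ≤ j := Nat.cast_nonneg j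
      linarith)).trans (hK j)
  have hνβ : ∀ j, |ν j| ≤ β / 2 := fun j => (hνm j).trans (by nlinarith)
  have ht : ∀ j : ℕ, 1 ≤ (j : ℝ) + h := fun j => by
    have : (0 : ℝ) ≤ j := Nat.cast_nonneg j
    linarith
  have hth : ∀ j : ℕ, (j : ℝ) + h ≤ h * (j + 1) := fun j => by
    have : (0 : ℝ) ≤ j := Nat.cast_nonneg j
    nlinarith
  set C₀ := γ * Real.exp h * K * (1 + 2 * β * h) with hC₀
  have hK0 : 0 < K := by linarith
  have hC₀0 : 0 < C₀ := by positivity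
  have hμ : ∀ (j : ℕ) (δ : ℝ), 0 < δ → δ < ε →
      γ * lam ^ j * Real.exp ((j + h) * δ) ≤ C₀ * √q ^ j := by
    intro j δ h0 h1
    calc γ * lam ^ j * Real.exp ((j + h) * δ) = γ * (lam ^ j * Real.exp ((j + h) * δ)) := by ring
      _ ≤ γ * (Real.exp h * (K * √q ^ j)) := by
        refine mul_le_mul_of_nonneg_left ((hexp j δ h0 h1).trans ?_) hγ.le
        exact mul_le_mul_of_nonneg_left (hqK j) (Real.exp_pos h).le
      _ = γ * Real.exp h * K * 1 * √q ^ j := by ring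
      _ ≤ _ := by
        rw [hC₀]
        gcongr
        have : 0 < 2 * β * h := by positivity
        linarith
  have ha : ∀ (j : ℕ) (δ : ℝ), 0 < δ → δ < ε → β / 6 ≤ Real.exp (-((j + h) * δ)) *
      (β * ((Real.exp ((j + h) * δ) - 1) / δ) + ν j) := fun j δ h0 h1 =>
    le_exp_neg_mul hβ h0 (h1.le.trans hε1) (ht j) (hνβ j)
  have hμa : ∀ (j : ℕ) (δ : ℝ), 0 < δ → δ < ε → γ * lam ^ j * Real.exp ((j + h) * δ) *
      (Real.exp (-((j + h) * δ)) * (β * ((Real.exp ((j + h) * δ) - 1) / δ) + ν j)) ≤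
        C₀ * √q ^ j := by
    intro j δ h0 h1
    have e1 : (Real.exp ((j + h) * δ) - 1) / δ ≤ (j + h) * Real.exp ((j + h) * δ) := by
      rw [div_le_iff₀ h0]
      have f1 := Real.add_one_le_exp (-((j + h) * δ))
      have f2 : Real.exp (-((j + h) * δ)) * Real.exp ((j + h) * δ) = 1 := by
        rw [← Real.exp_add]; simp
      have f3 := Real.exp_pos (((j : ℝ) + h) * δ)
      nlinarith
    have e2 : ν j ≤ β := (le_abs_self _).trans ((hνβ j).trans (by linarith))
    have e3 : 1 ≤ Real.exp (((j : ℝ) + h) * δ) := Real.one_le_exp (by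
      have := ht j
      positivity)
    have e4 : 1 ≤ (h * ((j : ℝ) + 1)) * Real.exp (((j : ℝ) + h) * δ) := by
      have := (ht j).trans (hth j)
      nlinarith
    have e5 : β * ((Real.exp ((j + h) * δ) - 1) / δ) + ν j ≤
        2 * β * (h * (j + 1)) * Real.exp ((j + h) * δ) := by
      have f1 : (j + h) * Real.exp ((j + h) * δ) ≤ (h * (j + 1)) * Real.exp ((j + h) * δ) := by
        gcongr; exact hth j
      nlinarith
    have e6 : γ * lam ^ j * Real.exp ((j + h) * δ) *
        (Real.exp (-((j + h) * δ)) * (β * ((Real.exp ((j + h) * δ) - 1) / δ) + ν j)) =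
        γ * lam ^ j * (β * ((Real.exp ((j + h) * δ) - 1) / δ) + ν j) := by
      have f2 : Real.exp (-((j + h) * δ)) * Real.exp ((j + h) * δ) = 1 := by
        rw [← Real.exp_add]; simp
      linear_combination γ * lam ^ j * (β * ((Real.exp ((j + h) * δ) - 1) / δ) + ν j) * f2
    rw [e6]
    calc γ * lam ^ j * (β * ((Real.exp ((j + h) * δ) - 1) / δ) + ν j)
        ≤ γ * lam ^ j * (2 * β * (h * (j + 1)) * Real.exp ((j + h) * δ)) := by gcongr
      _ = γ * (2 * β * h) * (j + 1) * (lam ^ j * Real.exp ((j + h) * δ)) := by ring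
      _ ≤ γ * (2 * β * h) * (j + 1) * (Real.exp h * q ^ j) := by
        exact mul_le_mul_of_nonneg_left (hexp j δ h0 h1) (by positivity)
      _ = γ * (2 * β * h) * Real.exp h * ((j + 1) * q ^ j) := by ring
      _ ≤ γ * (2 * β * h) * Real.exp h * (K * √q ^ j) :=
          mul_le_mul_of_nonneg_left (hK j) (by positivity)
      _ = γ * Real.exp h * K * (2 * β * h) * √q ^ j := by ring
      _ ≤ _ := by rw [hC₀]; gcongr; linarith
  -- The factor `exp ((j + h) * δ)` is moved into the weight so that `s` gets coefficient one, as
  -- the expansion lemma requires.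
  obtain ⟨e, A, R, ε', hA, hR, hε', hε'ε, he, hes⟩ := exists_coeff_series
    (μ := fun j δ => γ * lam ^ j * Real.exp ((j + h) * δ))
    (a := fun j δ => Real.exp (-((j + h) * δ)) * (β * ((Real.exp ((j + h) * δ) - 1) / δ) + ν j))
    (ε := ε) (C := C₀) (θ := √q) (c₀ := β / 6) hG hC₀0 hΘ0 hΘ1 (by positivity) hε0
    (fun j δ _ _ => by positivity) hμ ha hμa
    (by
      filter_upwards [hsum] with p hp h0
      rw [← hp h0]
      refine tsum_congr fun j => ?_
      congr 1
      have f2 : Real.exp (-((j + h) * p.2)) * Real.exp ((j + h) * p.2) = 1 := by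
        rw [← Real.exp_add]; simp
      linear_combination γ * lam ^ j * (β * ((Real.exp ((j + h) * p.2) - 1) / p.2) + ν j) * f2)
  set D := B / β + B * (β * m / 2) with hD
  have hD0 : 0 < D := by positivity
  have hlΘ : ∀ j : ℕ, lam ^ j ≤ √q ^ j := by
    intro j
    have f1 : lam ≤ q := by rw [hq]; nlinarith [Real.mul_self_sqrt hlam0.le]
    have f2 : q ≤ √q := by nlinarith [Real.mul_self_sqrt hq0.le]
    gcongr
    linarith
  have hcoef : ∀ N, HasSum (fun j : ℕ => -(γ / 2) *
      (lam ^ j * ((j : ℝ) + h) ^ N * (b N / (β * (j + h)) + c j N))) (e 2 N) := by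
    intro N
    refine coeff_eq_tsum_coeff
      (k := fun j δ => negMulLogCoeff (γ * lam ^ j * Real.exp ((j + h) * δ))
        (Real.exp (-((j + h) * δ)) * (β * ((Real.exp ((j + h) * δ) - 1) / δ) + ν j)) 2)
      (a := fun j N => -(γ / 2) *
        (lam ^ j * ((j : ℝ) + h) ^ N * (b N / (β * (j + h)) + c j N)))
      (C := γ * D + C₀ / (β / 6)) (C' := A * R ^ 2)
      (q := √q) (ρ := r / h) (R := R) (ε := ε') hΘ0.le hΘ1 (by positivity) hε' hR ?_ ?_ ?_ ?_
      (fun δ h0 h1 => hes 2 δ h0 h1) N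
    · intro j N
      have f0 := ht j
      have f1 : |b N / (β * (j + h)) + c j N| ≤ D / r ^ N := by
        refine (abs_add_le _ _).trans ?_
        rw [abs_div, abs_of_pos (by positivity : 0 < β * (j + h))]
        have g1 : |b N| / (β * (j + h)) ≤ B / r ^ N / (β * 1) := by
          have := hb N
          gcongr
        have g2 : |c j N| ≤ B * (β * m / 2) / r ^ N := (hc j N).trans (by
          have := hνm j
          gcongr)
        calc |b N| / (β * (j + h)) + |c j N| ≤ B / r ^ N / (β * 1) + B * (β * m / 2) / r ^ N :=
              add_le_add g1 g2
          _ = _ := by rw [hD]; field_simp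
      rw [abs_mul, abs_neg, abs_of_pos (by positivity : 0 < γ / 2), abs_mul, abs_mul, abs_pow,
        abs_pow, abs_of_pos hlam0, abs_of_pos (by positivity : (0 : ℝ) < j + h)]
      calc γ / 2 * (lam ^ j * ((j : ℝ) + h) ^ N * |b N / (β * (j + h)) + c j N|)
          ≤ γ * (√q ^ j * (h * (j + 1)) ^ N * (D / r ^ N)) := by
            have := hlΘ j
            have := hth j
            gcongr
            linarith
        _ = γ * D * √q ^ j * (((j : ℝ) + 1) / (r / h)) ^ N := by
          rw [div_pow, div_pow, mul_pow]; field_simp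
        _ ≤ _ := by
          gcongr
          have : 0 < C₀ / (β / 6) := by positivity
          linarith
    · intro j δ hδ0 hδ
      have f0 := ht j
      have hX : 0 < ((j : ℝ) + h) * δ := by positivity
      have f1 : |((j : ℝ) + h) * δ| < r := by
        rw [abs_of_pos hX]
        rw [div_div_eq_mul_div, div_mul_eq_mul_div, div_lt_one hr] at hδ
        have := hth j
        nlinarith
      have f2 := (hbc j _ hX.ne' f1).mul_left (-(γ / 2) * lam ^ j)
      have f3 : (fun N => -(γ / 2) * (lam ^ j * ((j : ℝ) + h) ^ N *
          (b N / (β * (j + h)) + c j N)) * δ ^ N) = fun N => -(γ / 2) * lam ^ j *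
          ((b N / (β * (j + h)) + c j N) * (((j : ℝ) + h) * δ) ^ N) := by
        ext N
        rw [mul_pow]
        ring
      have f4 : negMulLogCoeff (γ * lam ^ j * Real.exp ((j + h) * δ))
          (Real.exp (-((j + h) * δ)) * (β * ((Real.exp ((j + h) * δ) - 1) / δ) + ν j)) 2 =
          -(γ / 2) * lam ^ j * (Real.exp (2 * ((j + h) * δ)) /
            (β * (j + h) * ((Real.exp ((j + h) * δ) - 1) / ((j + h) * δ)) + ν j)) := by
        have g1 : β * (j + h) * ((Real.exp ((j + h) * δ) - 1) / ((j + h) * δ)) + ν j =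
            β * ((Real.exp ((j + h) * δ) - 1) / δ) + ν j := by field_simp
        have g2 : negMulLogCoeff (γ * lam ^ j * Real.exp ((j + h) * δ))
            (Real.exp (-((j + h) * δ)) * (β * ((Real.exp ((j + h) * δ) - 1) / δ) + ν j)) 2 =
            -(γ * lam ^ j * Real.exp ((j + h) * δ) / (2 * (Real.exp (-((j + h) * δ)) *
              (β * ((Real.exp ((j + h) * δ) - 1) / δ) + ν j)))) := by
          simp [negMulLogCoeff]
        rw [g1, g2, two_mul ((j + h) * δ), Real.exp_add, Real.exp_neg, neg_mul, neg_mul, neg_inj]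
        have := Real.exp_pos (((j : ℝ) + h) * δ)
        simp only [div_eq_mul_inv, mul_inv, inv_inv]
        ring
      rw [f3, f4]
      exact f2
    · intro j δ hδ0 hδ
      have f1 := ha j δ hδ0 (hδ.trans_le hε'ε)
      have f2 := hμ j δ hδ0 (hδ.trans_le hε'ε)
      have f3 : (0 : ℝ) < β / 6 := by positivity
      have f4 := f3.trans_le f1
      have g2 : negMulLogCoeff (γ * lam ^ j * Real.exp ((j + h) * δ))
          (Real.exp (-((j + h) * δ)) * (β * ((Real.exp ((j + h) * δ) - 1) / δ) + ν j)) 2 =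
          -(γ * lam ^ j * Real.exp ((j + h) * δ) / (2 * (Real.exp (-((j + h) * δ)) *
            (β * ((Real.exp ((j + h) * δ) - 1) / δ) + ν j)))) := by
        simp [negMulLogCoeff]
      rw [g2, abs_neg, abs_of_nonneg (by positivity)]
      calc γ * lam ^ j * Real.exp ((j + h) * δ) / (2 * (Real.exp (-((j + h) * δ)) *
            (β * ((Real.exp ((j + h) * δ) - 1) / δ) + ν j))) ≤ C₀ * √q ^ j / (1 * (β / 6)) := by
            gcongr
            norm_num
        _ = C₀ / (β / 6) * √q ^ j := by ring
        _ ≤ _ := by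
          gcongr
          have : 0 < γ * D := by positivity
          linarith
    · intro N
      refine (he _ _).trans (le_of_eq ?_)
      rw [pow_add]; ring
  refine ⟨2 / γ * (A * R ^ 2), R, by positivity, hR, fun N => ⟨-(2 / γ) * e 2 N, ?_, ?_⟩⟩
  · rw [abs_mul, abs_neg, abs_of_pos (by positivity : 0 < 2 / γ)]
    calc 2 / γ * |e 2 N| ≤ 2 / γ * (A * R ^ (2 + N)) := by gcongr; exact he 2 N
      _ = _ := by rw [pow_add]; ring
  · have := (hcoef N).mul_left (-(2 / γ))
    have f1 : (fun j : ℕ => lam ^ j * ((j : ℝ) + h) ^ N * (b N / (β * (j + h)) + c j N)) =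
        fun j : ℕ => -(2 / γ) * (-(γ / 2) *
          (lam ^ j * ((j : ℝ) + h) ^ N * (b N / (β * (j + h)) + c j N))) := by
      ext j
      field_simp
    rw [f1]
    exact this

/-- The coefficients of `s ^ 2` bound the sum of `lam ^ j * (j + h) ^ N * (b N / (β * (j + h)) + c j
N)` by `A * R ^ N`. The factor of `b N` is a positive sum of size at least about `N ^ N * exp (-N) /
l ^ N`, up to a factor `N + 1`, with `l = -log lam`. The part with `c` is of order `N ^ N * exp (-N)
/ (l₁ * r) ^ N`, as `ν` decays with ratio `κ`. Hence `b N` is `O((N + 1) * (l / (l₁ * r)) ^ N)`, and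
`2 π < l₁ * r / l` contradicts the singularity at `2 π i`. -/
lemma false_of_analytic_linear_aux (hγ : 0 < γ) (hlam0 : 0 < lam) (hlam1 : lam < 1) (hβ : 0 < β)
    (hh : 1 ≤ h) (hκ0 : 0 < κ) (hκ1 : κ < 1) (hν : ∀ j, |ν j| ≤ C * κ ^ j)
    (hr : 0 < r) (hrl : 2 * Real.pi * -Real.log lam < r * -Real.log (lam * √κ))
    (hm0 : 0 < m) (hm1 : m ≤ 1) (hm : ∀ z ∈ Metric.closedBall (0 : ℂ) r, m ≤ ‖expQuot z‖)
    (hνm : ∀ j, |ν j| ≤ β * m / 2) (hG : AnalyticAt ℝ G 0)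
    (hsum : ∀ᶠ p : ℝ × ℝ in 𝓝 0, 0 < p.2 →
      ∑' j : ℕ, Real.negMulLog (γ * lam ^ j * (β * ((Real.exp ((j + h) * p.2) - 1) / p.2) +
        p.1 * Real.exp ((j + h) * p.2) + ν j)) = G p) : False := by
  obtain ⟨b, B, hB, hb1, hb2, hb3⟩ := exists_coeff_exp_div hβ hr hm0 hm
  have ht : ∀ j : ℕ, 1 ≤ (j : ℝ) + h := fun j => by
    have : (0 : ℝ) ≤ j := Nat.cast_nonneg j
    linarith
  choose c hc hbc using fun j : ℕ => hb3 (j + h) (ν j) (ht j) (hνm j)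
  obtain ⟨A, R, hA, hR, hT⟩ := exists_bound_hasSum_linear hγ hlam0 hlam1 hβ hh hr hm0 hm1 hνm
    hG hsum hB hb1 hc hbc
  set l := -Real.log lam with hl
  set l₁ := -Real.log (lam * √κ) with hl₁
  have hs0 : 0 < √κ := Real.sqrt_pos.2 hκ0
  have hs1 : √κ < 1 := by rw [Real.sqrt_lt' one_pos]; simpa using hκ1
  have hl0 : 0 < l := by have := Real.log_neg hlam0 hlam1; linarith
  have hl₁0 : 0 < l₁ := by
    have := Real.log_neg (by positivity : 0 < lam * √κ) (by nlinarith)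
    linarith
  have hpi := Real.pi_pos
  have hC : 0 ≤ C := by simpa using (abs_nonneg _).trans (hν 0)
  have hlpow : ∀ j : ℕ, lam ^ j = Real.exp (-(l * j)) := by
    intro j
    rw [hl, show -(-Real.log lam * (j : ℝ)) = j * Real.log lam by ring, Real.exp_nat_mul,
      Real.exp_log hlam0]
  have hl₁pow : ∀ j : ℕ, (lam * √κ) ^ j = Real.exp (l₁ * h) * Real.exp (-(l₁ * (j + h))) := by
    intro j
    rw [← Real.exp_add, hl₁, show -Real.log (lam * √κ) * h + -(-Real.log (lam * √κ) * ((j : ℝ) + h))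
      = j * Real.log (lam * √κ) by ring, Real.exp_nat_mul, Real.exp_log (by positivity)]
  set Er := B * C * Real.exp (l₁ * h) * (1 - √κ)⁻¹ with hEr
  have h1s : 0 < 1 - √κ := by linarith
  have hEr0 : 0 ≤ Er := by positivity
  -- the contribution of the perturbation `ν`
  have herr : ∀ N : ℕ, ∃ S, |S| ≤ Er * ((N : ℝ) ^ N * Real.exp (-N) / (l₁ * r) ^ N) ∧
      HasSum (fun j : ℕ => lam ^ j * ((j : ℝ) + h) ^ N * c j N) S := by
    intro N
    have hbd : ∀ j : ℕ, ‖lam ^ j * ((j : ℝ) + h) ^ N * c j N‖ ≤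
        B * C * Real.exp (l₁ * h) * ((N : ℝ) ^ N * Real.exp (-N) / (l₁ * r) ^ N) * √κ ^ j := by
      intro j
      have f0 := ht j
      rw [Real.norm_eq_abs, abs_mul, abs_of_nonneg (by positivity)]
      have f1 : |c j N| ≤ B * (C * κ ^ j) / r ^ N := (hc j N).trans (by
        have := hν j
        gcongr)
      have f2 := pow_mul_exp_neg_le (by linarith : 0 ≤ (j : ℝ) + h) hl₁0 N
      calc lam ^ j * ((j : ℝ) + h) ^ N * |c j N|
          ≤ lam ^ j * ((j : ℝ) + h) ^ N * (B * (C * κ ^ j) / r ^ N) := by gcongr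
        _ = B * C / r ^ N * √κ ^ j * (((j : ℝ) + h) ^ N * (lam * √κ) ^ j) := by
          rw [show κ ^ j = (√κ * √κ) ^ j by rw [Real.mul_self_sqrt hκ0.le], mul_pow, mul_pow]
          ring
        _ = B * C / r ^ N * √κ ^ j * Real.exp (l₁ * h) *
            (((j : ℝ) + h) ^ N * Real.exp (-(l₁ * (j + h)))) := by rw [hl₁pow]; ring
        _ ≤ B * C / r ^ N * √κ ^ j * Real.exp (l₁ * h) *
            ((N : ℝ) ^ N * Real.exp (-N) / l₁ ^ N) := by gcongr
        _ = _ := by rw [mul_pow l₁]; field_simp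
    have hg := (hasSum_geometric_of_lt_one hs0.le hs1).mul_left
      (B * C * Real.exp (l₁ * h) * ((N : ℝ) ^ N * Real.exp (-N) / (l₁ * r) ^ N))
    have hs := Summable.of_norm_bounded hg.summable hbd
    refine ⟨_, ?_, hs.hasSum⟩
    refine (hs.hasSum.norm_le_of_bounded hg hbd).trans (le_of_eq ?_)
    rw [hEr]; ring
  set K₁ := β * (1 / l + 1 + h) / lam with hK₁
  have hK₁0 : 0 < K₁ := by positivity
  have hmain : ∀ N : ℕ, 0 < N → |b N| ≤ K₁ * (N + 1) * (A * (R * l * Real.exp 1) ^ N / N ^ N +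
      Er * (l / (l₁ * r)) ^ N) := by
    intro N hN
    have hN0 : (0 : ℝ) < N := by exact_mod_cast hN
    obtain ⟨T, hT1, hT2⟩ := hT N
    obtain ⟨S, hS1, hS2⟩ := herr N
    have f1 := hT2.sub hS2
    have f2 : (fun j : ℕ => lam ^ j * ((j : ℝ) + h) ^ N * (b N / (β * (j + h)) + c j N) -
        lam ^ j * ((j : ℝ) + h) ^ N * c j N) =
        fun j : ℕ => b N * (lam ^ j * ((j : ℝ) + h) ^ N / (β * (j + h))) := by
      ext j; ring
    rw [f2] at f1
    have hw : ∀ j : ℕ, 0 ≤ lam ^ j * ((j : ℝ) + h) ^ N / (β * (j + h)) := fun j => by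
      have := ht j
      positivity
    -- The summand near the maximum of `lam ^ j * j ^ N` is singled out; it alone supplies the
    -- required lower bound.
    set j₀ := ⌈(N : ℝ) / l⌉₊ with hj₀
    have g1 : (N : ℝ) / l ≤ j₀ := Nat.le_ceil _
    have g2 : (j₀ : ℝ) < N / l + 1 := Nat.ceil_lt_add_one (by positivity)
    have f3 : |b N| * (lam ^ j₀ * ((j₀ : ℝ) + h) ^ N / (β * (j₀ + h))) ≤ |T - S| := by
      rcases le_total 0 (b N) with h0 | h0
      · rw [abs_of_nonneg h0]
        exact (le_hasSum f1 j₀ fun j _ => mul_nonneg h0 (hw j)).trans (le_abs_self _)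
      · rw [abs_of_nonpos h0]
        refine le_trans ?_ (neg_le_abs _)
        have f4 := f1.neg
        have f5 := le_hasSum f4 j₀ fun j _ => by
          have := mul_nonneg (neg_nonneg.2 h0) (hw j)
          linarith
        linarith
    have f4 : lam * Real.exp (-N) * (N / l) ^ N / (β * ((N + 1) * (1 / l + 1 + h))) ≤
        lam ^ j₀ * ((j₀ : ℝ) + h) ^ N / (β * (j₀ + h)) := by
      have f0 := ht j₀
      have g3 : lam * Real.exp (-N) ≤ lam ^ j₀ := by
        rw [hlpow]
        nth_rewrite 1 [← pow_one lam]
        rw [hlpow, ← Real.exp_add]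
        refine Real.exp_le_exp.2 ?_
        have : l * (N / l) = N := by field_simp
        push_cast
        nlinarith
      have g4 : (N : ℝ) / l ≤ j₀ + h := by linarith
      have g5 : (j₀ : ℝ) + h ≤ (N + 1) * (1 / l + 1 + h) := by
        have : (N + 1) * (1 / l + 1 + h) = N / l + 1 + h + (N * (1 + h) + 1 / l) := by ring
        have : 0 ≤ N * (1 + h) + 1 / l := by positivity
        linarith
      gcongr
    have f5 : |T - S| ≤ A * R ^ N + Er * ((N : ℝ) ^ N * Real.exp (-N) / (l₁ * r) ^ N) :=
      (abs_sub _ _).trans (add_le_add hT1 hS1)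
    have f6 := (mul_le_mul_of_nonneg_left f4 (abs_nonneg (b N))).trans (f3.trans f5)
    have hE : Real.exp (-N) * Real.exp 1 ^ N = 1 := by
      rw [← Real.exp_nat_mul, ← Real.exp_add]; simp
    have hW : 0 < lam * Real.exp (-N) * (N / l) ^ N / (β * ((N + 1) * (1 / l + 1 + h))) := by
      positivity
    rw [← le_div_iff₀ hW] at f6
    refine f6.trans (le_of_eq ?_)
    have hen : Real.exp (-(N : ℝ)) = (Real.exp 1 ^ N)⁻¹ := eq_inv_of_mul_eq_one_left hE
    rw [hK₁, hen, div_pow, div_pow, mul_pow, mul_pow, mul_pow]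
    field_simp
  -- The gap between `2 π` and `r * l₁ / l` leaves room for a radius `r'` that also absorbs the
  -- polynomial factor `N + 1`.
  obtain ⟨r', hr'1, hr'2⟩ := exists_between
    (show 2 * Real.pi < r * l₁ / l by rw [lt_div_iff₀ hl0]; exact hrl)
  have hr'0 : 0 < r' := by linarith
  have hq : l / (l₁ * r) * r' < 1 := by
    rw [lt_div_iff₀ hl0] at hr'2
    rw [div_mul_eq_mul_div, div_lt_one (by positivity)]
    linarith
  have hq0 : 0 < l / (l₁ * r) * r' := by positivity
  obtain ⟨K, hK1, hK⟩ := exists_succ_mul_pow_le hq0 hq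
  have hev : ∀ᶠ N : ℕ in atTop, |b N| * r' ^ N ≤ K₁ * (A + Er * K) := by
    filter_upwards [eventually_gt_atTop 0, eventually_mul_pow_lt_self_pow 1
      (Q := 2 * (R * l * Real.exp 1 * r')) (by positivity)] with N hN hN2
    have hN0 : (0 : ℝ) < N := by exact_mod_cast hN
    have f1 : (N : ℝ) + 1 ≤ 2 ^ N := by
      have : N + 1 ≤ 2 ^ N := Nat.lt_two_pow_self
      exact_mod_cast this
    have f2 : ((N : ℝ) + 1) * (R * l * Real.exp 1 * r') ^ N / N ^ N ≤ 1 := by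
      rw [div_le_one (by positivity)]
      refine le_trans ?_ hN2.le
      rw [one_mul, mul_pow 2]
      gcongr
    have f3 : ((N : ℝ) + 1) * (l / (l₁ * r) * r') ^ N ≤ K := by
      refine (hK N).trans ?_
      exact mul_le_of_le_one_right (by linarith)
        (pow_le_one₀ (Real.sqrt_nonneg _) (Real.sqrt_le_one.2 hq.le))
    calc |b N| * r' ^ N ≤ K₁ * (N + 1) * (A * (R * l * Real.exp 1) ^ N / N ^ N +
          Er * (l / (l₁ * r)) ^ N) * r' ^ N := by gcongr; exact hmain N hN
      _ = K₁ * (A * (((N : ℝ) + 1) * (R * l * Real.exp 1 * r') ^ N / N ^ N) +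
          Er * (((N : ℝ) + 1) * (l / (l₁ * r) * r') ^ N)) := by
          rw [mul_pow _ r', mul_pow _ r']; ring
      _ ≤ K₁ * (A * 1 + Er * K) := by gcongr
      _ = _ := by ring
  obtain ⟨N₀, hN₀⟩ := eventually_atTop.1 hev
  refine not_bounded_coeff_exp_div_expQuot (C := K₁ * (A + Er * K) +
    ∑ i ∈ Finset.range N₀, |b i| * r' ^ i) hr hr'1 hb2 fun N => ?_
  rw [le_div_iff₀ (by positivity)]
  rcases le_or_gt N₀ N with h0 | h0
  · refine (hN₀ N h0).trans (le_add_of_nonneg_right ?_)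
    exact Finset.sum_nonneg fun i _ => by positivity
  · refine le_trans (Finset.single_le_sum (f := fun i => |b i| * r' ^ i)
      (fun i _ => by positivity) (Finset.mem_range.2 h0)) (le_add_of_nonneg_left ?_)
    have : 0 < K := by linarith
    positivity

end LinearFamily

end

section
section LinearFamily

lemma analyticAt_dslope_exp : AnalyticAt ℝ (dslope Real.exp 0) 0 := by
  obtain ⟨p, hp⟩ := (analyticAt_rexp (x := (0 : ℝ)))
  exact ⟨_, hp.has_fpower_series_dslope_fslope⟩

lemma mul_dslope_exp (t : ℝ) {δ : ℝ} (hδ : δ ≠ 0) :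
    t * dslope Real.exp 0 (t * δ) = (Real.exp (t * δ) - 1) / δ := by
  have h := sub_smul_dslope Real.exp 0 (t * δ)
  rw [sub_zero, smul_eq_mul, Real.exp_zero] at h
  rw [eq_div_iff hδ, ← h]
  ring

lemma analyticAt_negMulLog {E : Type*} [NormedAddCommGroup E] [NormedSpace ℝ E] {f : E → ℝ} {x : E}
    (hf : AnalyticAt ℝ f x) (h0 : 0 < f x) : AnalyticAt ℝ (fun y => Real.negMulLog (f y)) x := by
  exact hf.fun_neg.fun_mul (AnalyticAt.comp (f := f) (analyticAt_log (by simpa using h0)) hf)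

variable {lam β h κ C : ℝ} {ν : ℕ → ℝ} {G : ℝ × ℝ → ℝ}

/-- The first `J` terms are analytic at the origin because their arguments are positive there, so
they can be removed. Afterwards `h + J ≥ 1` and `ν` is as small as needed. The radius `r < 2 π` is
taken so close to `2 π` that `2 π * l < r * l₁`, possible because `l < l₁`. -/
lemma false_of_analytic_linear (hlam0 : 0 < lam) (hlam1 : lam < 1) (hβ : 0 < β)
    (hκ0 : 0 < κ) (hκ1 : κ < 1) (hν : ∀ j, |ν j| ≤ C * κ ^ j)
    (hpos : ∀ j : ℕ, 0 < β * (j + h) + ν j) (hG : AnalyticAt ℝ G 0)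
    (hsum : ∀ᶠ p : ℝ × ℝ in 𝓝 0, 0 < p.2 →
      HasSum (fun j : ℕ => Real.negMulLog (lam ^ j * (β * ((Real.exp ((j + h) * p.2) - 1) / p.2) +
        p.1 * Real.exp ((j + h) * p.2) + ν j))) (G p)) : False := by
  have hpi := Real.pi_pos
  have hs0 : 0 < √κ := Real.sqrt_pos.2 hκ0
  have hs1 : √κ < 1 := by rw [Real.sqrt_lt' one_pos]; simpa using hκ1
  have hl0 : 0 < -Real.log lam := by have := Real.log_neg hlam0 hlam1; linarith
  have hl₁ : -Real.log lam < -Real.log (lam * √κ) := by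
    rw [Real.log_mul hlam0.ne' hs0.ne']
    have := Real.log_neg hs0 hs1
    linarith
  obtain ⟨r, hr1, hr2⟩ := exists_between
    (show 2 * Real.pi * -Real.log lam / -Real.log (lam * √κ) < 2 * Real.pi by
      rw [div_lt_iff₀ (by linarith)]; gcongr)
  have hr0 : 0 < r := lt_of_le_of_lt (by
    have : 0 < -Real.log (lam * √κ) := by linarith
    positivity) hr1
  rw [div_lt_iff₀ (by linarith)] at hr1
  obtain ⟨m, hm0, hm1, hm⟩ := exists_le_norm_expQuot hr0 hr2
  have hev : ∀ᶠ j : ℕ in atTop, C * κ ^ j < β * m / 2 := by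
    have h1 := (tendsto_pow_atTop_nhds_zero_of_lt_one hκ0.le hκ1).const_mul C
    rw [mul_zero] at h1
    exact h1.eventually (gt_mem_nhds (by positivity))
  obtain ⟨J₁, hJ₁⟩ := eventually_atTop.1 hev
  obtain ⟨J₂, hJ₂⟩ := exists_nat_ge (1 - h)
  set J := max J₁ J₂ with hJ
  have hJh : 1 ≤ h + J := by
    have : (J₂ : ℝ) ≤ J := by exact_mod_cast le_max_right _ _
    linarith
  have hterm : ∀ j : ℕ, AnalyticAt ℝ (fun p : ℝ × ℝ => Real.negMulLog (lam ^ j *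
      (β * ((j + h) * dslope Real.exp 0 ((j + h) * p.2)) +
        p.1 * Real.exp ((j + h) * p.2) + ν j))) 0 := by
    intro j
    have h1 : AnalyticAt ℝ (fun p : ℝ × ℝ => ((j : ℝ) + h) * p.2) 0 :=
      analyticAt_const.fun_mul analyticAt_snd
    have h2 : AnalyticAt ℝ (fun p : ℝ × ℝ => dslope Real.exp 0 (((j : ℝ) + h) * p.2)) 0 :=
      AnalyticAt.comp (f := fun p : ℝ × ℝ => ((j : ℝ) + h) * p.2)
        (by rw [Prod.snd_zero, mul_zero]; exact analyticAt_dslope_exp) h1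
    refine analyticAt_negMulLog (analyticAt_const.fun_mul (((analyticAt_const.fun_mul
      (analyticAt_const.fun_mul h2)).fun_add (analyticAt_fst.fun_mul h1.rexp)).fun_add
        analyticAt_const)) ?_
    have := hpos j
    simp only [Prod.snd_zero, Prod.fst_zero, mul_zero, dslope_same, Real.deriv_exp, Real.exp_zero,
      mul_one, add_zero]
    positivity
  refine false_of_analytic_linear_aux (γ := lam ^ J) (h := h + J) (ν := fun i => ν (i + J))
    (C := C * κ ^ J) (G := fun p => G p - ∑ j ∈ Finset.range J, Real.negMulLog (lam ^ j *
      (β * ((j + h) * dslope Real.exp 0 ((j + h) * p.2)) +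
        p.1 * Real.exp ((j + h) * p.2) + ν j))) (by positivity) hlam0 hlam1 hβ hJh hκ0 hκ1
    (fun i => by
      have := hν (i + J)
      rw [pow_add] at this
      linarith) hr0 hr1 hm0 hm1 hm
    (fun i => (hν _).trans (hJ₁ _ ((le_max_left _ _).trans (Nat.le_add_left _ _))).le)
    (hG.fun_sub (Finset.analyticAt_fun_sum _ fun j _ => hterm j)) ?_
  filter_upwards [hsum] with p hp h0
  have h1 := (hasSum_nat_add_iff' J).2 (hp h0)
  simp only [mul_dslope_exp _ h0.ne']
  rw [← h1.tsum_eq]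
  refine tsum_congr fun i => ?_
  push_cast
  congr 1
  rw [pow_add, show (i : ℝ) + (h + J) = i + J + h by ring]
  ring

end LinearFamily

end

/-! ### Interpolation towards an eigenprojection. -/

section
open scoped Matrix.Norms.Operator

variable {n : ℕ} {r : Fin n → ℝ} {B : Matrix (Fin n) (Fin n) ℝ}

lemma ReturnEntropyAnalyticAt.exists_hasSum (h : ReturnEntropyAnalyticAt r B)
    (hadm : IsAdmissible r B) {R : ℝ × ℝ → Fin n → ℝ} {M : ℝ × ℝ → Matrix (Fin n) (Fin n) ℝ}
    (hR : AnalyticAt ℝ R 0) (hM : AnalyticAt ℝ M 0) (hR0 : R 0 = r) (hM0 : M 0 = B) :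
    ∃ G : ℝ × ℝ → ℝ, AnalyticAt ℝ G 0 ∧ ∀ᶠ p in 𝓝 0, (∀ i j, 0 ≤ M p i j) →
      HasSum (fun j : ℕ => Real.negMulLog (R p ⬝ᵥ (M p ^ j) *ᵥ (1 - M p *ᵥ 1))) (G p) := by
  obtain ⟨G, hG, hG2⟩ := h
  have hF : AnalyticAt ℝ (fun p => (R p, M p)) 0 := hR.prod hM
  have hF0 : (fun p => (R p, M p)) 0 = (r, B) := by rw [← hR0, ← hM0]
  have hFt : Tendsto (fun p => (R p, M p)) (𝓝 0) (𝓝 (r, B)) := by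
    rw [← hF0]; exact hF.continuousAt
  refine ⟨fun p => G (R p, M p), AnalyticAt.comp (by rw [hR0, hM0]; exact hG) hF, ?_⟩
  filter_upwards [hFt.eventually hG2, hFt.eventually hadm.eventually] with p h1 h2 h3
  rw [← h1 h3]
  exact (h2 h3).summable.hasSum

section Projection

variable {P : Matrix (Fin n) (Fin n) ℝ} {lam : ℝ}

lemma pow_mul_of_mul_eq (hBP : B * P = lam • P) (j : ℕ) : B ^ j * P = lam ^ j • P := by
  induction j with
  | zero => simp
  | succ j ih => rw [pow_succ', Matrix.mul_assoc, ih, Matrix.mul_smul, hBP, smul_smul, ← pow_succ]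

lemma mul_pow_of_mul_eq (hPB : P * B = lam • P) (j : ℕ) : P * B ^ j = lam ^ j • P := by
  induction j with
  | zero => simp
  | succ j ih => rw [pow_succ, ← Matrix.mul_assoc, ih, Matrix.smul_mul, hPB, smul_smul, ← pow_succ]

/-- Powers of the interpolation between `B` and `lam • P` for an eigenprojection `P`. -/
lemma interpolate_pow_mul (hPP : P * P = P) (hBP : B * P = lam • P) (hPB : P * B = lam • P)
    {e s : ℝ} (hu : IsUnit (1 - e • B)) (j : ℕ) :
    (P + (1 - B) * (1 - e • B)⁻¹ * (1 - P) + s • P) *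
        (e • B + ((1 - e) * lam) • P) ^ j * (1 - (e • B + ((1 - e) * lam) • P)) =
      (1 + s) • (lam ^ j • (P * (1 - B))) +
        e ^ j • (B ^ j * (1 - B) - lam ^ j • (P * (1 - B))) := by
  -- `M` acts as `lam` on the range of `P` and as `e • B` on its kernel. The factor `(1 - B) * (1 -
  -- e • B)⁻¹` exchanges the `1 - e • B` that `1 - M` produces on the kernel for `1 - B`.
  set M := e • B + ((1 - e) * lam) • P with hM
  have hPM : P * M = lam • P := by
    rw [hM, Matrix.mul_add, Matrix.mul_smul, Matrix.mul_smul, hPB, hPP, smul_smul, ← add_smul]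
    congr 1; ring
  have hPMj := mul_pow_of_mul_eq hPM
  have hcomm : P * B = B * P := by rw [hPB, hBP]
  have hQM : (1 - P) * M = e • (B * (1 - P)) := by
    rw [Matrix.sub_mul, Matrix.one_mul, hPM, hM, Matrix.mul_sub, Matrix.mul_one, hBP, smul_sub,
      smul_smul, add_sub_assoc, ← sub_smul, sub_eq_add_neg, sub_eq_add_neg (e • B), ← neg_smul]
    congr 2; ring
  have hQMj : ∀ j, (1 - P) * M ^ j = e ^ j • (B ^ j * (1 - P)) := by
    intro j
    induction j with
    | zero => simp
    | succ j ih =>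
      rw [pow_succ, ← Matrix.mul_assoc, ih, Matrix.smul_mul, Matrix.mul_assoc, hQM,
        Matrix.mul_smul, ← Matrix.mul_assoc, ← pow_succ, smul_smul, ← pow_succ]
  have hP1 : P * M ^ j * (1 - M) = lam ^ j • (P * (1 - B)) := by
    rw [hPMj, Matrix.smul_mul, Matrix.mul_sub, Matrix.mul_one, hPM, Matrix.mul_sub, Matrix.mul_one,
      hPB]
  have hcomm2 : (1 - P) * B = B * (1 - P) := by
    rw [Matrix.sub_mul, Matrix.mul_sub, hcomm, Matrix.one_mul, Matrix.mul_one]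
  have hQ1 : (1 - P) * M ^ j * (1 - M) = (1 - e • B) * (e ^ j • (B ^ j * (1 - P))) := by
    rw [hQMj, Matrix.smul_mul, Matrix.mul_smul, Matrix.mul_assoc, Matrix.mul_sub (1 - P),
      Matrix.mul_one, hQM, Matrix.sub_mul, Matrix.one_mul, Matrix.mul_sub, Matrix.mul_smul,
      Matrix.smul_mul, ← Matrix.mul_assoc, ← Matrix.mul_assoc, ← pow_succ, ← pow_succ']
  have hinv : (1 - e • B)⁻¹ * (1 - e • B) = 1 :=
    nonsing_inv_mul _ ((isUnit_iff_isUnit_det _).1 hu)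
  have hV : (1 - B) * (1 - e • B)⁻¹ * (1 - P) * M ^ j * (1 - M) =
      e ^ j • (B ^ j * (1 - B) - lam ^ j • (P * (1 - B))) := by
    have h1 : (1 - B) * (1 - e • B)⁻¹ * (1 - P) * M ^ j * (1 - M) =
        (1 - B) * ((1 - e • B)⁻¹ * ((1 - P) * M ^ j * (1 - M))) := by
      simp only [Matrix.mul_assoc]
    rw [h1, hQ1, ← Matrix.mul_assoc (1 - e • B)⁻¹, hinv, Matrix.one_mul, Matrix.mul_smul]
    congr 1
    have hc : Commute (1 - B) (B ^ j) :=
      ((Commute.one_left _).sub_left (Commute.refl B)).pow_right j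
    rw [← Matrix.mul_assoc, hc.eq, Matrix.mul_assoc, Matrix.mul_sub (1 - B), Matrix.mul_one,
      Matrix.mul_sub (B ^ j)]
    congr 1
    have : (1 - B) * P = P * (1 - B) := by
      rw [Matrix.sub_mul, Matrix.mul_sub, hcomm, Matrix.one_mul, Matrix.mul_one]
    rw [this, ← Matrix.mul_assoc, pow_mul_of_mul_eq hBP, Matrix.smul_mul]
  rw [Matrix.add_mul, Matrix.add_mul, Matrix.add_mul, Matrix.add_mul, hV, Matrix.smul_mul,
    Matrix.smul_mul, hP1, add_smul, one_smul]
  abel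

/-- If the return entropy is analytic, the normalised return probabilities cannot be smaller, by a
fixed amount and infinitely often, than the part of them carried by a nonnegative
eigenprojection. -/
lemma ReturnEntropyAnalyticAt.not_frequently_le (h : ReturnEntropyAnalyticAt r B)
    (hadm : IsAdmissible r B) (hlam0 : 0 < lam) (hlam1 : lam < 1) (hP0 : ∀ i j, 0 ≤ P i j)
    (hPP : P * P = P) (hBP : B * P = lam • P) (hPB : P * B = lam • P)
    (hα : 0 < r ⬝ᵥ P *ᵥ (1 - B *ᵥ 1)) {c₀ η : ℝ} (hc₀ : 0 < c₀)
    (hf : ∀ j : ℕ, c₀ * lam ^ j ≤ r ⬝ᵥ (B ^ j) *ᵥ (1 - B *ᵥ 1)) (hη : 0 < η) :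
    ¬ ∃ᶠ j : ℕ in atTop, r ⬝ᵥ (B ^ j) *ᵥ (1 - B *ᵥ 1) ≤
      lam ^ j * (r ⬝ᵥ P *ᵥ (1 - B *ᵥ 1) - η) := by
  intro hinf
  set c := (1 : Fin n → ℝ) - B *ᵥ 1 with hc
  set α := r ⬝ᵥ P *ᵥ c with hαdef
  set e : ℝ × ℝ → ℝ := fun p => Real.exp (-p.2) with he
  have hean : AnalyticAt ℝ e 0 := analyticAt_snd.fun_neg.rexp
  have he0 : e 0 = 1 := by simp [he]
  have hu0 : IsUnit (1 - B) := hadm.isTransient.isUnit_one_sub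
  have hinvan : AnalyticAt ℝ (fun p => (1 - e p • B)⁻¹) 0 := by
    obtain ⟨z, hz⟩ := hu0
    simp only [nonsing_inv_eq_ringInverse]
    have h2 : AnalyticAt ℝ (Ring.inverse : Matrix (Fin n) (Fin n) ℝ → _) (1 - e 0 • B) := by
      rw [he0, one_smul, ← hz]; exact analyticAt_inverse z
    exact AnalyticAt.comp (f := fun p => 1 - e p • B) h2
      (analyticAt_const.fun_sub (hean.fun_smul analyticAt_const))
  have hu : ∀ᶠ p in 𝓝 (0 : ℝ × ℝ), IsUnit (1 - e p • B) := by
    have h1 : ContinuousAt (fun p => 1 - e p • B) 0 :=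
      (analyticAt_const.fun_sub (hean.fun_smul analyticAt_const)).continuousAt
    refine h1.eventually (Units.isOpen.mem_nhds ?_)
    simpa [he0] using hu0
  -- With `e = exp (-δ)` and the row `r` multiplied by `S`, the return probabilities become exactly
  -- `lam ^ j * (α + s + d j * exp (-j δ))`. `M` is nonnegative for `δ > 0` because `P` is.
  set S : ℝ × ℝ → Matrix (Fin n) (Fin n) ℝ :=
    fun p => P + (1 - B) * (1 - e p • B)⁻¹ * (1 - P) + (p.1 / α) • P with hS
  set M : ℝ × ℝ → Matrix (Fin n) (Fin n) ℝ := fun p => e p • B + ((1 - e p) * lam) • P with hM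
  have hSan : AnalyticAt ℝ S 0 := by
    refine (analyticAt_const.fun_add ((analyticAt_const.fun_mul hinvan).fun_mul
      analyticAt_const)).fun_add (AnalyticAt.fun_smul ?_ analyticAt_const)
    exact analyticAt_fst.fun_div analyticAt_const hα.ne'
  have hMan : AnalyticAt ℝ M 0 := (hean.fun_smul analyticAt_const).fun_add
    (((analyticAt_const.fun_sub hean).fun_mul analyticAt_const).fun_smul analyticAt_const)
  have hRan : AnalyticAt ℝ (fun p => r ᵥ* S p) 0 := by
    refine AnalyticAt.pi fun j => ?_
    simp only [vecMul, dotProduct]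
    exact Finset.analyticAt_fun_sum _ fun i _ =>
      analyticAt_const.fun_mul (analyticAt_matrix_apply hSan i j)
  have hS0 : S 0 = 1 := by
    have h1 : (1 - B) * (1 - B)⁻¹ = 1 := mul_nonsing_inv _ ((isUnit_iff_isUnit_det _).1 hu0)
    simp only [hS, he0, one_smul, h1, Matrix.one_mul, Prod.fst_zero, zero_div, zero_smul, add_zero]
    abel
  obtain ⟨G, hG, hG2⟩ := h.exists_hasSum hadm hRan hMan (by rw [hS0, vecMul_one])
    (by simp [hM, he0])
  obtain ⟨C, θ, hC, hθ0, hθ1, hb⟩ := hadm.isTransient.bound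
  set D := (∑ i, |r i|) * ‖c‖ * C + α with hD
  have hlj : ∀ j : ℕ, 0 < lam ^ j := fun j => pow_pos hlam0 j
  have hD0 : 0 < D := add_pos_of_nonneg_of_pos (by positivity) hα
  refine false_of_analytic_exp (lam := lam) (α := α) (c₀ := c₀) (C := D) (θ := max θ lam)
    (η := η) (d := fun j => (r ⬝ᵥ (B ^ j) *ᵥ c) / lam ^ j - α) (G := G) hlam0 hlam1 hα hc₀
    (fun j => ?_) (lt_max_of_lt_left hθ0) (max_lt hθ1 hlam1) hD0 (fun j => ?_) hG ?_ hη
    (hinf.mono fun j hj => ?_)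
  · rw [add_sub_cancel, le_div_iff₀ (hlj j)]
    exact hf j
  · have h1 : lam ^ j * |(r ⬝ᵥ (B ^ j) *ᵥ c) / lam ^ j - α| ≤
        |r ⬝ᵥ (B ^ j) *ᵥ c| + lam ^ j * α := by
      have h2 := abs_sub ((r ⬝ᵥ (B ^ j) *ᵥ c) / lam ^ j) α
      rw [abs_div, abs_of_pos (hlj j), abs_of_pos hα] at h2
      calc _ ≤ lam ^ j * (|r ⬝ᵥ (B ^ j) *ᵥ c| / lam ^ j + α) := by gcongr
        _ = _ := by field_simp
    refine h1.trans ?_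
    have h3 : |r ⬝ᵥ (B ^ j) *ᵥ c| ≤ (∑ i, |r i|) * ‖c‖ * (C * max θ lam ^ j) := by
      refine (abs_bilin_le _ _ _).trans ?_
      gcongr
      refine (hb j).trans ?_
      gcongr
      exact le_max_left _ _
    have h4 : lam ^ j * α ≤ max θ lam ^ j * α := by
      gcongr
      exact le_max_right _ _
    calc _ ≤ (∑ i, |r i|) * ‖c‖ * (C * max θ lam ^ j) + max θ lam ^ j * α := add_le_add h3 h4
      _ = _ := by rw [hD]; ring
  · filter_upwards [hG2, hu] with p hp hup h0
    have he1 : e p ≤ 1 := by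
      rw [he]
      exact Real.exp_le_one_iff.2 (by linarith)
    have hpe : 0 < e p := Real.exp_pos _
    have hs := hp fun i j => by
      have := hadm.B_nonneg i j
      have := hP0 i j
      have h1e : 0 ≤ 1 - e p := by linarith
      simp only [hM, Matrix.add_apply, Matrix.smul_apply, smul_eq_mul]
      positivity
    rw [← hs.tsum_eq]
    refine tsum_congr fun j => ?_
    congr 1
    have h1 : (1 : Fin n → ℝ) - M p *ᵥ 1 = (1 - M p) *ᵥ 1 := by
      rw [sub_mulVec, one_mulVec]
    have h1c : c = (1 - B) *ᵥ 1 := by rw [hc, sub_mulVec, one_mulVec]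
    rw [h1, ← dotProduct_mulVec, mulVec_mulVec, mulVec_mulVec,
      interpolate_pow_mul hPP hBP hPB hup, add_mulVec, smul_mulVec, smul_mulVec, smul_mulVec,
      sub_mulVec, smul_mulVec, ← mulVec_mulVec, ← mulVec_mulVec, ← h1c, dotProduct_add,
      dotProduct_smul, dotProduct_smul, dotProduct_smul, dotProduct_sub, dotProduct_smul,
      ← hαdef]
    have h2 : e p ^ j = Real.exp (-(j * p.2)) := by
      rw [he, ← Real.exp_nat_mul]; congr 1; ring
    rw [h2]
    simp only [smul_eq_mul]
    have := (hlj j).ne'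
    field_simp
  · rw [sub_le_iff_le_add, div_le_iff₀ (hlj j)]
    linarith

end Projection

end

/-! ### Perron–Frobenius theory for nonnegative matrices. -/

section
open scoped Matrix.Norms.Operator

variable {n : ℕ} {B : Matrix (Fin n) (Fin n) ℝ} {lam : ℝ}

/-- `lam` is a positive eigenvalue of `B` and no complex eigenvalue is larger in modulus. -/
structure IsPerron (B : Matrix (Fin n) (Fin n) ℝ) (lam : ℝ) : Prop where
  pos : 0 < lam
  root : B.charpoly.IsRoot lam
  le : ∀ μ : ℂ, (B.map Complex.ofReal).charpoly.IsRoot μ → ‖μ‖ ≤ lam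

lemma norm_pow_le_of_isRoot {μ : ℂ} (h : (B.map Complex.ofReal).charpoly.IsRoot μ) (K : ℕ) :
    ‖μ‖ ^ K ≤ ‖B ^ K‖ := by
  obtain ⟨v, hv, hBv⟩ := isRoot_charpoly_iff_exists_mulVec.1 h
  have h1 : ∀ K : ℕ, (B.map Complex.ofReal ^ K) *ᵥ v = μ ^ K • v := by
    intro K
    induction K with
    | zero => simp
    | succ K ih => rw [pow_succ, ← mulVec_mulVec, hBv, mulVec_smul, ih, smul_smul, ← pow_succ']
  have h2 := linfty_opNorm_mulVec (B.map Complex.ofReal ^ K) v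
  rw [h1, norm_smul, norm_pow, ← map_ofReal_pow, norm_map_ofReal] at h2
  exact le_of_mul_le_mul_right h2 (norm_pos_iff.2 hv)

lemma isTransient_inv_smul (h : ∀ μ : ℂ, (B.map Complex.ofReal).charpoly.IsRoot μ → ‖μ‖ ≤ lam)
    {t : ℝ} (ht0 : 0 < t) (ht : lam < t) : IsTransient (t⁻¹ • B) := by
  obtain ⟨K, hK, hlt⟩ := exists_norm_pow_lt (M := B) ht0 fun μ hμ => (h μ hμ).trans_lt ht
  refine ⟨K, hK, ?_⟩
  rw [smul_pow, norm_smul, norm_pow, norm_inv, Real.norm_of_nonneg ht0.le, inv_pow,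
    inv_mul_lt_one₀ (by positivity)]
  exact hlt

/-- Entrywise domination passes to powers and their norms, so Gelfand's formula compares the
spectral radii. -/
lemma norm_le_of_entry_le {X : Matrix (Fin n) (Fin n) ℝ} (hlam : 0 ≤ lam) (hX : ∀ i j, 0 ≤ X i j)
    (hXB : ∀ i j, X i j ≤ B i j)
    (h : ∀ μ : ℂ, (B.map Complex.ofReal).charpoly.IsRoot μ → ‖μ‖ ≤ lam) {μ : ℂ}
    (hμ : (X.map Complex.ofReal).charpoly.IsRoot μ) : ‖μ‖ ≤ lam := by
  by_contra! hlt
  have hμ0 : 0 < ‖μ‖ := hlam.trans_lt hlt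
  obtain ⟨K, hK, hlt2⟩ := exists_norm_pow_lt (M := B) hμ0 fun ν hν => (h ν hν).trans_lt hlt
  have h1 : ‖X ^ K‖ ≤ ‖B ^ K‖ := by
    rw [linfty_opNorm_def, linfty_opNorm_def, NNReal.coe_le_coe]
    refine Finset.sup_mono_fun fun i _ => Finset.sum_le_sum fun j _ => ?_
    rw [← NNReal.coe_le_coe, coe_nnnorm, coe_nnnorm,
      Real.norm_of_nonneg (pow_apply_nonneg hX K i j)]
    exact (pow_entry_le_pow hX hXB K i j).trans (Real.le_norm_self _)
  linarith [norm_pow_le_of_isRoot hμ K]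

/-- A nonnegative matrix that is not nilpotent has a Perron eigenvalue. -/
lemma exists_isPerron (hB : ∀ i j, 0 ≤ B i j) {ν : ℂ}
    (hν : (B.map Complex.ofReal).charpoly.IsRoot ν) (hν0 : ν ≠ 0) : ∃ lam, IsPerron B lam := by
  set A := B.map Complex.ofReal with hA
  have hA0 : A.charpoly ≠ 0 := A.charpoly_monic.ne_zero
  obtain ⟨μ, hμ, hmax⟩ := A.charpoly.roots.toFinset.exists_max_image (fun z => ‖z‖)
    ⟨ν, by simpa [hA0] using hν⟩
  have hmem : ∀ z, z ∈ A.charpoly.roots.toFinset ↔ A.charpoly.IsRoot z := fun z => by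
    simp [hA0]
  rw [hmem] at hμ
  have hle : ∀ z : ℂ, A.charpoly.IsRoot z → ‖z‖ ≤ ‖μ‖ := fun z hz => hmax z ((hmem z).2 hz)
  have hρ : 0 < ‖μ‖ := (norm_pos_iff.2 hν0).trans_le (hle ν hν)
  refine ⟨‖μ‖, hρ, ?_, hle⟩
  -- The vector `w` of moduli satisfies `‖μ‖ w ≤ B w`. Were `‖μ‖` not an eigenvalue, the resolvent
  -- would stay bounded as `t` decreases to `‖μ‖`, and `w ≤ (1 - ‖μ‖ / t) (1 - B / t)⁻¹ w` would
  -- force `w = 0`.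
  by_contra hnot
  obtain ⟨v, hv, hBv⟩ := isRoot_charpoly_iff_exists_mulVec.1 hμ
  set w : Fin n → ℝ := fun i => ‖v i‖ with hw
  have hw1 : ∀ i, ‖μ‖ * w i ≤ (B *ᵥ w) i := by
    intro i
    have h1 := congrFun hBv i
    rw [Pi.smul_apply, smul_eq_mul] at h1
    rw [hw, ← norm_mul, ← h1, mulVec, dotProduct, mulVec, dotProduct]
    refine (norm_sum_le _ _).trans (Finset.sum_le_sum fun j _ => ?_)
    rw [norm_mul, hA, Matrix.map_apply, Complex.norm_real, Real.norm_of_nonneg (hB i j)]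
  have hunit : IsUnit (1 - ‖μ‖⁻¹ • B) := by
    rw [isUnit_iff_isUnit_det, isUnit_iff_ne_zero]
    intro h0
    apply hnot
    have h2 : scalar (Fin n) ‖μ‖ - B = ‖μ‖ • (1 - ‖μ‖⁻¹ • B) := by
      rw [smul_sub, smul_smul, mul_inv_cancel₀ hρ.ne', one_smul, scalar_apply, smul_one_eq_diagonal]
    rw [Polynomial.IsRoot, eval_charpoly, h2, det_smul, h0, mul_zero]
  have hcont : ContinuousAt (fun t : ℝ => (1 - t⁻¹ • B)⁻¹) ‖μ‖ := by
    simp only [nonsing_inv_eq_ringInverse]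
    obtain ⟨z, hz⟩ := hunit
    have h2 : ContinuousAt (Ring.inverse : Matrix (Fin n) (Fin n) ℝ → _) (1 - ‖μ‖⁻¹ • B) := by
      rw [← hz]; exact NormedRing.inverse_continuousAt z
    refine ContinuousAt.comp (f := fun t : ℝ => 1 - t⁻¹ • B) h2 ?_
    exact continuousAt_const.sub ((continuousAt_inv₀ hρ.ne').smul continuousAt_const)
  apply hv
  ext i
  have hlim : Tendsto (fun t : ℝ => (1 - ‖μ‖ * t⁻¹) * ((1 - t⁻¹ • B)⁻¹ *ᵥ w) i) (𝓝 ‖μ‖) (𝓝 0) := by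
    have h1 : ContinuousAt (fun t : ℝ => 1 - ‖μ‖ * t⁻¹) ‖μ‖ :=
      continuousAt_const.sub (continuousAt_const.mul (continuousAt_inv₀ hρ.ne'))
    have h2 : ContinuousAt (fun t : ℝ => ((1 - t⁻¹ • B)⁻¹ *ᵥ w) i) ‖μ‖ := by
      have h3 : Continuous fun M : Matrix (Fin n) (Fin n) ℝ => (M *ᵥ w) i := by fun_prop
      exact h3.continuousAt.comp hcont
    have h3 := Tendsto.mul h1 h2
    simp only at h3
    rwa [mul_inv_cancel₀ hρ.ne', sub_self, zero_mul] at h3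
  have hle : ∀ᶠ t in 𝓝[>] ‖μ‖, w i ≤ (1 - ‖μ‖ * t⁻¹) * ((1 - t⁻¹ • B)⁻¹ *ᵥ w) i := by
    filter_upwards [self_mem_nhdsWithin] with t ht
    have ht0 : 0 < t := hρ.trans ht
    have htr := isTransient_inv_smul hle ht0 ht
    have hpos := htr.inv_nonneg fun i j => mul_nonneg (inv_nonneg.2 ht0.le) (hB i j)
    have h4 : 0 ≤ ((1 - t⁻¹ • B)⁻¹ *ᵥ ((1 - ‖μ‖ * t⁻¹) • w - (1 - t⁻¹ • B) *ᵥ w)) i := by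
      refine mulVec_entry_nonneg (fun j => ?_) hpos i
      rw [sub_mulVec, one_mulVec, smul_mulVec]
      simp only [Pi.sub_apply, Pi.smul_apply, smul_eq_mul]
      have := mul_le_mul_of_nonneg_left (hw1 j) (inv_nonneg.2 ht0.le)
      nlinarith
    rw [mulVec_sub, mulVec_mulVec, nonsing_inv_mul _ ((isUnit_iff_isUnit_det _).1
      htr.isUnit_one_sub), one_mulVec, mulVec_smul] at h4
    simp only [Pi.sub_apply, Pi.smul_apply, smul_eq_mul] at h4
    linarith
  have h5 := ge_of_tendsto (hlim.mono_left nhdsWithin_le_nhds) hle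
  simpa [hw] using h5

section Polynomial

open Polynomial

lemma IsPerron.charpoly_pos (h : IsPerron B lam) {z : ℝ} (hz : lam < z) :
    0 < B.charpoly.eval z := by
  have hno : ∀ x, lam < x → B.charpoly.eval x ≠ 0 := by
    intro x hx h0
    have := h.le x (isRoot_charpoly_ofReal.2 h0)
    rw [Complex.norm_real, Real.norm_eq_abs] at this
    linarith [le_abs_self x]
  rcases n with - | n
  · have := h.root
    simp [IsRoot, charpoly, det_fin_zero] at this
  by_contra! hneg
  have hdeg : 0 < B.charpoly.degree := by
    rw [charpoly_degree_eq_dim]; simp; positivity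
  have ht := B.charpoly.tendsto_atTop_of_leadingCoeff_nonneg hdeg (by
    rw [B.charpoly_monic.leadingCoeff]; exact zero_le_one)
  obtain ⟨y, hy1, hy2⟩ := ((ht.eventually_ge_atTop 0).and (eventually_ge_atTop z)).exists
  obtain ⟨x, hx, hx0⟩ := intermediate_value_Icc hy2 B.charpoly.continuous.continuousOn
    (show (0 : ℝ) ∈ Set.Icc _ _ from ⟨hneg, hy1⟩)
  exact hno x (hz.trans_le hx.1) hx0

/-- Right of the Perron eigenvalue the determinant is positive and the resolvent is a nonnegative
Neumann series; the adjugate is their product. -/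
lemma IsPerron.adjugate_nonneg (h : IsPerron B lam) (hB : ∀ i j, 0 ≤ B i j) {z : ℝ}
    (hz : lam < z) (i j : Fin n) : 0 ≤ adjugate (scalar (Fin n) z - B) i j := by
  have hz0 : 0 < z := h.pos.trans hz
  have htr := isTransient_inv_smul h.le hz0 hz
  have hpos := htr.inv_nonneg (fun i j => mul_nonneg (inv_nonneg.2 hz0.le) (hB i j)) i j
  have h2 : scalar (Fin n) z - B = z • (1 - z⁻¹ • B) := by
    rw [smul_sub, smul_smul, mul_inv_cancel₀ hz0.ne', one_smul, scalar_apply, smul_one_eq_diagonal]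
  have hdet := h.charpoly_pos hz
  rw [eval_charpoly] at hdet
  have h3 : adjugate (scalar (Fin n) z - B) =
      (det (scalar (Fin n) z - B) * z⁻¹) • (1 - z⁻¹ • B)⁻¹ := by
    have hu : IsUnit (1 - z⁻¹ • B).det := (isUnit_iff_isUnit_det _).1 htr.isUnit_one_sub
    calc adjugate (scalar (Fin n) z - B)
        = adjugate (scalar (Fin n) z - B) * ((1 - z⁻¹ • B) * (1 - z⁻¹ • B)⁻¹) := by
          rw [mul_nonsing_inv _ hu, Matrix.mul_one]
      _ = z⁻¹ • (adjugate (scalar (Fin n) z - B) * (scalar (Fin n) z - B)) * (1 - z⁻¹ • B)⁻¹ := by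
          nth_rewrite 3 [h2]
          rw [Matrix.mul_smul, smul_smul, inv_mul_cancel₀ hz0.ne', one_smul, Matrix.mul_assoc]
      _ = _ := by
          rw [adjugate_mul, smul_smul, Matrix.smul_mul, Matrix.one_mul, mul_comm z⁻¹]
  rw [h3, Matrix.smul_apply, smul_eq_mul]
  positivity

lemma tendsto_adjugate_scalar_sub (B : Matrix (Fin n) (Fin n) ℝ) (lam : ℝ) (i j : Fin n) :
    Tendsto (fun z => adjugate (scalar (Fin n) z - B) i j) (𝓝[>] lam)
      (𝓝 (adjugate (scalar (Fin n) lam - B) i j)) := by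
  have : Continuous fun z : ℝ => adjugate (scalar (Fin n) z - B) i j := by
    have h1 : Continuous fun z : ℝ => adjugate (scalar (Fin n) z - B) := by
      refine Continuous.matrix_adjugate ?_
      exact (Continuous.matrix_diagonal (continuous_pi fun _ => continuous_id)).sub continuous_const
    exact h1.matrix_elem i j
  exact (this.tendsto lam).mono_left nhdsWithin_le_nhds

lemma eval_adjugate_charmatrix (B : Matrix (Fin n) (Fin n) ℝ) (z : ℝ) (i j : Fin n) :
    (adjugate (charmatrix B) i j).eval z = adjugate (scalar (Fin n) z - B) i j := by
  rw [← eval_charmatrix, ← RingHom.map_adjugate]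
  rfl

/-- Jacobi's formula. It suffices to check it at the infinitely many points that are not
eigenvalues, where `z - B` can be factored out. -/
lemma derivative_charpoly (B : Matrix (Fin n) (Fin n) ℝ) :
    B.charpoly.derivative = ∑ i, adjugate (charmatrix B) i i := by
  refine Polynomial.eq_of_infinite_eval_eq _ _
    ((B.charpoly.roots.toFinset.finite_toSet.infinite_compl).mono fun z hz => ?_)
  have hz : B.charpoly.eval z ≠ 0 := by
    simpa [B.charpoly_monic.ne_zero] using hz
  have hdet : IsUnit (scalar (Fin n) z - B).det := by
    rw [← eval_charpoly]; exact isUnit_iff_ne_zero.2 hz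
  set A := scalar (Fin n) z - B with hA
  have h1 : B.charpoly.comp (X + C z) =
      C (B.charpoly.eval z) * (det (1 + (X : ℝ[X]) • (A⁻¹).map C)) := by
    refine Polynomial.funext fun s => ?_
    have h2 : (evalRingHom s).mapMatrix (1 + (X : ℝ[X]) • (A⁻¹).map C) = 1 + s • A⁻¹ := by
      ext i j
      by_cases hij : i = j <;> simp [hij] <;> ring
    have h3 : scalar (Fin n) (s + z) - B = A * (1 + s • A⁻¹) := by
      rw [Matrix.mul_add, Matrix.mul_smul, mul_nonsing_inv _ hdet, Matrix.mul_one, hA, map_add,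
        scalar_apply, smul_one_eq_diagonal]
      abel
    rw [eval_comp, eval_add, eval_X, eval_C, eval_charpoly, h3, det_mul, eval_mul, eval_C,
      eval_charpoly, ← hA, ← h2, ← RingHom.map_det, coe_evalRingHom]
  have h4 := congrArg (fun p => p.derivative.eval 0) h1
  simp only [derivative_comp, derivative_mul, derivative_C, zero_mul, zero_add, eval_mul, eval_C,
    derivative_det_one_add_X_smul] at h4
  simp only [derivative_add, derivative_X, derivative_C, add_zero, eval_one, one_mul, eval_comp,
    eval_add, eval_X, eval_C, zero_add] at h4
  show B.charpoly.derivative.eval z = (∑ i, adjugate (charmatrix B) i i).eval z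
  rw [h4, eval_finsetSum, eval_charpoly, ← hA]
  simp only [eval_adjugate_charmatrix, ← hA]
  rw [trace, Finset.mul_sum]
  refine Finset.sum_congr rfl fun i _ => ?_
  rw [inv_def, diag_apply, Matrix.smul_apply, smul_eq_mul, ← mul_assoc,
    Ring.mul_inverse_cancel _ hdet, one_mul]

end Polynomial

/-- The adjugate at `lam` is a limit from the right, and the derivative is its trace, hence
nonnegative too. Simplicity is not needed: for derivative zero the inverse is zero by convention. -/
lemma IsPerron.eigenProj_nonneg (h : IsPerron B lam) (hB : ∀ i j, 0 ≤ B i j) (i j : Fin n) :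
    0 ≤ eigenProj B lam i j := by
  have hadj : ∀ i j, 0 ≤ adjugate (scalar (Fin n) lam - B) i j := fun i j =>
    ge_of_tendsto (tendsto_adjugate_scalar_sub B lam i j) (by
      filter_upwards [self_mem_nhdsWithin] with z hz using h.adjugate_nonneg hB hz i j)
  have hd : 0 ≤ B.charpoly.derivative.eval lam := by
    rw [derivative_charpoly, Polynomial.eval_finsetSum]
    refine Finset.sum_nonneg fun i _ => ?_
    rw [eval_adjugate_charmatrix]
    exact hadj i i
  exact mul_nonneg (inv_nonneg.2 hd) (hadj i j)

/-- A nonzero column of `P` is a nonnegative eigenvector, and a multiple of the positive vector `c`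
dominates it; applying `r B ^ j` preserves the inequality. -/
lemma IsAdmissible.exists_lower_bound {r : Fin n → ℝ} (hadm : IsAdmissible r B)
    {P : Matrix (Fin n) (Fin n) ℝ} (hP0 : ∀ i j, 0 ≤ P i j) (hP : P ≠ 0)
    (hBP : B * P = lam • P) :
    ∃ c₀ : ℝ, 0 < c₀ ∧ ∀ j : ℕ, c₀ * lam ^ j ≤ r ⬝ᵥ (B ^ j) *ᵥ (1 - B *ᵥ 1) := by
  obtain ⟨i, k, hik⟩ : ∃ i k, P i k ≠ 0 := by
    by_contra! h0
    exact hP (Matrix.ext h0)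
  set c : Fin n → ℝ := 1 - B *ᵥ 1 with hc
  have hc0 : ∀ i, 0 < c i := fun i => by
    have := hadm.B_sum i
    simpa [hc] using this
  set s := 1 + ∑ m, P m k / c m with hs
  have hnn : ∀ m, 0 ≤ P m k / c m := fun m => div_nonneg (hP0 m k) (hc0 m).le
  have hs0 : 0 < s := by have := Finset.sum_nonneg fun m (_ : m ∈ Finset.univ) => hnn m; linarith
  have hle : ∀ m, P m k ≤ s * c m := fun m => by
    rw [← div_le_iff₀ (hc0 m)]
    have := Finset.single_le_sum (fun m _ => hnn m) (Finset.mem_univ m)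
    linarith
  have hrP : 0 < r ⬝ᵥ (fun m => P m k) :=
    Finset.sum_pos' (fun m _ => mul_nonneg (hadm.r_pos m).le (hP0 m k))
      ⟨i, Finset.mem_univ i, mul_pos (hadm.r_pos i) ((hP0 i k).lt_of_ne' hik)⟩
  refine ⟨s⁻¹ * (r ⬝ᵥ fun m => P m k), by positivity, fun j => ?_⟩
  have h1 : (B ^ j) *ᵥ (fun m => P m k) = lam ^ j • fun m => P m k := by
    have := pow_mul_of_mul_eq hBP j
    ext i
    have := Matrix.ext_iff.2 this i k
    simpa [mul_apply, mulVec, dotProduct] using this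
  have h2 : 0 ≤ r ⬝ᵥ (B ^ j) *ᵥ (s • c - fun m => P m k) :=
    dotProduct_nonneg_of_nonneg (fun i => (hadm.r_pos i).le)
      (mulVec_entry_nonneg (fun m => by simpa using hle m) (pow_apply_nonneg hadm.B_nonneg j))
  rw [mulVec_sub, h1, mulVec_smul, dotProduct_sub, dotProduct_smul, dotProduct_smul,
    smul_eq_mul, smul_eq_mul] at h2
  rw [mul_assoc, inv_mul_le_iff₀ hs0]
  linarith

end

/-! ### Abel means of the powers and diagonal conjugation. -/

section
open scoped Matrix.Norms.Operator

variable {n : ℕ} {r : Fin n → ℝ} {B : Matrix (Fin n) (Fin n) ℝ} {lam : ℝ}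

lemma IsPerron.lt_one (h : IsPerron B lam) (hB : IsTransient B) : lam < 1 := by
  obtain ⟨K, hK, hlt⟩ := hB
  have h1 := norm_pow_le_of_isRoot (isRoot_charpoly_ofReal.2 h.root) K
  rw [Complex.norm_real, Real.norm_of_nonneg h.pos.le] at h1
  exact lt_of_pow_lt_pow_left₀ K zero_le_one (by rw [one_pow]; linarith)

section Resolvent

variable {P : Matrix (Fin n) (Fin n) ℝ}

/-- The resolvent of `B`, scaled by the distance to the Perron eigenvalue, converges to the
eigenprojection. -/
lemma tendsto_resolvent (hlam : 0 < lam)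
    (hle : ∀ μ : ℂ, (B.map Complex.ofReal).charpoly.IsRoot μ → ‖μ‖ ≤ lam)
    (hPP : P * P = P) (hBP : B * P = lam • P) (hPB : P * B = lam • P)
    (hfix : ∀ v, B *ᵥ v = lam • v → P *ᵥ v = v) (r c : Fin n → ℝ) :
    Tendsto (fun s : ℝ => (1 - lam * s⁻¹) * (r ⬝ᵥ (1 - s⁻¹ • B)⁻¹ *ᵥ c)) (𝓝[>] lam)
      (𝓝 (r ⬝ᵥ P *ᵥ c)) := by
  -- Removing `lam • P` keeps the resolvent regular at `lam`, as every eigenvector at `lam` is fixed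
  -- by `P`.
  set X : ℝ → Matrix (Fin n) (Fin n) ℝ := fun s => 1 - s⁻¹ • (B - lam • P) with hX
  have hunit : IsUnit (X lam) := by
    rw [isUnit_iff_isUnit_det, isUnit_iff_ne_zero]
    intro h0
    obtain ⟨v, hv, h⟩ := exists_mulVec_eq_zero_iff.2 h0
    have h1 : B *ᵥ v = lam • v + lam • (P *ᵥ v) := by
      rw [hX, sub_mulVec, one_mulVec, smul_mulVec, sub_mulVec, smul_mulVec, sub_eq_zero] at h
      have h2 := congrArg (fun w => lam • w) h
      simp only [smul_smul, mul_inv_cancel₀ hlam.ne', one_smul] at h2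
      rw [h2]; abel
    have h2 : P *ᵥ v = 0 := by
      have h3 := congrArg (fun w => P *ᵥ w) h1
      simp only [mulVec_mulVec, hPB, mulVec_add, mulVec_smul, hPP, smul_mulVec] at h3
      have h4 : lam • (P *ᵥ v) = 0 := by simpa using h3
      exact (smul_eq_zero.1 h4).resolve_left hlam.ne'
    rw [h2, smul_zero, add_zero] at h1
    exact hv ((hfix v h1).symm.trans h2)
  have hXcont : ContinuousAt X lam :=
    continuousAt_const.sub ((continuousAt_inv₀ hlam.ne').smul continuousAt_const)
  have hcont : ContinuousAt (fun s => (X s)⁻¹) lam := by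
    simp only [nonsing_inv_eq_ringInverse]
    obtain ⟨z, hz⟩ := hunit
    have h2 : ContinuousAt (Ring.inverse : Matrix (Fin n) (Fin n) ℝ → _) (X lam) := by
      rw [← hz]; exact NormedRing.inverse_continuousAt z
    exact ContinuousAt.comp (f := X) h2 hXcont
  have hev : ∀ᶠ s in 𝓝[>] lam, r ⬝ᵥ (X s)⁻¹ *ᵥ ((1 - lam * s⁻¹) • c + (lam * s⁻¹) • (P *ᵥ c)) =
      (1 - lam * s⁻¹) * (r ⬝ᵥ (1 - s⁻¹ • B)⁻¹ *ᵥ c) := by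
    filter_upwards [self_mem_nhdsWithin,
      nhdsWithin_le_nhds (hXcont.eventually (Units.isOpen.mem_nhds hunit))] with s hs hXs
    have hs0 : 0 < s := hlam.trans hs
    have hu := (isUnit_iff_isUnit_det _).1 (isTransient_inv_smul hle hs0 hs).isUnit_one_sub
    obtain ⟨u, huc⟩ : ∃ u, u = (1 - s⁻¹ • B)⁻¹ *ᵥ c := ⟨_, rfl⟩
    rw [← huc]
    have h1 : u - s⁻¹ • (B *ᵥ u) = c := by
      have h0 : (1 - s⁻¹ • B) *ᵥ u = c := by
        rw [huc, mulVec_mulVec, mul_nonsing_inv _ hu, one_mulVec]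
      rwa [sub_mulVec, one_mulVec, smul_mulVec] at h0
    have h2 : (1 - lam * s⁻¹) • (P *ᵥ u) = P *ᵥ c := by
      rw [← h1, mulVec_sub, mulVec_smul, mulVec_mulVec, hPB, smul_mulVec, smul_smul, sub_smul,
        one_smul, mul_comm]
    have h3 : X s *ᵥ u = c + (lam * s⁻¹) • (P *ᵥ u) := by
      rw [hX]
      simp only
      rw [sub_mulVec, one_mulVec, smul_mulVec, sub_mulVec, smul_mulVec, smul_sub, smul_smul,
        mul_comm lam]
      rw [← h1]; abel
    have h4 : (1 - lam * s⁻¹) • c + (lam * s⁻¹) • (P *ᵥ c) = X s *ᵥ ((1 - lam * s⁻¹) • u) := by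
      rw [mulVec_smul, h3, smul_add, ← h2, smul_comm (lam * s⁻¹)]
    rw [h4, mulVec_mulVec, nonsing_inv_mul _ ((isUnit_iff_isUnit_det _).1 hXs), one_mulVec,
      dotProduct_smul, smul_eq_mul]
  refine Tendsto.congr' hev ?_
  have hlim : Tendsto (fun s : ℝ =>
      r ⬝ᵥ (X s)⁻¹ *ᵥ ((1 - lam * s⁻¹) • c + (lam * s⁻¹) • (P *ᵥ c))) (𝓝 lam)
      (𝓝 (r ⬝ᵥ (X lam)⁻¹ *ᵥ ((1 - lam * lam⁻¹) • c + (lam * lam⁻¹) • (P *ᵥ c)))) := by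
    have hinv : ContinuousAt (fun s : ℝ => lam * s⁻¹) lam :=
      continuousAt_const.mul (continuousAt_inv₀ hlam.ne')
    have h1 : ContinuousAt (fun s : ℝ => (1 - lam * s⁻¹) • c + (lam * s⁻¹) • (P *ᵥ c)) lam :=
      ((continuousAt_const.sub hinv).smul continuousAt_const).add (hinv.smul continuousAt_const)
    have h3 : Continuous fun q : Matrix (Fin n) (Fin n) ℝ × (Fin n → ℝ) => r ⬝ᵥ q.1 *ᵥ q.2 := by
      fun_prop
    have h4 := (h3.tendsto ((X lam)⁻¹, (1 - lam * lam⁻¹) • c + (lam * lam⁻¹) • (P *ᵥ c))).comp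
      (hcont.tendsto.prodMk_nhds h1.tendsto)
    simpa only [Function.comp_def] using h4
  have h5 : X lam *ᵥ (P *ᵥ c) = P *ᵥ c := by
    rw [hX]
    simp only
    rw [sub_mulVec, one_mulVec, smul_mulVec, sub_mulVec, smul_mulVec, mulVec_mulVec, mulVec_mulVec,
      hBP, hPP, smul_mulVec, sub_self, smul_zero, sub_zero]
  have h6 : (X lam)⁻¹ *ᵥ (P *ᵥ c) = P *ᵥ c := by
    conv_lhs => rw [← h5]
    rw [mulVec_mulVec, nonsing_inv_mul _ ((isUnit_iff_isUnit_det _).1 hunit), one_mulVec]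
  rw [mul_inv_cancel₀ hlam.ne', sub_self, zero_smul, zero_add, one_smul, h6] at hlim
  exact hlim.mono_left nhdsWithin_le_nhds

/-- If the scaled sequence were eventually at least `α + κ`, so would be the limit of its Abel
means, but the resolvent limit says that they tend to `α`. -/
lemma not_eventually_add_le (hlam : 0 < lam) (hB : ∀ i j, 0 ≤ B i j)
    (hle : ∀ μ : ℂ, (B.map Complex.ofReal).charpoly.IsRoot μ → ‖μ‖ ≤ lam)
    (hPP : P * P = P) (hBP : B * P = lam • P) (hPB : P * B = lam • P)
    (hfix : ∀ v, B *ᵥ v = lam • v → P *ᵥ v = v) {r c : Fin n → ℝ} (hr : ∀ i, 0 ≤ r i)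
    (hc : ∀ i, 0 ≤ c i) {κ : ℝ} (hκ : 0 < κ) :
    ¬ ∀ᶠ j : ℕ in atTop, lam ^ j * (r ⬝ᵥ P *ᵥ c + κ) ≤ r ⬝ᵥ (B ^ j) *ᵥ c := by
  intro hev
  obtain ⟨J, hJ⟩ := eventually_atTop.1 hev
  set α := r ⬝ᵥ P *ᵥ c with hα
  have key : ∀ s, lam < s → (lam * s⁻¹) ^ J * (α + κ) ≤
      (1 - lam * s⁻¹) * (r ⬝ᵥ (1 - s⁻¹ • B)⁻¹ *ᵥ c) := by
    intro s hs
    have hs0 : 0 < s := hlam.trans hs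
    have htr := isTransient_inv_smul hle hs0 hs
    set q := lam * s⁻¹ with hq
    have hq0 : 0 < q := by positivity
    have hq1 : q < 1 := by rw [hq, ← div_eq_mul_inv, div_lt_one hs0]; exact hs
    set T := (1 - s⁻¹ • B)⁻¹ with hT
    have hsB : ∀ i j, 0 ≤ (s⁻¹ • B) i j := fun i j => mul_nonneg (inv_nonneg.2 hs0.le) (hB i j)
    have h1 : ∀ K, ∑ j ∈ Finset.range K, s⁻¹ ^ j * (r ⬝ᵥ (B ^ j) *ᵥ c) ≤ r ⬝ᵥ T *ᵥ c := by
      intro K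
      have h2 : ∑ j ∈ Finset.range K, (s⁻¹ • B) ^ j = T * (1 - (s⁻¹ • B) ^ K) := by
        rw [← mul_neg_geom_sum, ← Matrix.mul_assoc, hT,
          nonsing_inv_mul _ ((isUnit_iff_isUnit_det _).1 htr.isUnit_one_sub), Matrix.one_mul]
      have h3 : ∑ j ∈ Finset.range K, s⁻¹ ^ j * (r ⬝ᵥ (B ^ j) *ᵥ c) =
          r ⬝ᵥ (∑ j ∈ Finset.range K, (s⁻¹ • B) ^ j) *ᵥ c := by
        rw [sum_mulVec, dotProduct_sum]
        refine Finset.sum_congr rfl fun j _ => ?_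
        rw [smul_pow, smul_mulVec, dotProduct_smul, smul_eq_mul]
      rw [h3, h2, Matrix.mul_sub, Matrix.mul_one, sub_mulVec, dotProduct_sub, ← mulVec_mulVec]
      have : 0 ≤ r ⬝ᵥ T *ᵥ ((s⁻¹ • B) ^ K) *ᵥ c :=
        dotProduct_nonneg_of_nonneg hr (mulVec_entry_nonneg (mulVec_entry_nonneg hc
          (pow_apply_nonneg hsB K)) (htr.inv_nonneg hsB))
      linarith
    have h4 : ∀ K, J ≤ K → (α + κ) * (q ^ J - q ^ K) ≤
        (1 - q) * ∑ j ∈ Finset.range K, s⁻¹ ^ j * (r ⬝ᵥ (B ^ j) *ᵥ c) := by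
      intro K hK
      induction K, hK using Nat.le_induction with
      | base =>
        rw [sub_self, mul_zero]
        refine mul_nonneg (by linarith) (Finset.sum_nonneg fun j _ => mul_nonneg (by positivity)
          (dotProduct_nonneg_of_nonneg hr (mulVec_entry_nonneg hc (pow_apply_nonneg hB j))))
      | succ K hK ih =>
        rw [Finset.sum_range_succ, mul_add]
        have h5 : q ^ K * (α + κ) ≤ s⁻¹ ^ K * (r ⬝ᵥ (B ^ K) *ᵥ c) := by
          rw [hq, mul_pow, mul_comm (lam ^ K), mul_assoc]
          exact mul_le_mul_of_nonneg_left (hJ K hK) (by positivity)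
        have h6 := mul_le_mul_of_nonneg_left h5 (show 0 ≤ 1 - q by linarith)
        have h7 : (α + κ) * (q ^ J - q ^ (K + 1)) =
            (α + κ) * (q ^ J - q ^ K) + (1 - q) * (q ^ K * (α + κ)) := by ring
        linarith
    have h8 : ∀ᶠ K in atTop, (α + κ) * (q ^ J - q ^ K) ≤ (1 - q) * (r ⬝ᵥ T *ᵥ c) := by
      filter_upwards [eventually_ge_atTop J] with K hK
      exact (h4 K hK).trans (mul_le_mul_of_nonneg_left (h1 K) (by linarith))
    have h9 : Tendsto (fun K => (α + κ) * (q ^ J - q ^ K)) atTop (𝓝 ((α + κ) * (q ^ J - 0))) :=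
      ((tendsto_const_nhds.sub (tendsto_pow_atTop_nhds_zero_of_lt_one hq0.le hq1))).const_mul _
    have := le_of_tendsto h9 h8
    rw [sub_zero] at this
    linarith
  have hl1 : Tendsto (fun s : ℝ => (lam * s⁻¹) ^ J * (α + κ)) (𝓝[>] lam) (𝓝 (α + κ)) := by
    have h1 : ContinuousAt (fun s : ℝ => (lam * s⁻¹) ^ J * (α + κ)) lam :=
      ((continuousAt_const.mul (continuousAt_inv₀ hlam.ne')).pow J).mul continuousAt_const
    have h2 := h1.tendsto
    rw [mul_inv_cancel₀ hlam.ne', one_pow, one_mul] at h2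
    exact h2.mono_left nhdsWithin_le_nhds
  have h := le_of_tendsto_of_tendsto hl1 (tendsto_resolvent hlam hle hPP hBP hPB hfix r c) (by
    filter_upwards [self_mem_nhdsWithin] with s hs using key s hs)
  linarith

end Resolvent

section Conjugation

/-- Conjugation of a matrix by a diagonal matrix. -/
def diagConj (d : Fin n → ℝ) (B : Matrix (Fin n) (Fin n) ℝ) : Matrix (Fin n) (Fin n) ℝ :=
  Matrix.of fun i j => (d i)⁻¹ * B i j * d j

lemma diagConj_one (B : Matrix (Fin n) (Fin n) ℝ) : diagConj 1 B = B := by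
  ext i j; simp [diagConj]

lemma diagConj_nonneg {d : Fin n → ℝ} (hd : ∀ i, 0 < d i) (hB : ∀ i j, 0 ≤ B i j) (i j : Fin n) :
    0 ≤ diagConj d B i j :=
  mul_nonneg (mul_nonneg (inv_nonneg.2 (hd i).le) (hB i j)) (hd j).le

lemma charpoly_diagConj {d : Fin n → ℝ} (hd : ∀ i, 0 < d i) (B : Matrix (Fin n) (Fin n) ℝ) :
    (diagConj d B).charpoly = B.charpoly := by
  have h1 : diagonal d⁻¹ * diagonal d = 1 := by
    rw [diagonal_mul_diagonal, ← diagonal_one]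
    congr 1
    ext i
    exact inv_mul_cancel₀ (hd i).ne'
  let u : (Matrix (Fin n) (Fin n) ℝ)ˣ :=
    ⟨diagonal d, diagonal d⁻¹, by rw [mul_eq_one_comm]; exact h1, h1⟩
  have h2 := charpoly_units_conj' u B
  rw [← h2]
  congr 1
  have h3 : (u.val)⁻¹ = diagonal d⁻¹ := by
    rw [← coe_units_inv]; rfl
  rw [h3]
  ext i j
  simp [diagConj, u]

lemma tendsto_diagConj (B : Matrix (Fin n) (Fin n) ℝ) (v : Fin n → ℝ) :
    Tendsto (fun ε : ℝ => diagConj (1 + ε • v) B) (𝓝 0) (𝓝 B) := by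
  have h1 : ContinuousAt (fun ε : ℝ => diagConj (1 + ε • v) B) 0 := by
    refine continuousAt_pi.2 fun i => continuousAt_pi.2 fun j => ?_
    simp only [diagConj, of_apply, Pi.add_apply, Pi.one_apply, Pi.smul_apply, smul_eq_mul]
    refine ContinuousAt.mul (ContinuousAt.mul (ContinuousAt.inv₀ (by fun_prop) (by simp))
      continuousAt_const) (by fun_prop)
  have h2 := h1.tendsto
  rwa [zero_smul, add_zero, diagConj_one] at h2

lemma eventually_one_add_smul_pos (v : Fin n → ℝ) :
    ∀ᶠ ε : ℝ in 𝓝 0, ∀ i, 0 < (1 + ε • v) i := by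
  refine eventually_all.2 fun i => ?_
  have : ContinuousAt (fun ε : ℝ => (1 + ε • v) i) 0 := by
    simp only [Pi.add_apply, Pi.one_apply, Pi.smul_apply, smul_eq_mul]
    fun_prop
  exact this.eventually (lt_mem_nhds (by simp))

lemma IsPerron.of_charpoly_eq (h : IsPerron B lam) {X : Matrix (Fin n) (Fin n) ℝ}
    (hX : X.charpoly = B.charpoly) : IsPerron X lam :=
  ⟨h.pos, by rw [hX]; exact h.root, fun μ hμ => h.le μ (by
    rwa [charpoly_map_ofReal, hX, ← charpoly_map_ofReal] at hμ)⟩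

end Conjugation

end

/-! ### Peripheral eigenvalues next to a simple Perron eigenvalue. -/

section
open scoped Matrix.Norms.Operator

variable {n : ℕ} {r : Fin n → ℝ} {B : Matrix (Fin n) (Fin n) ℝ} {lam : ℝ}

lemma re_dotProduct_ofReal (y : Fin n → ℂ) (w : Fin n → ℝ) :
    (y ⬝ᵥ fun i => (w i : ℂ)).re = (fun i => (y i).re) ⬝ᵥ w := by
  simp [dotProduct]

lemma im_dotProduct_ofReal (y : Fin n → ℂ) (w : Fin n → ℝ) :
    (y ⬝ᵥ fun i => (w i : ℂ)).im = (fun i => (y i).im) ⬝ᵥ w := by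
  simp [dotProduct]

lemma map_ofReal_mulVec (M : Matrix (Fin n) (Fin n) ℝ) (w : Fin n → ℝ) :
    M.map Complex.ofReal *ᵥ (fun i => (w i : ℂ)) = fun i => ((M *ᵥ w) i : ℂ) := by
  ext i; simp [mulVec, dotProduct]

lemma IsAdmissible.one_sub_pos (h : IsAdmissible r B) (i : Fin n) :
    0 < (1 - B *ᵥ 1 : Fin n → ℝ) i := by
  have := h.B_sum i
  simpa using this

lemma IsAdmissible.bilin_pos (h : IsAdmissible r B) {P : Matrix (Fin n) (Fin n) ℝ}
    (hP0 : ∀ i j, 0 ≤ P i j) (hP : P ≠ 0) : 0 < r ⬝ᵥ P *ᵥ (1 - B *ᵥ 1) := by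
  obtain ⟨i, k, hik⟩ : ∃ i k, P i k ≠ 0 := by
    by_contra! h0
    exact hP (Matrix.ext h0)
  have hn := mulVec_entry_nonneg (fun j => (h.one_sub_pos j).le) hP0
  refine Finset.sum_pos' (fun j _ => mul_nonneg (h.r_pos j).le (hn j))
    ⟨i, Finset.mem_univ i, mul_pos (h.r_pos i) ?_⟩
  exact Finset.sum_pos' (fun j _ => mul_nonneg (hP0 i j) (h.one_sub_pos j).le)
    ⟨k, Finset.mem_univ k, mul_pos ((hP0 i k).lt_of_ne' hik) (h.one_sub_pos k)⟩

lemma eventually_perturb_row (h : ReturnEntropyAnalyticAt r B) (hadm : IsAdmissible r B)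
    (e : Fin n → ℝ) :
    ∀ᶠ ε : ℝ in 𝓝 0, ReturnEntropyAnalyticAt (r + ε • e) B ∧ IsAdmissible (r + ε • e) B := by
  have ht : Tendsto (fun ε : ℝ => (r + ε • e, B)) (𝓝 0) (𝓝 (r, B)) := by
    have : Continuous fun ε : ℝ => (r + ε • e, B) := by fun_prop
    simpa using this.tendsto 0
  filter_upwards [ht.eventually h.eventually, ht.eventually hadm.eventually] with ε h1 h2
  exact ⟨h1, h2 hadm.B_nonneg⟩

lemma eventually_perturb_matrix (h : ReturnEntropyAnalyticAt r B) (hadm : IsAdmissible r B)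
    {ι : Type*} {l : Filter ι} {X : ι → Matrix (Fin n) (Fin n) ℝ} (hX : Tendsto X l (𝓝 B))
    (hX0 : ∀ᶠ ε in l, ∀ i j, 0 ≤ X ε i j) :
    ∀ᶠ ε in l, ReturnEntropyAnalyticAt r (X ε) ∧ IsAdmissible r (X ε) := by
  have ht : Tendsto (fun ε => (r, X ε)) l (𝓝 (r, B)) := tendsto_const_nhds.prodMk_nhds hX
  filter_upwards [ht.eventually h.eventually, ht.eventually hadm.eventually, hX0] with ε h1 h2 h3
  exact ⟨h1, h2 h3⟩

/-- A peripheral eigenvalue with a left eigenvector of nonzero sum destroys analyticity. -/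
lemma false_of_peripheral_of_dotProduct_ne_zero (h : ReturnEntropyAnalyticAt r B)
    (hadm : IsAdmissible r B) (hlam : IsPerron B lam) (hd : B.charpoly.derivative.eval lam ≠ 0)
    {μ : ℂ} (hμ : ‖μ‖ = lam) (hne : μ ≠ lam) {y : Fin n → ℂ}
    (hy : y ᵥ* B.map Complex.ofReal = μ • y) (hy1 : y ⬝ᵥ 1 ≠ 0) : False := by
  set P := eigenProj B lam with hP
  have hPP : P * P = P := eigenProj_mul_self hlam.root hd
  have hBP : B * P = lam • P := mul_eigenProj hlam.root
  have hPB : P * B = lam • P := eigenProj_mul hlam.root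
  have hP0 : ∀ i j, 0 ≤ P i j := hlam.eigenProj_nonneg hadm.B_nonneg
  have hPne : P ≠ 0 := eigenProj_ne_zero hlam.root hd
  have hlam1 := hlam.lt_one hadm.isTransient
  set c : Fin n → ℝ := 1 - B *ᵥ 1 with hc
  set A := B.map Complex.ofReal with hA
  set z := y ⬝ᵥ fun i => (c i : ℂ) with hz
  have hyAj : ∀ j : ℕ, y ᵥ* A ^ j = μ ^ j • y := by
    intro j
    induction j with
    | zero => simp
    | succ j ih => rw [pow_succ, ← vecMul_vecMul, ih, smul_vecMul, hy, smul_smul, ← pow_succ]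
  -- Since `c = 1 - B 1`, the pairing of `y` with `c` is `(1 - μ)` times the sum of `y`, and `‖μ‖ <
  -- 1`.
  have hz0 : z ≠ 0 := by
    have h1 : z = (1 - μ) * (y ⬝ᵥ 1) := by
      have h2 : (fun i => (c i : ℂ)) = 1 - A *ᵥ 1 := by
        have h3 := map_ofReal_mulVec B 1
        have h4 : (fun i => ((1 : Fin n → ℝ) i : ℂ)) = 1 := by ext; simp
        rw [h4, ← hA] at h3
        rw [h3]
        ext i; simp [hc]
      rw [hz, h2, dotProduct_sub, dotProduct_mulVec, hy, smul_dotProduct, smul_eq_mul]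
      ring
    rw [h1]
    refine mul_ne_zero (sub_ne_zero.2 fun h1 => ?_) hy1
    rw [← h1, norm_one] at hμ
    linarith
  have hyB : ∀ j : ℕ, (y ⬝ᵥ fun i => (((B ^ j) *ᵥ c) i : ℂ)) = μ ^ j * z := by
    intro j
    rw [← map_ofReal_mulVec, map_ofReal_pow, dotProduct_mulVec, ← hA, hyAj, smul_dotProduct,
      smul_eq_mul]
  have hyP : (y ⬝ᵥ fun i => ((P *ᵥ c) i : ℂ)) = 0 := by
    have h1 : A * P.map Complex.ofReal = (lam : ℂ) • P.map Complex.ofReal := by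
      have := congrArg (fun M : Matrix (Fin n) (Fin n) ℝ => Complex.ofRealHom.mapMatrix M) hBP
      rw [map_mul] at this
      refine this.trans ?_
      ext i j; simp
    have h2 : (μ - lam) • (y ᵥ* P.map Complex.ofReal) = 0 := by
      rw [sub_smul, ← smul_vecMul, ← hy, vecMul_vecMul, h1, vecMul_smul, sub_self]
    rw [← map_ofReal_mulVec, dotProduct_mulVec,
      (smul_eq_zero.1 h2).resolve_left (sub_ne_zero.2 hne), zero_dotProduct]
  -- Adding `e` with `e P c = 0` to the row `r` leaves `α` unchanged, so the exclusion of large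
  -- negative deviations applies to the perturbed sequence with the same `α`.
  have key : ∀ (e : Fin n → ℝ) (η : ℝ), 0 < η → e ⬝ᵥ P *ᵥ c = 0 →
      ReturnEntropyAnalyticAt (r + e) B → IsAdmissible (r + e) B →
      ∀ᶠ j : ℕ in atTop, lam ^ j * (r ⬝ᵥ P *ᵥ c - η) <
        r ⬝ᵥ (B ^ j) *ᵥ c + e ⬝ᵥ (B ^ j) *ᵥ c := by
    intro e η hη he h1 h2
    obtain ⟨c₀, hc₀, hlow⟩ := h2.exists_lower_bound hP0 hPne hBP
    have h3 := h1.not_frequently_le h2 hlam.pos hlam1 hP0 hPP hBP hPB (h2.bilin_pos hP0 hPne)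
      hc₀ hlow hη
    rw [not_frequently] at h3
    filter_upwards [h3] with j hj
    rw [not_le, ← hc, add_dotProduct, add_dotProduct, he, add_zero] at hj
    exact hj
  set a : Fin n → ℝ := fun i => (y i).re with ha
  set b : Fin n → ℝ := fun i => (y i).im with hb
  have haP : a ⬝ᵥ P *ᵥ c = 0 := by rw [ha, ← re_dotProduct_ofReal, hyP, Complex.zero_re]
  have hbP : b ⬝ᵥ P *ᵥ c = 0 := by rw [hb, ← im_dotProduct_ofReal, hyP, Complex.zero_im]
  have haB : ∀ j : ℕ, a ⬝ᵥ (B ^ j) *ᵥ c = (μ ^ j * z).re := fun j => by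
    rw [ha, ← re_dotProduct_ofReal, hyB]
  have hbB : ∀ j : ℕ, b ⬝ᵥ (B ^ j) *ᵥ c = (μ ^ j * z).im := fun j => by
    rw [hb, ← im_dotProduct_ofReal, hyB]
  have hneg : Tendsto (fun ε : ℝ => -ε) (𝓝 0) (𝓝 0) := by
    simpa using (continuous_neg.tendsto (0 : ℝ))
  have hall := ((eventually_perturb_row h hadm a).and
    (hneg.eventually (eventually_perturb_row h hadm a))).and
    ((eventually_perturb_row h hadm b).and (hneg.eventually (eventually_perturb_row h hadm b)))
  obtain ⟨ε, ⟨⟨⟨h1, h1'⟩, h2, h2'⟩, ⟨h3, h3'⟩, h4, h4'⟩, hε⟩ :=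
    ((hall.filter_mono nhdsWithin_le_nhds).and
      (self_mem_nhdsWithin : Set.Ioi (0 : ℝ) ∈ 𝓝[>] 0)).exists
  have hε : 0 < ε := hε
  have hzn : 0 < ‖z‖ := norm_pos_iff.2 hz0
  -- The bounds for `±` the real and imaginary parts add up to `2 (r B ^ j c - lam ^ j (α - κ)) ≥ ε
  -- lam ^ j ‖z‖ = 4 κ lam ^ j`. So `r B ^ j c` is eventually at least `lam ^ j (α + κ)`, which the
  -- Abel means forbid.
  set κ := ε * ‖z‖ / 4 with hκ
  have hκ0 : 0 < κ := by positivity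
  refine not_eventually_add_le (P := P) (κ := κ) hlam.pos hadm.B_nonneg hlam.le hPP hBP hPB
    (fun v hv => eigenProj_mulVec hlam.root hd hv) (fun i => (hadm.r_pos i).le)
    (fun i => (hadm.one_sub_pos i).le) hκ0 ?_
  rw [← hc]
  filter_upwards [key _ κ hκ0 (by rw [smul_dotProduct, haP, smul_zero]) h1 h1',
    key _ κ hκ0 (by rw [smul_dotProduct, haP, smul_zero]) h2 h2',
    key _ κ hκ0 (by rw [smul_dotProduct, hbP, smul_zero]) h3 h3',
    key _ κ hκ0 (by rw [smul_dotProduct, hbP, smul_zero]) h4 h4'] with j k1 k2 k3 k4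
  simp only [smul_dotProduct, haB, hbB, smul_eq_mul] at k1 k2 k3 k4
  have hn : lam ^ j * ‖z‖ ≤ |(μ ^ j * z).re| + |(μ ^ j * z).im| := by
    have := Complex.norm_le_abs_re_add_abs_im (μ ^ j * z)
    rwa [norm_mul, norm_pow, hμ] at this
  have e1 : ε * |(μ ^ j * z).re| ≤ r ⬝ᵥ (B ^ j) *ᵥ c - lam ^ j * (r ⬝ᵥ P *ᵥ c - κ) := by
    rcases abs_cases (μ ^ j * z).re with ⟨h, -⟩ | ⟨h, -⟩ <;> rw [h] <;> linarith
  have e2 : ε * |(μ ^ j * z).im| ≤ r ⬝ᵥ (B ^ j) *ᵥ c - lam ^ j * (r ⬝ᵥ P *ᵥ c - κ) := by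
    rcases abs_cases (μ ^ j * z).im with ⟨h, -⟩ | ⟨h, -⟩ <;> rw [h] <;> linarith
  have e3 := mul_le_mul_of_nonneg_left hn hε.le
  have e4 : ε * (lam ^ j * ‖z‖) = 4 * (lam ^ j * κ) := by rw [hκ]; ring
  nlinarith

/-- If the Perron eigenvalue is simple, analyticity excludes other peripheral eigenvalues. -/
lemma norm_lt_of_simple (h : ReturnEntropyAnalyticAt r B) (hadm : IsAdmissible r B)
    (hlam : IsPerron B lam) (hd : B.charpoly.derivative.eval lam ≠ 0) {μ : ℂ}
    (hμ : (B.map Complex.ofReal).charpoly.IsRoot μ) (hne : μ ≠ lam) : ‖μ‖ < lam := by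
  refine (hlam.le μ hμ).lt_of_ne fun hμl => ?_
  obtain ⟨y, hy0, hy⟩ := isRoot_charpoly_iff_exists_mulVec.1
    (show (B.map Complex.ofReal)ᵀ.charpoly.IsRoot μ by rwa [charpoly_transpose])
  rw [mulVec_transpose] at hy
  obtain ⟨i, hi⟩ := Function.ne_iff.1 hy0
  set v : Fin n → ℝ := Pi.single i 1 with hv
  have hev : ∀ᶠ ε : ℝ in 𝓝[>] 0, (∀ i, 0 < (1 + ε • v) i) ∧
      (ReturnEntropyAnalyticAt r (diagConj (1 + ε • v) B) ∧
        IsAdmissible r (diagConj (1 + ε • v) B)) := by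
    have h1 := (eventually_one_add_smul_pos v).and (eventually_perturb_matrix h hadm
      (tendsto_diagConj B v) ((eventually_one_add_smul_pos v).mono fun ε hε i j =>
        diagConj_nonneg hε hadm.B_nonneg i j))
    exact h1.filter_mono nhdsWithin_le_nhds
  -- Conjugation by `1 + ε • v` preserves the spectrum and turns the sum of the left eigenvector
  -- into `y ⬝ᵥ 1 + ε * y i`. This cannot vanish both for `ε = 0` and for some `ε > 0`, since `y i ≠
  -- 0`.
  have main : ∀ ε : ℝ, (∀ i, 0 < (1 + ε • v) i) →
      ReturnEntropyAnalyticAt r (diagConj (1 + ε • v) B) →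
      IsAdmissible r (diagConj (1 + ε • v) B) → y ⬝ᵥ 1 + ε * y i = 0 := by
    intro ε hε h1 h2
    by_contra hne0
    have hchar := charpoly_diagConj hε B
    refine false_of_peripheral_of_dotProduct_ne_zero h1 h2 (hlam.of_charpoly_eq hchar)
      (by rw [hchar]; exact hd) hμl hne (y := fun k => y k * ((1 + ε • v) k : ℝ)) ?_ ?_
    · ext k
      have h3 := congrFun hy k
      simp only [vecMul, dotProduct, map_apply, Pi.smul_apply, smul_eq_mul, diagConj,
        of_apply] at h3 ⊢
      rw [← mul_assoc, ← h3, Finset.sum_mul]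
      refine Finset.sum_congr rfl fun m _ => ?_
      have : (((1 + ε • v) m : ℝ) : ℂ) ≠ 0 := by exact_mod_cast (hε m).ne'
      push_cast
      field_simp
    · have : (fun k => y k * (((1 + ε • v) k : ℝ) : ℂ)) ⬝ᵥ 1 = y ⬝ᵥ 1 + ε * y i := by
        simp only [dotProduct, Pi.one_apply, mul_one, Pi.add_apply, Pi.smul_apply, smul_eq_mul,
          Complex.ofReal_add, Complex.ofReal_one, Complex.ofReal_mul, mul_add,
          Finset.sum_add_distrib]
        congr 1
        rw [Finset.sum_eq_single i]
        · simp [hv, mul_comm]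
        · intro k _ hk; simp [hv, hk]
        · simp
      rw [this]; exact hne0
  have h0 := main 0 (by simp) (by simpa [diagConj_one] using h) (by simpa [diagConj_one] using hadm)
  obtain ⟨ε, ⟨h1, h2, h3⟩, hε⟩ :=
    (hev.and (self_mem_nhdsWithin : Set.Ioi (0 : ℝ) ∈ 𝓝[>] 0)).exists
  have h4 := main ε h1 h2 h3
  simp only [Complex.ofReal_zero, zero_mul, add_zero] at h0
  rw [h0, zero_add] at h4
  rcases mul_eq_zero.1 h4 with h5 | h5
  · exact (show (0 : ℝ) < ε from hε).ne' (by exact_mod_cast h5)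
  · exact hi h5

end

/-! ### Lowering the multiplicity of the Perron eigenvalue to two. -/

section
open scoped Matrix.Norms.Operator

variable {n : ℕ} {r : Fin n → ℝ} {B : Matrix (Fin n) (Fin n) ℝ} {lam : ℝ}

section Multiplicity

open Polynomial

/-- A polynomial squeezed between zero and `q` to the right of `lam` vanishes at `lam` whenever `q`
does; dividing both by `X - lam` preserves the squeeze. -/
lemma pow_dvd_of_eval_le {p q : ℝ[X]} {k : ℕ}
    (h : ∀ z, lam < z → 0 ≤ p.eval z ∧ p.eval z ≤ q.eval z) (hq : (X - C lam) ^ k ∣ q) :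
    (X - C lam) ^ k ∣ p := by
  induction k generalizing p q with
  | zero => simp
  | succ k ih =>
    obtain ⟨q₁, rfl⟩ := hq
    have hp : p.eval lam = 0 := by
      have h1 := (p.continuous.tendsto lam).mono_left (nhdsWithin_le_nhds (s := Set.Ioi lam))
      have h2 := (((X - C lam) ^ (k + 1) * q₁).continuous.tendsto lam).mono_left
        (nhdsWithin_le_nhds (s := Set.Ioi lam))
      have h3 : ((X - C lam) ^ (k + 1) * q₁).eval lam = 0 := by simp
      rw [h3] at h2
      refine le_antisymm (le_of_tendsto_of_tendsto h1 h2 ?_) (ge_of_tendsto h1 ?_)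
      · filter_upwards [self_mem_nhdsWithin] with z hz using (h z hz).2
      · filter_upwards [self_mem_nhdsWithin] with z hz using (h z hz).1
    obtain ⟨p₁, rfl⟩ := dvd_iff_isRoot.2 hp
    rw [pow_succ']
    refine mul_dvd_mul_left _ (ih (q := (X - C lam) ^ k * q₁) (fun z hz => ?_) (dvd_mul_right _ _))
    have h1 := h z hz
    have hz' : 0 < z - lam := sub_pos.2 hz
    rw [pow_succ', mul_assoc, eval_mul, eval_mul (p := X - C lam)] at h1
    simp only [eval_sub, eval_X, eval_C] at h1
    exact ⟨nonneg_of_mul_nonneg_right h1.1 hz', le_of_mul_le_mul_left h1.2 hz'⟩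

/-- The derivative of the characteristic polynomial is the sum of the diagonal adjugate entries,
which are nonnegative right of `lam`. Nothing can cancel, so every entry vanishes to order `k` at
least and one of them to no higher order. -/
lemma IsPerron.exists_pow_dvd_adjugate (h : IsPerron B lam) (hB : ∀ i j, 0 ≤ B i j) {k : ℕ}
    (hk : B.charpoly.rootMultiplicity lam = k + 1) :
    ∃ i, (X - C lam) ^ k ∣ adjugate (charmatrix B) i i ∧
      ¬ (X - C lam) ^ (k + 1) ∣ adjugate (charmatrix B) i i := by
  have hd : B.charpoly.derivative.rootMultiplicity lam = k := by
    rw [derivative_rootMultiplicity_of_root h.root, hk, Nat.add_sub_cancel]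
  have hdvd : (X - C lam) ^ k ∣ B.charpoly.derivative := by
    rw [← hd]; exact pow_rootMultiplicity_dvd _ _
  have hne : B.charpoly.derivative ≠ 0 := by
    intro h0
    have h1 := derivative_eq_zero.1 h0
    have h2 : B.charpoly = 1 := B.charpoly_monic.natDegree_eq_zero.1 h1
    have := h.root
    rw [h2] at this
    simp at this
  have hndvd : ¬ (X - C lam) ^ (k + 1) ∣ B.charpoly.derivative := by
    rw [← le_rootMultiplicity_iff hne, hd]; omega
  have hall : ∀ i, (X - C lam) ^ k ∣ adjugate (charmatrix B) i i := by
    intro i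
    refine pow_dvd_of_eval_le (fun z hz => ?_) hdvd
    have hnn : ∀ j, 0 ≤ (adjugate (charmatrix B) j j).eval z := fun j => by
      rw [eval_adjugate_charmatrix]; exact h.adjugate_nonneg hB hz j j
    refine ⟨hnn i, ?_⟩
    rw [derivative_charpoly, eval_finsetSum]
    exact Finset.single_le_sum (fun j _ => hnn j) (Finset.mem_univ i)
  by_contra! hcon
  refine hndvd ?_
  rw [derivative_charpoly]
  exact Finset.dvd_sum fun i _ => hcon i (hall i)

lemma charpoly_updateRow_smul (B : Matrix (Fin n) (Fin n) ℝ) (i : Fin n) (ε : ℝ) :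
    (B.updateRow i ((1 - ε) • B i)).charpoly =
      C (1 - ε) * B.charpoly + C ε * (X * adjugate (charmatrix B) i i) := by
  have h1 : charmatrix (B.updateRow i ((1 - ε) • B i)) =
      (charmatrix B).updateRow i
        (C (1 - ε) • (charmatrix B) i + (C ε * X) • Pi.single i 1) := by
    ext1 a b
    by_cases ha : a = i
    · subst ha
      by_cases hb : b = a
      · subst hb
        simp [charmatrix]; ring
      · simp [charmatrix, hb, Ne.symm hb]
    · by_cases hab : a = b <;> simp [charmatrix, ha, hab]
      subst hab; simp [ha]
  rw [charpoly, h1, det_updateRow_add, det_updateRow_smul, det_updateRow_smul, updateRow_eq_self,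
    ← adjugate_apply, charpoly]
  ring

/-- The multiplicity of a Perron eigenvalue can be lowered by an arbitrarily small change of the
matrix. -/
lemma exists_rootMultiplicity_pred (h : ReturnEntropyAnalyticAt r B) (hadm : IsAdmissible r B)
    (hlam : IsPerron B lam) {k : ℕ} (hk : B.charpoly.rootMultiplicity lam = k + 1) (hk0 : 0 < k) :
    ∃ X : Matrix (Fin n) (Fin n) ℝ, ReturnEntropyAnalyticAt r X ∧ IsAdmissible r X ∧
      IsPerron X lam ∧ X.charpoly.rootMultiplicity lam = k := by
  obtain ⟨i, hi1, hi2⟩ := hlam.exists_pow_dvd_adjugate hadm.B_nonneg hk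
  -- Scaling row `i` by `1 - ε` adds a multiple of `X * adjugate i i` to the characteristic
  -- polynomial. As `lam ≠ 0`, this has order exactly `k` at `lam`, against `k + 1` for the old
  -- polynomial. Entries only decrease, so no eigenvalue exceeds `lam`.
  set M : ℝ → Matrix (Fin n) (Fin n) ℝ := fun ε => B.updateRow i ((1 - ε) • B i) with hM
  have hMt : Tendsto M (𝓝[>] 0) (𝓝 B) := by
    have h1 : Continuous M := by
      refine continuous_const.matrix_updateRow i ?_
      fun_prop
    have h2 := h1.tendsto 0
    rw [hM] at h2
    simp only [sub_zero, one_smul, updateRow_eq_self] at h2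
    exact h2.mono_left nhdsWithin_le_nhds
  have hε1 : ∀ᶠ ε : ℝ in 𝓝[>] 0, 0 < ε ∧ ε < 1 := by
    filter_upwards [self_mem_nhdsWithin, nhdsWithin_le_nhds (gt_mem_nhds (zero_lt_one' ℝ))]
      with ε a b using ⟨a, b⟩
  have hM0 : ∀ ε : ℝ, 0 < ε ∧ ε < 1 → ∀ a b, 0 ≤ M ε a b ∧ M ε a b ≤ B a b := by
    intro ε hε a b
    have := hadm.B_nonneg a b
    by_cases ha : a = i
    · subst ha
      simp only [hM, updateRow_self, Pi.smul_apply, smul_eq_mul]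
      constructor <;> nlinarith
    · simp only [hM, updateRow_ne ha]
      exact ⟨this, le_rfl⟩
  obtain ⟨ε, ⟨h1, h2⟩, hε⟩ := ((eventually_perturb_matrix h hadm hMt (hε1.mono fun ε hε a b =>
    (hM0 ε hε a b).1)).and hε1).exists
  have hne : (M ε).charpoly ≠ 0 := (M ε).charpoly_monic.ne_zero
  have hchar := charpoly_updateRow_smul B i ε
  have hB1 : (X - C lam) ^ (k + 1) ∣ B.charpoly := by
    rw [← hk]; exact pow_rootMultiplicity_dvd _ _
  have hmul : (M ε).charpoly.rootMultiplicity lam = k := by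
    refine le_antisymm ?_ ?_
    · by_contra! hlt
      have h3 : (X - C lam) ^ (k + 1) ∣ (M ε).charpoly := (le_rootMultiplicity_iff hne).1 hlt
      rw [hchar] at h3
      have h4 := (dvd_add_right (hB1.mul_left _)).1 h3
      have hu : IsUnit (C ε) := isUnit_C.2 (isUnit_iff_ne_zero.2 hε.1.ne')
      rw [hu.dvd_mul_left] at h4
      have hco : IsCoprime ((X - C lam) ^ (k + 1)) (X : ℝ[X]) := by
        refine IsCoprime.pow_left ?_
        have := isCoprime_X_sub_C_of_isUnit_sub (R := ℝ) (a := lam) (b := 0)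
          (by rw [sub_zero]; exact isUnit_iff_ne_zero.2 hlam.pos.ne')
        simpa using this
      exact hi2 (hco.dvd_of_dvd_mul_left h4)
    · rw [le_rootMultiplicity_iff hne, hchar]
      exact dvd_add (((pow_dvd_pow _ k.le_succ).trans hB1).mul_left _)
        ((hi1.mul_left _).mul_left _)
  refine ⟨M ε, h1, h2, ⟨hlam.pos, ?_, fun μ hμ => norm_le_of_entry_le hlam.pos.le
    (fun a b => (hM0 ε hε a b).1) (fun a b => (hM0 ε hε a b).2) hlam.le hμ⟩, hmul⟩
  exact (rootMultiplicity_pos hne).1 (by rw [hmul]; exact hk0)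

lemma exists_rootMultiplicity_eq_two (h : ReturnEntropyAnalyticAt r B) (hadm : IsAdmissible r B)
    (hlam : IsPerron B lam) (hk : 2 ≤ B.charpoly.rootMultiplicity lam) :
    ∃ X : Matrix (Fin n) (Fin n) ℝ, ReturnEntropyAnalyticAt r X ∧ IsAdmissible r X ∧
      IsPerron X lam ∧ X.charpoly.rootMultiplicity lam = 2 := by
  obtain ⟨k, hk2⟩ := Nat.exists_eq_add_of_le' hk
  clear hk
  induction k generalizing B with
  | zero => exact ⟨B, h, hadm, hlam, hk2⟩
  | succ k ih =>
    obtain ⟨X, h1, h2, h3, h4⟩ := exists_rootMultiplicity_pred h hadm hlam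
      (k := k + 2) (by omega) (by omega)
    exact ih h1 h2 h3 h4

end Multiplicity

end

/-! ### Splitting off a double Perron eigenvalue. -/

section
open scoped Matrix.Norms.Operator

variable {n : ℕ} {r : Fin n → ℝ} {B Q : Matrix (Fin n) (Fin n) ℝ} {lam : ℝ}

/-- `Q` is the projection onto the generalised eigenspace of `B` at `lam`, which has index at most
two and dimension at least two, and all other eigenvalues are smaller than `lam`. -/
structure IsSplitting (B Q : Matrix (Fin n) (Fin n) ℝ) (lam : ℝ) : Prop where
  comm : Commute B Q
  idem : Q * Q = Q
  sq : (lam⁻¹ • B - 1) * ((lam⁻¹ • B - 1) * Q) = 0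
  small : ∃ K, 0 < K ∧ ‖(lam⁻¹ • B * (1 - Q)) ^ K‖ < 1
  rank : 2 ≤ Q.rank

open Polynomial in
-- A Bézout identity between `(X - lam) ^ 2` and the cofactor of the characteristic polynomial,
-- evaluated at `B`.
lemma exists_projection (hk : B.charpoly.rootMultiplicity lam = 2) :
    ∃ Q U : Matrix (Fin n) (Fin n) ℝ, Commute B Q ∧ Commute B U ∧ Q * Q = Q ∧
      (B - lam • 1) ^ 2 * Q = 0 ∧ 1 - Q = U * (B - lam • 1) ^ 2 := by
  obtain ⟨g, hg, hg2⟩ := exists_eq_pow_rootMultiplicity_mul_and_not_dvd B.charpoly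
    B.charpoly_monic.ne_zero lam
  rw [hk] at hg
  have hco : IsCoprime ((X - C lam) ^ 2) g :=
    IsCoprime.pow_left ((irreducible_X_sub_C lam).coprime_iff_not_dvd.2 hg2)
  obtain ⟨u, v, huv⟩ := hco
  have hsq : aeval B ((X - C lam) ^ 2) = (B - lam • 1) ^ 2 := by
    simp [Algebra.algebraMap_eq_smul_one]
  have hzero : aeval B ((X - C lam) ^ 2 * g) = 0 := by rw [← hg]; exact aeval_self_charpoly B
  have hone : 1 - aeval B (v * g) = aeval B u * (B - lam • 1) ^ 2 := by
    rw [← hsq, ← map_mul, ← map_one (aeval (R := ℝ) B), ← map_sub, ← huv, add_sub_cancel_right]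
  have hcomm : ∀ p : ℝ[X], Commute B (aeval B p) := fun p => by
    have := (Commute.all X p).map (aeval B)
    rwa [aeval_X] at this
  have hsq0 : (B - lam • 1) ^ 2 * aeval B (v * g) = 0 := by
    rw [← hsq, ← map_mul, show (X - C lam) ^ 2 * (v * g) = v * ((X - C lam) ^ 2 * g) by ring,
      map_mul, hzero, mul_zero]
  refine ⟨aeval B (v * g), aeval B u, hcomm _, hcomm _, ?_, hsq0, hone⟩
  have h1 : (1 - aeval B (v * g)) * aeval B (v * g) = 0 := by
    rw [hone, Matrix.mul_assoc, hsq0, Matrix.mul_zero]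
  rw [Matrix.sub_mul, Matrix.one_mul, sub_eq_zero] at h1
  exact h1.symm

/-- On the generalised eigenspace `1 - Q = U (B - lam) ^ 2` is both idempotent and nilpotent, hence
zero; that space, whose dimension is the multiplicity, therefore lies in the range of `Q`. -/
lemma rootMultiplicity_le_rank {U : Matrix (Fin n) (Fin n) ℝ} (hU : Commute B U)
    (hQ : Commute B Q) (hQQ : Q * Q = Q) (h : 1 - Q = U * (B - lam • 1) ^ 2) :
    B.charpoly.rootMultiplicity lam ≤ Q.rank := by
  have h1 := LinearMap.finrank_maxGenEigenspace_eq (toLin' B) lam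
  rw [← LinearMap.charpoly_toMatrix (toLin' B) (Pi.basisFun ℝ (Fin n)),
    LinearMap.toMatrix_eq_toMatrix', LinearMap.toMatrix'_toLin'] at h1
  rw [← h1, Matrix.rank]
  refine Submodule.finrank_mono fun v hv => ?_
  obtain ⟨k, hk⟩ := Module.End.mem_maxGenEigenspace _ _ _ |>.1 hv
  have hk' : ((B - lam • 1) ^ k) *ᵥ v = 0 := by
    have h2 : toLin' B - lam • 1 = toLin' (B - lam • 1) := by
      rw [map_sub, map_smul, toLin'_one]; rfl
    rw [h2, ← toLin'_pow, toLin'_apply] at hk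
    exact hk
  refine ⟨v, ?_⟩
  rw [mulVecLin_apply]
  set w := (1 - Q) *ᵥ v with hw
  have hBl : Commute (B - lam • 1) Q := hQ.sub_left ((Commute.one_left Q).smul_left lam)
  have hBU : Commute (B - lam • 1) U := hU.sub_left ((Commute.one_left U).smul_left lam)
  have hwk : ((B - lam • 1) ^ k) *ᵥ w = 0 := by
    have h3 : Commute ((B - lam • 1) ^ k) (1 - Q) :=
      ((Commute.one_right _).sub_right hBl).pow_left k
    rw [hw, mulVec_mulVec, h3.eq, ← mulVec_mulVec, hk', mulVec_zero]
  have hfix : (1 - Q) *ᵥ w = w := by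
    rw [hw, mulVec_mulVec]
    congr 1
    rw [Matrix.sub_mul, Matrix.one_mul, Matrix.mul_sub, Matrix.mul_one, hQQ, sub_self, sub_zero]
  have hpow : ∀ j : ℕ, ((1 - Q) ^ j) *ᵥ w = w := by
    intro j
    induction j with
    | zero => simp
    | succ j ih => rw [pow_succ, ← mulVec_mulVec, hfix, ih]
  have h4 := hpow k
  rw [h, ((hBU.pow_left 2).symm).mul_pow, ← pow_mul, mul_comm 2 k, mul_two, pow_add,
    ← mulVec_mulVec, ← mulVec_mulVec, hwk, mulVec_zero, mulVec_zero] at h4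
  rw [hw, sub_mulVec, one_mulVec] at h4
  exact (sub_eq_zero.1 h4.symm).symm

/-- A small change of the matrix makes all eigenvalues except a double Perron eigenvalue smaller
than it. -/
lemma exists_isSplitting (h : ReturnEntropyAnalyticAt r B) (hadm : IsAdmissible r B)
    (hlam : IsPerron B lam) (hk : B.charpoly.rootMultiplicity lam = 2) :
    ∃ X Q : Matrix (Fin n) (Fin n) ℝ, ReturnEntropyAnalyticAt r X ∧ IsAdmissible r X ∧
      IsSplitting X Q lam := by
  obtain ⟨Q, U, hQ, hU, hQQ, hsq, hone⟩ := exists_projection hk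
  have hrank : 2 ≤ Q.rank := hk ▸ rootMultiplicity_le_rank hU hQ hQQ hone
  have hl := hlam.pos
  -- Adding `ε` and rescaling keeps `lam` as an eigenvalue and moves every other point of the disc
  -- of radius `lam` strictly inside: equality in `‖ν + ε‖ ≤ lam + ε` forces `ν = lam`.
  set M : ℝ → Matrix (Fin n) (Fin n) ℝ := fun ε => (lam / (lam + ε)) • (B + ε • 1) with hM
  have hMt : Tendsto M (𝓝[>] 0) (𝓝 B) := by
    have h1 : ContinuousAt M 0 := by
      have ha : ContinuousAt (fun ε : ℝ => lam / (lam + ε)) 0 :=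
        continuousAt_const.div (by fun_prop) (by simpa using hl.ne')
      have hb : ContinuousAt (fun ε : ℝ => B + ε • (1 : Matrix (Fin n) (Fin n) ℝ)) 0 :=
        continuousAt_const.add (continuousAt_id.smul continuousAt_const)
      exact ha.smul hb
    have h2 := h1.tendsto
    rw [hM] at h2
    simp only [add_zero, div_self hl.ne', one_smul, zero_smul] at h2
    exact h2.mono_left nhdsWithin_le_nhds
  have hM0 : ∀ᶠ ε in 𝓝[>] (0 : ℝ), ∀ i j, 0 ≤ M ε i j := by
    filter_upwards [self_mem_nhdsWithin] with ε hε i j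
    have hε : 0 < ε := hε
    have h1 := hadm.B_nonneg i j
    have h2 : (0 : ℝ) ≤ (1 : Matrix (Fin n) (Fin n) ℝ) i j := by
      rw [one_apply]; split_ifs <;> norm_num
    simp only [hM, Matrix.smul_apply, Matrix.add_apply, smul_eq_mul]
    positivity
  obtain ⟨ε, ⟨h1, h2⟩, hε⟩ := ((eventually_perturb_matrix h hadm hMt hM0).and
    (self_mem_nhdsWithin : Set.Ioi (0 : ℝ) ∈ 𝓝[>] 0)).exists
  have hε : 0 < ε := hε
  have hle : (lam + ε) ≠ 0 := by positivity
  have hX : lam⁻¹ • M ε = (lam + ε)⁻¹ • (B + ε • 1) := by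
    rw [hM]
    simp only
    rw [smul_smul]
    congr 1
    field_simp
  have hX1 : lam⁻¹ • M ε - 1 = (lam + ε)⁻¹ • (B - lam • 1) := by
    have h3 : (1 : Matrix (Fin n) (Fin n) ℝ) = (lam + ε)⁻¹ • ((lam + ε) • 1) := by
      rw [smul_smul, inv_mul_cancel₀ hle, one_smul]
    rw [hX]
    nth_rewrite 2 [h3]
    rw [← smul_sub, add_smul]
    congr 1
    abel
  have hcomm : Commute (M ε) Q := (hQ.add_left ((Commute.one_left Q).smul_left ε)).smul_left _
  refine ⟨M ε, Q, h1, h2, hcomm, hQQ, ?_, ?_, hrank⟩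
  · rw [hX1, Matrix.smul_mul, Matrix.smul_mul, Matrix.mul_smul, ← Matrix.mul_assoc, ← sq, hsq,
      smul_zero, smul_zero]
  · set Y := lam⁻¹ • M ε * (1 - Q) with hY
    have hroot : ∀ μ : ℂ, (Y.map Complex.ofReal).charpoly.IsRoot μ → ‖μ‖ < 1 := by
      intro μ hμ
      by_cases hμ0 : μ = 0
      · rw [hμ0, norm_zero]; exact one_pos
      obtain ⟨v, hv, hYv⟩ := isRoot_charpoly_iff_exists_mulVec.1 hμ
      have hmap : ∀ M₁ M₂ : Matrix (Fin n) (Fin n) ℝ, (M₁ * M₂).map Complex.ofReal =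
          M₁.map Complex.ofReal * M₂.map Complex.ofReal := fun M₁ M₂ =>
        map_mul Complex.ofRealHom.mapMatrix M₁ M₂
      have hQY : Q * Y = 0 := by
        have h3 : Q * (lam⁻¹ • M ε) = lam⁻¹ • M ε * Q := by
          rw [Matrix.mul_smul, Matrix.smul_mul, hcomm.eq]
        rw [hY, ← Matrix.mul_assoc, h3, Matrix.mul_assoc, Matrix.mul_sub, Matrix.mul_one, hQQ,
          sub_self, Matrix.mul_zero]
      have hQv : Q.map Complex.ofReal *ᵥ v = 0 := by
        have h3 : Q.map Complex.ofReal *ᵥ (Y.map Complex.ofReal *ᵥ v) = 0 := by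
          rw [mulVec_mulVec, ← hmap, hQY, map_ofReal_eq_zero.2 rfl, zero_mulVec]
        rw [hYv, mulVec_smul] at h3
        exact (smul_eq_zero.1 h3).resolve_left hμ0
      have hXv : (B.map Complex.ofReal) *ᵥ v = ((lam + ε) * μ - ε) • v := by
        have h3 : (lam + ε) • Y = (B + ε • 1) * (1 - Q) := by
          rw [hY, hX, Matrix.smul_mul, smul_smul, mul_inv_cancel₀ hle, one_smul]
        have h4 : (lam + ε) • Y + (B + ε • 1) * Q - ε • 1 = B := by
          rw [h3, Matrix.mul_sub, Matrix.mul_one]; abel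
        rw [← h4]
        have h5 : ((lam + ε) • Y + (B + ε • 1) * Q - ε • 1).map Complex.ofReal =
            ((lam : ℂ) + ε) • Y.map Complex.ofReal +
              (B + ε • 1).map Complex.ofReal * Q.map Complex.ofReal - (ε : ℂ) • 1 := by
          rw [← hmap]
          ext i j
          by_cases hij : i = j <;> simp [hij]
        rw [h5, sub_mulVec, add_mulVec, smul_mulVec, hYv, ← mulVec_mulVec, hQv, mulVec_zero,
          add_zero, smul_mulVec, one_mulVec, smul_smul, ← sub_smul]
      set ν : ℂ := (lam + ε) * μ - ε with hν
      have hνroot : (B.map Complex.ofReal).charpoly.IsRoot ν :=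
        isRoot_charpoly_iff_exists_mulVec.2 ⟨v, hv, hXv⟩
      have hνle := hlam.le ν hνroot
      have hνne : ν ≠ lam := by
        intro h3
        have h4 : (B - lam • 1).map Complex.ofReal *ᵥ v = 0 := by
          have h5 : (B - lam • 1).map Complex.ofReal = B.map Complex.ofReal - (lam : ℂ) • 1 := by
            ext i j
            by_cases hij : i = j <;> simp [hij]
          rw [h5, sub_mulVec, hXv, h3, smul_mulVec, one_mulVec, sub_self]
        have h6 : (1 - Q).map Complex.ofReal *ᵥ v = 0 := by
          rw [hone, sq, ← Matrix.mul_assoc, hmap, ← mulVec_mulVec, h4, mulVec_zero]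
        have h7 : (1 - Q).map Complex.ofReal = 1 - Q.map Complex.ofReal := by
          ext i j
          by_cases hij : i = j <;> simp [hij]
        rw [h7, sub_mulVec, one_mulVec, hQv, sub_zero] at h6
        exact hv h6
      have hμν : ((lam + ε : ℝ) : ℂ) * μ = ν + ε := by rw [hν]; push_cast; ring
      have h8 : ‖ν + ε‖ < lam + ε := by
        have hεn : ‖(ε : ℂ)‖ = ε := by rw [Complex.norm_real, Real.norm_of_nonneg hε.le]
        rcases hνle.lt_or_eq with h9 | h9
        · calc _ ≤ ‖ν‖ + ‖(ε : ℂ)‖ := norm_add_le _ _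
            _ < _ := by rw [hεn]; linarith
        · refine lt_of_le_of_ne ((norm_add_le _ _).trans (by rw [hεn, h9])) fun h10 => ?_
          have h11 : SameRay ℝ ν (ε : ℂ) := by
            rw [sameRay_iff_norm_add, h10, h9, hεn]
          rw [Complex.sameRay_iff] at h11
          rcases h11 with h11 | h11 | h11
          · rw [h11, norm_zero] at h9; exact hl.ne h9
          · exact hε.ne' (by exact_mod_cast h11)
          · rw [Complex.arg_ofReal_of_nonneg hε.le, Complex.arg_eq_zero_iff] at h11
            have h12 : ν = (ν.re : ℂ) := by
              rw [← Complex.re_add_im ν, h11.2]; simp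
            rw [h12, Complex.norm_real, Real.norm_of_nonneg h11.1] at h9
            exact hνne (by rw [h12, h9])
      rw [← hμν, norm_mul, Complex.norm_real, Real.norm_of_nonneg (by positivity)] at h8
      exact lt_of_mul_lt_mul_left (by rwa [mul_one]) (show 0 ≤ lam + ε by positivity)
    obtain ⟨K, hK, hlt⟩ := exists_norm_pow_lt one_pos hroot
    exact ⟨K, hK, by rwa [one_pow] at hlt⟩

namespace IsSplitting

/-- The nilpotent part of `lam⁻¹ • B` on the generalised eigenspace. -/
def nilPart (B Q : Matrix (Fin n) (Fin n) ℝ) (lam : ℝ) : Matrix (Fin n) (Fin n) ℝ :=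
  (lam⁻¹ • B - 1) * Q

lemma smul_mul_proj (B Q : Matrix (Fin n) (Fin n) ℝ) (lam : ℝ) :
    lam⁻¹ • B * Q = Q + nilPart B Q lam := by
  rw [nilPart, Matrix.sub_mul, Matrix.one_mul]; abel

lemma smul_mul_nilPart (h : IsSplitting B Q lam) :
    lam⁻¹ • B * nilPart B Q lam = nilPart B Q lam := by
  have h1 := h.sq
  rw [Matrix.sub_mul, Matrix.one_mul, sub_eq_zero] at h1
  exact h1

lemma pow_eq (h : IsSplitting B Q lam) (j : ℕ) : (lam⁻¹ • B) ^ j =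
    Q + (j : ℝ) • nilPart B Q lam + (lam⁻¹ • B * (1 - Q)) ^ j * (1 - Q) := by
  have hQ1 : (1 - Q) * (1 - Q) = 1 - Q := by
    rw [Matrix.sub_mul, Matrix.one_mul, Matrix.mul_sub, Matrix.mul_one, h.idem, sub_self, sub_zero]
  have hc : Commute (lam⁻¹ • B) (1 - Q) := (Commute.one_right _).sub_right (h.comm.smul_left _)
  induction j with
  | zero => simp
  | succ j ih =>
    rw [pow_succ', ih, Matrix.mul_add, Matrix.mul_add, smul_mul_proj, Matrix.mul_smul,
      h.smul_mul_nilPart, ← Matrix.mul_assoc]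
    have h1 : lam⁻¹ • B * (lam⁻¹ • B * (1 - Q)) ^ j * (1 - Q) =
        (lam⁻¹ • B * (1 - Q)) ^ (j + 1) * (1 - Q) := by
      have h2 : Commute (1 - Q) ((lam⁻¹ • B * (1 - Q)) ^ j) :=
        (hc.symm.mul_right (Commute.refl _)).pow_right j
      rw [pow_succ', Matrix.mul_assoc, Matrix.mul_assoc, Matrix.mul_assoc]
      congr 1
      rw [← Matrix.mul_assoc, h2.eq, Matrix.mul_assoc, hQ1]
    rw [h1]
    push_cast
    rw [add_smul, one_smul]
    abel

end IsSplitting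

end

/-! ### A semisimple multiple eigenvalue. -/

section
open scoped Matrix.Norms.Operator

variable {n : ℕ} {r : Fin n → ℝ} {B Q : Matrix (Fin n) (Fin n) ℝ} {lam : ℝ}

lemma nonneg_of_linear_growth {q x C θ : ℝ} {e : ℕ → ℝ} (hθ0 : 0 ≤ θ) (hθ1 : θ < 1)
    (he : ∀ j, |e j| ≤ C * θ ^ j) (h : ∀ j : ℕ, 0 ≤ q + j * x + e j) :
    0 ≤ x ∧ (x = 0 → 0 ≤ q) := by
  have hlim : Tendsto e atTop (𝓝 0) := by
    refine squeeze_zero_norm he ?_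
    simpa using (tendsto_pow_atTop_nhds_zero_of_lt_one hθ0 hθ1).const_mul C
  constructor
  · by_contra! hx
    have h1 : Tendsto (fun j : ℕ => q + j * x + e j) atTop atBot :=
      (tendsto_atBot_add_const_left atTop q
        (tendsto_natCast_atTop_atTop.atTop_mul_const_of_neg hx)).atBot_add hlim
    obtain ⟨j, hj⟩ := (h1.eventually_lt_atBot 0).exists
    exact absurd (h j) (not_le.2 hj)
  · rintro rfl
    have h1 : Tendsto (fun j : ℕ => q + j * 0 + e j) atTop (𝓝 q) := by
      simpa using hlim.const_add q
    exact ge_of_tendsto h1 (Eventually.of_forall h)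

namespace IsSplitting

/-- The exponentially small part of the powers of `lam⁻¹ • B`. -/
def remainder (B Q : Matrix (Fin n) (Fin n) ℝ) (lam : ℝ) (j : ℕ) : Matrix (Fin n) (Fin n) ℝ :=
  (lam⁻¹ • B * (1 - Q)) ^ j * (1 - Q)

lemma exists_remainder_bound (h : IsSplitting B Q lam) :
    ∃ C θ : ℝ, 0 < C ∧ 0 < θ ∧ θ < 1 ∧ ∀ j, ‖remainder B Q lam j‖ ≤ C * θ ^ j := by
  obtain ⟨K, hK, hlt⟩ := h.small
  obtain ⟨C, θ, hC, hθ0, hθ1, hb⟩ := exists_geometric_bound hK hlt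
  refine ⟨C * (‖1 - Q‖ + 1), θ, by positivity, hθ0, hθ1, fun j => ?_⟩
  refine (norm_mul_le _ _).trans ?_
  calc _ ≤ C * θ ^ j * (‖1 - Q‖ + 1) :=
        mul_le_mul (hb j) (by linarith) (norm_nonneg _) (by positivity)
    _ = _ := by ring

lemma bilin_pow (h : IsSplitting B Q lam) (v w : Fin n → ℝ) (j : ℕ) :
    v ⬝ᵥ ((lam⁻¹ • B) ^ j) *ᵥ w =
      v ⬝ᵥ Q *ᵥ w + j * (v ⬝ᵥ nilPart B Q lam *ᵥ w) + v ⬝ᵥ remainder B Q lam j *ᵥ w := by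
  rw [h.pow_eq, add_mulVec, add_mulVec, dotProduct_add, dotProduct_add, smul_mulVec,
    dotProduct_smul, smul_eq_mul, remainder]

lemma exists_bilin_remainder_bound (h : IsSplitting B Q lam) (v w : Fin n → ℝ) :
    ∃ C θ : ℝ, 0 < C ∧ 0 < θ ∧ θ < 1 ∧ ∀ j, |v ⬝ᵥ remainder B Q lam j *ᵥ w| ≤ C * θ ^ j := by
  obtain ⟨C, θ, hC, hθ0, hθ1, hb⟩ := h.exists_remainder_bound
  refine ⟨((∑ i, |v i|) * ‖w‖ + 1) * C, θ, by positivity, hθ0, hθ1, fun j => ?_⟩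
  refine (abs_bilin_le _ _ _).trans ?_
  rw [mul_assoc ((∑ i, |v i|) * ‖w‖ + 1)]
  exact mul_le_mul (by linarith) (hb j) (norm_nonneg _) (by positivity)

/-- The scaled powers are nonnegative and grow like `Q + j N`, so the coefficient of `j` is
nonnegative, and so is the constant one wherever the former vanishes. -/
lemma bilin_nonneg (h : IsSplitting B Q lam) (hlam : 0 < lam) (hB : ∀ i j, 0 ≤ B i j)
    {v w : Fin n → ℝ} (hv : ∀ i, 0 ≤ v i) (hw : ∀ i, 0 ≤ w i) :
    0 ≤ v ⬝ᵥ nilPart B Q lam *ᵥ w ∧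
      (v ⬝ᵥ nilPart B Q lam *ᵥ w = 0 → 0 ≤ v ⬝ᵥ Q *ᵥ w) := by
  obtain ⟨C, θ, -, hθ0, hθ1, hb⟩ := h.exists_bilin_remainder_bound v w
  refine nonneg_of_linear_growth hθ0.le hθ1 hb fun j => ?_
  rw [← h.bilin_pow]
  exact dotProduct_nonneg_of_nonneg hv (mulVec_entry_nonneg hw (pow_apply_nonneg
    (fun i j => mul_nonneg (inv_nonneg.2 hlam.le) (hB i j)) j))

lemma single_dotProduct_mulVec_single (M : Matrix (Fin n) (Fin n) ℝ) (i j : Fin n) :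
    (Pi.single i 1 : Fin n → ℝ) ⬝ᵥ M *ᵥ Pi.single j 1 = M i j := by
  simp [mulVec_single]

lemma single_nonneg (i j : Fin n) : (0 : ℝ) ≤ (Pi.single i 1 : Fin n → ℝ) j := by
  by_cases h : j = i
  · subst h; simp
  · simp [h]

lemma nilPart_nonneg (h : IsSplitting B Q lam) (hlam : 0 < lam) (hB : ∀ i j, 0 ≤ B i j)
    (i j : Fin n) : 0 ≤ nilPart B Q lam i j := by
  rw [← single_dotProduct_mulVec_single (nilPart B Q lam) i j]
  exact (h.bilin_nonneg hlam hB (single_nonneg i) (single_nonneg j)).1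

lemma proj_nonneg (h : IsSplitting B Q lam) (hlam : 0 < lam) (hB : ∀ i j, 0 ≤ B i j)
    (hN : nilPart B Q lam = 0) (i j : Fin n) : 0 ≤ Q i j := by
  rw [← single_dotProduct_mulVec_single Q i j]
  exact (h.bilin_nonneg hlam hB (single_nonneg i) (single_nonneg j)).2 (by simp [hN])

lemma mul_proj (hlam : 0 < lam) (hN : nilPart B Q lam = 0) : B * Q = lam • Q := by
  have h1 := smul_mul_proj B Q lam
  rw [hN, add_zero, Matrix.smul_mul] at h1
  conv_rhs => rw [← h1]
  rw [smul_smul, mul_inv_cancel₀ hlam.ne', one_smul]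

lemma bilin_pow_scaled (hlam : 0 < lam) (v w : Fin n → ℝ) (j : ℕ) :
    v ⬝ᵥ (B ^ j) *ᵥ w = lam ^ j * (v ⬝ᵥ ((lam⁻¹ • B) ^ j) *ᵥ w) := by
  rw [smul_pow, smul_mulVec, dotProduct_smul, smul_eq_mul, ← mul_assoc, ← mul_pow,
    mul_inv_cancel₀ hlam.ne', one_pow, one_mul]

/-- A multiple eigenvalue of index one destroys analyticity. -/
lemma false_of_nilPart_eq_zero (hs : IsSplitting B Q lam) (h : ReturnEntropyAnalyticAt r B)
    (hadm : IsAdmissible r B) (hlam : 0 < lam) (hlam1 : lam < 1)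
    (hN : nilPart B Q lam = 0) : False := by
  set c : Fin n → ℝ := 1 - B *ᵥ 1 with hc
  have hQ0 := hs.proj_nonneg hlam hadm.B_nonneg hN
  have hQne : Q ≠ 0 := by
    rintro rfl
    have := hs.rank
    rw [Matrix.rank_zero] at this
    omega
  have hBQ := mul_proj hlam hN
  have hQB : Q * B = lam • Q := by rw [← hs.comm.eq, hBQ]
  have hα0 := hadm.bilin_pos hQ0 hQne
  rw [← hc] at hα0
  set u := r ᵥ* Q with hu
  set w := Q *ᵥ c with hw
  set α := r ⬝ᵥ w with hα
  have hc0 : ∀ k, 0 < c k := hadm.one_sub_pos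
  have hu0 : ∀ k, 0 ≤ u k := vecMul_entry_nonneg (fun i => (hadm.r_pos i).le) hQ0
  -- If `α Q i k` were at least `u k w i` everywhere, pairing with the positive vector `c` would
  -- give equality, and `Q` would have rank one.
  obtain ⟨i, k, hik⟩ : ∃ i k, α * Q i k < u k * w i := by
    by_contra! hall
    have heq : ∀ i k, α * Q i k - u k * w i = 0 := by
      intro i
      have h1 : ∑ k, (α * Q i k - u k * w i) * c k = 0 := by
        have h2 : ∑ k, (α * Q i k - u k * w i) * c k =
            α * (∑ k, Q i k * c k) - (∑ k, u k * c k) * w i := by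
          rw [Finset.mul_sum, Finset.sum_mul, ← Finset.sum_sub_distrib]
          exact Finset.sum_congr rfl fun k _ => by ring
        have h3 : ∑ k, Q i k * c k = w i := rfl
        have h4 : ∑ k, u k * c k = α := by
          rw [hα, hw, dotProduct_mulVec]; rfl
        rw [h2, h3, h4, sub_self]
      intro k
      have h5 := (Finset.sum_eq_zero_iff_of_nonneg fun k _ => mul_nonneg
        (sub_nonneg.2 (hall i k)) (hc0 k).le).1 h1 k (Finset.mem_univ k)
      exact (mul_eq_zero.1 h5).resolve_right (hc0 k).ne'
    have hQv : Q = vecMulVec (α⁻¹ • w) u := by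
      ext i k
      have := heq i k
      rw [vecMulVec_apply, Pi.smul_apply, smul_eq_mul]
      field_simp
      linarith
    have h6 := hs.rank
    rw [hQv] at h6
    have := rank_vecMulVec_le (α⁻¹ • w) u
    omega
  have huk : 0 < u k := by
    refine (hu0 k).lt_of_ne fun h0 => ?_
    rw [← h0, zero_mul] at hik
    exact absurd hik (not_lt.2 (mul_nonneg hα0.le (hQ0 i k)))
  set t := u k + Q i k with ht
  have ht0 : 0 < t := add_pos_of_pos_of_nonneg huk (hQ0 i k)
  -- A rank-one eigenprojection made of column `k` and the row `u + Q i`. Its value `r P c = u k (α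
  -- + w i) / (u k + Q i k)` exceeds `α` exactly by the choice of `i` and `k`, whereas `r B ^ j c /
  -- lam ^ j` tends to `α`.
  set P : Matrix (Fin n) (Fin n) ℝ := t⁻¹ • (vecMulVec (fun m => Q m k) (u + Q i)) with hP
  have hP0 : ∀ a b, 0 ≤ P a b := fun a b => by
    rw [hP, Matrix.smul_apply, vecMulVec_apply, smul_eq_mul, Pi.add_apply]
    have := hu0 b
    have := hQ0 i b
    have := hQ0 a k
    positivity
  have hcol : (fun m => Q m k) = Q *ᵥ Pi.single k 1 := by
    ext m; simp [mulVec_single]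
  have hrow : Q i = Pi.single i 1 ᵥ* Q := by ext m; simp
  have hrowQ : (u + Q i) ᵥ* Q = u + Q i := by
    rw [hrow, hu, ← add_vecMul, vecMul_vecMul, hs.idem]
  have hdot : (u + Q i) ⬝ᵥ (fun m => Q m k) = t := by
    rw [hcol, dotProduct_mulVec, hrowQ]
    simp [ht]
  have hBP : B * P = lam • P := by
    rw [hP, Matrix.mul_smul, mul_vecMulVec]
    have : B *ᵥ (fun m => Q m k) = lam • fun m => Q m k := by
      rw [hcol, mulVec_mulVec, hBQ, smul_mulVec]
    rw [this, smul_vecMulVec, smul_comm]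
  have hPB : P * B = lam • P := by
    rw [hP, Matrix.smul_mul, vecMulVec_mul]
    have : (u + Q i) ᵥ* B = lam • (u + Q i) := by
      conv_lhs => rw [← hrowQ]
      rw [vecMul_vecMul, hQB, vecMul_smul, hrowQ]
    rw [this, vecMulVec_smul, smul_comm]
  have hPP : P * P = P := by
    rw [hP, Matrix.smul_mul, Matrix.mul_smul, vecMulVec_mul_vecMulVec, hdot, vecMulVec_smul,
      smul_smul, smul_smul]
    congr 1
    field_simp
  have hPc : r ⬝ᵥ P *ᵥ c = t⁻¹ * (u k * (α + w i)) := by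
    rw [hP, smul_mulVec, dotProduct_smul, smul_eq_mul]
    congr 1
    have h1 : vecMulVec (fun m => Q m k) (u + Q i) *ᵥ c = ((u + Q i) ⬝ᵥ c) • fun m => Q m k := by
      ext m
      simp only [mulVec, dotProduct, vecMulVec_apply, Pi.smul_apply, smul_eq_mul, Finset.sum_mul]
      exact Finset.sum_congr rfl fun x _ => by ring
    have h2 : (u + Q i) ⬝ᵥ c = α + w i := by
      rw [add_dotProduct, hu, ← dotProduct_mulVec]; rfl
    have h3 : r ⬝ᵥ (fun m => Q m k) = u k := rfl
    rw [h1, dotProduct_smul, h2, h3, smul_eq_mul, mul_comm]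
  have hgt : α < r ⬝ᵥ P *ᵥ c := by
    rw [hPc, lt_inv_mul_iff₀ ht0, ht]
    nlinarith
  obtain ⟨c₀, hc₀, hlow⟩ := hadm.exists_lower_bound hQ0 hQne hBQ
  refine h.not_frequently_le hadm hlam hlam1 hP0 hPP hBP hPB (hα0.trans hgt) hc₀ hlow
    (η := (r ⬝ᵥ P *ᵥ c - α) / 2) (by linarith) (Eventually.frequently ?_)
  obtain ⟨C, θ, -, hθ0, hθ1, hb⟩ := hs.exists_bilin_remainder_bound r c
  have hlim : Tendsto (fun j => r ⬝ᵥ remainder B Q lam j *ᵥ c) atTop (𝓝 0) := by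
    refine squeeze_zero_norm hb ?_
    simpa using (tendsto_pow_atTop_nhds_zero_of_lt_one hθ0.le hθ1).const_mul C
  filter_upwards [hlim.eventually (gt_mem_nhds (show 0 < (r ⬝ᵥ P *ᵥ c - α) / 2 by linarith))]
    with j hj
  rw [← hc, bilin_pow_scaled hlam, hs.bilin_pow, hN, zero_mulVec, dotProduct_zero, mul_zero,
    add_zero]
  refine mul_le_mul_of_nonneg_left ?_ (by positivity)
  rw [← hw, ← hα]
  linarith

end IsSplitting

end

/-! ### A Jordan block of size two. -/

section
open scoped Matrix.Norms.Operator

variable {n : ℕ} {r : Fin n → ℝ} {B Q : Matrix (Fin n) (Fin n) ℝ} {lam : ℝ}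

section RankOne

variable {X : Matrix (Fin n) (Fin n) ℝ} {u q ℓ : Fin n → ℝ} {x : ℝ}

lemma vecMul_add_smul_vecMulVec (v : Fin n → ℝ) :
    v ᵥ* (X + x • vecMulVec ℓ q) = v ᵥ* X + (x * (v ⬝ᵥ ℓ)) • q := by
  rw [vecMul_add, vecMul_smul]
  congr 1
  ext i
  simp only [vecMul, dotProduct, vecMulVec_apply, Pi.smul_apply, smul_eq_mul, Finset.mul_sum,
    Finset.sum_mul]
  exact Finset.sum_congr rfl fun m _ => by ring

lemma vecMul_rankOne_pow_fixed (hu : u ᵥ* X = u) (huℓ : u ⬝ᵥ ℓ = 0) (j : ℕ) :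
    u ᵥ* (X + x • vecMulVec ℓ q) ^ j = u := by
  induction j with
  | zero => simp
  | succ j ih =>
    rw [pow_succ, ← vecMul_vecMul, ih, vecMul_add_smul_vecMulVec, hu, huℓ, mul_zero, zero_smul,
      add_zero]

/-- On the span of `q` and `u` the matrix `X` is a Jordan block; the rank-one term moves one of the
two eigenvalues to `1 + x`, and `((1 + x) ^ j - 1) / x` replaces the linear growth `j`. -/
lemma vecMul_rankOne_pow_of_eq_add (hx : x ≠ 0) (hu : u ᵥ* X = u) (huℓ : u ⬝ᵥ ℓ = 0)
    (hq : q ᵥ* X = q + u) (hqℓ : q ⬝ᵥ ℓ = 1) (j : ℕ) :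
    q ᵥ* (X + x • vecMulVec ℓ q) ^ j =
      ((1 + x) ^ j) • q + (((1 + x) ^ j - 1) / x) • u := by
  induction j with
  | zero => simp
  | succ j ih =>
    rw [pow_succ, ← vecMul_vecMul, ih, vecMul_add_smul_vecMulVec, add_vecMul, smul_vecMul,
      smul_vecMul, hq, hu, add_dotProduct, smul_dotProduct, smul_dotProduct, hqℓ, huℓ]
    ext i
    simp only [Pi.add_apply, Pi.smul_apply, smul_eq_mul]
    field_simp
    ring

lemma vecMul_rankOne_pow (hx : x ≠ 0) (hu : u ᵥ* X = u) (huℓ : u ⬝ᵥ ℓ = 0)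
    (hq : q ᵥ* X = q + u) (hqℓ : q ⬝ᵥ ℓ = 1) (hXℓ : X *ᵥ ℓ = ℓ) (hrℓ : r ⬝ᵥ ℓ = 1) (j : ℕ) :
    r ᵥ* (X + x • vecMulVec ℓ q) ^ j =
      r ᵥ* X ^ j + ((1 + x) ^ j - 1) • q + (((1 + x) ^ j - 1) / x - j) • u := by
  have hXj : ∀ j : ℕ, (r ᵥ* X ^ j) ⬝ᵥ ℓ = 1 := by
    intro j
    induction j with
    | zero => simpa using hrℓ
    | succ j ih => rw [pow_succ, ← vecMul_vecMul, ← dotProduct_mulVec, hXℓ, ih]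
  induction j with
  | zero => simp
  | succ j ih =>
    rw [pow_succ, ← vecMul_vecMul, ih, vecMul_add_smul_vecMulVec, add_vecMul, add_vecMul,
      smul_vecMul, smul_vecMul, hq, hu, add_dotProduct, add_dotProduct, smul_dotProduct,
      smul_dotProduct, hqℓ, huℓ, hXj, vecMul_vecMul, ← pow_succ]
    ext i
    simp only [Pi.add_apply, Pi.smul_apply, smul_eq_mul]
    push_cast
    field_simp
    ring

end RankOne

/-- The corrections `ρ₁` and `ρ₂` to the row are the solution of two linear equations, obtained by
matching the part proportional to `E = exp (j δ)` and the part independent of `j` with the target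
family. -/
lemma linear_family_identity {β s δ x κ₁ qc rq J E H ν D ρ₁ ρ₂ j : ℝ} (hδ : δ ≠ 0) (hx : x ≠ 0)
    (hD0 : D ≠ 0) (hD : D = β + x * qc - x ^ 2 * κ₁) (hJ : qc = rq + J * β)
    (hρ₁ : ρ₁ = (β + s * δ) * H * (x / δ) / D - 1)
    (hρ₂ : ρ₂ = (β * H / D - 1) / δ + s * H / D + J) :
    (rq + j * β + ν + (E - 1) * qc + ((E - 1) / x - j) * β + ρ₁ * (E * qc + (E - 1) / x * β) +
      ρ₂ * β) - x * κ₁ * (1 + (E - 1) + ρ₁ * E) =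
      β * ((E * H - 1) / δ) + s * (E * H) + ν := by
  have hκ : κ₁ = (β + x * qc - D) / x ^ 2 := by rw [hD]; field_simp; ring
  have hr : rq = qc - J * β := by rw [hJ]; ring
  rw [hκ, hr, hρ₁, hρ₂]
  field_simp
  ring

lemma analyticAt_dslope {f : ℝ → ℝ} (hf : AnalyticAt ℝ f 0) : AnalyticAt ℝ (dslope f 0) 0 := by
  obtain ⟨p, hp⟩ := hf
  exact ⟨_, hp.has_fpower_series_dslope_fslope⟩

namespace IsSplitting

lemma nilPart_mul_nilPart (h : IsSplitting B Q lam) :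
    nilPart B Q lam * nilPart B Q lam = 0 := by
  have hc : Commute (lam⁻¹ • B - 1) Q := (h.comm.smul_left _).sub_left (Commute.one_left Q)
  have h1 := h.sq
  rw [nilPart, Matrix.mul_assoc, ← Matrix.mul_assoc Q, ← hc.eq, Matrix.mul_assoc, h.idem, h1]

lemma proj_mul_nilPart (h : IsSplitting B Q lam) : Q * nilPart B Q lam = nilPart B Q lam := by
  have hc : Commute (lam⁻¹ • B - 1) Q := (h.comm.smul_left _).sub_left (Commute.one_left Q)
  rw [nilPart, ← Matrix.mul_assoc, ← hc.eq, Matrix.mul_assoc, h.idem]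

lemma commute_nilPart (h : IsSplitting B Q lam) : Commute (lam⁻¹ • B) (nilPart B Q lam) :=
  ((Commute.refl _).sub_right (Commute.one_right _)).mul_right (h.comm.smul_left _)

/-- A multiple of `r N ≥ 0` compensates negative entries of `r Q`, which can occur only where `r N`
is positive. The resulting row keeps the rank-one perturbation of `B` nonnegative. -/
lemma exists_row_nonneg (h : IsSplitting B Q lam) (hlam : 0 < lam) (hB : ∀ i j, 0 ≤ B i j)
    (hr : ∀ i, 0 ≤ r i) : ∃ J : ℕ, ∀ i, 0 ≤ (r ᵥ* Q + (J : ℝ) • (r ᵥ* nilPart B Q lam)) i := by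
  have h1 : ∀ i, ∀ᶠ J : ℕ in atTop, 0 ≤ (r ᵥ* Q + (J : ℝ) • (r ᵥ* nilPart B Q lam)) i := by
    intro i
    have h2 := h.bilin_nonneg hlam hB hr (single_nonneg i)
    rw [dotProduct_mulVec, dotProduct_mulVec, dotProduct_single_one, dotProduct_single_one] at h2
    simp only [Pi.add_apply, Pi.smul_apply, smul_eq_mul]
    rcases h2.1.eq_or_lt with h3 | h3
    · rw [← h3]
      have := h2.2 h3.symm
      exact Eventually.of_forall fun J => by linarith
    · exact (tendsto_atTop_add_const_left atTop _
        (tendsto_natCast_atTop_atTop.atTop_mul_const h3)).eventually_ge_atTop 0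
  exact (eventually_all.2 h1).exists

/-- A multiple eigenvalue of index two destroys analyticity. -/
lemma false_of_nilPart_ne_zero (hs : IsSplitting B Q lam) (h : ReturnEntropyAnalyticAt r B)
    (hadm : IsAdmissible r B) (hlam : 0 < lam) (hlam1 : lam < 1)
    (hN : nilPart B Q lam ≠ 0) : False := by
  obtain ⟨J, hJ⟩ := hs.exists_row_nonneg (r := r) hlam hadm.B_nonneg fun i => (hadm.r_pos i).le
  set N := nilPart B Q lam with hNdef
  set c : Fin n → ℝ := 1 - B *ᵥ 1 with hc
  have hN0 := hs.nilPart_nonneg hlam hadm.B_nonneg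
  have hβ := hadm.bilin_pos hN0 hN
  rw [← hc, ← hNdef] at hβ
  set X := lam⁻¹ • B with hX
  set β := r ⬝ᵥ N *ᵥ c with hβdef
  set u := r ᵥ* N with hu
  set q := r ᵥ* Q + (J : ℝ) • u with hq
  set ℓ := β⁻¹ • (N *ᵥ c) with hℓ
  have hXN : X * N = N := hs.smul_mul_nilPart
  have hNX : N * X = N := by rw [← hs.commute_nilPart.eq]; exact hXN
  have hQX : Q * X = Q + N := by
    rw [hX, ← (hs.comm.smul_left lam⁻¹).eq]; exact smul_mul_proj B Q lam
  have huX : u ᵥ* X = u := by rw [hu, vecMul_vecMul, hNX]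
  have hqX : q ᵥ* X = q + u := by
    rw [hq, add_vecMul, smul_vecMul, huX, vecMul_vecMul, hQX, vecMul_add, ← hu]; abel
  have hXℓ : X *ᵥ ℓ = ℓ := by rw [hℓ, mulVec_smul, mulVec_mulVec, hXN]
  have huc : u ⬝ᵥ c = β := by rw [hu, ← dotProduct_mulVec]
  have hrℓ : r ⬝ᵥ ℓ = 1 := by
    rw [hℓ, dotProduct_smul, smul_eq_mul, ← hβdef, inv_mul_cancel₀ hβ.ne']
  have huℓ : u ⬝ᵥ ℓ = 0 := by
    rw [hℓ, dotProduct_smul, hu, ← dotProduct_mulVec, mulVec_mulVec, hs.nilPart_mul_nilPart,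
      zero_mulVec, dotProduct_zero, smul_zero]
  have hqℓ : q ⬝ᵥ ℓ = 1 := by
    rw [hq, add_dotProduct, smul_dotProduct, huℓ, smul_zero, add_zero, ← dotProduct_mulVec, hℓ,
      mulVec_smul, mulVec_mulVec, hs.proj_mul_nilPart, ← hNdef, ← hℓ, hrℓ]
  have hℓ0 : ∀ i, 0 ≤ ℓ i := fun i => mul_nonneg (inv_nonneg.2 hβ.le)
    (mulVec_entry_nonneg (fun j => (hadm.one_sub_pos j).le) hN0 i)
  set rq := r ⬝ᵥ Q *ᵥ c with hrq
  set qc := q ⬝ᵥ c with hqc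
  have hqcJ : qc = rq + J * β := by
    rw [hqc, hq, add_dotProduct, smul_dotProduct, huc, ← dotProduct_mulVec, smul_eq_mul]
  set κ₁ := lam * (q ⬝ᵥ 1) with hκ₁
  -- With this shift the unperturbed values are `lam ^ j * (β * (j + a) + ν j)`, with `ν` the
  -- remainder.
  set a := rq / β with ha
  set D : ℝ → ℝ := fun δ => β + (Real.exp δ - 1) * qc - (Real.exp δ - 1) ^ 2 * κ₁ with hD
  have hDan : AnalyticAt ℝ D 0 := by
    have h1 : AnalyticAt ℝ (fun δ : ℝ => Real.exp δ - 1) 0 :=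
      analyticAt_rexp.fun_sub analyticAt_const
    exact (analyticAt_const.fun_add (h1.fun_mul analyticAt_const)).fun_sub
      ((h1.fun_pow 2).fun_mul analyticAt_const)
  have hD0 : D 0 = β := by simp [hD]
  have hDan2 : AnalyticAt ℝ (fun p : ℝ × ℝ => D p.2) 0 :=
    AnalyticAt.comp (g := D) (f := fun p : ℝ × ℝ => p.2) hDan analyticAt_snd
  set ψ : ℝ → ℝ := fun δ => β * Real.exp (a * δ) / D δ with hψ
  have hψan : AnalyticAt ℝ ψ 0 := by
    refine AnalyticAt.fun_div (analyticAt_const.fun_mul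
      (analyticAt_const.fun_mul analyticAt_id).rexp) hDan (by rw [hD0]; exact hβ.ne')
  have hψ0 : ψ 0 = 1 := by simp [hψ, hD0, hβ.ne']
  have hψd : deriv ψ 0 = -J := by
    have h1 : HasDerivAt (fun δ : ℝ => Real.exp δ - 1) 1 0 := by
      simpa using (Real.hasDerivAt_exp 0).sub_const 1
    have h2 : HasDerivAt D qc 0 := by
      have h3 := ((h1.mul_const qc).const_add β).sub ((h1.pow 2).mul_const κ₁)
      refine (h3.congr_deriv ?_)
      simp
    have h4 : HasDerivAt (fun δ : ℝ => β * Real.exp (a * δ)) (β * a) 0 := by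
      have h5 : HasDerivAt (fun δ : ℝ => a * δ) a 0 := by
        simpa using (hasDerivAt_id (0 : ℝ)).const_mul a
      have h6 := h5.exp.const_mul β
      simpa using h6
    have h7 := h4.div h2 (by rw [hD0]; exact hβ.ne')
    have h8 : deriv ψ 0 = _ := h7.deriv
    rw [h8, hD0, mul_zero, Real.exp_zero, hqcJ, ha]
    field_simp
    ring
  have hdsan : AnalyticAt ℝ (fun p : ℝ × ℝ => dslope ψ 0 p.2) 0 :=
    AnalyticAt.comp (g := dslope ψ 0) (f := fun p : ℝ × ℝ => p.2) (analyticAt_dslope hψan)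
      analyticAt_snd
  have hdean : AnalyticAt ℝ (fun p : ℝ × ℝ => dslope Real.exp 0 p.2) 0 :=
    AnalyticAt.comp (g := dslope Real.exp 0) (f := fun p : ℝ × ℝ => p.2) analyticAt_dslope_exp
      analyticAt_snd
  have hexan : AnalyticAt ℝ (fun p : ℝ × ℝ => Real.exp (a * p.2)) 0 :=
    (analyticAt_const.fun_mul analyticAt_snd).rexp
  have hD2 : D (0 : ℝ × ℝ).2 ≠ 0 := by rw [Prod.snd_zero, hD0]; exact hβ.ne'
  -- The quotients by `δ` in the corrections are written with `dslope`, which is analytic across `δ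
  -- = 0`. Both corrections vanish at the origin, the second because the derivative of `ψ` at zero
  -- is `-J`.
  set ρ₁ : ℝ × ℝ → ℝ := fun p =>
    (β + p.1 * p.2) * Real.exp (a * p.2) * dslope Real.exp 0 p.2 / D p.2 - 1 with hρ₁
  set ρ₂ : ℝ × ℝ → ℝ := fun p =>
    dslope ψ 0 p.2 + p.1 * Real.exp (a * p.2) / D p.2 + J with hρ₂
  have hρ₁an : AnalyticAt ℝ ρ₁ 0 :=
    (((((analyticAt_const.fun_add (analyticAt_fst.fun_mul analyticAt_snd)).fun_mul hexan).fun_mul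
      hdean)).fun_div hDan2 hD2).fun_sub analyticAt_const
  have hρ₂an : AnalyticAt ℝ ρ₂ 0 :=
    (hdsan.fun_add ((analyticAt_fst.fun_mul hexan).fun_div hDan2 hD2)).fun_add analyticAt_const
  have hρ₁0 : ρ₁ 0 = 0 := by simp [hρ₁, hD0, hβ.ne']
  have hρ₂0 : ρ₂ 0 = 0 := by simp [hρ₂, hψd]
  set R : ℝ × ℝ → Fin n → ℝ := fun p => r + ρ₁ p • q + ρ₂ p • u with hR
  set M : ℝ × ℝ → Matrix (Fin n) (Fin n) ℝ :=
    fun p => B + (lam * (Real.exp p.2 - 1)) • vecMulVec ℓ q with hM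
  have hRan : AnalyticAt ℝ R 0 :=
    (analyticAt_const.fun_add (hρ₁an.fun_smul analyticAt_const)).fun_add
      (hρ₂an.fun_smul analyticAt_const)
  have hMan : AnalyticAt ℝ M 0 :=
    analyticAt_const.fun_add ((analyticAt_const.fun_mul
      (analyticAt_snd.rexp.fun_sub analyticAt_const)).fun_smul analyticAt_const)
  obtain ⟨G, hG, hG2⟩ := h.exists_hasSum hadm hRan hMan (by simp [hR, hρ₁0, hρ₂0]) (by simp [hM])
  obtain ⟨C, θ, -, hθ0, hθ1, hb⟩ := hs.exists_bilin_remainder_bound r c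
  have hβa : β * a = rq := by rw [ha]; field_simp
  have hBN : B * N = lam • N := by
    have h1 := hXN
    rw [hX, Matrix.smul_mul] at h1
    conv_rhs => rw [← h1]
    rw [smul_smul, mul_inv_cancel₀ hlam.ne', one_smul]
  obtain ⟨c₀, hc₀, hlow⟩ := hadm.exists_lower_bound hN0 hN hBN
  refine false_of_analytic_linear (h := a) (G := G) hlam hlam1 hβ hθ0 hθ1 hb (fun j => ?_) hG ?_
  · have h1 := hlow j
    rw [← hc, bilin_pow_scaled hlam, hs.bilin_pow, mul_comm c₀] at h1
    have h2 := le_of_mul_le_mul_left h1 (pow_pos hlam j)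
    rw [← hrq, ← hNdef, ← hβdef] at h2
    rw [mul_add, hβa]
    linarith
  · filter_upwards [hG2, hDan2.continuousAt.eventually_ne hD2] with p hp hDp h0
    have hx : 0 < Real.exp p.2 - 1 := by
      have := Real.add_one_lt_exp h0.ne'
      linarith
    have hs' := hp fun i j => by
      have := hadm.B_nonneg i j
      have := hℓ0 i
      have := hJ j
      simp only [hM, Matrix.add_apply, Matrix.smul_apply, vecMulVec_apply, smul_eq_mul]
      positivity
    have hterm : ∀ j : ℕ, R p ⬝ᵥ (M p ^ j) *ᵥ (1 - M p *ᵥ 1) =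
        lam ^ j * (β * ((Real.exp ((j + a) * p.2) - 1) / p.2) +
          p.1 * Real.exp ((j + a) * p.2) + r ⬝ᵥ remainder B Q lam j *ᵥ c) := by
      intro j
      set x := Real.exp p.2 - 1 with hxdef
      have hMp : M p = lam • (X + x • vecMulVec ℓ q) := by
        rw [hM, smul_add, hX, smul_smul, smul_smul, mul_inv_cancel₀ hlam.ne', one_smul]
      have h1 : (1 : Fin n → ℝ) - M p *ᵥ 1 = c - (x * κ₁) • ℓ := by
        have h2 : vecMulVec ℓ q *ᵥ 1 = (q ⬝ᵥ 1) • ℓ := by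
          ext i
          simp only [mulVec, dotProduct, vecMulVec_apply, Pi.one_apply, mul_one, Pi.smul_apply,
            smul_eq_mul, Finset.sum_mul]
          exact Finset.sum_congr rfl fun m _ => by ring
        rw [hM]
        simp only
        rw [add_mulVec, smul_mulVec, h2, smul_smul, hc, hκ₁, ← hxdef,
          show lam * x * (q ⬝ᵥ 1) = x * (lam * (q ⬝ᵥ 1)) by ring]
        abel
      have hE : (1 + x) ^ j = Real.exp (j * p.2) := by
        rw [hxdef, add_sub_cancel, Real.exp_nat_mul]
      have hEH : Real.exp ((j + a) * p.2) = Real.exp (j * p.2) * Real.exp (a * p.2) := by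
        rw [← Real.exp_add]; congr 1; ring
      rw [h1, hMp, smul_pow, smul_mulVec, dotProduct_smul, smul_eq_mul, dotProduct_mulVec, hR]
      congr 1
      simp only
      rw [add_vecMul, add_vecMul, smul_vecMul, smul_vecMul,
        vecMul_rankOne_pow hx.ne' huX huℓ hqX hqℓ hXℓ hrℓ,
        vecMul_rankOne_pow_of_eq_add hx.ne' huX huℓ hqX hqℓ, vecMul_rankOne_pow_fixed huX huℓ]
      have hXjℓ : (r ᵥ* X ^ j) ⬝ᵥ ℓ = 1 := by
        have h3 : ∀ j : ℕ, (X ^ j) *ᵥ ℓ = ℓ := by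
          intro j
          induction j with
          | zero => simp
          | succ j ih => rw [pow_succ, ← mulVec_mulVec, hXℓ, ih]
        rw [← dotProduct_mulVec, h3, hrℓ]
      have hXjc : (r ᵥ* X ^ j) ⬝ᵥ c = rq + j * β + r ⬝ᵥ remainder B Q lam j *ᵥ c := by
        rw [← dotProduct_mulVec, hX, hs.bilin_pow]
      have hfin := linear_family_identity (β := β) (s := p.1) (δ := p.2) (x := x) (κ₁ := κ₁)
        (qc := qc) (rq := rq) (J := J) (E := Real.exp (j * p.2)) (H := Real.exp (a * p.2))
        (ν := r ⬝ᵥ remainder B Q lam j *ᵥ c) (D := D p.2) (ρ₁ := ρ₁ p) (ρ₂ := ρ₂ p) (j := j)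
        h0.ne' hx.ne' hDp rfl hqcJ (by
          have := mul_dslope_exp 1 h0.ne'
          rw [one_mul, one_mul] at this
          simp only [hρ₁]
          rw [this, ← hxdef]) (by
          simp only [hρ₂]
          rw [dslope_of_ne _ h0.ne', slope_def_field, hψ0, sub_zero])
      rw [hEH, ← hfin, hE]
      simp only [dotProduct_sub, add_dotProduct, dotProduct_smul, smul_dotProduct, smul_eq_mul,
        hXjℓ, hXjc, huℓ, hqℓ, huc, ← hqc, smul_add]
      ring
    simp only [hterm] at hs'
    exact hs'

end IsSplitting

/-- If the return entropy is analytic, the Perron eigenvalue is simple and dominant. -/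
lemma hasSimpleDominantEigenvalue_of_analyticAt (h : ReturnEntropyAnalyticAt r B)
    (hadm : IsAdmissible r B) {ν : ℂ} (hν : (B.map Complex.ofReal).charpoly.IsRoot ν)
    (hν0 : ν ≠ 0) : HasSimpleDominantEigenvalue B := by
  obtain ⟨lam, hlam⟩ := exists_isPerron hadm.B_nonneg hν hν0
  have hne : B.charpoly ≠ 0 := B.charpoly_monic.ne_zero
  have hpos := (Polynomial.rootMultiplicity_pos hne).2 hlam.root
  have hone : B.charpoly.rootMultiplicity lam = 1 := by
    by_contra hcon
    obtain ⟨X, h1, h2, h3, h4⟩ := exists_rootMultiplicity_eq_two h hadm hlam (by omega)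
    obtain ⟨Y, Q, h5, h6, hs⟩ := exists_isSplitting h1 h2 h3 h4
    have hlt := h3.lt_one h2.isTransient
    by_cases hN : IsSplitting.nilPart Y Q lam = 0
    · exact hs.false_of_nilPart_eq_zero h5 h6 hlam.pos hlt hN
    · exact hs.false_of_nilPart_ne_zero h5 h6 hlam.pos hlt hN
  have hd : B.charpoly.derivative.eval lam ≠ 0 := fun h0 => by
    have := (Polynomial.one_lt_rootMultiplicity_iff_isRoot hne).2 ⟨hlam.root, h0⟩
    omega
  refine ⟨lam, ?_, fun μ hμ hμne => ?_⟩
  · rw [charpoly_map_ofReal]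
    have := Polynomial.eq_rootMultiplicity_map (p := B.charpoly) (f := Complex.ofRealHom)
      Complex.ofRealHom.injective lam
    rw [← hone, this]
    rfl
  · rw [Complex.norm_real, Real.norm_of_nonneg hlam.pos.le]
    exact norm_lt_of_simple h hadm hlam hd hμ hμne

end

/-! ### Necessity for an arbitrary irreducible matrix. -/

section
open scoped Matrix.Norms.Operator

variable {n : ℕ} {Δ : Matrix (Fin (n + 1)) (Fin (n + 1)) ℝ}

/-- Admissibility is reached without touching the spectrum. Adding `ε` to every entry of `r` makes
it positive, and conjugating `B` by `1 + ε v` with `v = (1 - B)⁻¹ 1` lowers all row sums below one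
because `B v = v - 1`. Positivity of the return probabilities supplies a nonzero eigenvalue. -/
lemma hasSimpleDominantEigenvalue_of_loopEntropyAnalyticAt
    (hΔ : Δ ∈ rowStochastic ℝ (Fin (n + 1))) (hB : IsTransient (blockB Δ))
    (hpos : PositivityCondition Δ) (h : LoopEntropyAnalyticAt Δ) :
    HasSimpleDominantEigenvalue (blockB Δ) := by
  set B := blockB Δ with hBdef
  set r := blockR Δ with hrdef
  have hB0 : ∀ i j, 0 ≤ B i j := blockB_nonneg hΔ.1
  have hr0 : ∀ i, 0 ≤ r i := blockR_nonneg hΔ.1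
  have hB1 : B *ᵥ 1 = 1 - blockC Δ := blockB_mulVec_one hΔ.2
  have hrsum : ∑ i, r i < 1 := by
    have := hpos.1
    rw [blockR_sum hΔ.2]; linarith
  obtain ⟨ν, hν, hν0⟩ : ∃ ν : ℂ, (B.map Complex.ofReal).charpoly.IsRoot ν ∧ ν ≠ 0 := by
    by_contra! hall
    have h1 := hpos.2 n
    rw [← hBdef, pow_eq_zero_of_forall_root hall, zero_mulVec, dotProduct_zero] at h1
    exact lt_irrefl _ h1
  set v : Fin n → ℝ := (1 - B)⁻¹ *ᵥ 1 with hv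
  have hv0 : ∀ i, 0 ≤ v i := mulVec_entry_nonneg (fun _ => zero_le_one) (hB.inv_nonneg hB0)
  have hBv : B *ᵥ v = v - 1 := by
    have h1 : (1 - B) *ᵥ v = 1 := by
      rw [hv, mulVec_mulVec, mul_nonsing_inv _ ((isUnit_iff_isUnit_det _).1 hB.isUnit_one_sub),
        one_mulVec]
    rw [sub_mulVec, one_mulVec] at h1
    rw [← h1]; abel
  have hrt : Tendsto (fun ε : ℝ => r + ε • (1 : Fin n → ℝ)) (𝓝 0) (𝓝 r) := by
    have : Continuous fun ε : ℝ => r + ε • (1 : Fin n → ℝ) := by fun_prop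
    simpa using this.tendsto 0
  have hsum : ∀ᶠ ε : ℝ in 𝓝 0, ∑ i, (r + ε • (1 : Fin n → ℝ)) i < 1 := by
    have h1 : Continuous fun w : Fin n → ℝ => ∑ i, w i := by fun_prop
    exact ((h1.tendsto r).comp hrt).eventually (gt_mem_nhds hrsum)
  have hpair : Tendsto (fun ε : ℝ => (r + ε • (1 : Fin n → ℝ), diagConj (1 + ε • v) B)) (𝓝 0)
      (𝓝 (r, B)) := hrt.prodMk_nhds (tendsto_diagConj B v)
  have hof : Tendsto (fun ε : ℝ => ofBlocks (r + ε • (1 : Fin n → ℝ)) (diagConj (1 + ε • v) B))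
      (𝓝 0) (𝓝 Δ) := by
    have h1 := (analyticAt_ofBlocks (r, B)).continuousAt.tendsto.comp hpair
    simp only at h1
    rw [ofBlocks_block hΔ.2] at h1
    exact h1
  have hev : ∀ᶠ ε : ℝ in 𝓝[>] 0, 0 < ε ∧ ∑ i, (r + ε • (1 : Fin n → ℝ)) i < 1 ∧
      LoopEntropyAnalyticAt (ofBlocks (r + ε • (1 : Fin n → ℝ)) (diagConj (1 + ε • v) B)) := by
    filter_upwards [self_mem_nhdsWithin, nhdsWithin_le_nhds hsum,
      nhdsWithin_le_nhds (hof.eventually h.eventually)] with ε a b c using ⟨a, b, c⟩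
  obtain ⟨ε, hε, hεsum, hεan⟩ := hev.exists
  have hd : ∀ i, 0 < (1 + ε • v : Fin n → ℝ) i := fun i => by
    have := hv0 i
    simp only [Pi.add_apply, Pi.one_apply, Pi.smul_apply, smul_eq_mul]
    positivity
  have hadm : IsAdmissible (r + ε • (1 : Fin n → ℝ)) (diagConj (1 + ε • v) B) := by
    refine ⟨fun i => ?_, hεsum, diagConj_nonneg hd hB0, fun i => ?_⟩
    · have := hr0 i
      simp only [Pi.add_apply, Pi.one_apply, Pi.smul_apply, smul_eq_mul]
      linarith
    · have h1 : (diagConj (1 + ε • v) B *ᵥ 1) i =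
          ((1 + ε • v : Fin n → ℝ) i)⁻¹ * (B *ᵥ (1 + ε • v)) i := by
        simp only [mulVec, dotProduct, diagConj, of_apply, Pi.one_apply, mul_one, Finset.mul_sum,
          mul_assoc]
      rw [h1, inv_mul_lt_one₀ (hd i), mulVec_add, mulVec_smul, hBv, hB1]
      have := blockC_nonneg hΔ.1 i
      simp only [Pi.add_apply, Pi.one_apply, Pi.smul_apply, Pi.sub_apply, smul_eq_mul]
      linarith
  have hchar := charpoly_diagConj hd B
  have hmap : ((diagConj (1 + ε • v) B).map Complex.ofReal).charpoly =
      (B.map Complex.ofReal).charpoly := by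
    rw [charpoly_map_ofReal, hchar, charpoly_map_ofReal]
  have hmain := hasSimpleDominantEigenvalue_of_analyticAt (hεan.returnEntropyAnalyticAt hadm) hadm
    (ν := ν) (by rw [hmap]; exact hν) hν0
  rw [HasSimpleDominantEigenvalue, hmap] at hmain
  exact hmain

lemma conditions_of_natural (hn : 1 ≤ n) (hΔ : Δ ∈ rowStochastic ℝ (Fin (n + 1)))
    (hirr : Δ.IsIrreducible) {k : Fin (n + 1) → Fin (n + 1)}
    (h : EntropyRateAnalyticAt unambiguousObs (naturalParam k) (naturalCoord k Δ)) :
    PositivityCondition Δ ∧ HasSimpleDominantEigenvalue (blockB Δ) := by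
  have hB := isTransient_of_isIrreducible hΔ hirr
  have h1 := loopEntropyAnalyticAt_of_natural hB h
  have hpos := positivityCondition_of_analyticAt hn hΔ hirr h1
  exact ⟨hpos, hasSimpleDominantEigenvalue_of_loopEntropyAnalyticAt hΔ hB hpos h1⟩

lemma EntropyRateAnalyticAt.of_comp_equiv {S A E F : Type*} [Fintype S] [DecidableEq S]
    [Fintype A] [DecidableEq A] [NormedAddCommGroup E] [NormedSpace ℝ E] [NormedAddCommGroup F]
    [NormedSpace ℝ F] {Φ : S → A} {Θ : F → Matrix S S ℝ} {x : F} (e : E ≃L[ℝ] F)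
    (h : EntropyRateAnalyticAt Φ (fun y => Θ (e y)) (e.symm x)) :
    EntropyRateAnalyticAt Φ Θ x := by
  obtain ⟨G, hG, hG2⟩ := h
  refine ⟨fun y => G (e.symm y), AnalyticAt.comp (g := G) (f := e.symm) hG
    (e.symm.toContinuousLinearMap.analyticAt x), ?_⟩
  have ht : Tendsto e.symm (𝓝 x) (𝓝 (e.symm x)) := e.symm.continuous.tendsto x
  filter_upwards [ht.eventually hG2] with y hy
  rwa [e.apply_symm_apply] at hy

end

end HiddenMarkov

end

theorem theorem3 (n : ℕ) (hn : 1 ≤ n)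
    (Δ : Matrix (Fin (n + 1)) (Fin (n + 1)) ℝ)
    (hstoch : Δ ∈ Matrix.rowStochastic ℝ (Fin (n + 1)))
    (hirr : Δ.IsIrreducible) :
    ((∀ (m : ℕ) (Θ : (Fin m → ℝ) → Matrix (Fin (n + 1)) (Fin (n + 1)) ℝ) (ε₀ : Fin m → ℝ),
        HiddenMarkov.IsAnalyticParametrization Θ ε₀ Δ →
        HiddenMarkov.EntropyRateAnalyticAt HiddenMarkov.unambiguousObs Θ ε₀) ↔
      HiddenMarkov.PositivityCondition Δ ∧
        HiddenMarkov.HasSimpleDominantEigenvalue (HiddenMarkov.blockB Δ)) ∧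
    (∀ k : Fin (n + 1) → Fin (n + 1),
      HiddenMarkov.EntropyRateAnalyticAt HiddenMarkov.unambiguousObs
          (HiddenMarkov.naturalParam k) (HiddenMarkov.naturalCoord k Δ) ↔
        HiddenMarkov.PositivityCondition Δ ∧
          HiddenMarkov.HasSimpleDominantEigenvalue (HiddenMarkov.blockB Δ)) := by
  refine ⟨⟨fun h => ?_, fun h m Θ ε₀ hΘ =>
    HiddenMarkov.entropyRateAnalyticAt_of_conditions hstoch hirr h.1 h.2 hΘ⟩, fun k =>
    ⟨HiddenMarkov.conditions_of_natural hn hstoch hirr, fun h =>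
      HiddenMarkov.entropyRateAnalyticAt_of_conditions hstoch hirr h.1 h.2
        (HiddenMarkov.analyticAt_naturalParam k hstoch.2)⟩⟩
  have hnat := HiddenMarkov.analyticAt_naturalParam (fun _ => 0) hstoch.2
  -- The natural parameters live in a product space; a linear isomorphism with some `Fin m → ℝ`
  -- turns the natural parametrization into one of those quantified over.
  let e : (Fin (Module.finrank ℝ (Fin (n + 1) → Fin n → ℝ)) → ℝ) ≃L[ℝ]
      (Fin (n + 1) → Fin n → ℝ) := ContinuousLinearEquiv.ofFinrankEq (by simp)
  refine HiddenMarkov.conditions_of_natural (k := fun _ => 0) hn hstoch hirr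
    (HiddenMarkov.EntropyRateAnalyticAt.of_comp_equiv e (h _ _ _ ⟨fun i j => ?_, ?_⟩))
  · refine AnalyticAt.comp (g := fun x => HiddenMarkov.naturalParam (fun _ => 0) x i j) (f := e) ?_
      (e.toContinuousLinearMap.analyticAt _)
    rw [e.apply_symm_apply]
    exact hnat.1 i j
  · simp only [e.apply_symm_apply]
    exact hnat.2
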